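/- **Conventions.** For $a,b\in\{0,1\}^n$ let $X^aZ^b$ be the $n$-qubit Pauli operator $|y\rangle\mapsto(-1)^{b\cdot y}|y\oplus a\rangle$. The tableau $(M,p,s)$ of an $n$-qubit Clifford unitary $Q$ consists of a $2n\times 2n$ binary matrix $M=\left[\begin{smallmatrix}A&B\\C&D\end{smallmatrix}\right]$ and of $p=(\alpha,\delta),\ s=(\beta,\epsilon)\in\{0,1\}^{2n}$ such that, for all $j$, $$QX^{e_j}Q^\dagger=i^{\alpha_j}(-1)^{\beta_j}X^{A_j}Z^{B_j},\qquad QZ^{e_j}Q^\dagger=i^{\delta_j}(-1)^{\epsilon_j}X^{C_j}Z^{D_j},$$ where $A_j,B_j,C_j,D_j$ are the $j$-th rows. It is a tableau of the stabilizer state $|\psi\rangle$, the unit vector (unique up to phase) with $i^{\delta_j}(-1)^{\epsilon_j}X^{C_j}Z^{D_j}|\psi\rangle=|\psi\rangle$ for all $j$. Algorithms run on a word RAM with words of $O(\log n)$ bits and unit-cost word operations, whose memory may initially hold arbitrary words outside the input; a randomized algorithm is given uniformly random bits as part of its input. Let $\omega\ge 2$ be a real number such that $n\times n$ matrices over $\mathbb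 F_2$ can be multiplied in time $O(n^\omega)$ on this machine. **Theorem.** There is a single algorithm that takes as input a tableau of an $n$-qubit stabilizer state $|\psi\rangle$, a set $S$ of $k$ qubits with $1\le k\le n$, a choice between measurement and postselection, and $k$ bits, that runs in time $$O\!\left(\min\!\left(n^2k^{\omega-2}\,(1+\log(n/k)),\ k\,n^2\right)\right)$$ (with $\log(n/k)$ replaced by $\log n$ in the case $\omega=2$; the implied constant does not depend on $n$, $k$, $S$ or the state), and that does the following. 1. *Measurement.* If the $k$ input bits are uniformly random, it returns $Z$-basis measurement outcomes $z\in\{0,1\}^S$, distributed exactly by the Born rule $\Pr[z]=\|(\langle z|_S\otimes I)|\psi\rangle\|^2$, together with a Clifford tableau of the $(n-k)$-qubit post-measurement state $(\langle z|_S\otimes I)|\psi\rangle/\|(\langle z|_S\otimes I)|\psi\rangle\|$. 2. *Postselection.* If the $k$ input bits are a desired outcome $z\in\{0,1\}^S$, it reports whether $\|(\langle z|_S\otimes I)|\psi\rangle\|^2=0$ and, if it is nonzero, returns a Clifford tableau of the $(n-k)$-qubit state $(\langle z|_S\otimes I)|\psi\rangle/\|(\langle z|_S\otimes I)|\psi\rangle\|$.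 -/

import Mathlib

open scoped Matrix

noncomputable section

/-! ### Paulis, tableaux and stabilizer states

The qubits are labelled by a finite linearly ordered type `ι`. A vector of the state space
`(ℂ²)^{⊗ι}` is given by its amplitudes in the computational basis. -/

/-- Bit strings indexed by `ι`, as vectors over `𝔽₂`. -/
abbrev Bits (ι : Type) := ι → ZMod 2

/-- Vectors of `(ℂ²)^{⊗ι}`; `ψ x` is the amplitude `⟨x|ψ⟩`. -/
abbrev QVec (ι : Type) := Bits ι → ℂ

/-- The Pauli operator `X^a Z^b`, which maps `|y⟩` to `(-1)^{b·y} |y + a⟩`. -/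
def pauliXZ {ι : Type} [Fintype ι] [DecidableEq ι] (a b : Bits ι) :
    Matrix (Bits ι) (Bits ι) ℂ :=
  Matrix.of fun x y => if x = y + a then (-1 : ℂ) ^ (b ⬝ᵥ y).val else 0

/-- The Pauli operator `i^α (-1)^β X^a Z^b`. -/
def phasedPauli {ι : Type} [Fintype ι] [DecidableEq ι] (α β : ZMod 2) (a b : Bits ι) :
    Matrix (Bits ι) (Bits ι) ℂ :=
  (Complex.I ^ α.val * (-1 : ℂ) ^ β.val) • pauliXZ a b

/-- The data `(M, p, s)` of a tableau. Rows and columns are indexed by `ι ⊕ ι`: the rows `inl j`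
form the upper half `[A | B]`, the rows `inr j` the lower half `[C | D]`. -/
structure Tableau (ι : Type) where
  M : Matrix (ι ⊕ ι) (ι ⊕ ι) (ZMod 2)
  p : ι ⊕ ι → ZMod 2
  s : ι ⊕ ι → ZMod 2

namespace Tableau

variable {ι : Type} [Fintype ι] [DecidableEq ι]

/-- The Pauli operator recorded in a row of the tableau. -/
def row (T : Tableau ι) (j : ι ⊕ ι) : Matrix (Bits ι) (Bits ι) ℂ :=
  phasedPauli (T.p j) (T.s j) (fun i => T.M j (Sum.inl i)) (fun i => T.M j (Sum.inr i))

/-- `T` is the tableau of the operator `Q`: the upper rows are the images `Q X^{e_j} Q†`, the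
lower rows the images `Q Z^{e_j} Q†`. -/
def Represents (T : Tableau ι) (Q : Matrix (Bits ι) (Bits ι) ℂ) : Prop :=
  (∀ j, Q * pauliXZ (Pi.single j 1) 0 * Qᴴ = T.row (Sum.inl j)) ∧
  (∀ j, Q * pauliXZ 0 (Pi.single j 1) * Qᴴ = T.row (Sum.inr j))

/-- `T` is the tableau of some Clifford unitary. -/
def IsClifford (T : Tableau ι) : Prop :=
  ∃ Q ∈ Matrix.unitaryGroup (Bits ι) ℂ, T.Represents Q

/-- `T` is a Clifford tableau of the state `ψ`: `ψ` is the unit vector (unique up to a phase)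
that is fixed by the Paulis in the lower half of `T`. -/
def IsTableauOf (T : Tableau ι) (ψ : QVec ι) : Prop :=
  T.IsClifford ∧ ∑ x, ‖ψ x‖ ^ 2 = 1 ∧ ∀ j, T.row (Sum.inr j) *ᵥ ψ = ψ

end Tableau

/-! ### Measuring a set of qubits in the computational basis -/

/-- The string on all the qubits that is `z` on `S` and `y` off `S`. -/
def mergeBits {n : ℕ} (S : Finset (Fin n)) (z : Bits {i // i ∈ S}) (y : Bits {i // i ∉ S}) :
    Bits (Fin n) :=
  fun i => if h : i ∈ S then z ⟨i, h⟩ else y ⟨i, h⟩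

/-- The unnormalized vector `(⟨z|_S ⊗ I) ψ` on the qubits outside `S`. -/
def project {n : ℕ} (S : Finset (Fin n)) (ψ : QVec (Fin n)) (z : Bits {i // i ∈ S}) :
    QVec {i // i ∉ S} :=
  fun y => ψ (mergeBits S z y)

/-- The Born probability of the outcome `z` when the qubits in `S` are measured. -/
def outcomeProb {n : ℕ} (S : Finset (Fin n)) (ψ : QVec (Fin n)) (z : Bits {i // i ∈ S}) : ℝ :=
  ∑ y, ‖project S ψ z y‖ ^ 2

/-- The post-measurement state of the qubits outside `S`, given the outcome `z`
(meaningful if `z` has nonzero probability). -/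
def postState {n : ℕ} (S : Finset (Fin n)) (ψ : QVec (Fin n)) (z : Bits {i // i ∈ S}) :
    QVec {i // i ∉ S} :=
  fun y => project S ψ z y / (Real.sqrt (outcomeProb S ψ z) : ℂ)

/-! ### The machine model: a word RAM with a step count

A machine has registers and random access arrays, numbered by naturals (a program mentions only
finitely many of them). Every register and every array cell holds one word, a natural number
below `W`. Every arithmetic operation, memory access, assignment and test costs one step. A result
that is not below `W` has no defined behaviour, so that a program has to avoid it. -/

structure MachineState where
  reg : ℕ → ℕ
  arr : ℕ → ℕ → ℕ

/-- The operations on words. -/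
inductive WordOp
  | add | sub | mul | div | mod | lt | eq

/-- `sub` is truncated, `div` and `mod` are Euclidean, comparisons return `0` or `1`. -/
def WordOp.apply : WordOp → ℕ → ℕ → ℕ
  | .add, x, y => x + y
  | .sub, x, y => x - y
  | .mul, x, y => x * y
  | .div, x, y => x / y
  | .mod, x, y => x % y
  | .lt, x, y => if x < y then 1 else 0
  | .eq, x, y => if x = y then 1 else 0

/-- Expressions: constants, registers, array cells `A[e]`, and operations. -/
inductive RExpr
  | const (c : ℕ)
  | reg (r : ℕ)
  | get (A : ℕ) (e : RExpr)
  | op (o : WordOp) (e₁ e₂ : RExpr)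

namespace RExpr

def val (σ : MachineState) : RExpr → ℕ
  | const c => c
  | reg r => σ.reg r
  | get A e => σ.arr A (e.val σ)
  | op o e₁ e₂ => o.apply (e₁.val σ) (e₂.val σ)

/-- All the values that occur in the evaluation are words. -/
def Fits (W : ℕ) (σ : MachineState) : RExpr → Prop
  | const c => c < W
  | reg r => σ.reg r < W
  | get A e => e.Fits W σ ∧ σ.arr A (e.val σ) < W
  | op o e₁ e₂ => e₁.Fits W σ ∧ e₂.Fits W σ ∧ o.apply (e₁.val σ) (e₂.val σ) < W

/-- The number of steps of an evaluation. -/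
def cost : RExpr → ℕ
  | const _ => 1
  | reg _ => 1
  | get _ e => e.cost + 1
  | op _ e₁ e₂ => e₁.cost + e₂.cost + 1

end RExpr

/-- Programs. -/
inductive Prog
  | skip
  | assign (r : ℕ) (e : RExpr)
  | store (A : ℕ) (i e : RExpr)
  | seq (c₁ c₂ : Prog)
  | ite (e : RExpr) (c₁ c₂ : Prog)
  | loop (e : RExpr) (c : Prog)

/-- `Exec W c σ σ' t`: with words below `W`, the program `c` started in `σ` halts in `σ'` after
exactly `t` steps. `ite e` and `loop e` (a while loop) test whether `e` is nonzero. -/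
inductive Exec (W : ℕ) : Prog → MachineState → MachineState → ℕ → Prop
  | skip (σ : MachineState) : Exec W .skip σ σ 1
  | assign (σ : MachineState) (r : ℕ) (e : RExpr) (he : e.Fits W σ) :
      Exec W (.assign r e) σ ⟨Function.update σ.reg r (e.val σ), σ.arr⟩ (e.cost + 1)
  | store (σ : MachineState) (A : ℕ) (i e : RExpr) (hi : i.Fits W σ) (he : e.Fits W σ) :
      Exec W (.store A i e) σ
        ⟨σ.reg, Function.update σ.arr A (Function.update (σ.arr A) (i.val σ) (e.val σ))⟩
        (i.cost + e.cost + 1)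
  | seq {c₁ c₂ : Prog} {σ₁ σ₂ σ₃ : MachineState} {t₁ t₂ : ℕ}
      (h₁ : Exec W c₁ σ₁ σ₂ t₁) (h₂ : Exec W c₂ σ₂ σ₃ t₂) :
      Exec W (.seq c₁ c₂) σ₁ σ₃ (t₁ + t₂)
  | ite_true {e : RExpr} {c₁ c₂ : Prog} {σ σ' : MachineState} {t : ℕ}
      (he : e.Fits W σ) (hv : e.val σ ≠ 0) (h : Exec W c₁ σ σ' t) :
      Exec W (.ite e c₁ c₂) σ σ' (e.cost + 1 + t)
  | ite_false {e : RExpr} {c₁ c₂ : Prog} {σ σ' : MachineState} {t : ℕ}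
      (he : e.Fits W σ) (hv : e.val σ = 0) (h : Exec W c₂ σ σ' t) :
      Exec W (.ite e c₁ c₂) σ σ' (e.cost + 1 + t)
  | loop_stop {e : RExpr} {c : Prog} {σ : MachineState}
      (he : e.Fits W σ) (hv : e.val σ = 0) :
      Exec W (.loop e c) σ σ (e.cost + 1)
  | loop_step {e : RExpr} {c : Prog} {σ₁ σ₂ σ₃ : MachineState} {t₁ t₂ : ℕ}
      (he : e.Fits W σ₁) (hv : e.val σ₁ ≠ 0) (h₁ : Exec W c σ₁ σ₂ t₁)
      (h₂ : Exec W (.loop e c) σ₂ σ₃ t₂) :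
      Exec W (.loop e c) σ₁ σ₃ (e.cost + 1 + t₁ + t₂)

/-- All registers and array cells hold words. Apart from this and the input, the initial contents
of the memory are arbitrary in everything that follows. -/
def MachineState.IsWord (W : ℕ) (σ : MachineState) : Prop :=
  (∀ r, σ.reg r < W) ∧ ∀ A i, σ.arr A i < W

/-! ### Storing the data -/

/-- The array `A` holds the matrix `X` over `𝔽₂` in row-major order. -/
def StoresMatrix {n : ℕ} (σ : MachineState) (A : ℕ) (X : Matrix (Fin n) (Fin n) (ZMod 2)) : Prop :=
  ∀ i j : Fin n, σ.arr A ((i : ℕ) * n + j) = (X i j).val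

/-- The number of labels before `i`, that is, the place of `i` in the increasing list of labels. -/
def position {ι : Type} [Fintype ι] [LinearOrder ι] (i : ι) : ℕ :=
  (Finset.univ.filter (· < i)).card

/-- The array `A` holds the bit string `z`, listed in increasing order of the labels. -/
def StoresBits {ι : Type} [Fintype ι] [LinearOrder ι] (σ : MachineState) (A : ℕ) (z : Bits ι) :
    Prop :=
  ∀ i, σ.arr A (position i) = (z i).val

/-- The number of a row or a column of a tableau. -/
def slot {ι : Type} [Fintype ι] [LinearOrder ι] : ι ⊕ ι → ℕ
  | Sum.inl i => position i
  | Sum.inr i => Fintype.card ι + position i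

/-- The arrays `0`, `1`, `2` hold `M` (row-major, `2m × 2m` for `m` qubits), `p` and `s`. -/
def StoresTableau {ι : Type} [Fintype ι] [LinearOrder ι] (σ : MachineState) (T : Tableau ι) :
    Prop :=
  (∀ a b, σ.arr 0 (slot a * (2 * Fintype.card ι) + slot b) = (T.M a b).val) ∧
  (∀ a, σ.arr 1 (slot a) = (T.p a).val) ∧
  (∀ a, σ.arr 2 (slot a) = (T.s a).val)

/-- Matrices over `𝔽₂` can be multiplied in time `O(n^ω)`: a single program multiplies `n × n`
matrices for all `n ≥ 1`, with words of `O(log n)` bits. Input: `n` in register `0`, the factors in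
the arrays `0` and `1`. Output: the product in the array `2`. -/
def MatMulInTime (ω : ℝ) : Prop :=
  ∃ (c : Prog) (C d : ℕ), ∀ n : ℕ, 1 ≤ n → ∀ X Y : Matrix (Fin n) (Fin n) (ZMod 2),
    ∀ W : ℕ, (n + 2) ^ d ≤ W → ∀ σ : MachineState, σ.IsWord W →
      σ.reg 0 = n → StoresMatrix σ 0 X → StoresMatrix σ 1 Y →
      ∃ (σ' : MachineState) (t : ℕ), Exec W c σ σ' t ∧ (t : ℝ) ≤ C * (n : ℝ) ^ ω ∧
        StoresMatrix σ' 2 (X * Y)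

/-- The input of the measurement program: `n`, `k` and the mode (`0`: measure, `1`: postselect) in
the registers `0`, `1`, `2`; the tableau in the arrays `0`, `1`, `2`; the indicator of the set `S`
of `k` qubits in the array `3`; and `k` bits in the array `4`. -/
def IsInput {n : ℕ} (σ : MachineState) (mode : ℕ) (S : Finset (Fin n)) (T : Tableau (Fin n))
    (b : Bits {i // i ∈ S}) : Prop :=
  σ.reg 0 = n ∧ σ.reg 1 = S.card ∧ σ.reg 2 = mode ∧ StoresTableau σ T ∧
    (∀ i : Fin n, σ.arr 3 i = if i ∈ S then 1 else 0) ∧ StoresBits σ 4 b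

/-- `min (n² k^{ω-2} log (n/k), k n²)`, where the logarithm is increased by `1` (it vanishes for
`k = n`), and is `log n` instead of `log (n/k)` if `ω = 2`. -/
def measureBound (ω : ℝ) (n k : ℕ) : ℝ :=
  min ((n : ℝ) ^ 2 * (k : ℝ) ^ (ω - 2) *
      (1 + if ω = 2 then Real.log n else Real.log ((n : ℝ) / k)))
    ((k : ℝ) * (n : ℝ) ^ 2)

end

/-! ### Expressions and programs -/

namespace RExpr

/-! A tableau is treated as a list of rows over `𝔽₂`, each an `X` part and a `Z` part, with a phase
in `ℤ/4`. The commutation relations say that the rows form a symplectic basis. One program serves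
both modes.

Gauss–Jordan elimination of the stabilizers on the `X` parts of the `k` measured columns turns the
pivot columns into unit vectors and leaves the rows without a pivot free of measured `X` parts
(`stab_x_pivot`, `stab_x_unused`). The bits in pivot columns are free: applying a stabilizer
translates the basis states without changing the moduli of the amplitudes, and products of pivot
stabilizers realize every change of the pivot bits (`exists_shift`). The bit in a column `c` without
a pivot is determined: `Z` on that qubit, times `Z` on suitable pivot qubits, commutes with all
stabilizers, so up to a sign it is a product of stabilizers. The exponents of this product are the
`X` entries in column `c` of the destabilizers after their pivot columns are cleared
(`constraint_spec`), and the phase of the product gives the bit as an affine function of the pivot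
bits. The resulting map `out` depends on the pivot bits only, its fixed points are exactly the
outcomes of nonzero probability, these are equally likely, and its nonempty fibres have equal size.
This is the Born rule (`card_out_eq`), and it also settles postselection: `z` is possible if and
only if `out z = z`.

For the new tableau, the cleared destabilizers that belong to unused stabilizers are eliminated on
the remaining measured columns. The rows that are pivots of neither elimination have no measured `X`
part and still form dual families, so their restrictions to the other qubits number at most `n - k`;
since every measured column has a pivot in at most one of the eliminations, at least `n - k` rows
remain (`count_kept`). Substituting the outcome into the stabilizers contributes signs only
(`project_fixed`), and commutation relations together with Hermitian destabilizers suffice for a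
Clifford tableau (`isTableauOf_of_form`).

For the time, all bulk work is matrix multiplication in blocks of the size `width k`, a power of two
between `k` and `2k`. Multiplying `n` rows by up to `width k` common rows is a matrix product even
for the phases (`PRow.prod_ph`). The elimination is lazy: a column receives pending steps in dyadic
blocks (`level`), so that `2^(e-h)` block operations of size `2^h` occur, with a geometric sum as
total cost (`tElim_le`). The constraints need `n / width k + 1` products of `k` rows. The bound `k
n²` follows because schoolbook multiplication allows the exponent `min ω 3`. -/

instance : Add RExpr := ⟨fun a b => .op .add a b⟩
instance : Sub RExpr := ⟨fun a b => .op .sub a b⟩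
instance : Mul RExpr := ⟨fun a b => .op .mul a b⟩
instance : Div RExpr := ⟨fun a b => .op .div a b⟩
instance : Mod RExpr := ⟨fun a b => .op .mod a b⟩

/-- The test `a < b`. -/
def lt (a b : RExpr) : RExpr := .op .lt a b

/-- The test `a = b`. -/
def eqv (a b : RExpr) : RExpr := .op .eq a b

variable {W : ℕ} {σ : MachineState} {a b : RExpr}

@[simp] theorem val_const (c : ℕ) : (const c).val σ = c := rfl
@[simp] theorem val_reg (r : ℕ) : (reg r).val σ = σ.reg r := rfl
@[simp] theorem val_get (A : ℕ) (e : RExpr) : (get A e).val σ = σ.arr A (e.val σ) := rfl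
@[simp] theorem val_add : (a + b).val σ = a.val σ + b.val σ := rfl
@[simp] theorem val_sub : (a - b).val σ = a.val σ - b.val σ := rfl
@[simp] theorem val_mul : (a * b).val σ = a.val σ * b.val σ := rfl
@[simp] theorem val_div : (a / b).val σ = a.val σ / b.val σ := rfl
@[simp] theorem val_mod : (a % b).val σ = a.val σ % b.val σ := rfl
@[simp] theorem val_lt : (lt a b).val σ = if a.val σ < b.val σ then 1 else 0 := rfl
@[simp] theorem val_eqv : (eqv a b).val σ = if a.val σ = b.val σ then 1 else 0 := rfl

@[simp] theorem cost_const (c : ℕ) : (const c).cost = 1 := rfl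
@[simp] theorem cost_reg (r : ℕ) : (reg r).cost = 1 := rfl
@[simp] theorem cost_get (A : ℕ) (e : RExpr) : (get A e).cost = e.cost + 1 := rfl
@[simp] theorem cost_add : (a + b).cost = a.cost + b.cost + 1 := rfl
@[simp] theorem cost_sub : (a - b).cost = a.cost + b.cost + 1 := rfl
@[simp] theorem cost_mul : (a * b).cost = a.cost + b.cost + 1 := rfl
@[simp] theorem cost_div : (a / b).cost = a.cost + b.cost + 1 := rfl
@[simp] theorem cost_mod : (a % b).cost = a.cost + b.cost + 1 := rfl
@[simp] theorem cost_lt : (lt a b).cost = a.cost + b.cost + 1 := rfl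
@[simp] theorem cost_eqv : (eqv a b).cost = a.cost + b.cost + 1 := rfl

theorem Fits.val_lt {e : RExpr} (h : e.Fits W σ) : e.val σ < W := by
  cases e with
  | const c => exact h
  | reg r => exact h
  | get A e => exact h.2
  | op o e₁ e₂ => exact h.2.2

@[simp] theorem fits_const (c : ℕ) : (const c).Fits W σ ↔ c < W := Iff.rfl

theorem fits_reg (hσ : σ.IsWord W) (r : ℕ) : (reg r).Fits W σ ↔ True :=
  iff_true_intro (hσ.1 r)

theorem fits_get (hσ : σ.IsWord W) (A : ℕ) (e : RExpr) : (get A e).Fits W σ ↔ e.Fits W σ :=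
  ⟨fun h => h.1, fun h => ⟨h, hσ.2 _ _⟩⟩

@[simp] theorem fits_add : (a + b).Fits W σ ↔ a.Fits W σ ∧ b.Fits W σ ∧ a.val σ + b.val σ < W := Iff.rfl

@[simp] theorem fits_mul : (a * b).Fits W σ ↔ a.Fits W σ ∧ b.Fits W σ ∧ a.val σ * b.val σ < W := Iff.rfl

-- Truncated differences, quotients and remainders never exceed the first operand, so only sums and
-- products carry an overflow condition.
@[simp] theorem fits_sub : (a - b).Fits W σ ↔ a.Fits W σ ∧ b.Fits W σ :=
  ⟨fun h => ⟨h.1, h.2.1⟩, fun h => ⟨h.1, h.2, lt_of_le_of_lt (Nat.sub_le _ _) h.1.val_lt⟩⟩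

@[simp] theorem fits_div : (a / b).Fits W σ ↔ a.Fits W σ ∧ b.Fits W σ :=
  ⟨fun h => ⟨h.1, h.2.1⟩, fun h => ⟨h.1, h.2, lt_of_le_of_lt (Nat.div_le_self _ _) h.1.val_lt⟩⟩

@[simp] theorem fits_mod : (a % b).Fits W σ ↔ a.Fits W σ ∧ b.Fits W σ :=
  ⟨fun h => ⟨h.1, h.2.1⟩, fun h => ⟨h.1, h.2, lt_of_le_of_lt (Nat.mod_le _ _) h.1.val_lt⟩⟩

theorem fits_lt (hW : 1 < W) : (lt a b).Fits W σ ↔ a.Fits W σ ∧ b.Fits W σ :=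
  ⟨fun h => ⟨h.1, h.2.1⟩, fun h => ⟨h.1, h.2, by simp only [WordOp.apply]; split <;> omega⟩⟩

theorem fits_eqv (hW : 1 < W) : (eqv a b).Fits W σ ↔ a.Fits W σ ∧ b.Fits W σ :=
  ⟨fun h => ⟨h.1, h.2.1⟩, fun h => ⟨h.1, h.2, by simp only [WordOp.apply]; split <;> omega⟩⟩

end RExpr

/-! ### Hoare-style reasoning about executions with step bounds. -/

theorem Exec.isWord {W : ℕ} {c : Prog} {σ σ' : MachineState} {t : ℕ} (h : Exec W c σ σ' t) :
    σ.IsWord W → σ'.IsWord W := by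
  induction h with
  | skip σ => exact id
  | assign σ r e he =>
    intro hσ
    refine ⟨fun x => ?_, hσ.2⟩
    by_cases hx : x = r
    · subst hx; simpa using he.val_lt
    · simpa [hx] using hσ.1 x
  | store σ A i e hi he =>
    intro hσ
    refine ⟨hσ.1, fun B x => ?_⟩
    by_cases hB : B = A
    · subst hB
      by_cases hx : x = i.val σ
      · subst hx; simpa using he.val_lt
      · simpa [hx] using hσ.2 B x
    · simpa [hB] using hσ.2 B x
  | seq _ _ ih₁ ih₂ => exact fun hσ => ih₂ (ih₁ hσ)
  | ite_true _ _ _ ih => exact ih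
  | ite_false _ _ _ ih => exact ih
  | loop_stop _ _ => exact id
  | loop_step _ _ _ _ ih₁ ih₂ => exact fun hσ => ih₂ (ih₁ hσ)

/-- The program `c` started in `σ` halts within `t` steps in a state that satisfies `Q`. -/
def Runs (W : ℕ) (c : Prog) (σ : MachineState) (t : ℕ) (Q : MachineState → Prop) : Prop :=
  ∃ σ' t', Exec W c σ σ' t' ∧ t' ≤ t ∧ σ'.IsWord W ∧ Q σ'

namespace MachineState

def setReg (σ : MachineState) (r v : ℕ) : MachineState := ⟨Function.update σ.reg r v, σ.arr⟩

def setArr (σ : MachineState) (A i v : ℕ) : MachineState :=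
  ⟨σ.reg, Function.update σ.arr A (Function.update (σ.arr A) i v)⟩

variable (σ : MachineState)

theorem setReg_reg (r v x : ℕ) : (σ.setReg r v).reg x = if x = r then v else σ.reg x := by
  simp [setReg, Function.update_apply]

theorem setReg_arr (r v : ℕ) : (σ.setReg r v).arr = σ.arr := rfl

theorem setArr_reg (A i v : ℕ) : (σ.setArr A i v).reg = σ.reg := rfl

theorem setArr_arr_ne {A B : ℕ} (h : B ≠ A) (i v : ℕ) : (σ.setArr A i v).arr B = σ.arr B := by
  simp [setArr, h]

theorem setArr_arr (A i v x : ℕ) :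
    (σ.setArr A i v).arr A x = if x = i then v else σ.arr A x := by
  simp [setArr, Function.update_apply]

end MachineState

namespace Runs

variable {W : ℕ} {c c₁ c₂ : Prog} {σ : MachineState} {t t₁ t₂ : ℕ} {Q Q₁ : MachineState → Prop}

theorem mono {Q' : MachineState → Prop} {t' : ℕ} (h : Runs W c σ t Q) (ht : t ≤ t')
    (hQ : ∀ τ, τ.IsWord W → Q τ → Q' τ) : Runs W c σ t' Q' := by
  obtain ⟨τ, s, h₁, h₂, h₃, h₄⟩ := h
  exact ⟨τ, s, h₁, h₂.trans ht, h₃, hQ τ h₃ h₄⟩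

theorem seq (h₁ : Runs W c₁ σ t₁ Q₁)
    (h₂ : ∀ τ, τ.IsWord W → Q₁ τ → Runs W c₂ τ t₂ Q) : Runs W (.seq c₁ c₂) σ (t₁ + t₂) Q := by
  obtain ⟨τ, s, e, hs, hw, hq⟩ := h₁
  obtain ⟨τ', s', e', hs', hw', hq'⟩ := h₂ τ hw hq
  exact ⟨τ', s + s', .seq e e', by omega, hw', hq'⟩

theorem assign (hσ : σ.IsWord W) (r : ℕ) {e : RExpr} (he : e.Fits W σ) {v : ℕ}
    (hv : e.val σ = v) :
    Runs W (.assign r e) σ (e.cost + 1) (fun τ => τ = σ.setReg r v) := by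
  have h := Exec.assign σ r e he
  subst hv
  exact ⟨_, _, h, le_rfl, h.isWord hσ, rfl⟩

theorem store (hσ : σ.IsWord W) (A : ℕ) {i e : RExpr} (hi : i.Fits W σ) (he : e.Fits W σ)
    {u v : ℕ} (hu : i.val σ = u) (hv : e.val σ = v) :
    Runs W (.store A i e) σ (i.cost + e.cost + 1) (fun τ => τ = σ.setArr A u v) := by
  have h := Exec.store σ A i e hi he
  subst hv; subst hu
  exact ⟨_, _, h, le_rfl, h.isWord hσ, rfl⟩

/-- A while loop that runs exactly `N` rounds. -/
theorem loop {e : RExpr} (N : ℕ) (I : ℕ → MachineState → Prop) (t : ℕ → ℕ)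
    (hσ : σ.IsWord W) (h₀ : I 0 σ)
    (hstep : ∀ i τ, i < N → τ.IsWord W → I i τ →
      e.Fits W τ ∧ e.val τ ≠ 0 ∧ Runs W c τ (t i) (I (i + 1)))
    (hend : ∀ τ, τ.IsWord W → I N τ → e.Fits W τ ∧ e.val τ = 0) :
    Runs W (.loop e c) σ ((∑ i ∈ Finset.range N, (t i + e.cost + 1)) + e.cost + 1) (I N) := by
  induction N generalizing σ I t with
  | zero =>
    obtain ⟨h₁, h₂⟩ := hend σ hσ h₀
    exact ⟨σ, _, Exec.loop_stop h₁ h₂, by simp, hσ, h₀⟩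
  | succ N ih =>
    obtain ⟨h₁, h₂, τ, s, hx, hs, hw, hI⟩ := hstep 0 σ (Nat.succ_pos _) hσ h₀
    obtain ⟨τ', s', hx', hs', hw', hI'⟩ := ih (fun i => I (i + 1)) (fun i => t (i + 1)) hw hI
      (fun i τ hi => hstep (i + 1) τ (by omega)) hend
    refine ⟨τ', _, .loop_step h₁ h₂ hx hx', ?_, hw', hI'⟩
    rw [Finset.sum_range_succ']
    omega

end Runs

/-- `for r := 0, …, b - 1 do c`, where `b` is a register. -/
def forLoop (r b : ℕ) (c : Prog) : Prog :=
  .seq (.assign r (.const 0))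
    (.loop (.lt (.reg r) (.reg b)) (.seq c (.assign r (.reg r + .const 1))))

/-- A `for` loop with invariant `I`. -/
theorem runs_forLoop {W : ℕ} {c : Prog} {σ : MachineState} {r b : ℕ}
    (I : ℕ → MachineState → Prop) (t : ℕ → ℕ) (hσ : σ.IsWord W) (hW : 1 < W)
    -- The counter register is overwritten by the loop itself, so the invariant has to be
    -- insensitive to it.
    (hI : ∀ i τ v, I i τ → I i (τ.setReg r v)) (h₀ : I 0 σ)
    (hb : ∀ i τ, I i τ → τ.reg b = σ.reg b)
    (hstep : ∀ i τ, i < σ.reg b → τ.IsWord W → τ.reg r = i → I i τ →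
      Runs W c τ (t i) (fun τ' => τ'.reg r = i ∧ I (i + 1) τ')) :
    Runs W (forLoop r b c) σ ((∑ i ∈ Finset.range (σ.reg b), (t i + 8)) + 6)
      (fun τ => I (σ.reg b) τ) := by
  have hn : σ.reg b < W := hσ.1 b
  have hl : ∀ τ : MachineState, τ.IsWord W → (RExpr.lt (.reg r) (.reg b)).Fits W τ := fun τ hτ => by
    simp [RExpr.fits_lt hW, RExpr.fits_reg hτ]
  have h1 := Runs.assign hσ r (e := .const 0) (v := 0) (by rw [RExpr.fits_const]; omega) rfl
  refine (Runs.seq h1 fun τ hτ hτe => Runs.mono (t' := (∑ i ∈ Finset.range (σ.reg b), (t i + 8)) + 4)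
    (Runs.loop (σ.reg b) (fun i τ => τ.reg r = i ∧ I i τ) (fun i => t i + 4) hτ ?_ ?_ ?_) ?_
    (fun _ _ h => h.2)).mono ?_ (fun _ _ h => h)
  · subst hτe
    exact ⟨by simp [MachineState.setReg_reg], hI _ _ _ h₀⟩
  · rintro i τ hi hτ ⟨hr, hi'⟩
    refine ⟨hl τ hτ, ?_, ?_⟩
    · simp [RExpr.val_lt, RExpr.val_reg, hb i τ hi', hr, hi]
    · refine Runs.seq (hstep i τ hi hτ hr hi') fun τ' hτ' h => ?_
      have h2 := Runs.assign hτ' r (e := .reg r + .const 1) (v := i + 1)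
        (by
          rw [RExpr.fits_add, RExpr.fits_reg hτ', RExpr.fits_const, RExpr.val_reg, RExpr.val_const,
            h.1]
          exact ⟨trivial, hW, by omega⟩)
        (by rw [RExpr.val_add, RExpr.val_reg, RExpr.val_const, h.1])
      refine h2.mono le_rfl fun τ'' _ he => ?_
      subst he
      exact ⟨by simp [MachineState.setReg_reg], hI _ _ _ h.2⟩
  · rintro τ hτ ⟨hr, hi'⟩
    refine ⟨hl τ hτ, ?_⟩
    simp [RExpr.val_lt, RExpr.val_reg, hb _ τ hi', hr]
  · exact le_of_eq (by rfl)
  · simp only [RExpr.cost_const]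
    omega

/-- `for i < R, j < C do A[addr] := e`, with `i`, `j` in the registers `40`, `41`. -/
def map2 (A rR rC : ℕ) (addr e : RExpr) : Prog :=
  forLoop 40 rR (forLoop 41 rC (.store A addr e))

/-- Injectivity of the addresses guarantees that a cell is untouched until its own turn. Hence `H`
may assume that the target cell still has its initial value, and in-place updates are covered. -/
theorem runs_map2 {W : ℕ} {σ : MachineState} {A rR rC : ℕ} {addr e : RExpr} (hσ : σ.IsWord W)
    (hW : 1 < W) (hR : rR < 40) (hC : rC < 40) (hcost : addr.cost + e.cost ≤ 100)
    (ad f : ℕ → ℕ → ℕ) {R C : ℕ} (hR' : σ.reg rR = R) (hC' : σ.reg rC = C)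
    (inj : ∀ i j i' j', i < R → j < C → i' < R → j' < C →
      ad i j = ad i' j' → i = i' ∧ j = j')
    (H : ∀ i j τ, i < R → j < C → τ.IsWord W →
      (∀ r < 40, τ.reg r = σ.reg r) → τ.reg 40 = i → τ.reg 41 = j →
      (∀ B, B ≠ A → τ.arr B = σ.arr B) → τ.arr A (ad i j) = σ.arr A (ad i j) →
      addr.Fits W τ ∧ addr.val τ = ad i j ∧ e.Fits W τ ∧ e.val τ = f i j) :
    Runs W (map2 A rR rC addr e) σ (200 * ((R + 1) * (C + 1)))
      (fun τ => (∀ i j, i < R → j < C → τ.arr A (ad i j) = f i j) ∧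
        (∀ x, (∀ i j, i < R → j < C → ad i j ≠ x) → τ.arr A x = σ.arr A x) ∧
        (∀ r, r ≠ 40 → r ≠ 41 → τ.reg r = σ.reg r) ∧ ∀ B, B ≠ A → τ.arr B = σ.arr B) := by
  subst hR' hC'
  set R := σ.reg rR with hR'
  set C := σ.reg rC with hC'
  let P : ℕ → ℕ → MachineState → Prop := fun a b τ =>
    (∀ i j, i < R → j < C → i < a ∨ (i = a ∧ j < b) → τ.arr A (ad i j) = f i j) ∧
      (∀ x, (∀ i j, i < R → j < C → i < a ∨ (i = a ∧ j < b) → ad i j ≠ x) →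
        τ.arr A x = σ.arr A x) ∧
      (∀ r, r ≠ 40 → r ≠ 41 → τ.reg r = σ.reg r) ∧ ∀ B, B ≠ A → τ.arr B = σ.arr B
  have hset : ∀ a b τ v r, (r = 40 ∨ r = 41) → P a b τ → P a b (τ.setReg r v) := by
    rintro a b τ v r hr ⟨h1, h2, h3, h4⟩
    refine ⟨h1, h2, fun x hx hx' => ?_, h4⟩
    rw [MachineState.setReg_reg, if_neg (by omega), h3 x hx hx']
  have inner : ∀ a τ, a < R → τ.IsWord W → τ.reg 40 = a → P a 0 τ →
      Runs W (forLoop 41 rC (.store A addr e)) τ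
        ((∑ i ∈ Finset.range C, (101 + 8)) + 6)
        (fun τ => τ.reg 40 = a ∧ P (a + 1) 0 τ) := by
    intro a τ ha hτ hτ40 hP
    have hCτ : τ.reg rC = C := hP.2.2.1 rC (by omega) (by omega)
    have hl := runs_forLoop (c := .store A addr e) (r := 41) (b := rC)
      (fun b τ => τ.reg 40 = a ∧ P a b τ) (fun _ => 101) hτ hW
      (fun b τ v h => ⟨by rw [MachineState.setReg_reg, if_neg (by omega)]; exact h.1,
        hset _ _ _ _ _ (Or.inr rfl) h.2⟩)
      ⟨hτ40, hP⟩
      (fun b τ' h => by rw [h.2.2.2.1 rC (by omega) (by omega), hCτ])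
      (by
        rintro b τ' hb hτ' h41 ⟨h40, h1, h2, h3, h4⟩
        rw [hCτ] at hb
        obtain ⟨f1, v1, f2, v2⟩ := H a b τ' ha hb hτ'
          (fun r hr => h3 r (by omega) (by omega)) h40 h41 h4
          (h2 _ fun i j hi hj hij he => by
            obtain ⟨rfl, rfl⟩ := inj _ _ _ _ hi hj ha hb he
            omega)
        refine (Runs.store hτ' A f1 f2 v1 v2).mono (by omega) fun τ'' _ he => ?_
        subst he
        refine ⟨h41, h40, fun i j hi hj hij => ?_, fun x hx => ?_, h3, fun B hB => ?_⟩
        · rw [MachineState.setArr_arr]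
          split
          · rename_i he
            obtain ⟨rfl, rfl⟩ := inj _ _ _ _ hi hj ha hb he
            rfl
          · rename_i he
            refine h1 i j hi hj ?_
            rcases hij with hij | ⟨rfl, hij⟩
            · exact Or.inl hij
            · refine Or.inr ⟨rfl, ?_⟩
              have : j ≠ b := fun h => he (by rw [h])
              omega
        · rw [MachineState.setArr_arr, if_neg (fun h => hx a b ha hb (Or.inr ⟨rfl, by omega⟩) h.symm)]
          exact h2 x fun i j hi hj hij => hx i j hi hj (by omega)
        · rw [MachineState.setArr_arr_ne _ hB, h4 B hB])
    rw [hCτ] at hl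
    refine hl.mono le_rfl fun τ' _ h => ⟨h.1, ?_⟩
    obtain ⟨-, h1, h2, h3, h4⟩ := h
    exact ⟨fun i j hi hj hij => h1 i j hi hj (by omega),
      fun x hx => h2 x fun i j hi hj hij => hx i j hi hj (by omega), h3, h4⟩
  have outer := runs_forLoop (c := forLoop 41 rC (.store A addr e)) (r := 40) (b := rR)
    (fun a τ => P a 0 τ) (fun _ => (∑ i ∈ Finset.range C, (101 + 8)) + 6) hσ hW
    (fun a τ v h => hset _ _ _ _ _ (Or.inl rfl) h)
    ⟨fun i j _ _ h => by omega, fun _ _ => rfl, fun _ _ _ => rfl, fun _ _ => rfl⟩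
    (fun a τ h => h.2.2.1 rR (by omega) (by omega))
    (fun a τ ha hτ h40 hP => inner a τ ha hτ h40 hP)
  refine outer.mono ?_ fun τ _ h => ?_
  · simp only [Finset.sum_const, Finset.card_range, smul_eq_mul, ← hR']
    nlinarith [Nat.zero_le (R * C)]
  · obtain ⟨h1, h2, h3, h4⟩ := h
    exact ⟨fun i j hi hj => h1 i j hi hj (by omega),
      fun x hx => h2 x fun i j hi hj _ => hx i j hi hj, h3, h4⟩

/-- `for i < R, j < C do A[addr] := (A[addr] + e) % μ`. -/
def acc2 (A rR rC μ : ℕ) (addr e : RExpr) : Prog :=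
  forLoop 40 rR (forLoop 41 rC (.store A addr ((.get A addr + e) % .const μ)))

/-- Every cell stays reduced modulo `μ ≤ 100` and every summand is at most `100`, so the
intermediate sum is below `200` and fits in a word; reductions modulo `μ` can be postponed to the
end of the sum. -/
theorem runs_acc2 {W : ℕ} {σ : MachineState} {A rR rC μ : ℕ} {addr e : RExpr}
    (hσ : σ.IsWord W) (hW : 200 < W) (hR : rR < 40) (hC : rC < 40)
    (hcost : addr.cost + e.cost ≤ 60) (hμ : 0 < μ) (hμ' : μ ≤ 100) (ad : ℕ → ℕ) (f : ℕ → ℕ → ℕ)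
    {R C : ℕ} (hR' : σ.reg rR = R) (hC' : σ.reg rC = C)
    (inj : ∀ i i', i < R → i' < R → ad i = ad i' → i = i')
    (hlt : ∀ i, i < R → σ.arr A (ad i) < μ)
    (hf : ∀ i j, i < R → j < C → f i j ≤ 100)
    (H : ∀ i j τ, i < R → j < C → τ.IsWord W →
      (∀ r < 40, τ.reg r = σ.reg r) → τ.reg 40 = i → τ.reg 41 = j →
      (∀ B, B ≠ A → τ.arr B = σ.arr B) →
      addr.Fits W τ ∧ addr.val τ = ad i ∧ e.Fits W τ ∧ e.val τ = f i j) :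
    Runs W (acc2 A rR rC μ addr e) σ (200 * ((R + 1) * (C + 1)))
      (fun τ => (∀ i, i < R → τ.arr A (ad i) =
          (σ.arr A (ad i) + ∑ j ∈ Finset.range C, f i j) % μ) ∧
        (∀ x, (∀ i, i < R → ad i ≠ x) → τ.arr A x = σ.arr A x) ∧
        (∀ r, r ≠ 40 → r ≠ 41 → τ.reg r = σ.reg r) ∧ ∀ B, B ≠ A → τ.arr B = σ.arr B) := by
  subst hR' hC'
  set R := σ.reg rR with hR'
  set C := σ.reg rC with hC'
  have hW' : 1 < W := by omega
  let P : ℕ → ℕ → MachineState → Prop := fun a b τ =>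
    (∀ i, i < R → τ.arr A (ad i) = (σ.arr A (ad i) +
        ∑ j ∈ Finset.range (if i < a then C else if i = a then b else 0), f i j) % μ) ∧
      (∀ x, (∀ i, i < R → ad i ≠ x) → τ.arr A x = σ.arr A x) ∧
      (∀ r, r ≠ 40 → r ≠ 41 → τ.reg r = σ.reg r) ∧ ∀ B, B ≠ A → τ.arr B = σ.arr B
  have hset : ∀ a b τ v r, (r = 40 ∨ r = 41) → P a b τ → P a b (τ.setReg r v) := by
    rintro a b τ v r hr ⟨h1, h2, h3, h4⟩
    refine ⟨h1, h2, fun x hx hx' => ?_, h4⟩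
    rw [MachineState.setReg_reg, if_neg (by omega), h3 x hx hx']
  have inner : ∀ a τ, a < R → τ.IsWord W → τ.reg 40 = a → P a 0 τ →
      Runs W (forLoop 41 rC (.store A addr ((.get A addr + e) % .const μ))) τ
        ((∑ i ∈ Finset.range C, (126 + 8)) + 6)
        (fun τ => τ.reg 40 = a ∧ P (a + 1) 0 τ) := by
    intro a τ ha hτ hτ40 hP
    have hCτ : τ.reg rC = C := hP.2.2.1 rC (by omega) (by omega)
    have hl := runs_forLoop (c := .store A addr ((.get A addr + e) % .const μ)) (r := 41) (b := rC)
      (fun b τ => τ.reg 40 = a ∧ P a b τ) (fun _ => 126) hτ hW'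
      (fun b τ v h => ⟨by rw [MachineState.setReg_reg, if_neg (by omega)]; exact h.1,
        hset _ _ _ _ _ (Or.inr rfl) h.2⟩)
      ⟨hτ40, hP⟩
      (fun b τ' h => by rw [h.2.2.2.1 rC (by omega) (by omega), hCτ])
      (by
        rintro b τ' hb hτ' h41 ⟨h40, h1, h2, h3, h4⟩
        rw [hCτ] at hb
        obtain ⟨f1, v1, f2, v2⟩ := H a b τ' ha hb hτ'
          (fun r hr => h3 r (by omega) (by omega)) h40 h41 h4
        have hv := h1 a ha
        rw [if_neg (lt_irrefl a), if_pos rfl] at hv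
        have hlt' : τ'.arr A (ad a) < μ := by rw [hv]; exact Nat.mod_lt _ hμ
        have hfb := hf a b ha hb
        refine (Runs.store hτ' A f1 (e := (.get A addr + e) % .const μ)
          (by
            rw [RExpr.fits_mod, RExpr.fits_add, RExpr.fits_get hτ', RExpr.fits_const,
              RExpr.val_get, v1, v2]
            exact ⟨⟨f1, f2, by omega⟩, by omega⟩) v1
          (by rw [RExpr.val_mod, RExpr.val_add, RExpr.val_get, v1, v2, RExpr.val_const])).mono (t' := 126)
            (by simp only [RExpr.cost_mod, RExpr.cost_add, RExpr.cost_get, RExpr.cost_const]; omega)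
            fun τ'' _ he => ?_
        subst he
        refine ⟨h41, h40, fun i hi => ?_, fun x hx => ?_, h3, fun B hB => ?_⟩
        · rw [MachineState.setArr_arr]
          split
          · rename_i he
            obtain rfl := inj _ _ hi ha he
            rw [if_neg (lt_irrefl i), if_pos rfl, hv, Finset.sum_range_succ, Nat.mod_add_mod,
              add_assoc]
          · rename_i he
            have hia : i ≠ a := fun h => he (by rw [h])
            rw [h1 i hi, if_neg hia, if_neg hia]
        · rw [MachineState.setArr_arr, if_neg (fun h => hx a ha h.symm)]
          exact h2 x hx
        · rw [MachineState.setArr_arr_ne _ hB, h4 B hB])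
    rw [hCτ] at hl
    refine hl.mono le_rfl fun τ' _ h => ⟨h.1, ?_⟩
    obtain ⟨-, h1, h2, h3, h4⟩ := h
    refine ⟨fun i hi => ?_, h2, h3, h4⟩
    rw [h1 i hi]
    congr 3
    split_ifs <;> first | rfl | omega
  have outer := runs_forLoop
    (c := forLoop 41 rC (.store A addr ((.get A addr + e) % .const μ))) (r := 40) (b := rR)
    (fun a τ => P a 0 τ) (fun _ => (∑ i ∈ Finset.range C, (126 + 8)) + 6) hσ hW'
    (fun a τ v h => hset _ _ _ _ _ (Or.inl rfl) h)
    ⟨fun i hi => by simp [Nat.mod_eq_of_lt (hlt i hi)], fun _ _ => rfl, fun _ _ _ => rfl, fun _ _ => rfl⟩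
    (fun a τ h => h.2.2.1 rR (by omega) (by omega))
    (fun a τ ha hτ h40 hP => inner a τ ha hτ h40 hP)
  refine outer.mono ?_ fun τ _ h => ?_
  · simp only [Finset.sum_const, Finset.card_range, smul_eq_mul, ← hR']
    nlinarith [Nat.zero_le (R * C)]
  · obtain ⟨h1, h2, h3, h4⟩ := h
    refine ⟨fun i hi => ?_, h2, h3, h4⟩
    rw [h1 i hi, if_pos hi]

/-! ### Renaming registers and arrays -/

def RExpr.shift : RExpr → RExpr
  | .const c => .const c
  | .reg r => .reg (r + 50)
  | .get A e => .get (A + 50) e.shift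
  | .op o a b => .op o a.shift b.shift

/-- The program that uses the registers and arrays from number `50` on. -/
def Prog.shift : Prog → Prog
  | .skip => .skip
  | .assign r e => .assign (r + 50) e.shift
  | .store A i e => .store (A + 50) i.shift e.shift
  | .seq a b => .seq a.shift b.shift
  | .ite e a b => .ite e.shift a.shift b.shift
  | .loop e a => .loop e.shift a.shift

/-- The registers and arrays from number `50` on. -/
def MachineState.view (σ : MachineState) : MachineState :=
  ⟨fun r => σ.reg (r + 50), fun A => σ.arr (A + 50)⟩

theorem RExpr.val_shift (σ : MachineState) (e : RExpr) : e.shift.val σ = e.val σ.view := by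
  induction e with
  | const c => rfl
  | reg r => rfl
  | get A e ih => simp only [shift, val, ih]; rfl
  | op o a b iha ihb => simp only [shift, val, iha, ihb]

theorem RExpr.fits_shift (W : ℕ) (σ : MachineState) (e : RExpr) :
    e.shift.Fits W σ ↔ e.Fits W σ.view := by
  induction e with
  | const c => rfl
  | reg r => rfl
  | get A e ih => simp only [shift, Fits, ih, val_shift]; rfl
  | op o a b iha ihb => simp only [shift, Fits, iha, ihb, val_shift]

theorem RExpr.cost_shift (e : RExpr) : e.shift.cost = e.cost := by
  induction e with
  | const c => rfl
  | reg r => rfl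
  | get A e ih => simp only [shift, cost, ih]
  | op o a b iha ihb => simp only [shift, cost, iha, ihb]

/-- The relocated program sees the memory only through `view`, so it simulates the original step by
step at equal cost. What lies below `50` is safe from the given multiplication program, about whose
side effects nothing is known. -/
theorem Exec.shift {W : ℕ} {c : Prog} {ρ ρ' : MachineState} {t : ℕ} (h : Exec W c ρ ρ' t) :
    ∀ σ : MachineState, σ.view = ρ → ∃ σ', Exec W c.shift σ σ' t ∧ σ'.view = ρ' ∧
      (∀ r < 50, σ'.reg r = σ.reg r) ∧ ∀ A < 50, σ'.arr A = σ.arr A := by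
  induction h with
  | skip ρ => exact fun σ h => ⟨σ, .skip σ, h, fun _ _ => rfl, fun _ _ => rfl⟩
  | assign ρ r e he =>
    rintro σ rfl
    have := Exec.assign σ (r + 50) e.shift ((RExpr.fits_shift _ _ _).2 he)
    rw [RExpr.cost_shift, RExpr.val_shift] at this
    refine ⟨_, this, ?_, fun x hx => ?_, fun _ _ => rfl⟩
    · simp only [MachineState.view, MachineState.mk.injEq, and_true]
      funext x
      simp [Function.update_apply]
    · exact Function.update_of_ne (by omega) _ _
  | store ρ A i e hi he =>
    rintro σ rfl
    have := Exec.store σ (A + 50) i.shift e.shift ((RExpr.fits_shift _ _ _).2 hi)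
      ((RExpr.fits_shift _ _ _).2 he)
    rw [RExpr.cost_shift, RExpr.cost_shift, RExpr.val_shift, RExpr.val_shift] at this
    refine ⟨_, this, ?_, fun _ _ => rfl, fun x hx => ?_⟩
    · simp only [MachineState.view, MachineState.mk.injEq, true_and]
      funext x
      simp [Function.update_apply]
    · exact Function.update_of_ne (by omega) _ _
  | seq _ _ ih₁ ih₂ =>
    intro σ h
    obtain ⟨σ₁, e₁, v₁, r₁, a₁⟩ := ih₁ σ h
    obtain ⟨σ₂, e₂, v₂, r₂, a₂⟩ := ih₂ σ₁ v₁
    exact ⟨σ₂, .seq e₁ e₂, v₂, fun r hr => (r₂ r hr).trans (r₁ r hr),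
      fun A hA => (a₂ A hA).trans (a₁ A hA)⟩
  | @ite_true _ _ c₂ _ _ _ he hv _ ih =>
    rintro σ rfl
    obtain ⟨σ₁, e₁, v₁, r₁, a₁⟩ := ih σ rfl
    have := Exec.ite_true (c₂ := c₂.shift) ((RExpr.fits_shift _ _ _).2 he)
      (by rwa [RExpr.val_shift]) e₁
    rw [RExpr.cost_shift] at this
    exact ⟨σ₁, this, v₁, r₁, a₁⟩
  | @ite_false _ c₁ _ _ _ _ he hv _ ih =>
    rintro σ rfl
    obtain ⟨σ₁, e₁, v₁, r₁, a₁⟩ := ih σ rfl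
    have := Exec.ite_false (c₁ := c₁.shift) ((RExpr.fits_shift _ _ _).2 he)
      (by rwa [RExpr.val_shift]) e₁
    rw [RExpr.cost_shift] at this
    exact ⟨σ₁, this, v₁, r₁, a₁⟩
  | loop_stop he hv =>
    rintro σ rfl
    refine ⟨σ, ?_, rfl, fun _ _ => rfl, fun _ _ => rfl⟩
    rw [← RExpr.cost_shift]
    exact Exec.loop_stop ((RExpr.fits_shift _ _ _).2 he) (by rwa [RExpr.val_shift])
  | loop_step he hv _ _ ih₁ ih₂ =>
    rintro σ rfl
    obtain ⟨σ₁, e₁, v₁, r₁, a₁⟩ := ih₁ σ rfl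
    obtain ⟨σ₂, e₂, v₂, r₂, a₂⟩ := ih₂ σ₁ v₁
    have := Exec.loop_step ((RExpr.fits_shift _ _ _).2 he) (by rwa [RExpr.val_shift]) e₁ e₂
    rw [RExpr.cost_shift] at this
    exact ⟨σ₂, this, v₂, fun r hr => (r₂ r hr).trans (r₁ r hr),
      fun A hA => (a₂ A hA).trans (a₁ A hA)⟩

/-! ### Square products -/

/-- `c` multiplies the `m × m` matrices in the arrays `50`, `51` into the array `52`, where `m` is
in register `50`, in at most `F m` steps, and leaves everything numbered below `50` alone. -/
def MulSpec (c : Prog) (F : ℕ → ℕ) (d : ℕ) : Prop :=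
  ∀ (m W : ℕ), 1 ≤ m → (m + 2) ^ d ≤ W → ∀ (X Y : ℕ → ℕ → ZMod 2) (σ : MachineState),
    σ.IsWord W → σ.reg 50 = m →
    (∀ i j, i < m → j < m → σ.arr 50 (i * m + j) = (X i j).val) →
    (∀ i j, i < m → j < m → σ.arr 51 (i * m + j) = (Y i j).val) →
    Runs W c σ (F m) (fun τ =>
      (∀ i j, i < m → j < m →
        τ.arr 52 (i * m + j) = (∑ l ∈ Finset.range m, X i l * Y l j).val) ∧
      (∀ r < 50, τ.reg r = σ.reg r) ∧ ∀ A < 50, τ.arr A = σ.arr A)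

/-- Step counts are integers, so rounding the real bound down loses nothing; afterwards time is
handled in `ℕ` with an abstract function `F`. -/
theorem MatMulInTime.mulSpec {ω : ℝ} (h : MatMulInTime ω) :
    ∃ (c : Prog) (C d : ℕ), MulSpec c (fun m => ⌊(C : ℝ) * (m : ℝ) ^ ω⌋₊) d := by
  obtain ⟨c, C, d, h⟩ := h
  refine ⟨c.shift, C, d, fun m W hm hW X Y σ hσ hr hX hY => ?_⟩
  obtain ⟨ρ, t, he, ht, hs⟩ := h m hm (Matrix.of fun i j => X i j) (Matrix.of fun i j => Y i j) W hW
    σ.view ⟨fun r => hσ.1 _, fun A i => hσ.2 _ _⟩ hr (fun i j => hX i j i.2 j.2)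
    (fun i j => hY i j i.2 j.2)
  obtain ⟨σ', he', hv, hr', ha'⟩ := he.shift σ rfl
  refine ⟨σ', t, he', Nat.le_floor ht, he'.isWord hσ, fun i j hi hj => ?_, hr', ha'⟩
  have := hs ⟨i, hi⟩ ⟨j, hj⟩
  rw [← hv] at this
  simp only [MachineState.view, Matrix.mul_apply, Matrix.of_apply] at this
  rw [this, Finset.sum_range (fun l => X i l * Y l j)]

/-! ### Rectangular products -/

/-- The array `f` holds the matrix `X` over `𝔽₂` with `R` rows, `C` columns and stride `D`. -/
def Stored (f : ℕ → ℕ) (D R C : ℕ) (X : ℕ → ℕ → ZMod 2) : Prop :=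
  ∀ i j, i < R → j < C → f (i * D + j) = (X i j).val

theorem Stored.le_one {f : ℕ → ℕ} {D R C : ℕ} {X : ℕ → ℕ → ZMod 2} (h : Stored f D R C X)
    {i j : ℕ} (hi : i < R) (hj : j < C) : f (i * D + j) ≤ 1 := by
  rw [h i j hi hj]
  exact Nat.lt_succ_iff.1 (ZMod.val_lt _)

theorem mul_add_inj {D i j i' j' : ℕ} (hj : j < D) (hj' : j' < D) (h : i * D + j = i' * D + j') :
    i = i' ∧ j = j' := by
  have hD : 0 < D := by omega
  have h1 : i = i' := by
    have := congrArg (· / D) h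
    simpa [Nat.add_div_of_dvd_right (Dvd.intro_left _ rfl), Nat.mul_div_cancel _ hD,
      Nat.div_eq_of_lt hj, Nat.div_eq_of_lt hj'] using this
  subst h1
  exact ⟨rfl, by omega⟩

/-- Row-major addresses have this form, which is why `L * L + L < W` is the only condition on the
word size for indexing. -/
theorem mul_add_lt {L W a b c : ℕ} (hL : L * L + L < W) (ha : a ≤ L) (hb : b ≤ L) (hc : c ≤ L) :
    a * b + c < W :=
  lt_of_le_of_lt (Nat.add_le_add (Nat.mul_le_mul ha hb) hc) hL

theorem ite_val (p : Prop) [Decidable p] (x : ZMod 2) :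
    (if p then x else 0).val = x.val * (if p then 1 else 0) := by
  split <;> simp

section

variable (c : Prog) (A B Z rR rK rC rm : ℕ)

/-- One step of a blocked matrix product. -/
def tileStep : Prog :=
  .seq (map2 50 rm rm (.reg 40 * .reg rm + .reg 41)
    (.get A ((.reg 33 * .reg rm + .reg 40) * .reg 4 + (.reg 35 * .reg rm + .reg 41)) *
      (.lt (.reg 33 * .reg rm + .reg 40) (.reg rR) * .lt (.reg 35 * .reg rm + .reg 41) (.reg rK))))
  (.seq (map2 51 rm rm (.reg 40 * .reg rm + .reg 41)
    (.get B ((.reg 35 * .reg rm + .reg 40) * .reg 4 + (.reg 34 * .reg rm + .reg 41)) *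
      (.lt (.reg 35 * .reg rm + .reg 40) (.reg rK) * .lt (.reg 34 * .reg rm + .reg 41) (.reg rC))))
  (.seq (.assign 50 (.reg rm))
  (.seq c
  (map2 Z rm rm ((.reg 33 * .reg rm + .reg 40) * .reg 4 + (.reg 34 * .reg rm + .reg 41))
    ((.get Z ((.reg 33 * .reg rm + .reg 40) * .reg 4 + (.reg 34 * .reg rm + .reg 41)) % .const 2 +
      .get 52 (.reg 40 * .reg rm + .reg 41)) % .const 2)))))

/-- The product of the matrices in the arrays `A` (`R × K`) and `B` (`K × C`) into the array `Z`,
with square blocks of size `m`. -/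
def mulBlocks : Prog :=
  .seq (map2 Z rR rC (.reg 40 * .reg 4 + .reg 41) (.const 0))
  (.seq (.assign 30 (.reg rR / .reg rm + .const 1))
  (.seq (.assign 31 (.reg rC / .reg rm + .const 1))
  (.seq (.assign 32 (.reg rK / .reg rm + .const 1))
  (forLoop 33 30 (forLoop 34 31 (forLoop 35 32 (tileStep c A B Z rR rK rC rm)))))))

end

def tile (m R C : ℕ) (X : ℕ → ℕ → ZMod 2) (a b i j : ℕ) : ZMod 2 :=
  if a * m + i < R ∧ b * m + j < C then X (a * m + i) (b * m + j) else 0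

/-- The contribution of one pair of blocks to a product. -/
def tileProd (m R K C : ℕ) (X Y : ℕ → ℕ → ZMod 2) (a b l i j : ℕ) : ZMod 2 :=
  if i / m = a ∧ j / m = b then
    ∑ x ∈ Finset.range m, tile m R K X a l (i % m) x * tile m K C Y l b x (j % m) else 0

-- Blocks may stick out of the matrices. The margins `R + m ≤ D`, `C + m ≤ D`, `K + m ≤ D` keep such
-- addresses small and free of wraparound, comparisons multiply the arbitrary words found there by
-- zero, and the old target cell is reduced modulo `2` before the addition because it too may be
-- arbitrary outside the matrix.
set_option maxHeartbeats 1600000 in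
theorem runs_tileStep {c : Prog} {F : ℕ → ℕ} {d W L : ℕ} {A B Z rR rK rC rm : ℕ}
    (hc : MulSpec c F d) {σ : MachineState} (hσ : σ.IsWord W) (hL : L * L + L < W)
    (hA : A < 50) (hB : B < 50) (hZ : Z < 50)
    (hrR : rR < 30) (hrK : rK < 30) (hrC : rC < 30) (hrm : rm < 30)
    {m R K C D a b l : ℕ} (hm : σ.reg rm = m) (hR : σ.reg rR = R) (hK : σ.reg rK = K)
    (hC : σ.reg rC = C) (hD : σ.reg 4 = D) (ha : σ.reg 33 = a) (hb : σ.reg 34 = b)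
    (hl : σ.reg 35 = l) (hm1 : 1 ≤ m) (hmd : (m + 2) ^ d ≤ W) (haR : a ≤ R / m) (hbC : b ≤ C / m)
    (hlK : l ≤ K / m) (hDL : D ≤ L) (hRD : R + m ≤ D) (hCD : C + m ≤ D) (hKD : K + m ≤ D)
    {X Y U : ℕ → ℕ → ZMod 2} (hX : Stored (σ.arr A) D R K X) (hY : Stored (σ.arr B) D K C Y)
    (hU : Stored (σ.arr Z) D R C U) :
    Runs W (tileStep c A B Z rR rK rC rm) σ (600 * ((m + 1) * (m + 1)) + F m + 2) (fun τ =>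
      Stored (τ.arr Z) D R C (fun i j => U i j + tileProd m R K C X Y a b l i j) ∧
      (∀ r < 50, r ≠ 40 → r ≠ 41 → τ.reg r = σ.reg r) ∧ ∀ A < 50, A ≠ Z → τ.arr A = σ.arr A) := by
  have hW : 1 < W := by nlinarith
  have h2W : 2 < W := by nlinarith
  have ham : a * m ≤ R := le_trans (Nat.mul_le_mul_right _ haR) (Nat.div_mul_le_self _ _)
  have hbm : b * m ≤ C := le_trans (Nat.mul_le_mul_right _ hbC) (Nat.div_mul_le_self _ _)
  have hlm : l * m ≤ K := le_trans (Nat.mul_le_mul_right _ hlK) (Nat.div_mul_le_self _ _)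
  have haL : a ≤ a * m := Nat.le_mul_of_pos_right _ hm1
  have hbL : b ≤ b * m := Nat.le_mul_of_pos_right _ hm1
  have hlL : l ≤ l * m := Nat.le_mul_of_pos_right _ hm1
  have hlt : ∀ x, x ≤ L → x < W := fun x hx => by nlinarith
  have hmul : ∀ x y, x ≤ L → y ≤ L → x * y < W := fun x y hx hy => by
    have := mul_add_lt hL hx hy (Nat.zero_le L); omega
  have hmuladd : ∀ x y z, x ≤ L → y ≤ L → z ≤ L → x * y + z < W := fun x y z hx hy hz =>
    mul_add_lt hL hx hy hz
  have h1 := runs_map2 (A := 50) (rR := rm) (rC := rm) (addr := .reg 40 * .reg rm + .reg 41)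
    (e := .get A ((.reg 33 * .reg rm + .reg 40) * .reg 4 + (.reg 35 * .reg rm + .reg 41)) *
      (.lt (.reg 33 * .reg rm + .reg 40) (.reg rR) * .lt (.reg 35 * .reg rm + .reg 41) (.reg rK)))
    hσ hW (by omega) (by omega) (by simp) (fun i j => i * m + j)
    (fun i j => (tile m R K X a l i j).val) hm hm
    (fun i j i' j' _ hj _ hj' h => mul_add_inj hj hj' h)
    (by
      intro i j τ hi hj hτ hreg h40 h41 harr _
      simp only [RExpr.fits_add, RExpr.fits_mul, RExpr.fits_get hτ, RExpr.fits_reg hτ,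
        RExpr.fits_lt hW, RExpr.val_add, RExpr.val_mul, RExpr.val_get, RExpr.val_lt, RExpr.val_reg,
        h40, h41, harr A (by omega), hreg rm (by omega), hreg 33 (by omega), hreg 35 (by omega),
        hreg rR (by omega), hreg rK (by omega), hreg 4 (by omega), hm, hR, hK, hD, ha, hl, true_and,
        and_true]
      constructorm* _ ∧ _
      all_goals first
        | exact hmuladd _ _ _ (by omega) (by omega) (by omega)
        | exact hmul _ _ (by omega) (by omega)
        | exact hlt _ (by omega)
        | skip
      · split_ifs <;> omega
      · have := hσ.2 A ((a * m + i) * D + (l * m + j))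
        split_ifs <;> omega
      · rw [tile, ite_val]
        by_cases h : a * m + i < R ∧ l * m + j < K
        · rw [hX _ _ h.1 h.2]; simp [h.1, h.2]
        · rw [if_neg h]
          by_cases h' : a * m + i < R
          · have : ¬ l * m + j < K := fun h'' => h ⟨h', h''⟩
            simp [this]
          · simp [h'])
  refine (Runs.seq h1 (t₂ := 400 * ((m + 1) * (m + 1)) + F m + 2) fun τ₁ hτ₁ ⟨q1, _, r1, a1⟩ => ?_).mono
    (by omega) (fun _ _ h => h)
  have h2 := runs_map2 (A := 51) (rR := rm) (rC := rm) (addr := .reg 40 * .reg rm + .reg 41)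
    (e := .get B ((.reg 35 * .reg rm + .reg 40) * .reg 4 + (.reg 34 * .reg rm + .reg 41)) *
      (.lt (.reg 35 * .reg rm + .reg 40) (.reg rK) * .lt (.reg 34 * .reg rm + .reg 41) (.reg rC)))
    hτ₁ hW (by omega) (by omega) (by simp) (fun i j => i * m + j)
    (fun i j => (tile m K C Y l b i j).val) ((r1 rm (by omega) (by omega)).trans hm)
    ((r1 rm (by omega) (by omega)).trans hm)
    (fun i j i' j' _ hj _ hj' h => mul_add_inj hj hj' h)
    (by
      intro i j τ hi hj hτ hreg' h40 h41 harr _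
      have hreg : ∀ r < 40, τ.reg r = σ.reg r := fun r hr =>
        (hreg' r hr).trans (r1 r (by omega) (by omega))
      simp only [RExpr.fits_add, RExpr.fits_mul, RExpr.fits_get hτ, RExpr.fits_reg hτ,
        RExpr.fits_lt hW, RExpr.val_add, RExpr.val_mul, RExpr.val_get, RExpr.val_lt, RExpr.val_reg,
        h40, h41, harr B (by omega), a1 B (by omega), hreg rm (by omega), hreg 34 (by omega),
        hreg 35 (by omega),
        hreg rC (by omega), hreg rK (by omega), hreg 4 (by omega), hm, hC, hK, hD, hb, hl, true_and,
        and_true]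
      constructorm* _ ∧ _
      all_goals first
        | exact hmuladd _ _ _ (by omega) (by omega) (by omega)
        | exact hmul _ _ (by omega) (by omega)
        | exact hlt _ (by omega)
        | skip
      · split_ifs <;> omega
      · have := hσ.2 B ((l * m + i) * D + (b * m + j))
        split_ifs <;> omega
      · rw [tile, ite_val]
        by_cases h : l * m + i < K ∧ b * m + j < C
        · rw [hY _ _ h.1 h.2]; simp [h.1, h.2]
        · rw [if_neg h]
          by_cases h' : l * m + i < K
          · have : ¬ b * m + j < C := fun h'' => h ⟨h', h''⟩
            simp [this]
          · simp [h'])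
  refine (Runs.seq h2 (t₂ := 200 * ((m + 1) * (m + 1)) + F m + 2) fun τ₂ hτ₂ ⟨q2, _, r2, a2⟩ => ?_).mono
    (by omega) (fun _ _ h => h)
  have hm2 : τ₂.reg rm = m := by
    rw [r2 _ (by omega) (by omega), r1 _ (by omega) (by omega), hm]
  refine (Runs.seq (Runs.assign hτ₂ 50 (e := .reg rm) (v := m) (by simp [RExpr.fits_reg hτ₂])
    (by simpa using hm2)) (t₂ := 200 * ((m + 1) * (m + 1)) + F m) fun τ₃ hτ₃ he3 => ?_).mono
    (by simp only [RExpr.cost_reg]; omega) (fun _ _ h => h)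
  have r3 : ∀ r, r ≠ 40 → r ≠ 41 → r ≠ 50 → τ₃.reg r = σ.reg r := fun r h h' h'' => by
    rw [he3, MachineState.setReg_reg, if_neg h'', r2 r h h', r1 r h h']
  have a3 : ∀ B, B ≠ 50 → B ≠ 51 → τ₃.arr B = σ.arr B := fun B h h' => by
    rw [he3, MachineState.setReg_arr, a2 B h', a1 B h]
  have h4 := hc m W hm1 hmd (tile m R K X a l) (tile m K C Y l b) τ₃ hτ₃
    (by rw [he3, MachineState.setReg_reg, if_pos rfl])
    (fun i j hi hj => by
      rw [he3, MachineState.setReg_arr, a2 50 (by omega)]; exact q1 i j hi hj)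
    (fun i j hi hj => by rw [he3, MachineState.setReg_arr]; exact q2 i j hi hj)
  refine (Runs.seq h4 (t₂ := 200 * ((m + 1) * (m + 1))) fun τ₄ hτ₄ ⟨q4, r4', a4'⟩ => ?_).mono
    (by omega) (fun _ _ h => h)
  have r4 : ∀ r < 50, r ≠ 40 → r ≠ 41 → τ₄.reg r = σ.reg r := fun r h h' h'' => by
    rw [r4' r h, r3 r h' h'' (by omega)]
  have a4 : ∀ B < 50, τ₄.arr B = σ.arr B := fun B h => by
    rw [a4' B h, a3 B (by omega) (by omega)]
  have h5 := runs_map2 (A := Z) (rR := rm) (rC := rm)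
    (addr := (.reg 33 * .reg rm + .reg 40) * .reg 4 + (.reg 34 * .reg rm + .reg 41))
    (e := (.get Z ((.reg 33 * .reg rm + .reg 40) * .reg 4 + (.reg 34 * .reg rm + .reg 41)) % .const 2 +
      .get 52 (.reg 40 * .reg rm + .reg 41)) % .const 2)
    hτ₄ hW (by omega) (by omega) (by simp) (fun i j => (a * m + i) * D + (b * m + j))
    (fun i j => (σ.arr Z ((a * m + i) * D + (b * m + j)) % 2 +
      (∑ x ∈ Finset.range m, tile m R K X a l i x * tile m K C Y l b x j).val) % 2)
    ((r4 rm (by omega) (by omega) (by omega)).trans hm)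
    ((r4 rm (by omega) (by omega) (by omega)).trans hm)
    (fun i j i' j' _ hj _ hj' h => by
      obtain ⟨h1, h2⟩ := mul_add_inj (by omega) (by omega) h
      omega)
    (by
      intro i j τ hi hj hτ hreg' h40 h41 harr hself
      have hreg : ∀ r < 40, τ.reg r = σ.reg r := fun r hr =>
        (hreg' r hr).trans (r4 r (by omega) (by omega) (by omega))
      have hv := ZMod.val_lt (∑ x ∈ Finset.range m, tile m R K X a l i x * tile m K C Y l b x j)
      simp only [RExpr.fits_add, RExpr.fits_mul, RExpr.fits_get hτ, RExpr.fits_reg hτ,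
        RExpr.fits_mod, RExpr.fits_const, RExpr.val_mod, RExpr.val_const,
        RExpr.val_add, RExpr.val_mul, RExpr.val_get, RExpr.val_reg,
        h40, h41, harr 52 (by omega), hreg rm (by omega), hreg 34 (by omega), hreg 33 (by omega),
        hreg 4 (by omega), hm, hD, hb, ha, true_and, and_true, q4 i j hi hj, hself, a4 Z hZ]
      constructorm* _ ∧ _
      all_goals first
        | exact hmuladd _ _ _ (by omega) (by omega) (by omega)
        | exact hmul _ _ (by omega) (by omega)
        | exact hlt _ (by omega)
        | skip
      all_goals omega)
  refine h5.mono le_rfl fun τ₅ hτ₅ ⟨q5, q5', r5, a5⟩ => ⟨fun i j hi hj => ?_, fun r h h' h'' => ?_,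
    fun B hB hBZ => by rw [a5 B hBZ, a4 B hB]⟩
  · simp only [tileProd]
    by_cases hij : i / m = a ∧ j / m = b
    · have hi' : a * m + i % m = i := by rw [← hij.1]; exact Nat.div_add_mod' i m
      have hj' : b * m + j % m = j := by rw [← hij.2]; exact Nat.div_add_mod' j m
      have := q5 (i % m) (j % m) (Nat.mod_lt _ hm1) (Nat.mod_lt _ hm1)
      rw [hi', hj', hU i j hi hj] at this
      rw [this, if_pos hij, ZMod.val_add, Nat.mod_add_mod]
    · rw [if_neg hij, add_zero, q5' _ fun i' j' hi' hj' he => hij ?_, a4 Z hZ, hU i j hi hj]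
      obtain ⟨h1, h2⟩ := mul_add_inj (by omega) (by omega) he
      rw [← h1, ← h2, Nat.mul_comm a, Nat.mul_comm b, Nat.mul_add_div hm1, Nat.mul_add_div hm1,
        Nat.div_eq_of_lt hi', Nat.div_eq_of_lt hj']
      exact ⟨rfl, rfl⟩
  · rw [r5 r h' h'', r4 r h h' h'']

theorem sum_range_tiles {M : Type*} [AddCommMonoid M] (N m : ℕ) (f : ℕ → M) :
    ∑ l ∈ Finset.range N, ∑ x ∈ Finset.range m, f (l * m + x) = ∑ y ∈ Finset.range (N * m), f y := by
  induction N with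
  | zero => simp
  | succ N ih => rw [Finset.sum_range_succ, ih, Nat.succ_mul, Finset.sum_range_add]

theorem sum_range_guard {M : Type*} [AddCommMonoid M] {K N : ℕ} (h : K ≤ N) (f : ℕ → M) :
    ∑ y ∈ Finset.range N, (if y < K then f y else 0) = ∑ y ∈ Finset.range K, f y := by
  rw [← Finset.sum_filter]
  congr 1
  ext y
  simp only [Finset.mem_filter, Finset.mem_range]
  omega

theorem lt_div_add_one_mul {R m : ℕ} (hm : 1 ≤ m) : R < (R / m + 1) * m := by
  rw [Nat.add_mul, one_mul]
  exact Nat.lt_div_mul_add hm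

/-- Only the blocks that contain the row `i` and the column `j` contribute. Their inner sums tile an
interval that covers `range K`, and the guards remove the excess. -/
theorem sum_tileProd {m R K C : ℕ} (hm : 1 ≤ m) (X Y : ℕ → ℕ → ZMod 2) {i j : ℕ} (hi : i < R)
    (hj : j < C) :
    ∑ a ∈ Finset.range (R / m + 1), ∑ b ∈ Finset.range (C / m + 1),
      ∑ l ∈ Finset.range (K / m + 1), tileProd m R K C X Y a b l i j =
      ∑ x ∈ Finset.range K, X i x * Y x j := by
  have ha : i / m ∈ Finset.range (R / m + 1) :=
    Finset.mem_range.2 (Nat.lt_succ_of_le (Nat.div_le_div_right hi.le))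
  have hb : j / m ∈ Finset.range (C / m + 1) :=
    Finset.mem_range.2 (Nat.lt_succ_of_le (Nat.div_le_div_right hj.le))
  rw [Finset.sum_eq_single_of_mem _ ha, Finset.sum_eq_single_of_mem _ hb]
  · rw [← sum_range_guard (N := (K / m + 1) * m) (lt_div_add_one_mul hm).le, ← sum_range_tiles]
    refine Finset.sum_congr rfl fun l _ => ?_
    rw [tileProd, if_pos ⟨rfl, rfl⟩]
    refine Finset.sum_congr rfl fun x _ => ?_
    simp only [tile, Nat.div_add_mod', hi, hj, true_and, and_true]
    split_ifs <;> simp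
  · intro b _ hne
    exact Finset.sum_eq_zero fun l _ => if_neg fun h => hne h.2.symm
  · intro a _ hne
    exact Finset.sum_eq_zero fun b _ => Finset.sum_eq_zero fun l _ => if_neg fun h => hne h.1.symm

def tMul (F : ℕ → ℕ) (R K C m : ℕ) : ℕ :=
  200 * ((R + 1) * (C + 1)) +
    (R / m + 1) * ((C / m + 1) * ((K / m + 1) * (600 * ((m + 1) * (m + 1)) + F m + 50))) + 50

theorem runs_mulBlocks {c : Prog} {F : ℕ → ℕ} {d W L : ℕ} {A B Z rR rK rC rm : ℕ}
    (hc : MulSpec c F d) {σ : MachineState} (hσ : σ.IsWord W) (hL : L * L + L < W)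
    (hA : A < 50) (hB : B < 50) (hZ : Z < 50) (hAZ : A ≠ Z) (hBZ : B ≠ Z)
    (hrR : rR < 30) (hrK : rK < 30) (hrC : rC < 30) (hrm : rm < 30)
    {m R K C D : ℕ} (hm : σ.reg rm = m) (hR : σ.reg rR = R) (hK : σ.reg rK = K)
    (hC : σ.reg rC = C) (hD : σ.reg 4 = D) (hm1 : 1 ≤ m) (hmd : (m + 2) ^ d ≤ W)
    (hDL : D ≤ L) (hRD : R + m ≤ D) (hCD : C + m ≤ D) (hKD : K + m ≤ D)
    {X Y : ℕ → ℕ → ZMod 2} (hX : Stored (σ.arr A) D R K X) (hY : Stored (σ.arr B) D K C Y) :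
    Runs W (mulBlocks c A B Z rR rK rC rm) σ (tMul F R K C m) (fun τ =>
      Stored (τ.arr Z) D R C (fun i j => ∑ x ∈ Finset.range K, X i x * Y x j) ∧
      (∀ r < 30, τ.reg r = σ.reg r) ∧ ∀ A < 50, A ≠ Z → τ.arr A = σ.arr A) := by
  have hW : 1 < W := by nlinarith
  have hlt : ∀ x, x ≤ L → x < W := fun x hx => by nlinarith
  have h1 := runs_map2 (A := Z) (rR := rR) (rC := rC) (addr := .reg 40 * .reg 4 + .reg 41)
    (e := .const 0) hσ hW (by omega) (by omega) (by simp) (fun i j => i * D + j)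
    (fun i j => 0) hR hC
    (fun i j i' j' _ hj _ hj' h => mul_add_inj (by omega) (by omega) h)
    (by
      intro i j τ hi hj hτ hreg h40 h41 harr _
      simp only [RExpr.fits_add, RExpr.fits_mul, RExpr.fits_reg hτ, RExpr.val_add, RExpr.val_mul,
        RExpr.val_reg, h40, h41, hreg 4 (by omega), hD, true_and, and_true, RExpr.fits_const,
        RExpr.val_const]
      have := mul_add_lt hL (show i ≤ L by omega) hDL (show j ≤ L by omega)
      exact ⟨⟨by omega, this⟩, by omega⟩)
  refine (Runs.seq h1 (t₂ := (R / m + 1) * ((C / m + 1) * ((K / m + 1) *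
    (600 * ((m + 1) * (m + 1)) + F m + 50))) + 50) fun τ₁ hτ₁ ⟨q1, _, r1, a1⟩ => ?_).mono
    (by unfold tMul; omega) (fun _ _ h => h)
  have hdiv : ∀ x, x ≤ D → x / m + 1 < W := fun x hx => by
    have : x / m ≤ x := Nat.div_le_self _ _
    nlinarith
  have key : ∀ (τ : MachineState) (s r x : ℕ), τ.IsWord W → τ.reg r = x → τ.reg rm = m → x ≤ D →
      Runs W (.assign s (.reg r / .reg rm + .const 1)) τ 6 (fun τ' => τ' = τ.setReg s (x / m + 1)) :=
    fun τ s r x hτ hx hm' hxD =>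
      (Runs.assign hτ s (e := .reg r / .reg rm + .const 1) (v := x / m + 1)
        (by simp [RExpr.fits_reg hτ, hx, hm', hdiv x hxD, hW]) (by simp [hx, hm'])).mono (by simp)
        (fun _ _ h => h)
  refine (Runs.seq (key τ₁ 30 rR R hτ₁ ((r1 _ (by omega) (by omega)).trans hR)
    ((r1 _ (by omega) (by omega)).trans hm) (by omega))
    (t₂ := (R / m + 1) * ((C / m + 1) * ((K / m + 1) *
    (600 * ((m + 1) * (m + 1)) + F m + 50))) + 44) fun τ₂ hτ₂ e2 => ?_).mono
    (by omega) (fun _ _ h => h)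
  have r2 : ∀ r < 30, τ₂.reg r = σ.reg r := fun r hr => by
    rw [e2, MachineState.setReg_reg, if_neg (by omega), r1 r (by omega) (by omega)]
  refine (Runs.seq (key τ₂ 31 rC C hτ₂ ((r2 _ hrC).trans hC) ((r2 _ hrm).trans hm) (by omega))
    (t₂ := (R / m + 1) * ((C / m + 1) * ((K / m + 1) *
    (600 * ((m + 1) * (m + 1)) + F m + 50))) + 38) fun τ₃ hτ₃ e3 => ?_).mono
    (by omega) (fun _ _ h => h)
  have r3 : ∀ r < 30, τ₃.reg r = σ.reg r := fun r hr => by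
    rw [e3, MachineState.setReg_reg, if_neg (by omega), r2 r hr]
  refine (Runs.seq (key τ₃ 32 rK K hτ₃ ((r3 _ hrK).trans hK) ((r3 _ hrm).trans hm) (by omega))
    (t₂ := (R / m + 1) * ((C / m + 1) * ((K / m + 1) *
    (600 * ((m + 1) * (m + 1)) + F m + 50))) + 32) fun τ₄ hτ₄ e4 => ?_).mono
    (by omega) (fun _ _ h => h)
  have r4 : ∀ r < 30, τ₄.reg r = σ.reg r := fun r hr => by
    rw [e4, MachineState.setReg_reg, if_neg (by omega), r3 r hr]
  have n30 : τ₄.reg 30 = R / m + 1 := by simp [e4, e3, e2, MachineState.setReg_reg]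
  have n31 : τ₄.reg 31 = C / m + 1 := by simp [e4, e3, MachineState.setReg_reg]
  have n32 : τ₄.reg 32 = K / m + 1 := by simp [e4, MachineState.setReg_reg]
  have a4 : τ₄.arr = τ₁.arr := by simp only [e4, e3, e2, MachineState.setReg_arr]
  let P : (ℕ → ℕ → ZMod 2) → MachineState → Prop := fun U τ =>
    Stored (τ.arr Z) D R C U ∧ (∀ r < 33, τ.reg r = τ₄.reg r) ∧
      ∀ A < 50, A ≠ Z → τ.arr A = σ.arr A
  have hset : ∀ U τ r v, 33 ≤ r → P U τ → P U (τ.setReg r v) := by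
    rintro U τ r v hr ⟨p1, p2, p3⟩
    exact ⟨p1, fun x hx => by rw [MachineState.setReg_reg, if_neg (by omega), p2 x hx], p3⟩
  have hP30 : ∀ U τ r, r < 30 → P U τ → τ.reg r = σ.reg r := fun U τ r hr h => by
    rw [h.2.1 r (by omega), r4 r hr]
  set T := tileProd m R K C X Y with hT
  have loop3 : ∀ a b τ U, a ≤ R / m → b ≤ C / m → τ.IsWord W → τ.reg 33 = a → τ.reg 34 = b →
      P U τ → Runs W (forLoop 35 32 (tileStep c A B Z rR rK rC rm)) τ
        ((∑ i ∈ Finset.range (K / m + 1), (600 * ((m + 1) * (m + 1)) + F m + 2 + 8)) + 6)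
        (fun τ' => τ'.reg 34 = b ∧ τ'.reg 33 = a ∧
          P (fun i j => U i j + ∑ l ∈ Finset.range (K / m + 1), T a b l i j) τ') := by
    intro a b τ U ha hb hτ h33 h34 hP
    have h32 : τ.reg 32 = K / m + 1 := by rw [hP.2.1 32 (by omega), n32]
    have := runs_forLoop (c := tileStep c A B Z rR rK rC rm) (r := 35) (b := 32)
      (fun l τ' => τ'.reg 34 = b ∧ τ'.reg 33 = a ∧
        P (fun i j => U i j + ∑ l ∈ Finset.range l, T a b l i j) τ')
      (fun _ => 600 * ((m + 1) * (m + 1)) + F m + 2) hτ hW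
      (by
        rintro i τ' v ⟨p1, p2, p3⟩
        exact ⟨by simp [MachineState.setReg_reg, p1], by simp [MachineState.setReg_reg, p2],
          hset _ _ _ _ (by omega) p3⟩)
      ⟨h34, h33, by simpa using hP⟩
      (fun i τ' h => by rw [h.2.2.2.1 32 (by omega), hP.2.1 32 (by omega)])
      (by
        rintro l τ' hl hτ' h35 ⟨p1, p2, p3⟩
        rw [h32] at hl
        refine (runs_tileStep hc hτ' hL hA hB hZ hrR hrK hrC hrm
          ((hP30 _ _ _ hrm p3).trans hm) ((hP30 _ _ _ hrR p3).trans hR)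
          ((hP30 _ _ _ hrK p3).trans hK) ((hP30 _ _ _ hrC p3).trans hC)
          ((hP30 _ _ _ (by omega) p3).trans hD) p2 p1 h35 hm1 hmd ha hb (by omega) hDL hRD hCD hKD
          (X := X) (Y := Y) (by rw [p3.2.2 A hA hAZ]; exact hX)
          (by rw [p3.2.2 B hB hBZ]; exact hY) p3.1).mono le_rfl fun τ'' _ ⟨s1, s2, s3⟩ => ?_
        refine ⟨by rw [s2 35 (by omega) (by omega) (by omega), h35],
          by rw [s2 34 (by omega) (by omega) (by omega), p1],
          by rw [s2 33 (by omega) (by omega) (by omega), p2], ?_,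
          fun r hr => by rw [s2 r (by omega) (by omega) (by omega), p3.2.1 r hr],
          fun A' hA' hAZ' => by rw [s3 A' hA' hAZ', p3.2.2 A' hA' hAZ']⟩
        simpa only [Finset.sum_range_succ, add_assoc] using s1)
    rw [h32] at this
    exact this
  have loop2 : ∀ a τ U, a ≤ R / m → τ.IsWord W → τ.reg 33 = a →
      P U τ → Runs W (forLoop 34 31 (forLoop 35 32 (tileStep c A B Z rR rK rC rm))) τ
        ((∑ i ∈ Finset.range (C / m + 1),
          ((∑ i ∈ Finset.range (K / m + 1), (600 * ((m + 1) * (m + 1)) + F m + 2 + 8)) + 6 + 8)) + 6)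
        (fun τ' => τ'.reg 33 = a ∧
          P (fun i j => U i j + ∑ b ∈ Finset.range (C / m + 1),
            ∑ l ∈ Finset.range (K / m + 1), T a b l i j) τ') := by
    intro a τ U ha hτ h33 hP
    have h31 : τ.reg 31 = C / m + 1 := by rw [hP.2.1 31 (by omega), n31]
    have := runs_forLoop (c := forLoop 35 32 (tileStep c A B Z rR rK rC rm)) (r := 34) (b := 31)
      (fun b τ' => τ'.reg 33 = a ∧
        P (fun i j => U i j + ∑ b ∈ Finset.range b,
            ∑ l ∈ Finset.range (K / m + 1), T a b l i j) τ')
      (fun _ => (∑ i ∈ Finset.range (K / m + 1), (600 * ((m + 1) * (m + 1)) + F m + 2 + 8)) + 6) hτ hW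
      (by
        rintro i τ' v ⟨p2, p3⟩
        exact ⟨by simp [MachineState.setReg_reg, p2], hset _ _ _ _ (by omega) p3⟩)
      ⟨h33, by simpa using hP⟩
      (fun i τ' h => by rw [h.2.2.1 31 (by omega), hP.2.1 31 (by omega)])
      (by
        rintro b τ' hb hτ' h34 ⟨p2, p3⟩
        rw [h31] at hb
        refine (loop3 a b τ' _ ha (by omega) hτ' p2 h34 p3).mono le_rfl fun τ'' _ ⟨s1, s2, s3⟩ => ?_
        refine ⟨s1, s2, ?_⟩
        simpa only [Finset.sum_range_succ, add_assoc] using s3)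
    rw [h31] at this
    exact this
  have loop1 := runs_forLoop
    (c := forLoop 34 31 (forLoop 35 32 (tileStep c A B Z rR rK rC rm))) (r := 33) (b := 30)
    (fun a τ' => P (fun i j => 0 + ∑ a ∈ Finset.range a, ∑ b ∈ Finset.range (C / m + 1),
            ∑ l ∈ Finset.range (K / m + 1), T a b l i j) τ')
    (fun _ => (∑ i ∈ Finset.range (C / m + 1),
          ((∑ i ∈ Finset.range (K / m + 1), (600 * ((m + 1) * (m + 1)) + F m + 2 + 8)) + 6 + 8)) + 6)
    hτ₄ hW (fun i τ' v p3 => hset _ _ _ _ (by omega) p3)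
    ⟨fun i j hi hj => by rw [a4, q1 i j hi hj]; simp, fun r hr => rfl, fun A' hA' hAZ' => by
      rw [a4, a1 A' hAZ']⟩
    (fun i τ' h => by rw [h.2.1 30 (by omega)])
    (by
      rintro a τ' ha hτ' h33 p3
      rw [n30] at ha
      refine (loop2 a τ' _ (by omega) hτ' h33 p3).mono le_rfl fun τ'' _ ⟨s2, s3⟩ => ?_
      refine ⟨s2, ?_⟩
      simpa only [Finset.sum_range_succ, add_assoc] using s3)
  rw [n30] at loop1
  refine loop1.mono ?_ fun τ hτ h => ⟨fun i j hi hj => ?_, fun r hr => hP30 _ _ _ hr h, h.2.2⟩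
  · simp only [Finset.sum_const, Finset.card_range, smul_eq_mul]
    generalize 600 * ((m + 1) * (m + 1)) + F m = g
    nlinarith [Nat.zero_le ((R / m) * (C / m)), Nat.zero_le ((R / m) * (K / m)),
      Nat.zero_le ((R / m) * (C / m) * (K / m)), Nat.zero_le ((C / m) * (K / m)),
      Nat.zero_le (R / m), Nat.zero_le (C / m), Nat.zero_le (K / m)]
  · rw [h.1 i j hi hj]
    beta_reduce
    rw [zero_add, hT, sum_tileProd hm1 X Y hi hj]

/-! ### Gauss–Jordan elimination -/

/-- One plus the first `i < n` with `P i`, or `0` if there is none. -/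
def firstSucc (P : ℕ → Prop) [DecidablePred P] : ℕ → ℕ
  | 0 => 0
  | n + 1 => if firstSucc P n = 0 ∧ P n then n + 1 else firstSucc P n

theorem firstSucc_spec (P : ℕ → Prop) [DecidablePred P] (n : ℕ) :
    (firstSucc P n = 0 → ∀ i < n, ¬ P i) ∧
      (firstSucc P n ≠ 0 → firstSucc P n - 1 < n ∧ P (firstSucc P n - 1)) := by
  induction n with
  | zero => simp [firstSucc]
  | succ n ih =>
    rw [firstSucc]
    split
    · rename_i h
      exact ⟨by simp, fun _ => ⟨by simp, h.2⟩⟩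
    · rename_i h
      refine ⟨fun h0 i hi hP => ?_, fun h0 => ⟨by have := (ih.2 h0).1; omega, (ih.2 h0).2⟩⟩
      rcases Nat.lt_succ_iff_lt_or_eq.1 hi with hi | rfl
      · exact ih.1 h0 i hi hP
      · exact h ⟨h0, hP⟩

/-- The state of an elimination. In `X`, the columns that are already eliminated are replaced by
the columns of the transformation matrix; `piv c` is one plus the pivot row of the column `c`. -/
structure Elim where
  X : ℕ → ℕ → ZMod 2
  used : ℕ → ZMod 2
  piv : ℕ → ℕ

namespace Elim

/-- One plus the pivot row that is chosen for the column `t`. -/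
def choose (n : ℕ) (s : Elim) (t : ℕ) : ℕ := firstSucc (fun i => s.used i = 0 ∧ s.X i t = 1) n

/-- The multipliers of the elimination of the column `t`. -/
def mult (n : ℕ) (s : Elim) (t i : ℕ) : ZMod 2 :=
  if s.choose n t = 0 ∨ i + 1 = s.choose n t then 0 else s.X i t

def step (n : ℕ) (s : Elim) (t : ℕ) : Elim where
  X i c := if c = t then s.mult n t i else s.X i c + s.mult n t i * s.X (s.choose n t - 1) c
  used i := if i + 1 = s.choose n t then 1 else s.used i
  piv c := if c = t then s.choose n t else s.piv c

/-- The elimination of the first columns of `Y` with pivots in the first `n` rows. -/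
def run (n : ℕ) (Y : ℕ → ℕ → ZMod 2) : ℕ → Elim
  | 0 => ⟨Y, fun _ => 0, fun _ => 0⟩
  | t + 1 => (run n Y t).step n t

variable {n : ℕ} {Y : ℕ → ℕ → ZMod 2}

/-- The row of a pivot column, and zero for the other columns. -/
def pivRow (p : ℕ → ℕ) (y : ℕ → ZMod 2) (l : ℕ) : ZMod 2 := if p l = 0 then 0 else y (p l - 1)

theorem run_succ_X (t i c : ℕ) : (run n Y (t + 1)).X i c =
    if c = t then (run n Y t).mult n t i else (run n Y t).X i c +
      (run n Y t).mult n t i * (run n Y t).X ((run n Y t).choose n t - 1) c := rfl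

theorem run_succ_piv (t c : ℕ) : (run n Y (t + 1)).piv c =
    if c = t then (run n Y t).choose n t else (run n Y t).piv c := rfl

theorem run_succ_used (t i : ℕ) : (run n Y (t + 1)).used i =
    if i + 1 = (run n Y t).choose n t then 1 else (run n Y t).used i := rfl

theorem run_piv {l t : ℕ} (h : l < t) : (run n Y t).piv l = (run n Y l).choose n l := by
  induction t with
  | zero => omega
  | succ t ih =>
    rw [run_succ_piv]
    split
    · rename_i h; rw [h]
    · exact ih (by omega)

theorem run_piv_le (t l : ℕ) : (run n Y t).piv l ≤ n := by
  induction t with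
  | zero => exact Nat.zero_le _
  | succ t ih =>
    rw [run_succ_piv]
    split
    · by_cases h : (run n Y t).choose n t = 0
      · omega
      · have := ((firstSucc_spec (fun i => (run n Y t).used i = 0 ∧ (run n Y t).X i t = 1) n).2 h).1
        unfold choose
        omega
    · exact ih

/-- The elimination steps `s, …, t - 1` in one go. -/
theorem run_block (s t i c : ℕ) (hst : s ≤ t) (hc : c < s ∨ t ≤ c) :
    (run n Y t).X i c = (run n Y s).X i c + ∑ l ∈ Finset.Ico s t,
      (run n Y t).X i l * pivRow (run n Y t).piv (fun p => (run n Y s).X p c) l := by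
  induction t, hst using Nat.le_induction generalizing i with
  | base => simp
  | succ t hst ih =>
    rw [Finset.sum_Ico_succ_top hst, run_succ_X, if_neg (by omega), ih i (by omega),
      ih _ (by omega)]
    set e := run n Y t with he
    set p := e.choose n t with hp
    have hpiv : pivRow (run n Y (t + 1)).piv (fun p => (run n Y s).X p c) t =
        if p = 0 then 0 else (run n Y s).X (p - 1) c := by
      rw [pivRow, run_succ_piv, if_pos rfl]
    have hm : e.mult n t i * (run n Y s).X (p - 1) c =
        (run n Y (t + 1)).X i t * (if p = 0 then 0 else (run n Y s).X (p - 1) c) := by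
      rw [run_succ_X, if_pos rfl, ← he]
      by_cases h0 : p = 0
      · simp [mult, ← hp, h0]
      · rw [if_neg h0]
    -- The stored multiplier columns undergo the same row operation as the matrix. The change of
    -- column `l` is exactly what the pivot row of step `t` had received from step `l`.
    have hsum : ∑ l ∈ Finset.Ico s t, (run n Y (t + 1)).X i l *
        pivRow (run n Y (t + 1)).piv (fun p => (run n Y s).X p c) l =
        ∑ l ∈ Finset.Ico s t, (e.X i l * pivRow e.piv (fun p => (run n Y s).X p c) l +
          e.mult n t i * (e.X (p - 1) l * pivRow e.piv (fun p => (run n Y s).X p c) l)) := by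
      refine Finset.sum_congr rfl fun l hl => ?_
      rw [Finset.mem_Ico] at hl
      simp only [pivRow, run_succ_X, run_succ_piv, if_neg (show ¬ l = t by omega), ← he, ← hp]
      ring
    rw [hpiv, hsum, Finset.sum_add_distrib, ← hm, ← Finset.mul_sum]
    ring

/-- The row operations of the elimination, applied to a column `y`. -/
def app (n : ℕ) (Y : ℕ → ℕ → ZMod 2) (t : ℕ) (y : ℕ → ZMod 2) (i : ℕ) : ZMod 2 :=
  y i + ∑ l ∈ Finset.range t, (run n Y t).X i l * pivRow (run n Y t).piv y l

theorem app_zero (y : ℕ → ZMod 2) : app n Y 0 y = y := by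
  funext i; simp [app]

/-- Step `t` adds multiples of the pivot row to the other rows. The multiplier columns of earlier
steps are updated along with the matrix, so the closed form in terms of original entries satisfies
the same recursion. -/
theorem app_succ (t : ℕ) (y : ℕ → ZMod 2) (i : ℕ) : app n Y (t + 1) y i =
    app n Y t y i + (run n Y t).mult n t i * app n Y t y ((run n Y t).choose n t - 1) := by
  rw [app, app, app, Finset.sum_range_succ]
  set e := run n Y t with he
  set p := e.choose n t with hp
  have hpiv : pivRow (run n Y (t + 1)).piv y t = if p = 0 then 0 else y (p - 1) := by
    rw [pivRow, run_succ_piv, if_pos rfl]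
  have hm : e.mult n t i * y (p - 1) =
      (run n Y (t + 1)).X i t * (if p = 0 then 0 else y (p - 1)) := by
    rw [run_succ_X, if_pos rfl, ← he]
    by_cases h0 : p = 0
    · simp [mult, ← hp, h0]
    · rw [if_neg h0]
  have hsum : ∑ l ∈ Finset.range t, (run n Y (t + 1)).X i l * pivRow (run n Y (t + 1)).piv y l =
      ∑ l ∈ Finset.range t, (e.X i l * pivRow e.piv y l +
        e.mult n t i * (e.X (p - 1) l * pivRow e.piv y l)) := by
    refine Finset.sum_congr rfl fun l hl => ?_
    rw [Finset.mem_range] at hl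
    simp only [pivRow, run_succ_X, run_succ_piv, if_neg (show ¬ l = t by omega), ← he, ← hp]
    ring
  rw [hpiv, hsum, Finset.sum_add_distrib, ← hm, ← Finset.mul_sum]
  ring

/-- Links the two descriptions of the process: until its own step a column of the working matrix is
the original column after the row operations so far, and from then on its place stores multipliers.
-/
theorem app_col (t c : ℕ) (h : t ≤ c) (i : ℕ) :
    app n Y t (fun p => Y p c) i = (run n Y t).X i c := by
  rw [run_block 0 t i c (Nat.zero_le _) (Or.inr h), app, Finset.range_eq_Ico]
  rfl

theorem choose_spec (t : ℕ) :
    ((run n Y t).choose n t = 0 → ∀ i < n, (run n Y t).used i = 0 → (run n Y t).X i t = 0) ∧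
    ((run n Y t).choose n t ≠ 0 → (run n Y t).choose n t - 1 < n ∧
      (run n Y t).used ((run n Y t).choose n t - 1) = 0 ∧
      (run n Y t).X ((run n Y t).choose n t - 1) t = 1) := by
  have := firstSucc_spec (fun i => (run n Y t).used i = 0 ∧ (run n Y t).X i t = 1) n
  refine ⟨fun h i hi hu => ?_, this.2⟩
  have h' := this.1 h i hi
  have h2 : ∀ x : ZMod 2, x ≠ 1 → x = 0 := by decide
  exact h2 _ fun h1 => h' ⟨hu, h1⟩

theorem used_iff (t i : ℕ) : (run n Y t).used i = 1 ↔ ∃ l < t, (run n Y t).piv l = i + 1 := by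
  induction t with
  | zero => simp [run]
  | succ t ih =>
    rw [run_succ_used]
    constructor
    · intro h
      split at h
      · rename_i h'
        exact ⟨t, by omega, by rw [run_succ_piv, if_pos rfl, h']⟩
      · obtain ⟨l, hl, h''⟩ := ih.1 h
        exact ⟨l, by omega, by rw [run_succ_piv, if_neg (by omega), h'']⟩
    · rintro ⟨l, hl, h⟩
      rw [run_succ_piv] at h
      split at h
      · rw [if_pos h.symm]
      · split
        · rfl
        · exact ih.2 ⟨l, by omega, h⟩

/-- A pivot row is marked as used at once, and `choose` takes unused rows only. -/
theorem piv_inj {t l l' : ℕ} (hl : l < t) (hl' : l' < t) (h0 : (run n Y t).piv l ≠ 0)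
    (h : (run n Y t).piv l = (run n Y t).piv l') : l = l' := by
  have key : ∀ a b, a < b → b < t → (run n Y t).piv a ≠ 0 →
      (run n Y t).piv a ≠ (run n Y t).piv b := by
    intro a b hab hb h0 he
    rw [run_piv (hab.trans hb), run_piv hb] at he
    rw [run_piv (hab.trans hb)] at h0
    have h1 := ((choose_spec (n := n) (Y := Y) b).2 (he ▸ h0)).2.1
    rw [← he] at h1
    have h2 := (used_iff (n := n) (Y := Y) b ((run n Y a).choose n a - 1)).2
      ⟨a, hab, by rw [run_piv hab]; omega⟩
    rw [h1] at h2
    exact absurd h2 (by decide)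
  rcases lt_trichotomy l l' with hlt | he | hgt
  · exact absurd h (key _ _ hlt hl' h0)
  · exact he
  · exact absurd h.symm (key _ _ hgt hl (h ▸ h0))

/-- After the elimination the pivot columns are unit vectors and the others are supported on the
pivot rows. -/
theorem app_reduced (t c : ℕ) (hc : c < t) :
    ((run n Y t).piv c ≠ 0 → ∀ i, app n Y t (fun p => Y p c) i =
      if i + 1 = (run n Y t).piv c then 1 else 0) ∧
    (∀ i < n, (run n Y t).used i = 0 → app n Y t (fun p => Y p c) i = 0) := by
  induction t with
  | zero => omega
  | succ t ih =>
    set e := run n Y t with he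
    set p := e.choose n t with hp
    have hsp := choose_spec (n := n) (Y := Y) t
    rw [← he, ← hp] at hsp
    have hpc := run_succ_piv (n := n) (Y := Y) t c
    rcases Nat.lt_succ_iff_lt_or_eq.1 hc with hc' | rfl
    · rw [if_neg (by omega)] at hpc
      rw [hpc]
      -- An earlier column is supported on used rows, and the pivot row chosen now was unused.
      -- Adding multiples of it therefore does not disturb that column.
      have hzero : p = 0 ∨ app n Y t (fun p => Y p c) (p - 1) = 0 := by
        by_cases h0 : p = 0
        · exact Or.inl h0
        · exact Or.inr ((ih hc').2 _ (hsp.2 h0).1 (hsp.2 h0).2.1)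
      have hsame : ∀ i, app n Y (t + 1) (fun p => Y p c) i = app n Y t (fun p => Y p c) i := by
        intro i
        rw [app_succ, ← he, ← hp]
        rcases hzero with h | h
        · simp [mult, ← hp, h]
        · rw [h, mul_zero, add_zero]
      refine ⟨fun h i => by rw [hsame, (ih hc').1 h], fun i hi hu => ?_⟩
      rw [hsame]
      refine (ih hc').2 i hi ?_
      rw [run_succ_used] at hu
      split at hu
      · exact absurd hu (by decide)
      · exact hu
    · rw [if_pos rfl, ← he, ← hp] at hpc
      rw [hpc]
      have hval : ∀ i, app n Y (c + 1) (fun p => Y p c) i =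
          e.X i c + e.mult n c i * e.X (p - 1) c := fun i => by
        rw [app_succ, app_col c c le_rfl, app_col c c le_rfl]
      have h2 : ∀ x : ZMod 2, x + x = 0 := by decide
      by_cases h0 : p = 0
      · refine ⟨fun h => absurd h0 h, fun i hi hu => ?_⟩
        rw [hval, mult, ← hp, if_pos (Or.inl h0), zero_mul, add_zero]
        refine hsp.1 h0 i hi ?_
        rw [run_succ_used, ← he, ← hp, h0, if_neg (by omega)] at hu
        exact hu
      -- The pivot entry is `1`, and the multiplier of any other row is its own entry, so the sum
      -- vanishes in characteristic two; the pivot row has multiplier `0` and keeps its entry.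
      · have hfin : ∀ i, app n Y (c + 1) (fun p => Y p c) i = if i + 1 = p then 1 else 0 := by
          intro i
          rw [hval, (hsp.2 h0).2.2, mul_one, mult, ← hp]
          by_cases hi : i + 1 = p
          · rw [if_pos (Or.inr hi), if_pos hi, add_zero, show i = p - 1 by omega]
            exact (hsp.2 h0).2.2
          · rw [if_neg (by simp [h0, hi]), if_neg hi, h2]
        refine ⟨fun _ => hfin, fun i hi hu => ?_⟩
        rw [hfin, if_neg]
        intro hi'
        rw [run_succ_used, ← he, ← hp, if_pos hi'] at hu
        exact absurd hu (by decide)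

/-- Each step can be undone: its pivot row is unchanged, so if the result vanishes there, nothing
was added to the other rows. -/
theorem app_injective (t : ℕ) (y : ℕ → ZMod 2) (h : ∀ i < n, app n Y t y i = 0) :
    ∀ i < n, y i = 0 := by
  induction t with
  | zero => simpa [app_zero] using h
  | succ t ih =>
    refine ih fun i hi => ?_
    have hi' := h i hi
    rw [app_succ] at hi'
    by_cases h0 : (run n Y t).choose n t = 0
    · simpa [mult, h0] using hi'
    · have hp := h _ ((choose_spec (n := n) (Y := Y) t).2 h0).1
      rw [app_succ, mult, if_pos (Or.inr (by omega)), zero_mul, add_zero] at hp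
      rwa [hp, mul_zero, add_zero] at hi'

/-- The width of an elimination is rounded up to a power of two. The padding columns are zero, and
this lemma and the next show that they stay zero and never get a pivot. -/
theorem run_X_eq_zero (t i c k : ℕ) (hY : ∀ i c, k ≤ c → Y i c = 0) (hc : k ≤ c) :
    (run n Y t).X i c = 0 := by
  induction t generalizing i with
  | zero => exact hY i c hc
  | succ t ih =>
    rw [run_succ_X]
    split
    · subst c
      rw [mult]
      split
      · rfl
      · exact ih i
    · rw [ih, ih, mul_zero, add_zero]

theorem run_piv_eq_zero (t c k : ℕ) (hY : ∀ i c, k ≤ c → Y i c = 0) (hc : k ≤ c) :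
    (run n Y t).piv c = 0 := by
  induction t with
  | zero => rfl
  | succ t ih =>
    rw [run_succ_piv]
    split
    · subst c
      by_contra h
      have := ((choose_spec (n := n) (Y := Y) t).2 h).2.2
      rw [run_X_eq_zero t _ t k hY hc] at this
      exact absurd this (by decide)
    · exact ih

end Elim

/-! ### The schedule of the blocked elimination -/

theorem exists_div_pow_eq (c j : ℕ) : ∃ h, c / 2 ^ h = j / 2 ^ h :=
  ⟨c + j, by
    rw [Nat.div_eq_of_lt, Nat.div_eq_of_lt]
    · exact lt_of_le_of_lt (Nat.le_add_left _ _) Nat.lt_two_pow_self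
    · exact lt_of_le_of_lt (Nat.le_add_right _ _) Nat.lt_two_pow_self⟩

/-- The number of elimination steps that have been applied to the column `c` when `j` columns are
eliminated: the start of the dyadic block of `j` next to the one of `c`. -/
def level (c j : ℕ) : ℕ :=
  j / 2 ^ (Nat.find (exists_div_pow_eq c j) - 1) * 2 ^ (Nat.find (exists_div_pow_eq c j) - 1)

theorem div_pow_eq_mono {c j h g : ℕ} (hh : c / 2 ^ h = j / 2 ^ h) (hg : h ≤ g) :
    c / 2 ^ g = j / 2 ^ g := by
  obtain ⟨d, rfl⟩ := Nat.exists_eq_add_of_le hg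
  rw [pow_add, ← Nat.div_div_eq_div_mul, ← Nat.div_div_eq_div_mul, hh]

theorem level_of_ne {c j h : ℕ} (h1 : c / 2 ^ h ≠ j / 2 ^ h)
    (h2 : c / 2 ^ (h + 1) = j / 2 ^ (h + 1)) : level c j = j / 2 ^ h * 2 ^ h := by
  have : Nat.find (exists_div_pow_eq c j) = h + 1 := by
    rw [Nat.find_eq_iff]
    refine ⟨h2, fun g hg hg' => h1 (div_pow_eq_mono hg' (by omega))⟩
  rw [level, this, Nat.add_sub_cancel]

/-- Rounding `j` down to a multiple of `2^(f-1)`, where `f ≤ h` is the first exponent at which the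
blocks agree, changes nothing because `2^h` divides `j`. For `f = 0` the truncated exponent `0`
gives the same. -/
theorem level_of_eq {c j h : ℕ} (h1 : c / 2 ^ h = j / 2 ^ h) (hd : 2 ^ h ∣ j) :
    level c j = j := by
  have hle : Nat.find (exists_div_pow_eq c j) ≤ h := Nat.find_min' _ h1
  exact Nat.div_mul_cancel ((pow_dvd_pow 2 (by omega)).trans hd)

theorem level_self (j : ℕ) : level j j = j := level_of_eq (h := 0) rfl (by simp)

/-- A column outside the block shared by `j` and `j'` joins them only in a larger dyadic block, the
same for both, and the half of it that contains `j` also contains `j'`. -/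
theorem level_congr {c j j' h : ℕ} (hj : j / 2 ^ h = j' / 2 ^ h) (hc : c / 2 ^ h ≠ j / 2 ^ h) :
    level c j = level c j' := by
  have hf : Nat.find (exists_div_pow_eq c j) = Nat.find (exists_div_pow_eq c j') := by
    rw [Nat.find_eq_iff]
    have hlt : h < Nat.find (exists_div_pow_eq c j') := by
      by_contra hcon
      exact hc ((div_pow_eq_mono (Nat.find_spec (exists_div_pow_eq c j')) (by omega)).trans hj.symm)
    refine ⟨(Nat.find_spec (exists_div_pow_eq c j')).trans
      (div_pow_eq_mono hj.symm hlt.le), fun g hg hg' => ?_⟩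
    by_cases hgh : g ≤ h
    · exact hc (div_pow_eq_mono hg' hgh)
    · exact Nat.find_min _ hg (hg'.trans (div_pow_eq_mono hj (by omega)))
  have hlt : h < Nat.find (exists_div_pow_eq c j) := by
    by_contra hcon
    exact hc (div_pow_eq_mono (Nat.find_spec (exists_div_pow_eq c j)) (by omega))
  rw [level, level, ← hf, div_pow_eq_mono hj (by omega)]

/-- A merge: the block before the one that ends at `j + 1`. -/
theorem level_merge {c j h : ℕ} (hd : 2 ^ (h + 1) ∣ j + 1) (h1 : j + 1 - 2 * 2 ^ h ≤ c)
    (h2 : c < j + 1 - 2 ^ h) : level c j = j + 1 - 2 ^ h := by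
  obtain ⟨a, ha⟩ := hd
  have hp : 0 < 2 ^ h := by positivity
  rw [pow_succ] at ha
  obtain ⟨b, rfl⟩ : ∃ b, a = b + 1 := ⟨a - 1, by
    rcases a with - | a
    · simp at ha
    · rfl⟩
  set m := 2 ^ h with hm
  have hj : j + 1 = (2 * b + 1) * m + m := by rw [ha]; ring
  have e1 : j / 2 ^ h = 2 * b + 1 :=
    Nat.div_eq_of_lt_le (by rw [← hm]; omega) (by rw [← hm, Nat.succ_mul]; omega)
  have e2 : c / 2 ^ h = 2 * b :=
    Nat.div_eq_of_lt_le (by rw [← hm]; have : (2 * b + 1) * m = 2 * b * m + m := by ring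
                            omega)
      (by rw [← hm, Nat.succ_mul]; have : (2 * b + 1) * m = 2 * b * m + m := by ring
          omega)
  rw [level_of_ne (h := h) (by omega), e1, ← hm]
  · omega
  · rw [pow_succ, ← Nat.div_div_eq_div_mul, ← Nat.div_div_eq_div_mul, e1, e2]
    omega

/-- The update: the block after the one that ends at `j + 1`. -/
theorem level_update {c j h : ℕ} (hd : 2 ^ h ∣ j + 1) (hd' : ¬ 2 ^ (h + 1) ∣ j + 1) :
    (j + 1 ≤ c → c < j + 1 + 2 ^ h → level c j = j + 1 - 2 ^ h ∧ level c (j + 1) = j + 1) ∧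
    (j + 1 - 2 ^ h ≤ c → c < j + 1 → level c (j + 1) = j + 1) ∧
    (c < j + 1 - 2 ^ h ∨ j + 1 + 2 ^ h ≤ c → level c j = level c (j + 1)) := by
  obtain ⟨a, ha⟩ := hd
  have hp : 0 < 2 ^ h := by positivity
  have hodd : a % 2 = 1 := by
    by_contra hcon
    refine hd' ⟨a / 2, ?_⟩
    rw [ha, pow_succ, mul_assoc]
    congr 1
    omega
  obtain ⟨b, rfl⟩ : ∃ b, a = 2 * b + 1 := ⟨a / 2, by omega⟩
  set m := 2 ^ h with hm
  have hj : j + 1 = 2 * b * m + m := by rw [ha]; ring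
  have e1 : j / 2 ^ h = 2 * b :=
    Nat.div_eq_of_lt_le (by rw [← hm]; omega) (by rw [← hm, Nat.succ_mul]; omega)
  have e1' : (j + 1) / 2 ^ h = 2 * b + 1 :=
    Nat.div_eq_of_lt_le (by rw [← hm, Nat.succ_mul]; omega) (by rw [← hm, Nat.succ_mul, Nat.succ_mul]; omega)
  have hs : ∀ x : ℕ, x / 2 ^ (h + 1) = x / 2 ^ h / 2 := fun x => by
    rw [pow_succ, Nat.div_div_eq_div_mul]
  refine ⟨fun h1 h2 => ?_, fun h1 h2 => ?_, fun h12 => ?_⟩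
  · have e2 : c / 2 ^ h = 2 * b + 1 :=
      Nat.div_eq_of_lt_le (by rw [← hm, Nat.succ_mul]; omega)
        (by rw [← hm, Nat.succ_mul, Nat.succ_mul]; omega)
    refine ⟨?_, level_of_eq (h := h) (by rw [e2, e1']) ⟨_, ha⟩⟩
    rw [level_of_ne (h := h) (by omega) (by rw [hs, hs, e1, e2]; omega), e1, ← hm]
    omega
  · have e2 : c / 2 ^ h = 2 * b :=
      Nat.div_eq_of_lt_le (by rw [← hm]; omega) (by rw [← hm, Nat.succ_mul]; omega)
    rw [level_of_ne (h := h) (by omega) (by rw [hs, hs, e1', e2]; omega), e1', ← hm, Nat.succ_mul]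
    omega
  · refine level_congr (h := h + 1) (by rw [hs, hs, e1, e1']; omega) ?_
    rw [hs, hs, e1]
    intro hcon
    have h3 : 2 * b ≤ c / 2 ^ h := by omega
    have h4 : c / 2 ^ h < 2 * b + 2 := by omega
    rw [Nat.le_div_iff_mul_le hp] at h3
    rw [Nat.div_lt_iff_lt_mul hp, add_mul] at h4
    omega

/-- Once all `2^e` columns are eliminated none of them has pending updates, so the array holds the
complete transformation matrix. -/
theorem level_two_pow {c e : ℕ} (h : c < 2 ^ e) : level c (2 ^ e) = 2 ^ e := by
  have hp : 0 < 2 ^ e := by positivity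
  rw [level_of_ne (h := e), Nat.div_self hp, one_mul]
  · rw [Nat.div_self hp, Nat.div_eq_of_lt h]; omega
  · rw [Nat.div_eq_of_lt (h.trans (Nat.pow_lt_pow_right (by omega) (by omega))),
      Nat.div_eq_of_lt (Nat.pow_lt_pow_right (by omega) (by omega))]

theorem level_zero (c : ℕ) : level c 0 = 0 := by simp [level]

/-! ### Word-size estimates. -/

theorem fit_lin {L W x : ℕ} (hL : L * L + L < W) (h : x ≤ L) : x < W := by nlinarith

theorem fit_mul {L W x y : ℕ} (hL : L * L + L < W) (hx : x ≤ L) (hy : y ≤ L) : x * y < W := by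
  have := mul_add_lt hL hx hy (Nat.zero_le L); omega

theorem Runs.pre {W : ℕ} {c : Prog} {σ : MachineState} {t t' : ℕ} {Q : MachineState → Prop}
    (h : Runs W c σ t Q) (ht : t ≤ t') : Runs W c σ t' Q := h.mono ht fun _ _ h => h

/-! ### The program for the elimination -/

section

variable (c : Prog)

/-- Applies the eliminations of the columns `src, …, src + m - 1` to the columns
`dst, …, dst + m - 1`; registers `11`, `12`, `10` hold `src`, `dst`, `m`. -/
def blockOp : Prog :=
  .seq (map2 11 0 10 (.reg 40 * .reg 4 + .reg 41) (.get 10 (.reg 40 * .reg 4 + (.reg 11 + .reg 41))))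
  (.seq (map2 12 10 10 (.reg 40 * .reg 4 + .reg 41)
    (.get 10 ((.get 14 (.reg 11 + .reg 40) - .const 1) * .reg 4 + (.reg 12 + .reg 41)) *
      .lt (.const 0) (.get 14 (.reg 11 + .reg 40))))
  (.seq (mulBlocks c 11 12 13 0 10 10 10)
  (map2 10 0 10 (.reg 40 * .reg 4 + (.reg 12 + .reg 41))
    ((.get 10 (.reg 40 * .reg 4 + (.reg 12 + .reg 41)) + .get 13 (.reg 40 * .reg 4 + .reg 41)) %
      .const 2))))

/-- Chooses the pivot of the column `j` in register `8` and computes the multipliers. -/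
def pivotStep : Prog :=
  .seq (.assign 9 (.const 0))
  (.seq (forLoop 22 0 (.assign 9 (.reg 9 + .eqv (.reg 9) (.const 0) *
    (.eqv (.get 15 (.reg 22 + .const 1)) (.const 0) *
      (.get 10 (.reg 22 * .reg 4 + .reg 8) * (.reg 22 + .const 1))))))
  (.seq (.store 14 (.reg 8) (.reg 9))
  (.seq (.store 15 (.reg 9) (.const 1))
  (map2 10 0 19 (.reg 40 * .reg 4 + .reg 8) (.get 10 (.reg 40 * .reg 4 + .reg 8) *
    (.lt (.const 0) (.reg 9) * (.const 1 - .eqv (.reg 40 + .const 1) (.reg 9))))))))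

def elimBody : Prog :=
  .seq pivotStep
  (.seq (.assign 13 (.reg 8 + .const 1))
  (.seq (.assign 10 (.const 1))
  (.seq (.loop (.eqv (.reg 13 % (.reg 10 + .reg 10)) (.const 0))
    (.seq (.assign 11 (.reg 13 - .reg 10))
    (.seq (.assign 12 (.reg 13 - (.reg 10 + .reg 10)))
    (.seq (blockOp c) (.assign 10 (.reg 10 + .reg 10))))))
  (.seq (.assign 11 (.reg 13 - .reg 10))
  (.seq (.assign 12 (.reg 13)) (blockOp c))))))

/-- Eliminates the first columns of the array `10`; their number is in register `7`. -/
def elimProg : Prog :=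
  .seq (map2 15 0 19 (.reg 40 + .const 1) (.const 0)) (forLoop 8 7 (elimBody c))

end

def tOp (F : ℕ → ℕ) (n m : ℕ) : ℕ :=
  400 * ((n + 1) * (m + 1)) + 200 * ((m + 1) * (m + 1)) + tMul F n m m m

section

variable {c : Prog} {F : ℕ → ℕ} {d W L : ℕ} {σ : MachineState} {n : ℕ}

/-- A lazy update is one rectangular product: multiplier columns times the pivot rows of the target
columns. A column without a pivot has `p = 0`; the truncated `p - 1` then points to row `0`, and the
comparison masks the value that is read there. -/
theorem runs_blockOp (hc : MulSpec c F d) (hσ : σ.IsWord W) (hL : L * L + L < W)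
    {m src dst D D₀ : ℕ} (h0 : σ.reg 0 = n) (h4 : σ.reg 4 = D) (h10 : σ.reg 10 = m)
    (h11 : σ.reg 11 = src) (h12 : σ.reg 12 = dst) (hm1 : 1 ≤ m) (hmd : (m + 2) ^ d ≤ W)
    (hsrc : src + m ≤ D₀) (hdst : dst + m ≤ D₀) (hD₀ : D₀ ≤ D) (hDL : D ≤ L) (hn : n + m ≤ D)
    (hm : m + m ≤ D) {X : ℕ → ℕ → ZMod 2} (hX : Stored (σ.arr 10) D n D₀ X) {p : ℕ → ℕ}
    (hp : ∀ l < m, σ.arr 14 (src + l) = p (src + l)) (hpn : ∀ l, p l ≤ n) :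
    Runs W (blockOp c) σ (tOp F n m) (fun τ =>
      Stored (τ.arr 10) D n D₀ (fun i q => if dst ≤ q ∧ q < dst + m then
        X i q + ∑ l ∈ Finset.range m, X i (src + l) * Elim.pivRow p (fun a => X a q) (src + l)
        else X i q) ∧
      (∀ r < 30, τ.reg r = σ.reg r) ∧
      ∀ A < 50, A ≠ 10 → A ≠ 11 → A ≠ 12 → A ≠ 13 → τ.arr A = σ.arr A) := by
  have hW : 1 < W := fit_lin hL (by omega)
  have h2W : 2 < W := by nlinarith
  have s1 := runs_map2 (A := 11) (rR := 0) (rC := 10) (addr := .reg 40 * .reg 4 + .reg 41)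
    (e := .get 10 (.reg 40 * .reg 4 + (.reg 11 + .reg 41)))
    hσ hW (by omega) (by omega) (by simp) (fun i j => i * D + j)
    (fun i j => (X i (src + j)).val) h0 h10
    (fun i j i' j' _ hj _ hj' h => mul_add_inj (by omega) (by omega) h)
    (by
      intro i j τ hi hj hτ hreg h40 h41 harr _
      simp only [RExpr.fits_add, RExpr.fits_mul, RExpr.fits_get hτ, RExpr.fits_reg hτ,
        RExpr.val_add, RExpr.val_mul, RExpr.val_get, RExpr.val_reg, h40, h41,
        harr 10 (by omega), hreg 4 (by omega), hreg 11 (by omega), h4, h11, true_and, and_true]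
      refine ⟨⟨fit_mul hL (by omega) (by omega), mul_add_lt hL (by omega) (by omega) (by omega)⟩,
        ⟨fit_mul hL (by omega) (by omega), fit_lin hL (by omega),
          mul_add_lt hL (by omega) (by omega) (by omega)⟩, hX _ _ hi (by omega)⟩)
  refine (Runs.seq s1 (t₂ := 200 * ((n + 1) * (m + 1)) + 200 * ((m + 1) * (m + 1)) + tMul F n m m m)
    fun τ₁ hτ₁ ⟨q1, _, r1, a1⟩ => ?_).pre (by unfold tOp; omega)
  have s2 := runs_map2 (A := 12) (rR := 10) (rC := 10) (addr := .reg 40 * .reg 4 + .reg 41)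
    (e := .get 10 ((.get 14 (.reg 11 + .reg 40) - .const 1) * .reg 4 + (.reg 12 + .reg 41)) *
      .lt (.const 0) (.get 14 (.reg 11 + .reg 40)))
    hτ₁ hW (by omega) (by omega) (by simp) (fun i j => i * D + j)
    (fun i j => (Elim.pivRow p (fun a => X a (dst + j)) (src + i)).val)
    ((r1 10 (by omega) (by omega)).trans h10) ((r1 10 (by omega) (by omega)).trans h10)
    (fun i j i' j' _ hj _ hj' h => mul_add_inj (by omega) (by omega) h)
    (by
      intro i j τ hi hj hτ hreg' h40 h41 harr _
      have hreg : ∀ r < 40, τ.reg r = σ.reg r := fun r hr =>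
        (hreg' r hr).trans (r1 r (by omega) (by omega))
      have hpn' := hpn (src + i)
      simp only [RExpr.fits_add, RExpr.fits_mul, RExpr.fits_get hτ, RExpr.fits_reg hτ,
        RExpr.fits_lt hW, RExpr.fits_sub, RExpr.fits_const, RExpr.val_sub, RExpr.val_const,
        RExpr.val_lt, RExpr.val_add, RExpr.val_mul, RExpr.val_get, RExpr.val_reg, h40, h41,
        harr 10 (by omega), harr 14 (by omega), a1 10 (by omega), a1 14 (by omega),
        hreg 4 (by omega), hreg 11 (by omega), hreg 12 (by omega), h4, h11, h12, hp i hi,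
        true_and, and_true]
      refine ⟨⟨fit_mul hL (by omega) (by omega), mul_add_lt hL (by omega) (by omega) (by omega)⟩,
        ⟨⟨⟨⟨fit_lin hL (by omega), hW⟩, fit_mul hL (by omega) (by omega)⟩, fit_lin hL (by omega),
          mul_add_lt hL (by omega) (by omega) (by omega)⟩, ⟨by omega, fit_lin hL (by omega)⟩, ?_⟩, ?_⟩
      · have := hσ.2 10 ((p (src + i) - 1) * D + (dst + j))
        split_ifs <;> omega
      · rw [Elim.pivRow]
        by_cases h : p (src + i) = 0
        · simp [h]
        · rw [hX _ _ (by omega) (by omega), if_neg h, if_pos (by omega), mul_one])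
  refine (Runs.seq s2 (t₂ := 200 * ((n + 1) * (m + 1)) + tMul F n m m m)
    fun τ₂ hτ₂ ⟨q2, _, r2, a2⟩ => ?_).pre (by omega)
  have r2' : ∀ r < 40, τ₂.reg r = σ.reg r := fun r hr => by
    rw [r2 r (by omega) (by omega), r1 r (by omega) (by omega)]
  have s3 := runs_mulBlocks (A := 11) (B := 12) (Z := 13) (rR := 0) (rK := 10) (rC := 10) (rm := 10)
    hc hτ₂ hL (by omega) (by omega) (by omega) (by omega) (by omega) (by omega) (by omega) (by omega)
    (by omega) ((r2' _ (by omega)).trans h10) ((r2' _ (by omega)).trans h0)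
    ((r2' _ (by omega)).trans h10) ((r2' _ (by omega)).trans h10) ((r2' _ (by omega)).trans h4)
    hm1 hmd hDL hn hm hm
    (X := fun i j => X i (src + j)) (Y := fun i j => Elim.pivRow p (fun a => X a (dst + j)) (src + i))
    (by rw [a2 11 (by omega)]; exact q1) q2
  refine (Runs.seq s3 (t₂ := 200 * ((n + 1) * (m + 1)))
    fun τ₃ hτ₃ ⟨q3, r3, a3⟩ => ?_).pre (by omega)
  have r3' : ∀ r < 30, τ₃.reg r = σ.reg r := fun r hr => by rw [r3 r hr, r2' r (by omega)]
  have a3' : ∀ A < 50, A ≠ 11 → A ≠ 12 → A ≠ 13 → τ₃.arr A = σ.arr A := fun A h h1 h2 h3 => by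
    rw [a3 A h h3, a2 A h2, a1 A h1]
  have s4 := runs_map2 (A := 10) (rR := 0) (rC := 10) (addr := .reg 40 * .reg 4 + (.reg 12 + .reg 41))
    (e := (.get 10 (.reg 40 * .reg 4 + (.reg 12 + .reg 41)) + .get 13 (.reg 40 * .reg 4 + .reg 41)) %
      .const 2)
    hτ₃ hW (by omega) (by omega) (by simp) (fun i j => i * D + (dst + j))
    (fun i j => (X i (dst + j) + ∑ l ∈ Finset.range m,
      X i (src + l) * Elim.pivRow p (fun a => X a (dst + j)) (src + l)).val)
    ((r3' _ (by omega)).trans h0) ((r3' _ (by omega)).trans h10)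
    (fun i j i' j' _ hj _ hj' h => by
      obtain ⟨e1, e2⟩ := mul_add_inj (by omega) (by omega) h
      omega)
    (by
      intro i j τ hi hj hτ hreg h40 h41 harr hself
      have v1 := hX.le_one hi (show dst + j < D₀ by omega)
      have v2 := q3.le_one hi hj
      have k4 := (hreg 4 (by omega)).trans ((r3' 4 (by omega)).trans h4)
      have k12 := (hreg 12 (by omega)).trans ((r3' 12 (by omega)).trans h12)
      rw [a3' 10 (by omega) (by omega) (by omega) (by omega)] at hself
      simp only [RExpr.fits_add, RExpr.fits_mul, RExpr.fits_get hτ, RExpr.fits_reg hτ,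
        RExpr.fits_mod, RExpr.fits_const, RExpr.val_mod, RExpr.val_const,
        RExpr.val_add, RExpr.val_mul, RExpr.val_get, RExpr.val_reg, h40, h41,
        harr 13 (by omega), hself, k4, k12, true_and, and_true]
      refine ⟨⟨fit_mul hL (by omega) (by omega), fit_lin hL (by omega),
        mul_add_lt hL (by omega) (by omega) (by omega)⟩,
        ⟨⟨⟨fit_mul hL (by omega) (by omega), fit_lin hL (by omega),
        mul_add_lt hL (by omega) (by omega) (by omega)⟩,
        ⟨fit_mul hL (by omega) (by omega), mul_add_lt hL (by omega) (by omega) (by omega)⟩,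
        by omega⟩, h2W⟩, ?_⟩
      rw [ZMod.val_add, hX i _ hi (by omega), q3 i j hi hj])
  refine s4.mono le_rfl fun τ₄ hτ₄ ⟨q4, q4', r4, a4⟩ => ⟨fun i q hi hq => ?_,
    fun r hr => by rw [r4 r (by omega) (by omega), r3' r hr],
    fun A h h0 h1 h2 h3 => by rw [a4 A h0, a3' A h h1 h2 h3]⟩
  beta_reduce
  split
  · rename_i h
    have := q4 i (q - dst) hi (by omega)
    rwa [show dst + (q - dst) = q by omega] at this
  · rename_i h
    rw [q4', a3' 10 (by omega) (by omega) (by omega) (by omega), hX i q hi hq]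
    intro i' j' hi' hj' he
    obtain ⟨e1, e2⟩ := mul_add_inj (by omega) (by omega) he
    exact h (by omega)

theorem firstSucc_le (P : ℕ → Prop) [DecidablePred P] (n : ℕ) : firstSucc P n ≤ n := by
  have := (firstSucc_spec P n).2
  by_cases h : firstSucc P n = 0
  · omega
  · have := (this h).1
    omega

/-- The flags for used rows are stored one place further, so that when there is no pivot the
unconditional store goes to the dummy cell `0`. The search needs no branching: the term added to
register `9` is nonzero only for the first suitable row. -/
theorem runs_pivotStep (hσ : σ.IsWord W) (hL : L * L + L < W) {j D D₀ : ℕ}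
    (h0 : σ.reg 0 = n) (h4 : σ.reg 4 = D) (h8 : σ.reg 8 = j) (h19 : σ.reg 19 = 1)
    (hj : j < D₀) (hD₀ : D₀ ≤ D) (hDL : D ≤ L) (hn : n + 2 ≤ L) {Y X : ℕ → ℕ → ZMod 2}
    (hX : Stored (σ.arr 10) D n D₀ X) (hXj : ∀ i, X i j = (Elim.run n Y j).X i j)
    (hu : ∀ i < n, σ.arr 15 (i + 1) = ((Elim.run n Y j).used i).val)
    (hp : ∀ l < j, σ.arr 14 l = (Elim.run n Y j).piv l) :
    Runs W pivotStep σ (500 * (n + 1)) (fun τ =>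
      Stored (τ.arr 10) D n D₀ (fun i q => if q = j then (Elim.run n Y (j + 1)).X i j else X i q) ∧
      (∀ i < n, τ.arr 15 (i + 1) = ((Elim.run n Y (j + 1)).used i).val) ∧
      (∀ l < j + 1, τ.arr 14 l = (Elim.run n Y (j + 1)).piv l) ∧
      (∀ r < 30, r ≠ 9 → r ≠ 22 → τ.reg r = σ.reg r) ∧
      ∀ A < 50, A ≠ 10 → A ≠ 14 → A ≠ 15 → τ.arr A = σ.arr A) := by
  have hW : 1 < W := fit_lin hL (by omega)
  have h2W : 2 < W := by nlinarith
  set e := Elim.run n Y j with he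
  have hle : ∀ i, firstSucc (fun i => e.used i = 0 ∧ e.X i j = 1) i ≤ i := firstSucc_le _
  refine (Runs.seq (Runs.assign hσ 9 (e := .const 0) (v := 0) (by simp; omega) rfl)
    (t₂ := 490 * (n + 1)) fun τ₁ hτ₁ e1 => ?_).pre (by simp; omega)
  subst e1
  have s2 := runs_forLoop (c := .assign 9 (.reg 9 + .eqv (.reg 9) (.const 0) *
    (.eqv (.get 15 (.reg 22 + .const 1)) (.const 0) *
      (.get 10 (.reg 22 * .reg 4 + .reg 8) * (.reg 22 + .const 1))))) (r := 22) (b := 0)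
    (fun i τ => τ.reg 9 = firstSucc (fun i => e.used i = 0 ∧ e.X i j = 1) i ∧
      (∀ r, r ≠ 9 → r ≠ 22 → τ.reg r = σ.reg r) ∧ τ.arr = σ.arr) (fun _ => 30) hτ₁ hW
    (fun i τ v h => ⟨by simp [MachineState.setReg_reg, h.1],
      fun r h9 h22 => by rw [MachineState.setReg_reg, if_neg h22, h.2.1 r h9 h22], h.2.2⟩)
    ⟨by simp [MachineState.setReg_reg, firstSucc],
      fun r h9 _ => by rw [MachineState.setReg_reg, if_neg h9], rfl⟩
    (fun i τ h => by rw [h.2.1 0 (by omega) (by omega), MachineState.setReg_reg, if_neg (by omega)])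
    (by
      rintro i τ hi hτ h22 ⟨h9, hr, ha⟩
      rw [MachineState.setReg_reg, if_neg (by omega), h0] at hi
      have hle' := hle i
      have v1 := hX.le_one hi hj
      have hval : (RExpr.reg 9 + .eqv (.reg 9) (.const 0) *
          (.eqv (.get 15 (.reg 22 + .const 1)) (.const 0) *
          (.get 10 (.reg 22 * .reg 4 + .reg 8) * (.reg 22 + .const 1)))).val τ =
          firstSucc (fun i => e.used i = 0 ∧ e.X i j = 1) (i + 1) := by
        simp only [RExpr.val_add, RExpr.val_mul, RExpr.val_eqv, RExpr.val_reg, RExpr.val_const,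
          RExpr.val_get, h9, h22, hr 4 (by omega) (by omega), hr 8 (by omega) (by omega), h4, h8, ha,
          hu i hi, hX i j hi hj, hXj, firstSucc]
        have hux : ∀ x : ZMod 2, x = 0 ∨ x = 1 := by decide
        by_cases hf : firstSucc (fun i => e.used i = 0 ∧ e.X i j = 1) i = 0
        · rcases hux (e.used i) with h | h <;> rcases hux (e.X i j) with h' | h' <;>
            simp [hf, h, h', ZMod.val_one]
        · simp [hf]
      refine (Runs.assign hτ 9 ?_ hval).mono (by simp) fun τ' _ e' => ?_
      · simp only [RExpr.fits_add, RExpr.fits_mul, RExpr.fits_get hτ, RExpr.fits_reg hτ,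
          RExpr.fits_eqv hW, RExpr.fits_const, RExpr.val_add, RExpr.val_mul, RExpr.val_eqv,
          RExpr.val_reg, RExpr.val_const, RExpr.val_get, h9, h22, hr 4 (by omega) (by omega),
          hr 8 (by omega) (by omega), h4, h8, ha, true_and, and_true]
        have b1 : σ.arr 10 (i * D + j) * (i + 1) ≤ i + 1 := by nlinarith
        have b2 : ∀ x y : ℕ, (if x = y then 1 else 0) * (σ.arr 10 (i * D + j) * (i + 1)) ≤ i + 1 :=
          fun x y => by split <;> omega
        have b3 : ∀ x y x' y' : ℕ, (if x' = y' then 1 else 0) *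
            ((if x = y then 1 else 0) * (σ.arr 10 (i * D + j) * (i + 1))) ≤ i + 1 :=
          fun x y x' y' => by
            have := b2 x y
            split <;> omega
        have b4 : firstSucc (fun i => e.used i = 0 ∧ e.X i j = 1) i +
            (if firstSucc (fun i => e.used i = 0 ∧ e.X i j = 1) i = 0 then 1 else 0) *
            ((if σ.arr 15 (i + 1) = 0 then 1 else 0) * (σ.arr 10 (i * D + j) * (i + 1))) ≤ i + 1 := by
          have := b2 (σ.arr 15 (i + 1)) 0
          split_ifs <;> omega
        constructorm* _ ∧ _
        all_goals first
          | exact lt_of_le_of_lt b4 (fit_lin hL (by omega))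
          | exact lt_of_le_of_lt (b3 _ _ _ _) (fit_lin hL (by omega))
          | exact lt_of_le_of_lt (b2 _ _) (fit_lin hL (by omega))
          | exact lt_of_le_of_lt b1 (fit_lin hL (by omega))
          | exact mul_add_lt hL (by omega) (by omega) (by omega)
          | exact fit_mul hL (by omega) (by omega)
          | exact fit_lin hL (by omega)
      · subst e'
        refine ⟨by simp [MachineState.setReg_reg, h22], by simp [MachineState.setReg_reg], ?_, ha⟩
        intro r h9' h22'
        rw [MachineState.setReg_reg, if_neg h9', hr r h9' h22'])
  rw [MachineState.setReg_reg, if_neg (by omega), h0] at s2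
  refine (Runs.seq s2 (t₂ := 440 * (n + 1)) fun τ₂ hτ₂ ⟨q2, r2, a2⟩ => ?_).pre (by simp; omega)
  have q2' : τ₂.reg 9 = e.choose n j := q2
  have hpn : e.choose n j ≤ n := hle n
  refine (Runs.seq (Runs.store hτ₂ 14 (i := .reg 8) (e := .reg 9) (u := j) (v := e.choose n j)
    (by simp [RExpr.fits_reg hτ₂]) (by simp [RExpr.fits_reg hτ₂])
    (by simp [r2 8 (by omega) (by omega), h8]) (by simp [q2']))
    (t₂ := 430 * (n + 1)) fun τ₃ hτ₃ e3 => ?_).pre (by simp; omega)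
  refine (Runs.seq (Runs.store hτ₃ 15 (i := .reg 9) (e := .const 1) (u := e.choose n j) (v := 1)
    (by simp [RExpr.fits_reg hτ₃]) (by simp [hW])
    (by simp [e3, MachineState.setArr_reg, q2']) rfl)
    (t₂ := 420 * (n + 1)) fun τ₄ hτ₄ e4 => ?_).pre (by simp; omega)
  have r4 : ∀ r, r ≠ 9 → r ≠ 22 → τ₄.reg r = σ.reg r := fun r h h' => by
    rw [e4, MachineState.setArr_reg, e3, MachineState.setArr_reg, r2 r h h']
  have r49 : τ₄.reg 9 = e.choose n j := by
    rw [e4, MachineState.setArr_reg, e3, MachineState.setArr_reg, q2']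
  have a4 : ∀ A, A ≠ 14 → A ≠ 15 → τ₄.arr A = σ.arr A := fun A h h' => by
    rw [e4, MachineState.setArr_arr_ne _ h', e3, MachineState.setArr_arr_ne _ h, a2]
  have s5 := runs_map2 (A := 10) (rR := 0) (rC := 19) (addr := .reg 40 * .reg 4 + .reg 8)
    (e := .get 10 (.reg 40 * .reg 4 + .reg 8) *
    (.lt (.const 0) (.reg 9) * (.const 1 - .eqv (.reg 40 + .const 1) (.reg 9))))
    hτ₄ hW (by omega) (by omega) (by simp) (fun i _ => i * D + j)
    (fun i _ => (e.mult n j i).val) ((r4 _ (by omega) (by omega)).trans h0)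
    ((r4 _ (by omega) (by omega)).trans h19)
    (fun i a i' a' _ _ _ _ h => by
      obtain ⟨e1, e2⟩ := mul_add_inj (by omega) (by omega) h
      omega)
    (by
      intro i a τ hi _ hτ hreg h40 h41 harr hself
      have v1 := hX.le_one hi hj
      have k4 := (hreg 4 (by omega)).trans ((r4 4 (by omega) (by omega)).trans h4)
      have k8 := (hreg 8 (by omega)).trans ((r4 8 (by omega) (by omega)).trans h8)
      have k9 := (hreg 9 (by omega)).trans r49
      rw [a4 10 (by omega) (by omega)] at hself
      simp only [RExpr.fits_add, RExpr.fits_mul, RExpr.fits_get hτ, RExpr.fits_reg hτ,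
        RExpr.fits_lt hW, RExpr.fits_eqv hW, RExpr.fits_const, RExpr.val_const, RExpr.fits_sub,
        RExpr.val_add, RExpr.val_mul, RExpr.val_get, RExpr.val_reg, RExpr.val_sub, RExpr.val_lt,
        RExpr.val_eqv, h40, hself, k4, k8, k9, true_and, and_true]
      have b1 : (if 0 < e.choose n j then 1 else 0) * (1 - if i + 1 = e.choose n j then 1 else 0) ≤ 1 := by
        split_ifs <;> omega
      refine ⟨⟨fit_mul hL (by omega) (by omega), mul_add_lt hL (by omega) (by omega) (by omega)⟩,
        ⟨⟨fit_mul hL (by omega) (by omega), mul_add_lt hL (by omega) (by omega) (by omega)⟩,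
        ⟨by omega, ⟨hW, ⟨hW, fit_lin hL (by omega)⟩⟩, by omega⟩, ?_⟩, ?_⟩
      · exact lt_of_le_of_lt (Nat.mul_le_mul v1 b1) hW
      · rw [hX i j hi hj, hXj, Elim.mult]
        by_cases h1 : e.choose n j = 0
        · simp [h1]
        · by_cases h2 : i + 1 = e.choose n j
          · simp [h2]
          · have h3 : ¬ (e.choose n j = 0 ∨ i + 1 = e.choose n j) := by simp [h1, h2]
            rw [if_neg h3]; simp [h2, Nat.pos_of_ne_zero h1])
  refine s5.mono (by omega) fun τ₅ hτ₅ ⟨q5, q5', r5, a5⟩ => ⟨fun i q hi hq => ?_, fun i hi => ?_,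
    fun l hl => ?_, fun r hr h9 h22 => by rw [r5 r (by omega) (by omega), r4 r h9 h22],
    fun A hA h10 h14 h15 => by rw [a5 A h10, a4 A h14 h15]⟩
  · beta_reduce
    split
    · rename_i h
      subst h
      rw [q5 i 0 hi (by omega), Elim.run_succ_X, if_pos rfl]
    · rename_i h
      rw [q5', a4 10 (by omega) (by omega), hX i q hi hq]
      intro i' j' _ _ he'
      obtain ⟨e1, e2⟩ := mul_add_inj (by omega) (by omega) he'
      exact h e2.symm
  · rw [a5 15 (by omega), e4, MachineState.setArr_arr, Elim.run_succ_used, ← he]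
    split
    · rw [ZMod.val_one]
    · rw [e3, MachineState.setArr_arr_ne _ (by omega), a2, hu i hi]
  · rw [a5 14 (by omega), e4, MachineState.setArr_arr_ne _ (by omega), e3, MachineState.setArr_arr,
      Elim.run_succ_piv, ← he]
    split
    · rfl
    · rw [a2, hp l (by omega)]

end

theorem exists_two_pow_dvd (j : ℕ) : ∃ v, ¬ 2 ^ (v + 1) ∣ j + 1 :=
  ⟨j + 1, fun h => by
    have h1 := Nat.le_of_dvd (Nat.succ_pos j) h
    have h2 : j + 1 < 2 ^ (j + 1) := Nat.lt_two_pow_self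
    have h3 : 2 ^ (j + 1) ≤ 2 ^ (j + 1 + 1) := Nat.pow_le_pow_right (by omega) (by omega)
    omega⟩

/-- The exponent of `2` in `j + 1`. -/
def twoExp (j : ℕ) : ℕ := Nat.find (exists_two_pow_dvd j)

theorem twoExp_spec (j : ℕ) : ¬ 2 ^ (twoExp j + 1) ∣ j + 1 := Nat.find_spec (exists_two_pow_dvd j)

theorem two_pow_dvd_of_lt {j i : ℕ} (h : i < twoExp j) : 2 ^ (i + 1) ∣ j + 1 :=
  not_not.1 (Nat.find_min (exists_two_pow_dvd j) h)

theorem two_pow_dvd_of_le {j i : ℕ} (h : i ≤ twoExp j) : 2 ^ i ∣ j + 1 := by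
  rcases i with - | i
  · simp
  · exact two_pow_dvd_of_lt h

/-- The time for the elimination of `2 ^ e` columns. -/
def tElim (F : ℕ → ℕ) (n e : ℕ) : ℕ :=
  ∑ j ∈ Finset.range (2 ^ e), (500 * (n + 1) +
    (∑ h ∈ Finset.range (e + 1), if 2 ^ h ∣ j + 1 then tOp F n (2 ^ h) + 60 else 0) + 60) +
      400 * (n + 1) + 10

/-- Expresses the work done after column `j` as one operation for each power of two that divides `j
+ 1`. Summed over `j`, the size `2^h` then occurs `2^(e-h)` times. -/
theorem sum_two_pow_dvd {j e : ℕ} (hj : j < 2 ^ e) (f : ℕ → ℕ) :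
    ∑ i ∈ Finset.range (twoExp j + 1), f i ≤
      ∑ h ∈ Finset.range (e + 1), if 2 ^ h ∣ j + 1 then f h else 0 := by
  have hle : twoExp j ≤ e := by
    have h1 := Nat.le_of_dvd (Nat.succ_pos j) (two_pow_dvd_of_le (le_refl (twoExp j)))
    have : (2 : ℕ) ^ twoExp j ≤ 2 ^ e := by omega
    exact (Nat.pow_le_pow_iff_right (by omega)).1 this
  calc ∑ i ∈ Finset.range (twoExp j + 1), f i
      = ∑ i ∈ Finset.range (twoExp j + 1), if 2 ^ i ∣ j + 1 then f i else 0 :=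
        Finset.sum_congr rfl fun i hi => by
          rw [if_pos (two_pow_dvd_of_le (by rw [Finset.mem_range] at hi; omega))]
    _ ≤ _ := Finset.sum_le_sum_of_subset (Finset.range_mono (by omega))

section

variable {c : Prog} {F : ℕ → ℕ} {d W L : ℕ} {σ : MachineState} {n : ℕ}

open Elim in
/-- One block operation moves the columns from one level to the next. -/
theorem runs_blockOp_level (hc : MulSpec c F d) (hσ : σ.IsWord W) (hL : L * L + L < W)
    {m t dst D D₀ T : ℕ} {Y : ℕ → ℕ → ZMod 2} {lev : ℕ → ℕ}
    (h0 : σ.reg 0 = n) (h4 : σ.reg 4 = D) (h10 : σ.reg 10 = m)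
    (h11 : σ.reg 11 = t - m) (h12 : σ.reg 12 = dst) (hm1 : 1 ≤ m) (hmt : m ≤ t) (htT : t ≤ T)
    (hmd : (m + 2) ^ d ≤ W)
    (hsrc : t ≤ D₀) (hdst : dst + m ≤ D₀) (hD₀ : D₀ ≤ D) (hDL : D ≤ L) (hn : n + m ≤ D)
    (hm : m + m ≤ D) (hX : Stored (σ.arr 10) D n D₀ (fun i q => (run n Y (lev q)).X i q))
    (hp : ∀ l < T, σ.arr 14 l = (run n Y T).piv l)
    (hlev1 : ∀ q, t - m ≤ q → q < t → lev q = t)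
    (hlev2 : ∀ q, dst ≤ q → q < dst + m → lev q = t - m)
    (hdisj : dst + m ≤ t - m ∨ t ≤ dst) :
    Runs W (blockOp c) σ (tOp F n m) (fun τ =>
      Stored (τ.arr 10) D n D₀
        (fun i q => (run n Y (if dst ≤ q ∧ q < dst + m then t else lev q)).X i q) ∧
      (∀ r < 30, τ.reg r = σ.reg r) ∧
      ∀ A < 50, A ≠ 10 → A ≠ 11 → A ≠ 12 → A ≠ 13 → τ.arr A = σ.arr A) := by
  refine (runs_blockOp hc hσ hL h0 h4 h10 h11 h12 hm1 hmd (by omega) hdst hD₀ hDL hn hm hX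
    (p := (run n Y T).piv) (fun l hl => hp _ (by omega)) (fun l => run_piv_le T l)).mono le_rfl
    fun τ _ ⟨q1, q2⟩ => ⟨fun i q hi hq => ?_, q2⟩
  rw [q1 i q hi hq]
  congr 1
  beta_reduce
  by_cases h : dst ≤ q ∧ q < dst + m
  · rw [if_pos h, if_pos h, hlev2 q h.1 h.2, run_block (t - m) t i q (by omega) (by omega),
      Finset.sum_Ico_eq_sum_range, show t - (t - m) = m by omega]
    congr 1
    refine Finset.sum_congr rfl fun l hl => ?_
    rw [Finset.mem_range] at hl
    rw [hlev1 _ (by omega) (by omega)]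
    congr 1
    -- A pivot never changes once it is chosen, so the current pivot array may be used for the
    -- earlier time `t`.
    simp only [pivRow, run_piv (show t - m + l < T by omega), run_piv (show t - m + l < t by omega)]
  · rw [if_neg h, if_neg h]

-- The `v = twoExp j` merges double the fully updated block that ends at column `j`, and a final
-- operation of size `2^v` hands the steps of this block to the block on its right. By `level_merge`
-- and `level_update` this is exactly the passage from `level · j` to `level · (j + 1)`.
open Elim in
theorem runs_elimBody (hc : MulSpec c F d) (hσ : σ.IsWord W) (hL : L * L + L < W)
    {j e D : ℕ} {Y : ℕ → ℕ → ZMod 2}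
    (h0 : σ.reg 0 = n) (h4 : σ.reg 4 = D) (h8 : σ.reg 8 = j) (h19 : σ.reg 19 = 1)
    (hj : j < 2 ^ e) (hDL : D ≤ L) (hn : n + 2 ^ e ≤ D) (hD : 2 * 2 ^ e ≤ D)
    (hnL : n + 2 ≤ L) (hd : (2 ^ e + 2) ^ d ≤ W)
    (hX : Stored (σ.arr 10) D n (2 * 2 ^ e) (fun i q => (run n Y (level q j)).X i q))
    (hu : ∀ i < n, σ.arr 15 (i + 1) = ((run n Y j).used i).val)
    (hp : ∀ l < j, σ.arr 14 l = (run n Y j).piv l) :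
    Runs W (elimBody c) σ (500 * (n + 1) +
      (∑ h ∈ Finset.range (e + 1), if 2 ^ h ∣ j + 1 then tOp F n (2 ^ h) + 60 else 0) + 50) (fun τ =>
      Stored (τ.arr 10) D n (2 * 2 ^ e) (fun i q => (run n Y (level q (j + 1))).X i q) ∧
      (∀ i < n, τ.arr 15 (i + 1) = ((run n Y (j + 1)).used i).val) ∧
      (∀ l < j + 1, τ.arr 14 l = (run n Y (j + 1)).piv l) ∧
      (∀ r < 30, r ≠ 9 → r ≠ 10 → r ≠ 11 → r ≠ 12 → r ≠ 13 → r ≠ 22 → τ.reg r = σ.reg r) ∧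
      ∀ A < 50, (A < 10 ∨ 15 < A) → τ.arr A = σ.arr A) := by
  have hW : 1 < W := fit_lin hL (by omega)
  have h2W : 2 < W := by nlinarith
  have ht := sum_two_pow_dvd hj (fun h => tOp F n (2 ^ h) + 60)
  rw [Finset.sum_range_succ] at ht
  set S := ∑ i ∈ Finset.range (twoExp j), (tOp F n (2 ^ i) + 60) with hS
  set v := twoExp j with hv
  have hbig : ∀ i ≤ v, 2 ^ i ≤ j + 1 := fun i hi =>
    Nat.le_of_dvd (Nat.succ_pos j) (two_pow_dvd_of_le hi)
  refine Runs.pre (t := 500 * (n + 1) + (S + (tOp F n (2 ^ v) + 60)) + 50) ?_ (by omega)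
  refine (Runs.seq (runs_pivotStep (Y := Y) hσ hL h0 h4 h8 h19 (D₀ := 2 * 2 ^ e) (by omega) hD hDL hnL hX
    (fun i => by beta_reduce; rw [level_self]) hu hp) (t₂ := S + (tOp F n (2 ^ v) + 60) + 50)
    fun τ₁ hτ₁ ⟨x1, u1, p1, r1, a1⟩ => ?_).pre (by omega)
  refine (Runs.seq (Runs.assign hτ₁ 13 (e := .reg 8 + .const 1) (v := j + 1)
    (by
      simp only [RExpr.fits_add, RExpr.fits_reg hτ₁, RExpr.fits_const, RExpr.val_reg, RExpr.val_const,
        r1 8 (by omega) (by omega) (by omega), h8, true_and]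
      exact ⟨hW, fit_lin hL (by omega)⟩)
    (by simp [r1 8 (by omega) (by omega) (by omega), h8]))
    (t₂ := S + (tOp F n (2 ^ v) + 60) + 44) fun τ₂ hτ₂ e2 => ?_).pre (by simp; omega)
  refine (Runs.seq (Runs.assign hτ₂ 10 (e := .const 1) (v := 1) (by simpa using hW) rfl)
    (t₂ := S + (tOp F n (2 ^ v) + 60) + 40) fun τ₃ hτ₃ e3 => ?_).pre (by simp; omega)
  have r3 : ∀ r < 30, r ≠ 9 → r ≠ 10 → r ≠ 13 → r ≠ 22 → τ₃.reg r = σ.reg r :=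
    fun r h h9 h10 h13 h22 => by
      rw [e3, MachineState.setReg_reg, if_neg h10, e2, MachineState.setReg_reg, if_neg h13,
        r1 r h h9 h22]
  have r313 : τ₃.reg 13 = j + 1 := by simp [e3, e2, MachineState.setReg_reg]
  have r310 : τ₃.reg 10 = 1 := by simp [e3, MachineState.setReg_reg]
  have a3 : τ₃.arr = τ₁.arr := by rw [e3, e2]; rfl
  -- After `h` merges the `2^h` columns that end at column `j` have received all `j + 1` steps,
  -- while all others are still at their old level.
  let I : ℕ → MachineState → Prop := fun h τ =>
    Stored (τ.arr 10) D n (2 * 2 ^ e) (fun i q => (run n Y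
      (if j + 1 - 2 ^ h ≤ q ∧ q < j + 1 then j + 1 else level q j)).X i q) ∧
    τ.reg 10 = 2 ^ h ∧ τ.reg 13 = j + 1 ∧
    (∀ r < 30, r ≠ 9 → r ≠ 10 → r ≠ 11 → r ≠ 12 → r ≠ 13 → r ≠ 22 → τ.reg r = σ.reg r) ∧
    ∀ A < 50, A ≠ 10 → A ≠ 11 → A ≠ 12 → A ≠ 13 → τ.arr A = τ₁.arr A
  have hpiv : ∀ h τ, I h τ → ∀ l < j + 1, τ.arr 14 l = (run n Y (j + 1)).piv l := fun h τ hI l hl => by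
    rw [hI.2.2.2.2 14 (by omega) (by omega) (by omega) (by omega) (by omega), p1 l hl]
  have htest : ∀ h ≤ v, ∀ τ : MachineState, τ.IsWord W → I h τ →
      (RExpr.eqv (.reg 13 % (.reg 10 + .reg 10)) (.const 0)).Fits W τ ∧
      (RExpr.eqv (.reg 13 % (.reg 10 + .reg 10)) (.const 0)).val τ =
        if 2 ^ (h + 1) ∣ j + 1 then 1 else 0 := by
    intro h hh τ hτ hI
    have := hbig h hh
    refine ⟨?_, ?_⟩
    · simp only [RExpr.fits_eqv hW, RExpr.fits_mod, RExpr.fits_add, RExpr.fits_reg hτ,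
        RExpr.fits_const, RExpr.val_reg, hI.2.1, true_and]
      exact ⟨fit_lin hL (by omega), by omega⟩
    · simp only [RExpr.val_eqv, RExpr.val_mod, RExpr.val_add, RExpr.val_reg, RExpr.val_const,
        hI.2.1, hI.2.2.1, Nat.dvd_iff_mod_eq_zero]
      rw [pow_succ, mul_two]
  have hloop := Runs.loop (c := .seq (.assign 11 (.reg 13 - .reg 10))
    (.seq (.assign 12 (.reg 13 - (.reg 10 + .reg 10)))
    (.seq (blockOp c) (.assign 10 (.reg 10 + .reg 10)))))
    (e := .eqv (.reg 13 % (.reg 10 + .reg 10)) (.const 0)) v I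
    (fun h => tOp F n (2 ^ h) + 20) hτ₃
    ⟨fun i q hi hq => by
        rw [a3, x1 i q hi hq]
        beta_reduce
        congr 1
        rw [pow_zero, Nat.add_sub_cancel]
        by_cases hqj : q = j
        · subst hqj; rw [if_pos rfl, if_pos ⟨le_rfl, by omega⟩]
        · rw [if_neg hqj, if_neg (by omega)],
      r310, r313, fun r h h9 h10 _ _ h13 h22 => r3 r h h9 h10 h13 h22,
      fun A _ _ _ _ _ => by rw [a3]⟩
    (by
      intro h τ hh hτ hI
      obtain ⟨f1, v1⟩ := htest h hh.le τ hτ hI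
      have hdv := two_pow_dvd_of_lt hh
      rw [if_pos hdv] at v1
      have hb := hbig (h + 1) hh
      have hp2 : 2 ^ (h + 1) = 2 * 2 ^ h := by rw [pow_succ, mul_comm]
      have hp0 : 0 < 2 ^ h := by positivity
      refine ⟨f1, by omega, ?_⟩
      obtain ⟨x, i10, i13, ir, ia⟩ := hI
      refine (Runs.seq (Runs.assign hτ 11 (e := .reg 13 - .reg 10) (v := j + 1 - 2 ^ h)
        (by simp [RExpr.fits_reg hτ]) (by simp [i10, i13]))
        (t₂ := tOp F n (2 ^ h) + 16) fun τ₄ hτ₄ e4 => ?_).pre (by simp; omega)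
      refine (Runs.seq (Runs.assign hτ₄ 12 (e := .reg 13 - (.reg 10 + .reg 10))
        (v := j + 1 - (2 ^ h + 2 ^ h))
        (by
          simp only [RExpr.fits_sub, RExpr.fits_add, RExpr.fits_reg hτ₄, RExpr.val_reg, true_and]
          simp only [e4, MachineState.setReg_reg]
          rw [if_neg (by omega : ¬ (10 = 11)), i10]
          exact fit_lin hL (by omega))
        (by simp [e4, MachineState.setReg_reg, i10, i13]))
        (t₂ := tOp F n (2 ^ h) + 10) fun τ₅ hτ₅ e5 => ?_).pre (by simp; omega)
      have r5 : ∀ r, r ≠ 11 → r ≠ 12 → τ₅.reg r = τ.reg r := fun r h11 h12 => by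
        rw [e5, MachineState.setReg_reg, if_neg h12, e4, MachineState.setReg_reg, if_neg h11]
      have a5 : τ₅.arr = τ.arr := by rw [e5, e4]; rfl
      have hmono : (2 ^ h + 2) ^ d ≤ W := le_trans (Nat.pow_le_pow_left (by omega) d) hd
      refine (Runs.seq (runs_blockOp_level hc hτ₅ hL (m := 2 ^ h) (t := j + 1) (T := j + 1)
        (Y := Y) (lev := fun q => if j + 1 - 2 ^ h ≤ q ∧ q < j + 1 then j + 1 else level q j)
        ((r5 0 (by omega) (by omega)).trans ((ir 0 (by omega) (by omega) (by omega) (by omega)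
          (by omega) (by omega) (by omega)).trans h0))
        ((r5 4 (by omega) (by omega)).trans ((ir 4 (by omega) (by omega) (by omega) (by omega)
          (by omega) (by omega) (by omega)).trans h4))
        ((r5 10 (by omega) (by omega)).trans i10)
        (by simp [e5, e4, MachineState.setReg_reg])
        (dst := j + 1 - (2 ^ h + 2 ^ h)) (by simp [e5, MachineState.setReg_reg])
        hp0 (by omega) le_rfl hmono (D₀ := 2 * 2 ^ e) (by omega) (by omega) hD hDL (by omega)
        (by omega) (by rw [a5]; exact x)
        (fun l hl => by rw [a5]; exact hpiv h τ ⟨x, i10, i13, ir, ia⟩ l hl)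
        (fun q hq1 hq2 => if_pos ⟨hq1, hq2⟩)
        (fun q hq1 hq2 => by
          rw [if_neg (by omega)]
          exact level_merge hdv (by omega) (by omega))
        (Or.inl (by omega))) (t₂ := 10) fun τ₆ hτ₆ ⟨x6, r6, a6⟩ => ?_).pre (by omega)
      refine (Runs.assign hτ₆ 10 (e := .reg 10 + .reg 10) (v := 2 ^ (h + 1))
        (by
          simp only [RExpr.fits_add, RExpr.fits_reg hτ₆, RExpr.val_reg, r6 10 (by omega),
            r5 10 (by omega) (by omega), i10, true_and]
          exact fit_lin hL (by omega))
        (by simp only [RExpr.val_add, RExpr.val_reg, r6 10 (by omega),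
            r5 10 (by omega) (by omega), i10]; omega)).mono (by simp) fun τ₇ _ e7 => ?_
      have r7 : ∀ r < 30, r ≠ 10 → r ≠ 11 → r ≠ 12 → τ₇.reg r = τ.reg r := fun r h h10 h11 h12 => by
        rw [e7, MachineState.setReg_reg, if_neg h10, r6 r h, r5 r h11 h12]
      have a7 : τ₇.arr = τ₆.arr := by rw [e7]; rfl
      refine ⟨fun i q hi hq => ?_, by simp [e7, MachineState.setReg_reg],
        by rw [r7 13 (by omega) (by omega) (by omega) (by omega), i13],
        fun r h h9 h10 h11 h12 h13 h22 => by rw [r7 r h h10 h11 h12, ir r h h9 h10 h11 h12 h13 h22],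
        fun A hA h10 h11 h12 h13 => by
          rw [a7, a6 A hA h10 h11 h12 h13, a5, ia A hA h10 h11 h12 h13]⟩
      rw [a7, x6 i q hi hq]
      beta_reduce
      congr 2
      rw [hp2]
      split_ifs <;> first | rfl | omega)
    (by
      intro τ hτ hI
      obtain ⟨f1, v1⟩ := htest v le_rfl τ hτ hI
      rw [if_neg (twoExp_spec j)] at v1
      exact ⟨f1, v1⟩)
  refine (Runs.seq hloop (t₂ := tOp F n (2 ^ v) + 20) fun τ₄ hτ₄ hI => ?_).pre (by
    have : ∀ x, x + 20 + (RExpr.eqv (.reg 13 % (.reg 10 + .reg 10)) (.const 0)).cost + 1 ≤ x + 60 :=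
      fun x => by simp
    have h2 := Finset.sum_le_sum fun i (_ : i ∈ Finset.range v) => this (tOp F n (2 ^ i))
    simp only [RExpr.cost_eqv, RExpr.cost_mod, RExpr.cost_add, RExpr.cost_reg, RExpr.cost_const] at h2 ⊢
    omega)
  have hpv := hpiv v τ₄ hI
  obtain ⟨x, i10, i13, ir, ia⟩ := hI
  have hb := hbig v le_rfl
  have hp0 : 0 < 2 ^ v := by positivity
  refine (Runs.seq (Runs.assign hτ₄ 11 (e := .reg 13 - .reg 10) (v := j + 1 - 2 ^ v)
    (by simp [RExpr.fits_reg hτ₄]) (by simp [i10, i13]))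
    (t₂ := tOp F n (2 ^ v) + 16) fun τ₅ hτ₅ e5 => ?_).pre (by simp; omega)
  refine (Runs.seq (Runs.assign hτ₅ 12 (e := .reg 13) (v := j + 1)
    (by simp [RExpr.fits_reg hτ₅])
    (by simp [e5, MachineState.setReg_reg, i13]))
    (t₂ := tOp F n (2 ^ v)) fun τ₆ hτ₆ e6 => ?_).pre (by simp; omega)
  have r6 : ∀ r, r ≠ 11 → r ≠ 12 → τ₆.reg r = τ₄.reg r := fun r h11 h12 => by
    rw [e6, MachineState.setReg_reg, if_neg h12, e5, MachineState.setReg_reg, if_neg h11]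
  have a6 : τ₆.arr = τ₄.arr := by rw [e6, e5]; rfl
  have hmono : (2 ^ v + 2) ^ d ≤ W := le_trans (Nat.pow_le_pow_left (by omega) d) hd
  obtain ⟨l1, l2, l3⟩ : (∀ q, j + 1 ≤ q → q < j + 1 + 2 ^ v →
      level q j = j + 1 - 2 ^ v ∧ level q (j + 1) = j + 1) ∧
      (∀ q, j + 1 - 2 ^ v ≤ q → q < j + 1 → level q (j + 1) = j + 1) ∧
      (∀ q, q < j + 1 - 2 ^ v ∨ j + 1 + 2 ^ v ≤ q → level q j = level q (j + 1)) := by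
    have := fun q => level_update (c := q) (two_pow_dvd_of_le (le_refl v)) (twoExp_spec j)
    exact ⟨fun q => (this q).1, fun q => (this q).2.1, fun q => (this q).2.2⟩
  -- For the last column this operation falls on the columns from `2^e` to `2 * 2^e`, which is why
  -- the working array has twice the width.
  refine (runs_blockOp_level hc hτ₆ hL (m := 2 ^ v) (t := j + 1) (T := j + 1)
    (Y := Y) (lev := fun q => if j + 1 - 2 ^ v ≤ q ∧ q < j + 1 then j + 1 else level q j)
    ((r6 0 (by omega) (by omega)).trans ((ir 0 (by omega) (by omega) (by omega) (by omega)
      (by omega) (by omega) (by omega)).trans h0))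
    ((r6 4 (by omega) (by omega)).trans ((ir 4 (by omega) (by omega) (by omega) (by omega)
      (by omega) (by omega) (by omega)).trans h4))
    ((r6 10 (by omega) (by omega)).trans i10)
    (by simp [e6, e5, MachineState.setReg_reg])
    (dst := j + 1) (by simp [e6, MachineState.setReg_reg])
    hp0 (by omega) le_rfl hmono (D₀ := 2 * 2 ^ e) (by omega) (by omega) hD hDL (by omega)
    (by omega) (by rw [a6]; exact x)
    (fun l hl => by rw [a6]; exact hpv l hl)
    (fun q hq1 hq2 => if_pos ⟨hq1, hq2⟩)
    (fun q hq1 hq2 => by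
      rw [if_neg (by omega)]
      exact (l1 q hq1 hq2).1)
    (Or.inr le_rfl)).mono le_rfl fun τ₇ hτ₇ ⟨x7, r7, a7⟩ => ?_
  have afin : ∀ A < 50, A ≠ 10 → A ≠ 11 → A ≠ 12 → A ≠ 13 → τ₇.arr A = τ₁.arr A :=
    fun A hA h10 h11 h12 h13 => by rw [a7 A hA h10 h11 h12 h13, a6, ia A hA h10 h11 h12 h13]
  refine ⟨fun i q hi hq => ?_,
    fun i hi => by rw [afin 15 (by omega) (by omega) (by omega) (by omega) (by omega), u1 i hi],
    fun l hl => by rw [afin 14 (by omega) (by omega) (by omega) (by omega) (by omega), p1 l hl],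
    fun r h h9 h10 h11 h12 h13 h22 => by
      rw [r7 r h, r6 r h11 h12, ir r h h9 h10 h11 h12 h13 h22],
    fun A hA h => by
      rw [afin A hA (by omega) (by omega) (by omega) (by omega),
        a1 A hA (by omega) (by omega) (by omega)]⟩
  rw [x7 i q hi hq]
  beta_reduce
  congr 2
  by_cases h1 : j + 1 ≤ q ∧ q < j + 1 + 2 ^ v
  · rw [if_pos h1, (l1 q h1.1 h1.2).2]
  · rw [if_neg h1]
    by_cases h2 : j + 1 - 2 ^ v ≤ q ∧ q < j + 1
    · rw [if_pos h2, l2 q h2.1 h2.2]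
    · rw [if_neg h2, l3 q (by omega)]

-- All levels are zero at the start, when the array holds `Y`, and equal to `2^e` at the end, when
-- its first `2^e` columns hold the transformation matrix.
open Elim in
theorem runs_elimProg (hc : MulSpec c F d) (hσ : σ.IsWord W) (hL : L * L + L < W)
    {e D : ℕ} {Y : ℕ → ℕ → ZMod 2}
    (h0 : σ.reg 0 = n) (h4 : σ.reg 4 = D) (h7 : σ.reg 7 = 2 ^ e) (h19 : σ.reg 19 = 1)
    (hDL : D ≤ L) (hn : n + 2 ^ e ≤ D) (hD : 2 * 2 ^ e ≤ D)
    (hnL : n + 2 ≤ L) (hd : (2 ^ e + 2) ^ d ≤ W)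
    (hX : Stored (σ.arr 10) D n (2 * 2 ^ e) Y) :
    Runs W (elimProg c) σ (tElim F n e) (fun τ =>
      Stored (τ.arr 10) D n (2 ^ e) (run n Y (2 ^ e)).X ∧
      (∀ i < n, τ.arr 15 (i + 1) = ((run n Y (2 ^ e)).used i).val) ∧
      (∀ l < 2 ^ e, τ.arr 14 l = (run n Y (2 ^ e)).piv l) ∧
      (∀ r < 30, (r < 8 ∨ 13 < r) → r ≠ 22 → τ.reg r = σ.reg r) ∧
      ∀ A < 50, (A < 10 ∨ 15 < A) → τ.arr A = σ.arr A) := by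
  have hW : 1 < W := fit_lin hL (by omega)
  have s1 := runs_map2 (A := 15) (rR := 0) (rC := 19) (addr := .reg 40 + .const 1)
    (e := .const 0) hσ hW (by omega) (by omega) (by simp) (fun i _ => i + 1)
    (fun _ _ => 0) h0 h19 (fun i j i' j' _ _ _ _ h => by omega)
    (by
      intro i j τ hi hj hτ hreg h40 h41 harr _
      simp only [RExpr.fits_add, RExpr.fits_reg hτ, RExpr.val_add, RExpr.val_reg, h40, true_and,
        and_true, RExpr.fits_const, RExpr.val_const]
      exact ⟨⟨hW, fit_lin hL (by omega)⟩, by omega⟩)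
  set g : ℕ → ℕ := fun j => 500 * (n + 1) +
    (∑ h ∈ Finset.range (e + 1), if 2 ^ h ∣ j + 1 then tOp F n (2 ^ h) + 60 else 0) + 50 with hg
  refine (Runs.seq s1 (t₂ := (∑ j ∈ Finset.range (2 ^ e), (g j + 8)) + 6)
    fun τ₁ hτ₁ ⟨q1, _, r1, a1⟩ => ?_).pre (by
      have : ∑ j ∈ Finset.range (2 ^ e), (g j + 8) ≤ ∑ j ∈ Finset.range (2 ^ e), (500 * (n + 1) +
        (∑ h ∈ Finset.range (e + 1), if 2 ^ h ∣ j + 1 then tOp F n (2 ^ h) + 60 else 0) + 60) :=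
        Finset.sum_le_sum fun j _ => by simp only [hg]; omega
      unfold tElim
      omega)
  have hl := runs_forLoop (c := elimBody c) (r := 8) (b := 7)
    (fun j τ => Stored (τ.arr 10) D n (2 * 2 ^ e) (fun i q => (run n Y (level q j)).X i q) ∧
      (∀ i < n, τ.arr 15 (i + 1) = ((run n Y j).used i).val) ∧
      (∀ l < j, τ.arr 14 l = (run n Y j).piv l) ∧
      (∀ r < 30, (r < 8 ∨ 13 < r) → r ≠ 22 → τ.reg r = σ.reg r) ∧
      ∀ A < 50, (A < 10 ∨ 15 < A) → τ.arr A = σ.arr A) g hτ₁ hW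
    (fun j τ v ⟨p1, p2, p3, p4, p5⟩ => ⟨p1, p2, p3, fun r hr hr' h22 => by
      rw [MachineState.setReg_reg, if_neg (by omega), p4 r hr hr' h22], p5⟩)
    ⟨fun i q hi hq => by
        beta_reduce
        rw [level_zero, a1 10 (by omega)]
        exact hX i q hi hq,
      fun i hi => by rw [q1 i 0 hi (by omega)]; rfl, fun l hl => by omega,
      fun r hr _ h22 => r1 r (by omega) (by omega), fun A hA h => a1 A (by omega)⟩
    (fun j τ h => by
      rw [h.2.2.2.1 7 (by omega) (by omega) (by omega), r1 7 (by omega) (by omega)])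
    (by
      rintro j τ hj hτ h8 ⟨p1, p2, p3, p4, p5⟩
      rw [r1 7 (by omega) (by omega), h7] at hj
      refine (runs_elimBody hc hτ hL ((p4 0 (by omega) (by omega) (by omega)).trans h0)
        ((p4 4 (by omega) (by omega) (by omega)).trans h4) h8
        ((p4 19 (by omega) (by omega) (by omega)).trans h19) hj hDL hn hD hnL hd p1 p2 p3).mono
        le_rfl fun τ' _ ⟨k1, k2, k3, k4, k5⟩ => ⟨?_, k1, k2, k3, fun r hr h h22 => ?_, fun A hA h => ?_⟩
      · rw [k4 8 (by omega) (by omega) (by omega) (by omega) (by omega) (by omega) (by omega), h8]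
      · rw [k4 r hr (by omega) (by omega) (by omega) (by omega) (by omega) h22, p4 r hr h h22]
      · rw [k5 A hA h, p5 A hA h])
  rw [r1 7 (by omega) (by omega), h7] at hl
  refine hl.mono le_rfl fun τ _ ⟨k1, k2, k3, k4, k5⟩ => ⟨fun i q hi hq => ?_, k2, k3, k4, k5⟩
  rw [k1 i q hi (by omega)]
  beta_reduce
  rw [level_two_pow hq]

end

/-! ### Evaluation and frames -/

/-- The expression `e` evaluates to `v`, and all intermediate values are words. -/
def Ev (W : ℕ) (σ : MachineState) (e : RExpr) (v : ℕ) : Prop := e.Fits W σ ∧ e.val σ = v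

namespace Ev

variable {W : ℕ} {σ : MachineState} {a b : RExpr} {x y : ℕ}

theorem congr (h : Ev W σ a x) (hxy : x = y) : Ev W σ a y := hxy ▸ h

theorem const {v : ℕ} (h : v < W) : Ev W σ (.const v) v := ⟨h, rfl⟩

theorem reg (hσ : σ.IsWord W) {r : ℕ} (h : σ.reg r = x) : Ev W σ (.reg r) x := ⟨hσ.1 r, h⟩

theorem get (hσ : σ.IsWord W) {A : ℕ} (ha : Ev W σ a x) (h : σ.arr A x = y) :
    Ev W σ (.get A a) y :=
  ⟨(RExpr.fits_get hσ A a).2 ha.1, by rw [RExpr.val_get, ha.2, h]⟩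

theorem add (ha : Ev W σ a x) (hb : Ev W σ b y) (h : x + y < W) : Ev W σ (a + b) (x + y) :=
  ⟨RExpr.fits_add.2 ⟨ha.1, hb.1, by rwa [ha.2, hb.2]⟩, by rw [RExpr.val_add, ha.2, hb.2]⟩

theorem mul (ha : Ev W σ a x) (hb : Ev W σ b y) (h : x * y < W) : Ev W σ (a * b) (x * y) :=
  ⟨RExpr.fits_mul.2 ⟨ha.1, hb.1, by rwa [ha.2, hb.2]⟩, by rw [RExpr.val_mul, ha.2, hb.2]⟩

theorem lt_word (ha : Ev W σ a x) : x < W := by have := ha.1.val_lt; rwa [ha.2] at this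

/-- Multiplication by a truth value cannot overflow. Masking replaces branching: a value is read at
a harmless address and multiplied by `0` or `1`. -/
theorem mask (ha : Ev W σ a x) (hb : Ev W σ b y) (h : y ≤ 1) : Ev W σ (a * b) (x * y) :=
  mul ha hb (lt_of_le_of_lt (Nat.mul_le_mul_left x h) (by simpa using ha.lt_word))

theorem sub (ha : Ev W σ a x) (hb : Ev W σ b y) : Ev W σ (a - b) (x - y) :=
  ⟨RExpr.fits_sub.2 ⟨ha.1, hb.1⟩, by rw [RExpr.val_sub, ha.2, hb.2]⟩

theorem mod (ha : Ev W σ a x) (hb : Ev W σ b y) : Ev W σ (a % b) (x % y) :=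
  ⟨RExpr.fits_mod.2 ⟨ha.1, hb.1⟩, by rw [RExpr.val_mod, ha.2, hb.2]⟩

theorem div (ha : Ev W σ a x) (hb : Ev W σ b y) : Ev W σ (a / b) (x / y) :=
  ⟨RExpr.fits_div.2 ⟨ha.1, hb.1⟩, by rw [RExpr.val_div, ha.2, hb.2]⟩

theorem lt (hW : 1 < W) (ha : Ev W σ a x) (hb : Ev W σ b y) :
    Ev W σ (.lt a b) (if x < y then 1 else 0) :=
  ⟨(RExpr.fits_lt hW).2 ⟨ha.1, hb.1⟩, by rw [RExpr.val_lt, ha.2, hb.2]⟩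

theorem eqv (hW : 1 < W) (ha : Ev W σ a x) (hb : Ev W σ b y) :
    Ev W σ (.eqv a b) (if x = y then 1 else 0) :=
  ⟨(RExpr.fits_eqv hW).2 ⟨ha.1, hb.1⟩, by rw [RExpr.val_eqv, ha.2, hb.2]⟩

/-- Evaluation of an address in row-major order. -/
theorem idx {L : ℕ} (hL : L * L + L < W) (hσ : σ.IsWord W) {r D : ℕ} (hr : σ.reg r = D)
    (ha : Ev W σ a x) (hb : Ev W σ b y) (hx : x ≤ L) (hD : D ≤ L) (hy : y ≤ L) :
    Ev W σ (a * .reg r + b) (x * D + y) :=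
  add (mul ha (reg hσ hr) (fit_mul hL hx hD)) hb (mul_add_lt hL hx hD hy)

end Ev

theorem indicator_le_one (p : Prop) [Decidable p] : (if p then 1 else 0) ≤ 1 := by split <;> omega

/-- The registers below `30` outside `Rs` and the arrays below `50` outside `As` agree. -/
def Frame (Rs As : List ℕ) (σ τ : MachineState) : Prop :=
  (∀ r < 30, r ∉ Rs → τ.reg r = σ.reg r) ∧ ∀ A < 50, A ∉ As → τ.arr A = σ.arr A

namespace Frame

variable {Rs As Rs' As' : List ℕ} {σ τ υ : MachineState}

theorem refl (σ : MachineState) : Frame [] [] σ σ := ⟨fun _ _ _ => rfl, fun _ _ _ => rfl⟩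

theorem trans (h : Frame Rs As σ τ) (h' : Frame Rs' As' τ υ) :
    Frame (Rs ++ Rs') (As ++ As') σ υ := by
  refine ⟨fun r hr hm => ?_, fun A hA hm => ?_⟩ <;> rw [List.mem_append, not_or] at hm
  · rw [h'.1 r hr hm.2, h.1 r hr hm.1]
  · rw [h'.2 A hA hm.2, h.2 A hA hm.1]

theorem mono (h : Frame Rs As σ τ) (hR : Rs ⊆ Rs') (hA : As ⊆ As') : Frame Rs' As' σ τ :=
  ⟨fun r hr hm => h.1 r hr fun hh => hm (hR hh), fun A hA' hm => h.2 A hA' fun hh => hm (hA hh)⟩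

theorem setReg (σ : MachineState) (r v : ℕ) : Frame [r] [] σ (σ.setReg r v) :=
  ⟨fun x _ hx => by rw [MachineState.setReg_reg, if_neg (by simpa using hx)], fun _ _ _ => rfl⟩

theorem setArr (σ : MachineState) (A i v : ℕ) : Frame [] [A] σ (σ.setArr A i v) :=
  ⟨fun _ _ _ => rfl, fun B _ hB => MachineState.setArr_arr_ne _ (by simpa using hB) _ _⟩

end Frame

theorem Runs.assignEv {W : ℕ} {σ : MachineState} (hσ : σ.IsWord W) (r : ℕ) {e : RExpr} {v : ℕ}
    (h : Ev W σ e v) :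
    Runs W (.assign r e) σ (e.cost + 1) (fun τ => τ.reg r = v ∧ Frame [r] [] σ τ) :=
  (Runs.assign hσ r h.1 h.2).mono le_rfl fun τ _ e => by
    subst e
    exact ⟨by simp [MachineState.setReg_reg], Frame.setReg _ _ _⟩

/-! ### Filling and accumulating with frame conditions. -/

section

variable {W : ℕ} {σ : MachineState} {A rR rC : ℕ} {addr e : RExpr}

theorem runs_fill (hσ : σ.IsWord W) (hW : 1 < W) (hR : rR < 30) (hC : rC < 30)
    (hcost : addr.cost + e.cost ≤ 100) (ad f : ℕ → ℕ → ℕ) {R C : ℕ} (hR' : σ.reg rR = R)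
    (hC' : σ.reg rC = C)
    (inj : ∀ i j i' j', i < R → j < C → i' < R → j' < C → ad i j = ad i' j' → i = i' ∧ j = j')
    (H : ∀ i j τ, i < R → j < C → τ.IsWord W → Frame [] [A] σ τ → τ.reg 40 = i → τ.reg 41 = j →
      τ.arr A (ad i j) = σ.arr A (ad i j) → Ev W τ addr (ad i j) ∧ Ev W τ e (f i j)) :
    Runs W (map2 A rR rC addr e) σ (200 * ((R + 1) * (C + 1)))
      (fun τ => (∀ i j, i < R → j < C → τ.arr A (ad i j) = f i j) ∧
        (∀ x, (∀ i j, i < R → j < C → ad i j ≠ x) → τ.arr A x = σ.arr A x) ∧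
        Frame [] [A] σ τ) :=
  (runs_map2 hσ hW (by omega) (by omega) hcost ad f hR' hC' inj
    (fun i j τ hi hj hτ hr h40 h41 ha hs => by
      obtain ⟨⟨h1, h2⟩, h3, h4⟩ := H i j τ hi hj hτ
        ⟨fun r hr' _ => hr r (by omega), fun B _ hB => ha B (by simpa using hB)⟩ h40 h41 hs
      exact ⟨h1, h2, h3, h4⟩)).mono le_rfl
    fun τ _ ⟨h1, h2, h3, h4⟩ => ⟨h1, h2, fun r hr _ => h3 r (by omega) (by omega),
      fun B _ hB => h4 B (by simpa using hB)⟩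

/-- Filling a matrix of stride `D` in the array `A`. -/
theorem runs_fillMatrix {L : ℕ} (hσ : σ.IsWord W) (hL : L * L + L < W) (h1L : 1 ≤ L)
    (hR : rR < 30) (hC : rC < 30) (hcost : e.cost ≤ 90) (f : ℕ → ℕ → ℕ) {D R C : ℕ}
    (hD : σ.reg 4 = D) (hR' : σ.reg rR = R) (hC' : σ.reg rC = C) (hRL : R ≤ L) (hDL : D ≤ L)
    (hCD : C ≤ D)
    (H : ∀ i j τ, i < R → j < C → τ.IsWord W → Frame [] [A] σ τ → τ.reg 40 = i → τ.reg 41 = j →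
      Ev W τ (.reg 40 * .reg 4 + .reg 41) (i * D + j) →
      τ.arr A (i * D + j) = σ.arr A (i * D + j) → Ev W τ e (f i j)) :
    Runs W (map2 A rR rC (.reg 40 * .reg 4 + .reg 41) e) σ (200 * ((R + 1) * (C + 1)))
      (fun τ => (∀ i j, i < R → j < C → τ.arr A (i * D + j) = f i j) ∧ Frame [] [A] σ τ) :=
  (runs_fill hσ (fit_lin hL h1L) hR hC (by simp; omega) (fun i j => i * D + j) f hR' hC'
    (fun i j i' j' _ hj _ hj' h => mul_add_inj (by omega) (by omega) h)
    (fun i j τ hi hj hτ hF h40 h41 hs => by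
      have ha : Ev W τ (.reg 40 * .reg 4 + .reg 41) (i * D + j) :=
        Ev.idx hL hτ ((hF.1 4 (by omega) (by simp)).trans hD) (Ev.reg hτ h40) (Ev.reg hτ h41)
          (by omega) hDL (by omega)
      exact ⟨ha, H i j τ hi hj hτ hF h40 h41 ha hs⟩)).mono le_rfl
    fun τ _ ⟨h1, _, h3⟩ => ⟨h1, h3⟩

/-- Filling a vector in the array `A`; register `19` holds `1`. -/
theorem runs_fillVector (hσ : σ.IsWord W) (hW : 1 < W) (hR : rR < 30) (h19 : σ.reg 19 = 1)
    (hcost : e.cost ≤ 90) (f : ℕ → ℕ) {R : ℕ} (hR' : σ.reg rR = R)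
    (H : ∀ i τ, i < R → τ.IsWord W → Frame [] [A] σ τ → τ.reg 40 = i → Ev W τ (.reg 40) i →
      τ.arr A i = σ.arr A i → Ev W τ e (f i)) :
    Runs W (map2 A rR 19 (.reg 40) e) σ (400 * (R + 1))
      (fun τ => (∀ i, i < R → τ.arr A i = f i) ∧ Frame [] [A] σ τ) :=
  (runs_fill hσ hW hR (by omega) (by simp; omega) (fun i _ => i) (fun i _ => f i) hR' h19
    (fun i j i' j' _ hj _ hj' h => ⟨h, by omega⟩)
    (fun i j τ hi hj hτ hF h40 h41 hs =>
      ⟨Ev.reg hτ h40, H i τ hi hτ hF h40 (Ev.reg hτ h40) hs⟩)).mono (by omega)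
    fun τ _ ⟨h1, _, h3⟩ => ⟨fun i hi => h1 i 0 hi (by omega), h3⟩

theorem runs_accumulate {μ : ℕ} (hσ : σ.IsWord W) (hW : 200 < W) (hR : rR < 30) (hC : rC < 30)
    (hcost : addr.cost + e.cost ≤ 60) (hμ : 0 < μ) (hμ' : μ ≤ 100) (ad : ℕ → ℕ) (f : ℕ → ℕ → ℕ)
    {R C : ℕ} (hR' : σ.reg rR = R) (hC' : σ.reg rC = C)
    (inj : ∀ i i', i < R → i' < R → ad i = ad i' → i = i')
    (hlt : ∀ i, i < R → σ.arr A (ad i) < μ)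
    (hf : ∀ i j, i < R → j < C → f i j ≤ 100)
    (H : ∀ i j τ, i < R → j < C → τ.IsWord W → Frame [] [A] σ τ → τ.reg 40 = i → τ.reg 41 = j →
      Ev W τ addr (ad i) ∧ Ev W τ e (f i j)) :
    Runs W (acc2 A rR rC μ addr e) σ (200 * ((R + 1) * (C + 1)))
      (fun τ => (∀ i, i < R → τ.arr A (ad i) =
          (σ.arr A (ad i) + ∑ j ∈ Finset.range C, f i j) % μ) ∧
        (∀ x, (∀ i, i < R → ad i ≠ x) → τ.arr A x = σ.arr A x) ∧ Frame [] [A] σ τ) :=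
  (runs_acc2 hσ hW (by omega) (by omega) hcost hμ hμ' ad f hR' hC' inj hlt hf
    (fun i j τ hi hj hτ hr h40 h41 ha => by
      obtain ⟨⟨h1, h2⟩, h3, h4⟩ := H i j τ hi hj hτ
        ⟨fun r hr' _ => hr r (by omega), fun B _ hB => ha B (by simpa using hB)⟩ h40 h41
      exact ⟨h1, h2, h3, h4⟩)).mono le_rfl
    fun τ _ ⟨h1, h2, h3, h4⟩ => ⟨h1, h2, fun r hr _ => h3 r (by omega) (by omega),
      fun B _ hB => h4 B (by simpa using hB)⟩

end

/-! ### Rows of a tableau -/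

/-- The Pauli operator `i^ph X^x Z^z`. -/
structure PRow where
  ph : ZMod 4
  x : ℕ → ZMod 2
  z : ℕ → ZMod 2

/-- Multiplication by two, from `ℤ/2` to `ℤ/4`. -/
def twice (a : ZMod 2) : ZMod 4 := 2 * (a.val : ZMod 4)

theorem twice_add (a b : ZMod 2) : twice (a + b) = twice a + twice b := by
  revert a b; decide

theorem twice_zero : twice 0 = 0 := rfl

theorem twice_sum {κ : Type*} (s : Finset κ) (f : κ → ZMod 2) :
    twice (∑ a ∈ s, f a) = ∑ a ∈ s, twice (f a) := by
  classical
  induction s using Finset.induction_on with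
  | empty => rfl
  | insert a s ha ih => rw [Finset.sum_insert ha, Finset.sum_insert ha, twice_add, ih]

theorem two_or (a : ZMod 2) : a = 0 ∨ a = 1 := by revert a; decide

namespace PRow

def one : PRow := ⟨0, fun _ => 0, fun _ => 0⟩

def mul (n : ℕ) (a b : PRow) : PRow where
  ph := a.ph + b.ph + twice (∑ j ∈ Finset.range n, a.z j * b.x j)
  x j := a.x j + b.x j
  z j := a.z j + b.z j

/-- The product `a * ∏_{c < K} (P c)^{u c}`, in this order. -/
def prod (n : ℕ) (P : ℕ → PRow) (u : ℕ → ZMod 2) (a : PRow) : ℕ → PRow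
  | 0 => a
  | K + 1 => if u K = 0 then prod n P u a K else (prod n P u a K).mul n (P K)

variable {n : ℕ} {P : ℕ → PRow} {u : ℕ → ZMod 2} {a : PRow}

theorem prod_x (K j : ℕ) :
    (prod n P u a K).x j = a.x j + ∑ c ∈ Finset.range K, u c * (P c).x j := by
  induction K with
  | zero => simp [prod]
  | succ K ih =>
    rw [prod, Finset.sum_range_succ, ← add_assoc, ← ih]
    rcases two_or (u K) with h | h <;> simp [h, mul]

theorem prod_z (K j : ℕ) :
    (prod n P u a K).z j = a.z j + ∑ c ∈ Finset.range K, u c * (P c).z j := by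
  induction K with
  | zero => simp [prod]
  | succ K ih =>
    rw [prod, Finset.sum_range_succ, ← add_assoc, ← ih]
    rcases two_or (u K) with h | h <;> simp [h, mul]

/-- The commutation phases between the factors, for `c' < c`. -/
def tri (n : ℕ) (P : ℕ → PRow) (c' c : ℕ) : ZMod 2 :=
  if c' < c then ∑ j ∈ Finset.range n, (P c').z j * (P c).x j else 0

/-- Moving the `X` part of factor `c` past the `Z` parts of the factors `c' < c` and of `a` produces
signs. Collected in the strictly triangular matrix `tri`, the quadratic dependence on `u` becomes a
row of the product of the exponent matrix with `tri`, so the phases of many rows cost one matrix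
product and one pass over the entries. -/
theorem prod_ph (K : ℕ) :
    (prod n P u a K).ph = a.ph + ∑ c ∈ Finset.range K, ((u c).val : ZMod 4) *
        ((P c).ph + twice (∑ c' ∈ Finset.range K, u c' * tri n P c' c)) +
      ∑ j ∈ Finset.range n, twice (a.z j * ∑ c ∈ Finset.range K, u c * (P c).x j) := by
  induction K with
  | zero => simp [prod, twice_zero]
  | succ K ih =>
    have h1 : ∀ c ∈ Finset.range K, ∑ c' ∈ Finset.range (K + 1), u c' * tri n P c' c =
        ∑ c' ∈ Finset.range K, u c' * tri n P c' c := fun c hc => by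
      rw [Finset.mem_range] at hc
      rw [Finset.sum_range_succ, tri, if_neg (by omega), mul_zero, add_zero]
    rw [Finset.sum_range_succ, Finset.sum_congr rfl fun c hc => by rw [h1 c hc]]
    -- The column of `tri` for the new factor pairs its `X` part with the accumulated `Z` part,
    -- which is the sign arising in the last multiplication; the earlier columns do not see the new
    -- index by triangularity.
    have h2 : ∑ c' ∈ Finset.range (K + 1), u c' * tri n P c' K =
        ∑ j ∈ Finset.range n, (∑ c ∈ Finset.range K, u c * (P c).z j) * (P K).x j := by
      rw [Finset.sum_range_succ, tri, if_neg (lt_irrefl K), mul_zero, add_zero]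
      simp only [Finset.sum_mul]
      rw [Finset.sum_comm]
      refine Finset.sum_congr rfl fun c hc => ?_
      rw [tri, if_pos (Finset.mem_range.1 hc), Finset.mul_sum]
      exact Finset.sum_congr rfl fun j _ => by ring
    rw [h2]
    simp only [Finset.sum_range_succ (fun c => u c * (P c).x _) K, mul_add, twice_add,
      Finset.sum_add_distrib]
    rw [prod]
    rcases two_or (u K) with h | h
    · rw [if_pos h, ih]
      simp [h, twice_zero, mul_add, Finset.sum_add_distrib]
    · rw [if_neg (by simp [h]), PRow.mul, ih, h]
      simp only [prod_z, add_mul, Finset.sum_add_distrib, twice_add, twice_sum, one_mul, mul_add,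
        show ((1 : ZMod 2).val : ZMod 4) = 1 from rfl]
      ring

end PRow

/-- The arrays `7`, `8`, `9` hold the `X` parts, the `Z` parts and the phases of `N` rows. -/
def TableAt (σ : MachineState) (D n N : ℕ) (T : ℕ → PRow) : Prop :=
  Stored (σ.arr 7) D N n (fun i j => (T i).x j) ∧ Stored (σ.arr 8) D N n (fun i j => (T i).z j) ∧
    ∀ i < N, σ.arr 9 i = (T i).ph.val

theorem TableAt.frame {σ τ : MachineState} {D n N : ℕ} {T : ℕ → PRow} (h : TableAt σ D n N T)
    {Rs As : List ℕ} (hF : Frame Rs As σ τ) (h7 : 7 ∉ As) (h8 : 8 ∉ As) (h9 : 9 ∉ As) :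
    TableAt τ D n N T := by
  unfold TableAt
  rw [hF.2 7 (by omega) h7, hF.2 8 (by omega) h8, hF.2 9 (by omega) h9]
  exact h

/-! ### Multiplying many rows by the same rows -/

/-- The row `piv c - 1` after `src`, or the identity if `piv c = 0`. -/
def gatherRow (T : ℕ → PRow) (src : ℕ) (pv : ℕ → ℕ) (c : ℕ) : PRow :=
  if pv c = 0 then PRow.one else T (src + (pv c - 1))

section

variable (c : Prog)

/-- Collects the rows selected by the array `30`, counted from register `16`, in the arrays `17`,
`18`, `19`. -/
def gatherRows : Prog :=
  .seq (map2 17 7 0 (.reg 40 * .reg 4 + .reg 41)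
    (.get 7 ((.reg 16 + (.get 30 (.reg 40) - .const 1)) * .reg 4 + .reg 41) *
      .lt (.const 0) (.get 30 (.reg 40))))
  (.seq (map2 18 7 0 (.reg 40 * .reg 4 + .reg 41)
    (.get 8 ((.reg 16 + (.get 30 (.reg 40) - .const 1)) * .reg 4 + .reg 41) *
      .lt (.const 0) (.get 30 (.reg 40))))
  (map2 19 7 19 (.reg 40)
    (.get 9 (.reg 16 + (.get 30 (.reg 40) - .const 1)) * .lt (.const 0) (.get 30 (.reg 40)))))

/-- The products that describe the multiplication by the collected rows. -/
def rowProducts : Prog :=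
  .seq (map2 20 0 7 (.reg 40 * .reg 4 + .reg 41) (.get 17 (.reg 41 * .reg 4 + .reg 40)))
  (.seq (mulBlocks c 18 20 21 7 0 7 7)
  (.seq (map2 21 7 7 (.reg 40 * .reg 4 + .reg 41)
    (.get 21 (.reg 40 * .reg 4 + .reg 41) * .lt (.reg 40) (.reg 41)))
  (.seq (mulBlocks c 16 21 22 15 7 7 7)
  (.seq (mulBlocks c 16 17 23 15 7 0 7) (mulBlocks c 16 18 24 15 7 0 7)))))

/-- Multiplies the rows counted from register `14`. -/
def updateRows : Prog :=
  .seq (acc2 9 15 7 4 (.reg 14 + .reg 40) (.get 16 (.reg 40 * .reg 4 + .reg 41) *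
    (.get 19 (.reg 41) + .const 2 * .get 22 (.reg 40 * .reg 4 + .reg 41))))
  (.seq (acc2 9 15 0 4 (.reg 14 + .reg 40) (.const 2 *
    (.get 8 ((.reg 14 + .reg 40) * .reg 4 + .reg 41) * .get 23 (.reg 40 * .reg 4 + .reg 41))))
  (.seq (map2 7 15 0 ((.reg 14 + .reg 40) * .reg 4 + .reg 41)
    ((.get 7 ((.reg 14 + .reg 40) * .reg 4 + .reg 41) + .get 23 (.reg 40 * .reg 4 + .reg 41)) %
      .const 2))
  (map2 8 15 0 ((.reg 14 + .reg 40) * .reg 4 + .reg 41)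
    ((.get 8 ((.reg 14 + .reg 40) * .reg 4 + .reg 41) + .get 24 (.reg 40 * .reg 4 + .reg 41)) %
      .const 2))))

def mulRows : Prog := .seq gatherRows (.seq (rowProducts c) updateRows)

end

def tMulRows (F : ℕ → ℕ) (n R K : ℕ) : ℕ :=
  600 * ((K + 1) * (n + 1)) + 400 * (K + 1) + 200 * ((K + 1) * (K + 1)) + tMul F K n K K +
    tMul F R K K K + 2 * tMul F R K n K + 200 * ((R + 1) * (K + 1)) + 600 * ((R + 1) * (n + 1))

section

variable {c : Prog} {F : ℕ → ℕ} {d W L : ℕ} {σ : MachineState} {n K R D N src base : ℕ}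
  {T : ℕ → PRow} {pv : ℕ → ℕ} {U : ℕ → ℕ → ZMod 2}

theorem runs_gatherRows (hσ : σ.IsWord W) (hL : L * L + L < W) (h1L : 1 ≤ L)
    (h0 : σ.reg 0 = n) (h4 : σ.reg 4 = D) (h7 : σ.reg 7 = K) (h16 : σ.reg 16 = src)
    (h19 : σ.reg 19 = 1) (hDL : D ≤ L) (hn : n ≤ D) (hK : K ≤ D) (hsrc : src + n ≤ N) (hN : N ≤ L)
    (hp : ∀ c < K, σ.arr 30 c = pv c) (hpn : ∀ c < K, pv c ≤ n) (hT : TableAt σ D n N T) :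
    Runs W gatherRows σ (400 * ((K + 1) * (n + 1)) + 400 * (K + 1)) (fun τ =>
      Stored (τ.arr 17) D K n (fun c j => (gatherRow T src pv c).x j) ∧
      Stored (τ.arr 18) D K n (fun c j => (gatherRow T src pv c).z j) ∧
      (∀ c < K, τ.arr 19 c = (gatherRow T src pv c).ph.val) ∧
      Frame [] [17, 18, 19] σ τ) := by
  have hW : 1 < W := fit_lin hL h1L
  have row : ∀ {Rs As : List ℕ} {τ : MachineState} {i : ℕ}, Frame Rs As σ τ → 30 ∉ As → 16 ∉ Rs →
      τ.IsWord W → i < K → τ.reg 40 = i →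
      Ev W τ (.reg 16 + (.get 30 (.reg 40) - .const 1)) (src + (pv i - 1)) ∧
      Ev W τ (.lt (.const 0) (.get 30 (.reg 40))) (if 0 < pv i then 1 else 0) := by
    intro Rs As τ i hF h30 h16' hτ hi h40
    have hg : Ev W τ (.get 30 (.reg 40)) (pv i) := Ev.get hτ (Ev.reg hτ h40)
      (by rw [hF.2 30 (by omega) h30, hp i hi])
    have := hpn i hi
    exact ⟨Ev.add (Ev.reg hτ ((hF.1 16 (by omega) h16').trans h16)) (Ev.sub hg (Ev.const hW))
      (fit_lin hL (by omega)), Ev.lt hW (Ev.const (by omega)) hg⟩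
  have s1 := runs_fillMatrix (A := 17) (rR := 7) (rC := 0) (e :=
    .get 7 ((.reg 16 + (.get 30 (.reg 40) - .const 1)) * .reg 4 + .reg 41) *
      .lt (.const 0) (.get 30 (.reg 40)))
    hσ hL h1L (by omega) (by omega) (by simp)
    (fun i j => ((gatherRow T src pv i).x j).val) h4 h7 h0 (by omega) hDL hn
    (by
      intro i j τ hi hj hτ hF h40 h41 _ _
      obtain ⟨e1, e2⟩ := row hF (by decide) (by decide) hτ hi h40
      have := hpn i hi
      have e3 := Ev.idx hL hτ ((hF.1 4 (by omega) (by decide)).trans h4) e1 (Ev.reg hτ h41) (by omega)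
        hDL (by omega)
      refine (Ev.mask (Ev.get hτ e3 rfl) e2 (indicator_le_one _)).congr ?_
      rw [hF.2 7 (by omega) (by decide), gatherRow]
      by_cases h : pv i = 0
      · simp [h, PRow.one]
      · rw [if_neg h, if_pos (by omega), hT.1 _ _ (by omega) hj, mul_one])
  apply Runs.pre
  · apply Runs.seq s1
    rintro τ₁ hτ₁ ⟨q1, F1⟩
    have s2 := runs_fillMatrix (A := 18) (rR := 7) (rC := 0) (e :=
      .get 8 ((.reg 16 + (.get 30 (.reg 40) - .const 1)) * .reg 4 + .reg 41) *
        .lt (.const 0) (.get 30 (.reg 40)))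
      hτ₁ hL h1L (by omega) (by omega) (by simp)
      (fun i j => ((gatherRow T src pv i).z j).val) ((F1.1 4 (by omega) (by decide)).trans h4)
      ((F1.1 7 (by omega) (by decide)).trans h7) ((F1.1 0 (by omega) (by decide)).trans h0)
      (by omega) hDL hn
      (by
        intro i j τ hi hj hτ hF' h40 h41 _ _
        have hF := F1.trans hF'
        obtain ⟨e1, e2⟩ := row hF (by decide) (by decide) hτ hi h40
        have := hpn i hi
        have e3 := Ev.idx hL hτ ((hF.1 4 (by omega) (by decide)).trans h4) e1 (Ev.reg hτ h41)
          (by omega) hDL (by omega)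
        refine (Ev.mask (Ev.get hτ e3 rfl) e2 (indicator_le_one _)).congr ?_
        rw [hF.2 8 (by omega) (by decide), gatherRow]
        by_cases h : pv i = 0
        · simp [h, PRow.one]
        · rw [if_neg h, if_pos (by omega), hT.2.1 _ _ (by omega) hj, mul_one])
    apply Runs.seq s2
    rintro τ₂ hτ₂ ⟨q2, F2'⟩
    have F2 := F1.trans F2'
    refine (runs_fillVector (A := 19) (rR := 7) (e :=
      .get 9 (.reg 16 + (.get 30 (.reg 40) - .const 1)) * .lt (.const 0) (.get 30 (.reg 40)))
      hτ₂ hW (by omega) ((F2.1 19 (by omega) (by decide)).trans h19) (by simp)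
      (fun i => (gatherRow T src pv i).ph.val) ((F2.1 7 (by omega) (by decide)).trans h7)
      (by
        intro i τ hi hτ hF' h40 _ _
        have hF := F2.trans hF'
        obtain ⟨e1, e2⟩ := row hF (by decide) (by decide) hτ hi h40
        have := hpn i hi
        refine (Ev.mask (Ev.get hτ e1 rfl) e2 (indicator_le_one _)).congr ?_
        rw [hF.2 9 (by omega) (by decide), gatherRow]
        by_cases h : pv i = 0
        · simp [h, PRow.one]
        · rw [if_neg h, if_pos (by omega), hT.2.2 _ (by omega), mul_one])).mono le_rfl
      fun τ₃ _ ⟨q3, F3'⟩ => ?_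
    refine ⟨?_, ?_, q3, (F2.trans F3').mono (by decide) (by decide)⟩
    · rw [F3'.2 17 (by omega) (by decide), F2'.2 17 (by omega) (by decide)]; exact q1
    · rw [F3'.2 18 (by omega) (by decide)]; exact q2
  · omega

/-- All quantities in `prod_ph`, `prod_x` and `prod_z` come from four products: the pairings of the
selected rows (before the triangular mask), and the exponents times `tri`, times the `X` parts and
times the `Z` parts. -/
theorem runs_rowProducts (hc : MulSpec c F d) (hσ : σ.IsWord W) (hL : L * L + L < W)
    (h0 : σ.reg 0 = n) (h4 : σ.reg 4 = D) (h7 : σ.reg 7 = K) (h15 : σ.reg 15 = R)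
    (hK1 : 1 ≤ K) (hd : (K + 2) ^ d ≤ W) (hDL : D ≤ L) (hn : n + K ≤ D) (hK : K + K ≤ D)
    (hR : R + K ≤ D) {P : ℕ → PRow} (hU : Stored (σ.arr 16) D R K U)
    (hx : Stored (σ.arr 17) D K n (fun c j => (P c).x j))
    (hz : Stored (σ.arr 18) D K n (fun c j => (P c).z j)) :
    Runs W (rowProducts c) σ (200 * ((n + 1) * (K + 1)) + tMul F K n K K +
      200 * ((K + 1) * (K + 1)) + tMul F R K K K + 2 * tMul F R K n K) (fun τ =>
      Stored (τ.arr 22) D R K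
        (fun i c => ∑ c' ∈ Finset.range K, U i c' * PRow.tri n P c' c) ∧
      Stored (τ.arr 23) D R n (fun i j => ∑ c ∈ Finset.range K, U i c * (P c).x j) ∧
      Stored (τ.arr 24) D R n (fun i j => ∑ c ∈ Finset.range K, U i c * (P c).z j) ∧
      Frame [] [20, 21, 22, 23, 24] σ τ) := by
  have hW : 1 < W := fit_lin hL (by omega)
  have s1 := runs_fillMatrix (A := 20) (rR := 0) (rC := 7)
    (e := .get 17 (.reg 41 * .reg 4 + .reg 40)) hσ hL (by omega) (by omega) (by omega) (by simp)
    (fun j c => ((P c).x j).val) h4 h0 h7 (by omega) hDL (by omega)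
    (by
      intro i j τ hi hj hτ hF h40 h41 _ _
      exact Ev.get hτ (Ev.idx hL hτ ((hF.1 4 (by omega) (by decide)).trans h4) (Ev.reg hτ h41)
        (Ev.reg hτ h40) (by omega) hDL (by omega))
        (by rw [hF.2 17 (by omega) (by decide), hx j i hj hi]))
  apply Runs.pre
  · apply Runs.seq s1
    rintro τ₁ hτ₁ ⟨q1, F1⟩
    have fr : ∀ {A : ℕ} {τ τ' : MachineState}, (∀ r < 30, τ'.reg r = τ.reg r) ∧
        (∀ B < 50, B ≠ A → τ'.arr B = τ.arr B) → Frame [] [A] τ τ' := fun h =>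
      ⟨fun r hr _ => h.1 r hr, fun B hB hB' => h.2 B hB (by simpa using hB')⟩
    apply Runs.seq (runs_mulBlocks (A := 18) (B := 20) (Z := 21) (rR := 7) (rK := 0) (rC := 7)
      (rm := 7) hc hτ₁ hL (by omega) (by omega) (by omega) (by omega) (by omega) (by omega)
      (by omega) (by omega) (by omega) ((F1.1 7 (by omega) (by decide)).trans h7)
      ((F1.1 7 (by omega) (by decide)).trans h7) ((F1.1 0 (by omega) (by decide)).trans h0)
      ((F1.1 7 (by omega) (by decide)).trans h7) ((F1.1 4 (by omega) (by decide)).trans h4)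
      hK1 hd hDL hK hK hn (X := fun c j => (P c).z j) (Y := fun j c => (P c).x j)
      (by rw [F1.2 18 (by omega) (by decide)]; exact hz) q1)
    rintro τ₂ hτ₂ ⟨q2, g2⟩
    have F2' := fr g2
    have F2 := F1.trans F2'
    have s3 := runs_fillMatrix (A := 21) (rR := 7) (rC := 7)
      (e := .get 21 (.reg 40 * .reg 4 + .reg 41) * .lt (.reg 40) (.reg 41)) hτ₂ hL (by omega)
      (by omega) (by omega) (by simp) (fun c' c => (PRow.tri n P c' c).val)
      ((F2.1 4 (by omega) (by decide)).trans h4) ((F2.1 7 (by omega) (by decide)).trans h7)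
      ((F2.1 7 (by omega) (by decide)).trans h7) (by omega) hDL (by omega)
      (by
        intro i j τ hi hj hτ hF h40 h41 ha hs
        refine (Ev.mask (Ev.get hτ ha (hs.trans (q2 i j hi hj)))
          (Ev.lt hW (Ev.reg hτ h40) (Ev.reg hτ h41)) (indicator_le_one _)).congr ?_
        rw [PRow.tri, ite_val])
    apply Runs.seq s3
    rintro τ₃ hτ₃ ⟨q3, F3'⟩
    have F3 := F2.trans F3'
    apply Runs.seq (runs_mulBlocks (A := 16) (B := 21) (Z := 22) (rR := 15) (rK := 7) (rC := 7)
      (rm := 7) hc hτ₃ hL (by omega) (by omega) (by omega) (by omega) (by omega) (by omega)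
      (by omega) (by omega) (by omega) ((F3.1 7 (by omega) (by decide)).trans h7)
      ((F3.1 15 (by omega) (by decide)).trans h15) ((F3.1 7 (by omega) (by decide)).trans h7)
      ((F3.1 7 (by omega) (by decide)).trans h7) ((F3.1 4 (by omega) (by decide)).trans h4)
      hK1 hd hDL hR hK hK (X := U) (Y := fun c' c => PRow.tri n P c' c)
      (by rw [F3.2 16 (by omega) (by decide)]; exact hU) q3)
    rintro τ₄ hτ₄ ⟨q4, g4⟩
    have F4' := fr g4
    have F4 := F3.trans F4'
    apply Runs.seq (runs_mulBlocks (A := 16) (B := 17) (Z := 23) (rR := 15) (rK := 7) (rC := 0)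
      (rm := 7) hc hτ₄ hL (by omega) (by omega) (by omega) (by omega) (by omega) (by omega)
      (by omega) (by omega) (by omega) ((F4.1 7 (by omega) (by decide)).trans h7)
      ((F4.1 15 (by omega) (by decide)).trans h15) ((F4.1 7 (by omega) (by decide)).trans h7)
      ((F4.1 0 (by omega) (by decide)).trans h0) ((F4.1 4 (by omega) (by decide)).trans h4)
      hK1 hd hDL hR hn hK (X := U) (Y := fun c j => (P c).x j)
      (by rw [F4.2 16 (by omega) (by decide)]; exact hU)
      (by rw [F4.2 17 (by omega) (by decide)]; exact hx))
    rintro τ₅ hτ₅ ⟨q5, g5⟩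
    have F5' := fr g5
    have F5 := F4.trans F5'
    refine (runs_mulBlocks (A := 16) (B := 18) (Z := 24) (rR := 15) (rK := 7) (rC := 0)
      (rm := 7) hc hτ₅ hL (by omega) (by omega) (by omega) (by omega) (by omega) (by omega)
      (by omega) (by omega) (by omega) ((F5.1 7 (by omega) (by decide)).trans h7)
      ((F5.1 15 (by omega) (by decide)).trans h15) ((F5.1 7 (by omega) (by decide)).trans h7)
      ((F5.1 0 (by omega) (by decide)).trans h0) ((F5.1 4 (by omega) (by decide)).trans h4)
      hK1 hd hDL hR hn hK (X := U) (Y := fun c j => (P c).z j)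
      (by rw [F5.2 16 (by omega) (by decide)]; exact hU)
      (by rw [F5.2 18 (by omega) (by decide)]; exact hz)).mono le_rfl fun τ₆ _ ⟨q6, g6⟩ => ?_
    have F6' := fr g6
    refine ⟨?_, ?_, q6, (F5.trans F6').mono (by decide) (by decide)⟩
    · rw [F6'.2 22 (by omega) (by decide), F5'.2 22 (by omega) (by decide)]; exact q4
    · rw [F6'.2 23 (by omega) (by decide)]; exact q5
  · omega

theorem twice_mul (x y : ZMod 2) : ((2 * (x.val * y.val) : ℕ) : ZMod 4) = twice (x * y) := by
  revert x y; decide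

theorem val_mul_natCast (u h : ZMod 2) (p : ZMod 4) :
    ((u.val * (p.val + 2 * h.val) : ℕ) : ZMod 4) = (u.val : ZMod 4) * (p + twice h) := by
  revert u h p; decide

theorem val_mul_le (u h : ZMod 2) (p : ZMod 4) : u.val * (p.val + 2 * h.val) ≤ 5 := by
  revert u h p; decide

theorem two_mul_val_le (x y : ZMod 2) : 2 * (x.val * y.val) ≤ 2 := by
  revert x y; decide

/-- The phase formula in natural numbers modulo `4`, in the form in which the two accumulation loops
of `updateRows` compute it. -/
theorem PRow.prod_ph_val {P : ℕ → PRow} {u : ℕ → ZMod 2} {a : PRow} (n K : ℕ) :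
    (PRow.prod n P u a K).ph.val = (a.ph.val + ∑ c ∈ Finset.range K, (u c).val *
        ((P c).ph.val + 2 * (∑ c' ∈ Finset.range K, u c' * PRow.tri n P c' c).val) +
      ∑ j ∈ Finset.range n, 2 * ((a.z j).val * (∑ c ∈ Finset.range K, u c * (P c).x j).val)) % 4 := by
  rw [← ZMod.val_natCast, PRow.prod_ph, Nat.cast_add, Nat.cast_add, Nat.cast_sum, Nat.cast_sum,
    ZMod.natCast_zmod_val]
  simp only [twice_mul, val_mul_natCast]

/-- The rows of `T` from `base` on, multiplied by the rows `P`. -/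
def mulTable (n K : ℕ) (T P : ℕ → PRow) (U : ℕ → ℕ → ZMod 2) (base R i : ℕ) : PRow :=
  if base ≤ i ∧ i < base + R then PRow.prod n P (U (i - base)) (T i) K else T i

/-- The phases have to be updated first, because they refer to the old `Z` parts of the rows that
are about to be overwritten. -/
theorem runs_updateRows (hσ : σ.IsWord W) (hL : L * L + L < W) (h15L : 15 ≤ L)
    (h0 : σ.reg 0 = n) (h4 : σ.reg 4 = D) (h7 : σ.reg 7 = K) (h14 : σ.reg 14 = base)
    (h15 : σ.reg 15 = R) (hDL : D ≤ L) (hn : n ≤ D) (hK : K ≤ D) (hR : base + R ≤ N) (hN : N ≤ L)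
    {P : ℕ → PRow} (hT : TableAt σ D n N T) (hU : Stored (σ.arr 16) D R K U)
    (hp : ∀ c < K, σ.arr 19 c = (P c).ph.val)
    (hH : Stored (σ.arr 22) D R K
      (fun i c => ∑ c' ∈ Finset.range K, U i c' * PRow.tri n P c' c))
    (hx : Stored (σ.arr 23) D R n (fun i j => ∑ c ∈ Finset.range K, U i c * (P c).x j))
    (hz : Stored (σ.arr 24) D R n (fun i j => ∑ c ∈ Finset.range K, U i c * (P c).z j)) :
    Runs W updateRows σ (200 * ((R + 1) * (K + 1)) + 600 * ((R + 1) * (n + 1))) (fun τ =>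
      TableAt τ D n N (mulTable n K T P U base R) ∧ Frame [] [7, 8, 9] σ τ) := by
  -- Already `15 * 15 + 15` exceeds `200`, the room that the accumulation loops need.
  have hW' : 200 < W := by nlinarith
  have hW : 1 < W := by omega
  have row : ∀ {As : List ℕ} {τ : MachineState} {i : ℕ}, Frame [] As σ τ → τ.IsWord W → i < R →
      τ.reg 40 = i → Ev W τ (.reg 14 + .reg 40) (base + i) := by
    intro As τ i hF hτ hi h40
    exact Ev.add (Ev.reg hτ ((hF.1 14 (by omega) (by simp)).trans h14)) (Ev.reg hτ h40)
      (fit_lin hL (by omega))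
  have cell : ∀ {As : List ℕ} {τ : MachineState} {i j : ℕ}, Frame [] As σ τ → τ.IsWord W → i < R →
      j < D → τ.reg 40 = i → τ.reg 41 = j →
      Ev W τ (.reg 40 * .reg 4 + .reg 41) (i * D + j) ∧
      Ev W τ ((.reg 14 + .reg 40) * .reg 4 + .reg 41) ((base + i) * D + j) := by
    intro As τ i j hF hτ hi hj h40 h41
    have k4 := (hF.1 4 (by omega) (by simp)).trans h4
    exact ⟨Ev.idx hL hτ k4 (Ev.reg hτ h40) (Ev.reg hτ h41) (by omega) hDL (by omega),
      Ev.idx hL hτ k4 (row hF hτ hi h40) (Ev.reg hτ h41) (by omega) hDL (by omega)⟩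
  have s1 := runs_accumulate (A := 9) (rR := 15) (rC := 7) (μ := 4) (addr := .reg 14 + .reg 40)
    (e := .get 16 (.reg 40 * .reg 4 + .reg 41) *
    (.get 19 (.reg 41) + .const 2 * .get 22 (.reg 40 * .reg 4 + .reg 41))) hσ hW' (by omega)
    (by omega) (by simp) (by omega) (by omega) (fun i => base + i)
    (fun i c => (U i c).val * ((P c).ph.val + 2 *
      (∑ c' ∈ Finset.range K, U i c' * PRow.tri n P c' c).val)) h15 h7
    (fun i i' _ _ h => by omega)
    (fun i hi => by rw [hT.2.2 _ (by omega)]; exact ZMod.val_lt _)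
    (fun i c _ _ => (val_mul_le _ _ _).trans (by omega))
    (by
      intro i j τ hi hj hτ hF h40 h41
      have e1 := (cell hF hτ hi (by omega) h40 h41).1
      have a2 := ZMod.val_lt (∑ c' ∈ Finset.range K, U i c' * PRow.tri n P c' j)
      have a3 := ZMod.val_lt (P j).ph
      refine ⟨row hF hτ hi h40, Ev.mul
        (Ev.get hτ e1 (by rw [hF.2 16 (by omega) (by decide), hU i j hi hj]))
        (Ev.add (Ev.get hτ (Ev.reg hτ h41) (by rw [hF.2 19 (by omega) (by decide), hp j hj]))
          (Ev.mul (Ev.const (by omega))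
            (Ev.get hτ e1 (by rw [hF.2 22 (by omega) (by decide), hH i j hi hj])) (by omega))
          (by omega)) (lt_of_le_of_lt (val_mul_le _ _ _) (by omega))⟩)
  apply Runs.pre
  · apply Runs.seq s1
    rintro τ₁ hτ₁ ⟨q1, q1', F1⟩
    have s2 := runs_accumulate (A := 9) (rR := 15) (rC := 0) (μ := 4) (addr := .reg 14 + .reg 40)
      (e := .const 2 * (.get 8 ((.reg 14 + .reg 40) * .reg 4 + .reg 41) *
        .get 23 (.reg 40 * .reg 4 + .reg 41))) hτ₁ hW' (by omega)
      (by omega) (by simp) (by omega) (by omega) (fun i => base + i)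
      (fun i j => 2 * (((T (base + i)).z j).val *
        (∑ c ∈ Finset.range K, U i c * (P c).x j).val))
      ((F1.1 15 (by omega) (by decide)).trans h15) ((F1.1 0 (by omega) (by decide)).trans h0)
      (fun i i' _ _ h => by omega)
      (fun i hi => by rw [q1 _ hi]; exact Nat.mod_lt _ (by omega))
      (fun i j _ _ => (two_mul_val_le _ _).trans (by omega))
      (by
        intro i j τ hi hj hτ hF' h40 h41
        have hF := F1.trans hF'
        obtain ⟨e1, e2⟩ := cell hF hτ hi (by omega) h40 h41
        have a1 := two_mul_val_le ((T (base + i)).z j) (∑ c ∈ Finset.range K, U i c * (P c).x j)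
        refine ⟨row hF hτ hi h40, Ev.mul (Ev.const (by omega)) (Ev.mul
          (Ev.get hτ e2 (by rw [hF.2 8 (by omega) (by decide), hT.2.1 _ _ (by omega) hj]))
          (Ev.get hτ e1 (by rw [hF.2 23 (by omega) (by decide), hx i j hi hj])) (by omega))
          (by omega)⟩)
    apply Runs.seq s2
    rintro τ₂ hτ₂ ⟨q2, q2', F2'⟩
    have F2 := F1.trans F2'
    have inj : ∀ i j i' j', i < R → j < n → i' < R → j' < n →
        (base + i) * D + j = (base + i') * D + j' → i = i' ∧ j = j' := by
      intro i j i' j' _ hj _ hj' h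
      obtain ⟨h1, h2⟩ := mul_add_inj (by omega) (by omega) h
      exact ⟨by omega, h2⟩
    have s3 := runs_fill (A := 7) (rR := 15) (rC := 0)
      (addr := (.reg 14 + .reg 40) * .reg 4 + .reg 41)
      (e := (.get 7 ((.reg 14 + .reg 40) * .reg 4 + .reg 41) +
        .get 23 (.reg 40 * .reg 4 + .reg 41)) % .const 2) hτ₂ hW (by omega) (by omega) (by simp)
      (fun i j => (base + i) * D + j)
      (fun i j => ((T (base + i)).x j + ∑ c ∈ Finset.range K, U i c * (P c).x j).val)
      ((F2.1 15 (by omega) (by decide)).trans h15) ((F2.1 0 (by omega) (by decide)).trans h0) inj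
      (by
        intro i j τ hi hj hτ hF' h40 h41 hs
        have hF := F2.trans hF'
        obtain ⟨e1, e2⟩ := cell hF hτ hi (by omega) h40 h41
        have a1 := ZMod.val_lt ((T (base + i)).x j)
        have a2 := ZMod.val_lt (∑ c ∈ Finset.range K, U i c * (P c).x j)
        refine ⟨e2, (Ev.mod (Ev.add
          (Ev.get hτ e2 (by rw [hs, F2.2 7 (by omega) (by decide), hT.1 _ _ (by omega) hj]))
          (Ev.get hτ e1 (by rw [hF.2 23 (by omega) (by decide), hx i j hi hj])) (by beta_reduce; omega))
          (Ev.const (by omega))).congr ?_⟩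
        rw [ZMod.val_add])
    apply Runs.seq s3
    rintro τ₃ hτ₃ ⟨q3, q3', F3'⟩
    have F3 := F2.trans F3'
    have s4 := runs_fill (A := 8) (rR := 15) (rC := 0)
      (addr := (.reg 14 + .reg 40) * .reg 4 + .reg 41)
      (e := (.get 8 ((.reg 14 + .reg 40) * .reg 4 + .reg 41) +
        .get 24 (.reg 40 * .reg 4 + .reg 41)) % .const 2) hτ₃ hW (by omega) (by omega) (by simp)
      (fun i j => (base + i) * D + j)
      (fun i j => ((T (base + i)).z j + ∑ c ∈ Finset.range K, U i c * (P c).z j).val)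
      ((F3.1 15 (by omega) (by decide)).trans h15) ((F3.1 0 (by omega) (by decide)).trans h0) inj
      (by
        intro i j τ hi hj hτ hF' h40 h41 hs
        have hF := F3.trans hF'
        obtain ⟨e1, e2⟩ := cell hF hτ hi (by omega) h40 h41
        have a1 := ZMod.val_lt ((T (base + i)).z j)
        have a2 := ZMod.val_lt (∑ c ∈ Finset.range K, U i c * (P c).z j)
        refine ⟨e2, (Ev.mod (Ev.add
          (Ev.get hτ e2 (by rw [hs, F3.2 8 (by omega) (by decide), hT.2.1 _ _ (by omega) hj]))
          (Ev.get hτ e1 (by rw [hF.2 24 (by omega) (by decide), hz i j hi hj])) (by beta_reduce; omega))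
          (Ev.const (by omega))).congr ?_⟩
        rw [ZMod.val_add])
    refine s4.mono le_rfl fun τ₄ _ ⟨q4, q4', F4'⟩ => ?_
    have far : ∀ {i j : ℕ}, ¬ (base ≤ i ∧ i < base + R) → j < n →
        ∀ a b, a < R → b < n → (base + a) * D + b ≠ i * D + j := by
      intro i j h hj a b ha hb he
      obtain ⟨h1, h2⟩ := mul_add_inj (by omega) (by omega) he
      omega
    refine ⟨⟨fun i j hi hj => ?_, fun i j hi hj => ?_, fun i hi => ?_⟩,
      (F3.trans F4').mono (by decide) (by decide)⟩
    · beta_reduce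
      rw [F4'.2 7 (by omega) (by decide)]
      by_cases h : base ≤ i ∧ i < base + R
      · have := q3 (i - base) j (by omega) hj
        rw [show base + (i - base) = i by omega] at this
        rw [this, mulTable, if_pos h, PRow.prod_x]
      · rw [q3' _ (far h hj), F2.2 7 (by omega) (by decide), hT.1 i j hi hj, mulTable, if_neg h]
    · beta_reduce
      by_cases h : base ≤ i ∧ i < base + R
      · have := q4 (i - base) j (by omega) hj
        rw [show base + (i - base) = i by omega] at this
        rw [this, mulTable, if_pos h, PRow.prod_z]
      · rw [q4' _ (far h hj), F3.2 8 (by omega) (by decide), hT.2.1 i j hi hj, mulTable, if_neg h]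
    · rw [F4'.2 9 (by omega) (by decide), F3'.2 9 (by omega) (by decide)]
      by_cases h : base ≤ i ∧ i < base + R
      · have := q2 (i - base) (by omega)
        have hq := q1 (i - base) (by omega)
        rw [show base + (i - base) = i by omega] at this hq
        rw [this, hq, mulTable, if_pos h, PRow.prod_ph_val, hT.2.2 i hi, Nat.mod_add_mod]
      · rw [q2' i (fun a ha => by omega), q1' i (fun a ha => by omega), hT.2.2 i hi, mulTable,
          if_neg h]
  · omega

theorem runs_mulRows (hc : MulSpec c F d) (hσ : σ.IsWord W) (hL : L * L + L < W) (h15L : 15 ≤ L)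
    (h0 : σ.reg 0 = n) (h4 : σ.reg 4 = D) (h7 : σ.reg 7 = K) (h14 : σ.reg 14 = base)
    (h15 : σ.reg 15 = R) (h16 : σ.reg 16 = src) (h19 : σ.reg 19 = 1) (hDL : D ≤ L)
    (hK1 : 1 ≤ K) (hd : (K + 2) ^ d ≤ W) (hn : n + K ≤ D) (hK : K + K ≤ D) (hRK : R + K ≤ D)
    (hR : base + R ≤ N) (hsrc : src + n ≤ N) (hN : N ≤ L)
    (hp : ∀ c < K, σ.arr 30 c = pv c) (hpn : ∀ c < K, pv c ≤ n)
    (hT : TableAt σ D n N T) (hU : Stored (σ.arr 16) D R K U) :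
    Runs W (mulRows c) σ (tMulRows F n R K) (fun τ =>
      TableAt τ D n N (mulTable n K T (gatherRow T src pv) U base R) ∧
      Frame [] [7, 8, 9, 17, 18, 19, 20, 21, 22, 23, 24] σ τ) := by
  apply Runs.pre
  · apply Runs.seq (runs_gatherRows hσ hL (by omega) h0 h4 h7 h16 h19 hDL (by omega) (by omega)
      hsrc hN hp hpn hT)
    rintro τ₁ hτ₁ ⟨x1, z1, p1, F1⟩
    apply Runs.seq (runs_rowProducts hc hτ₁ hL ((F1.1 0 (by omega) (by decide)).trans h0)
      ((F1.1 4 (by omega) (by decide)).trans h4) ((F1.1 7 (by omega) (by decide)).trans h7)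
      ((F1.1 15 (by omega) (by decide)).trans h15) hK1 hd hDL hn hK hRK
      (by rw [F1.2 16 (by omega) (by decide)]; exact hU) x1 z1)
    rintro τ₂ hτ₂ ⟨a2, x2, z2, F2'⟩
    have F2 := F1.trans F2'
    refine (runs_updateRows hτ₂ hL h15L ((F2.1 0 (by omega) (by decide)).trans h0)
      ((F2.1 4 (by omega) (by decide)).trans h4) ((F2.1 7 (by omega) (by decide)).trans h7)
      ((F2.1 14 (by omega) (by decide)).trans h14) ((F2.1 15 (by omega) (by decide)).trans h15) hDL
      (by omega) (by omega) hR hN (hT.frame F2 (by decide) (by decide) (by decide))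
      (by rw [F2.2 16 (by omega) (by decide)]; exact hU)
      (by rw [F2'.2 19 (by omega) (by decide)]; exact p1) a2 x2 z2).mono le_rfl
      fun τ₃ _ ⟨q, F3'⟩ => ?_
    exact ⟨q, (F2.trans F3').mono (by decide) (by decide)⟩
  · unfold tMulRows
    nlinarith

end

/-! ### The stages of the measurement program -/

/-- The registers with constants: `n` qubits, `k` of them measured, `K` a power of two. -/
structure Consts (σ : MachineState) (n k K : ℕ) : Prop where
  r0 : σ.reg 0 = n
  r1 : σ.reg 1 = k
  r4 : σ.reg 4 = 4 * n
  r5 : σ.reg 5 = 2 * n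
  r6 : σ.reg 6 = n - k
  r7 : σ.reg 7 = K
  r18 : σ.reg 18 = n / K + 1
  r19 : σ.reg 19 = 1
  r20 : σ.reg 20 = 3 * n
  r23 : σ.reg 23 = 2 * K
  r24 : σ.reg 24 = 2 * (n - k)

theorem Consts.frame {σ τ : MachineState} {n k K : ℕ} (h : Consts σ n k K) {Rs As : List ℕ}
    (hF : Frame Rs As σ τ) (hd : ∀ r ∈ [0, 1, 4, 5, 6, 7, 18, 19, 20, 23, 24], r ∉ Rs) :
    Consts τ n k K where
  r0 := (hF.1 0 (by omega) (hd _ (by decide))).trans h.r0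
  r1 := (hF.1 1 (by omega) (hd _ (by decide))).trans h.r1
  r4 := (hF.1 4 (by omega) (hd _ (by decide))).trans h.r4
  r5 := (hF.1 5 (by omega) (hd _ (by decide))).trans h.r5
  r6 := (hF.1 6 (by omega) (hd _ (by decide))).trans h.r6
  r7 := (hF.1 7 (by omega) (hd _ (by decide))).trans h.r7
  r18 := (hF.1 18 (by omega) (hd _ (by decide))).trans h.r18
  r19 := (hF.1 19 (by omega) (hd _ (by decide))).trans h.r19
  r20 := (hF.1 20 (by omega) (hd _ (by decide))).trans h.r20
  r23 := (hF.1 23 (by omega) (hd _ (by decide))).trans h.r23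
  r24 := (hF.1 24 (by omega) (hd _ (by decide))).trans h.r24

/-- The word size and the parameters. -/
structure Bounds (W L n k K d : ℕ) : Prop where
  hL : L * L + L < W
  h4 : 4 * n ≤ L
  h15 : 15 ≤ L
  hk1 : 1 ≤ k
  hkn : k ≤ n
  hkK : k ≤ K
  hKn : K ≤ 2 * n
  hd : (K + 2) ^ d ≤ W

/-- The columns of the `X` part that belong to the labels in the array `5`. -/
def measuredPart (k : ℕ) (sl : ℕ → ℕ) (T : ℕ → PRow) (base i q : ℕ) : ZMod 2 :=
  if q < k then (T (base + i)).x (sl q) else 0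

def loadColumns (A rC : ℕ) (be : RExpr) : Prog :=
  map2 A 0 rC (.reg 40 * .reg 4 + .reg 41)
    (.get 7 ((be + .reg 40) * .reg 4 + .get 5 (.reg 41) * .lt (.reg 41) (.reg 1)) *
      .lt (.reg 41) (.reg 1))

/-- Multiplication of `R` rows from `base` on by rows from `src` on. -/
def mulRowsAt (c : Prog) (eb eR es : RExpr) : Prog :=
  .seq (.assign 14 eb) (.seq (.assign 15 eR) (.seq (.assign 16 es) (mulRows c)))

section

variable {c : Prog} {F : ℕ → ℕ} {d W L : ℕ} {σ : MachineState} {n k K : ℕ} {T : ℕ → PRow}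
  {sl pv : ℕ → ℕ}

/-- The width exceeds `k` in general. In a padding column the label read from the array `5` is
arbitrary, so both the column address and the entry are masked. -/
theorem runs_loadColumns (hB : Bounds W L n k K d) (hσ : σ.IsWord W) (hC : Consts σ n k K)
    {A rC C base : ℕ} {be : RExpr} (hA : A ≠ 7 ∧ A ≠ 5) (hrC : rC < 30) (hC' : σ.reg rC = C)
    (hCn : C ≤ 4 * n) (hcost : be.cost ≤ 10) (hbe : ∀ τ, τ.IsWord W → Frame [] [A] σ τ →
      Ev W τ be base) (hbase : base + n ≤ 4 * n) (hT : TableAt σ (4 * n) n (4 * n) T)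
    (hsl : ∀ c < k, σ.arr 5 c = sl c) (hsln : ∀ c < k, sl c < n) :
    Runs W (loadColumns A rC be) σ (200 * ((n + 1) * (C + 1))) (fun τ =>
      Stored (τ.arr A) (4 * n) n C (measuredPart k sl T base) ∧ Frame [] [A] σ τ) := by
  have hL := hB.hL
  have h4 := hB.h4
  have h15 := hB.h15
  have hW : 1 < W := fit_lin hL (by omega)
  refine runs_fillMatrix hσ hL (by omega) (by omega) hrC (by simp; omega)
    (fun i q => (measuredPart k sl T base i q).val) hC.r4 hC.r0 hC' (by omega) h4 hCn ?_
  intro i j τ hi hj hτ hF h40 h41 _ _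
  have c1 := Ev.lt hW (Ev.reg hτ h41) (Ev.reg hτ ((hF.1 1 (by omega) (by simp)).trans hC.r1))
  have c2 := Ev.mask (Ev.get hτ (A := 5) (Ev.reg hτ h41) rfl) c1 (indicator_le_one _)
  rw [hF.2 5 (by omega) (by simpa using hA.2.symm)] at c2
  have hm : σ.arr 5 j * (if j < k then 1 else 0) = if j < k then sl j else 0 := by
    split
    · rw [hsl j (by assumption), mul_one]
    · rw [mul_zero]
  rw [hm] at c2
  have hle : (if j < k then sl j else 0) < n := by
    split
    · exact hsln j (by assumption)
    · omega
  have c3 := Ev.idx hL hτ ((hF.1 4 (by omega) (by simp)).trans hC.r4)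
    (Ev.add (hbe τ hτ hF) (Ev.reg hτ h40) (fit_lin hL (by omega))) c2 (by omega) h4 (by omega)
  refine (Ev.mask (Ev.get hτ (A := 7) c3 rfl) c1 (indicator_le_one _)).congr ?_
  rw [hF.2 7 (by omega) (by simpa using hA.1.symm), hT.1 _ _ (by omega) hle, measuredPart]
  split <;> simp

theorem runs_mulRowsAt (hc : MulSpec c F d) (hB : Bounds W L n k K d) (hσ : σ.IsWord W)
    (hC : Consts σ n k K) {eb eR es : RExpr} {base R src : ℕ}
    (hcost : eb.cost ≤ 5 ∧ eR.cost ≤ 5 ∧ es.cost ≤ 5)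
    (hb : ∀ τ, τ.IsWord W → Frame [14, 15, 16] [] σ τ → Ev W τ eb base)
    (hR : ∀ τ, τ.IsWord W → Frame [14, 15, 16] [] σ τ → Ev W τ eR R)
    (hs : ∀ τ, τ.IsWord W → Frame [14, 15, 16] [] σ τ → Ev W τ es src)
    (hRn : R ≤ n) (hbR : base + R ≤ 4 * n) (hsn : src + n ≤ 4 * n)
    (hp : ∀ c < K, σ.arr 30 c = pv c) (hpn : ∀ c < K, pv c ≤ n)
    (hT : TableAt σ (4 * n) n (4 * n) T) {U : ℕ → ℕ → ZMod 2}
    (hU : Stored (σ.arr 16) (4 * n) R K U) :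
    Runs W (mulRowsAt c eb eR es) σ (tMulRows F n R K + 20) (fun τ =>
      TableAt τ (4 * n) n (4 * n) (mulTable n K T (gatherRow T src pv) U base R) ∧
      Frame [14, 15, 16] [7, 8, 9, 17, 18, 19, 20, 21, 22, 23, 24] σ τ) := by
  obtain ⟨hL, h4, h15, hk1, hkn, hkK, hKn, hd⟩ := hB
  apply Runs.pre
  · apply Runs.seq (Runs.assignEv hσ 14 (hb σ hσ ((Frame.refl σ).mono (by decide) (by decide))))
    rintro τ₁ hτ₁ ⟨v1, F1⟩
    apply Runs.seq (Runs.assignEv hτ₁ 15 (hR τ₁ hτ₁ (F1.mono (by decide) (by decide))))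
    rintro τ₂ hτ₂ ⟨v2, F2'⟩
    have F2 := F1.trans F2'
    apply Runs.seq (Runs.assignEv hτ₂ 16 (hs τ₂ hτ₂ (F2.mono (by decide) (by decide))))
    rintro τ₃ hτ₃ ⟨v3, F3'⟩
    have F3 := F2.trans F3'
    have C3 := hC.frame F3 (by decide)
    refine (runs_mulRows hc hτ₃ hL h15 C3.r0 C3.r4 C3.r7
      (((F2'.trans F3').1 14 (by omega) (by decide)).trans v1)
      ((F3'.1 15 (by omega) (by decide)).trans v2) v3 C3.r19 h4 (by omega) hd (by omega) (by omega)
      (by omega) hbR hsn h4 (by rw [F3.2 30 (by omega) (by decide)]; exact hp) hpn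
      (hT.frame F3 (by decide) (by decide) (by decide))
      (U := U) (by rw [F3.2 16 (by omega) (by decide)]; exact hU)).mono le_rfl
      fun τ₄ _ ⟨q, F4⟩ => ?_
    exact ⟨q, (F3.trans F4).mono (by decide) (by decide)⟩
  · omega

end

/-- Copies the transformation and the pivots that the elimination has found. -/
def copyElim : Prog :=
  .seq (map2 16 0 7 (.reg 40 * .reg 4 + .reg 41) (.get 10 (.reg 40 * .reg 4 + .reg 41)))
    (map2 30 7 19 (.reg 40) (.get 14 (.reg 40)))

/-- Replaces the stabilizers by ones with reduced `X` parts. -/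
def reduceStabilizers (c : Prog) : Prog :=
  .seq (loadColumns 10 23 (.reg 0))
  (.seq (elimProg c)
  (.seq copyElim
  (.seq (map2 25 7 19 (.reg 40) (.get 14 (.reg 40)))
  (.seq (map2 26 0 19 (.reg 40) (.get 15 (.reg 40 + .const 1)))
  (mulRowsAt c (.reg 5) (.reg 0) (.reg 0))))))

/-- Clears the pivot columns of the destabilizers. -/
def clearDestabilizers (c : Prog) : Prog :=
  .seq (loadColumns 16 7 (.const 0)) (mulRowsAt c (.const 0) (.reg 0) (.reg 5))

/-- Reduces the destabilizers on the columns without pivot. -/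
def reduceDestabilizers (c : Prog) : Prog :=
  .seq (map2 10 0 23 (.reg 40 * .reg 4 + .reg 41) (.get 27 (.reg 40 * .reg 4 + .reg 41) *
    (.lt (.reg 41) (.reg 1) * .eqv (.get 26 (.reg 40)) (.const 0))))
  (.seq (elimProg c)
  (.seq copyElim (mulRowsAt c (.const 0) (.reg 0) (.const 0))))

section

variable {c : Prog} {F : ℕ → ℕ} {d W L : ℕ} {σ : MachineState} {n k e : ℕ} {T : ℕ → PRow}
  {sl : ℕ → ℕ}

open Elim

theorem runs_copyElim (hB : Bounds W L n k (2 ^ e) d) (hσ : σ.IsWord W)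
    (hC : Consts σ n k (2 ^ e)) {X : ℕ → ℕ → ZMod 2} {pv : ℕ → ℕ}
    (hX : Stored (σ.arr 10) (4 * n) n (2 ^ e) X) (hp : ∀ l < 2 ^ e, σ.arr 14 l = pv l) :
    Runs W copyElim σ (200 * ((n + 1) * (2 ^ e + 1)) + 400 * (2 ^ e + 1)) (fun τ =>
      Stored (τ.arr 16) (4 * n) n (2 ^ e) X ∧ (∀ l < 2 ^ e, τ.arr 30 l = pv l) ∧
      Frame [] [16, 30] σ τ) := by
  obtain ⟨hL, h4, h15, hk1, hkn, hkK, hKn, hd⟩ := hB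
  have hW : 1 < W := fit_lin hL (by omega)
  apply Runs.seq (runs_fillMatrix (A := 16) (rR := 0) (rC := 7)
    (e := .get 10 (.reg 40 * .reg 4 + .reg 41)) hσ hL
    (by omega) (by omega) (by omega) (by simp) (fun i j => (X i j).val) hC.r4
    hC.r0 hC.r7 (by omega) h4 (by omega) (by
      intro i j τ hi hj hτ hF h40 h41 ha hs
      exact Ev.get hτ ha (by rw [hF.2 10 (by omega) (by decide), hX i j hi hj])))
  rintro τ₂ hτ₂ ⟨q2, F2⟩
  refine (runs_fillVector (A := 30) (rR := 7) (e := .get 14 (.reg 40)) hτ₂ hW (by omega)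
      (hC.frame F2 (by decide)).r19 (by simp) pv (hC.frame F2 (by decide)).r7 (by
      intro i τ hi hτ hF h40 ha _
      exact Ev.get hτ ha (by rw [(F2.trans hF).2 14 (by omega) (by decide), hp i hi]))).mono le_rfl
      fun τ₃ _ ⟨q3, F3⟩ => ?_
  exact ⟨by rw [F3.2 16 (by omega) (by decide)]; exact q2, q3,
    (F2.trans F3).mono (by decide) (by decide)⟩

theorem runs_elim (hc : MulSpec c F d) (hB : Bounds W L n k (2 ^ e) d) (hσ : σ.IsWord W)
    (hC : Consts σ n k (2 ^ e)) {Y : ℕ → ℕ → ZMod 2}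
    (hY : Stored (σ.arr 10) (4 * n) n (2 * 2 ^ e) Y) :
    Runs W (elimProg c) σ (tElim F n e) (fun τ =>
      Stored (τ.arr 10) (4 * n) n (2 ^ e) (run n Y (2 ^ e)).X ∧
      (∀ i < n, τ.arr 15 (i + 1) = ((run n Y (2 ^ e)).used i).val) ∧
      (∀ l < 2 ^ e, τ.arr 14 l = (run n Y (2 ^ e)).piv l) ∧
      Frame [8, 9, 10, 11, 12, 13, 22] [10, 11, 12, 13, 14, 15] σ τ) := by
  obtain ⟨hL, h4, h15, hk1, hkn, hkK, hKn, hd⟩ := hB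
  refine (runs_elimProg hc hσ hL hC.r0 hC.r4 hC.r7 hC.r19 h4 (by omega) (by omega)
    (by omega) hd hY).mono le_rfl fun τ _ ⟨x1, u1, p1, hr, ha⟩ => ⟨x1, u1, p1,
      fun r hr' hm => hr r hr' ?_ ?_, fun A hA hm => ha A hA ?_⟩ <;> simp at hm <;> omega

theorem runs_reduceStabilizers (hc : MulSpec c F d) (hB : Bounds W L n k (2 ^ e) d)
    (hσ : σ.IsWord W) (hC : Consts σ n k (2 ^ e)) (hT : TableAt σ (4 * n) n (4 * n) T)
    (hsl : ∀ c < k, σ.arr 5 c = sl c) (hsln : ∀ c < k, sl c < n) :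
    Runs W (reduceStabilizers c) σ
      (tElim F n e + tMulRows F n n (2 ^ e) + 2000 * ((n + 1) * (2 ^ e + 1))) (fun τ =>
      let E := run n (measuredPart k sl T n) (2 ^ e)
      TableAt τ (4 * n) n (4 * n)
        (mulTable n (2 ^ e) T (gatherRow T n E.piv) E.X (2 * n) n) ∧
      (∀ l < 2 ^ e, τ.arr 30 l = E.piv l) ∧ (∀ l < 2 ^ e, τ.arr 25 l = E.piv l) ∧
      (∀ i < n, τ.arr 26 i = (E.used i).val) ∧
      Frame [8, 9, 10, 11, 12, 13, 14, 15, 16, 22] [7, 8, 9, 10, 11, 12, 13, 14, 15, 16, 17, 18, 19,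
        20, 21, 22, 23, 24, 25, 26, 30] σ τ) := by
  have hB' := hB
  obtain ⟨hL, h4, h15, hk1, hkn, hkK, hKn, hd⟩ := hB'
  have hW : 1 < W := fit_lin hL (by omega)
  set E := run n (measuredPart k sl T n) (2 ^ e) with hE
  apply Runs.pre
  · apply Runs.seq (runs_loadColumns hB hσ hC (base := n) (A := 10) (rC := 23) (be := .reg 0)
      (by omega) (by omega) hC.r23 (by omega) (by simp)
      (fun τ hτ hF => Ev.reg hτ ((hF.1 0 (by omega) (by decide)).trans hC.r0)) (by omega) hT hsl hsln)
    rintro τ₁ hτ₁ ⟨q1, F1⟩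
    have C1 := hC.frame F1 (by decide)
    apply Runs.seq (runs_elim hc hB hτ₁ C1 q1)
    rintro τ₂ hτ₂ ⟨x2, u2, p2, F2'⟩
    have F2 := F1.trans F2'
    have C2 := hC.frame F2 (by decide)
    apply Runs.seq (runs_copyElim hB hτ₂ C2 x2 p2)
    rintro τ₃ hτ₃ ⟨x3, p3, F3'⟩
    have F3 := F2.trans F3'
    have C3 := hC.frame F3 (by decide)
    apply Runs.seq (runs_fillVector (A := 25) (rR := 7) (e := .get 14 (.reg 40)) hτ₃ hW (by omega)
      C3.r19 (by simp) E.piv C3.r7 (by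
      intro i τ hi hτ hF h40 ha _
      exact Ev.get hτ ha (by rw [(F3'.trans hF).2 14 (by omega) (by decide), p2 i hi])))
    rintro τ₄ hτ₄ ⟨p4, F4'⟩
    have F4 := F3.trans F4'
    have C4 := hC.frame F4 (by decide)
    apply Runs.seq (runs_fillVector (A := 26) (rR := 0) (e := .get 15 (.reg 40 + .const 1)) hτ₄ hW
      (by omega) C4.r19 (by simp) (fun i => (E.used i).val) C4.r0 (by
      intro i τ hi hτ hF h40 ha _
      exact Ev.get hτ (Ev.add ha (Ev.const hW) (fit_lin hL (by omega)))
        (by rw [((F3'.trans F4').trans hF).2 15 (by omega) (by decide), u2 i hi])))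
    rintro τ₅ hτ₅ ⟨u5, F5'⟩
    have F5 := F4.trans F5'
    have C5 := hC.frame F5 (by decide)
    have F35 := F4'.trans F5'
    -- The products are written to the second copy of the stabilizers. The original stabilizers stay
    -- in place for the constraints, since only they are dual to the original destabilizers.
    refine (runs_mulRowsAt hc hB hτ₅ C5 (eb := .reg 5) (eR := .reg 0) (es := .reg 0)
      (base := 2 * n) (R := n) (src := n) (by simp)
      (fun τ hτ hF => Ev.reg hτ (C5.frame hF (by decide)).r5)
      (fun τ hτ hF => Ev.reg hτ (C5.frame hF (by decide)).r0)
      (fun τ hτ hF => Ev.reg hτ (C5.frame hF (by decide)).r0) le_rfl (by omega) (by omega)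
      (pv := E.piv) (by rw [F35.2 30 (by omega) (by decide)]; exact p3)
      (fun c _ => run_piv_le _ _) (hT.frame F5 (by decide) (by decide) (by decide)) (U := E.X)
      (by rw [F35.2 16 (by omega) (by decide)]; exact x3)).mono le_rfl fun τ₆ _ ⟨q6, F6⟩ => ?_
    refine ⟨q6, ?_, ?_, ?_, (F5.trans F6).mono (by decide) (by decide)⟩
    · rw [(F35.trans F6).2 30 (by omega) (by decide)]; exact p3
    · rw [(F5'.trans F6).2 25 (by omega) (by decide)]; exact p4
    · rw [F6.2 26 (by omega) (by decide)]; exact u5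
  · have h1 : n + 1 ≤ (n + 1) * (2 ^ e + 1) := Nat.le_mul_of_pos_right _ (by omega)
    have h2 : 2 ^ e + 1 ≤ (n + 1) * (2 ^ e + 1) := Nat.le_mul_of_pos_left _ (by omega)
    have h3 : (n + 1) * (2 * 2 ^ e + 1) ≤ 2 * ((n + 1) * (2 ^ e + 1)) := by nlinarith
    omega

/-- The pivot columns of the reduced stabilizers are unit vectors, so the exponents that clear a
destabilizer are simply its own entries in these columns. Columns without a pivot select the
identity row. -/
theorem runs_clearDestabilizers (hc : MulSpec c F d) (hB : Bounds W L n k (2 ^ e) d)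
    (hσ : σ.IsWord W) (hC : Consts σ n k (2 ^ e)) (hT : TableAt σ (4 * n) n (4 * n) T)
    (hsl : ∀ c < k, σ.arr 5 c = sl c) (hsln : ∀ c < k, sl c < n) {pv : ℕ → ℕ}
    (hp : ∀ l < 2 ^ e, σ.arr 30 l = pv l) (hpn : ∀ l < 2 ^ e, pv l ≤ n) :
    Runs W (clearDestabilizers c) σ
      (tMulRows F n n (2 ^ e) + 300 * ((n + 1) * (2 ^ e + 1))) (fun τ =>
      TableAt τ (4 * n) n (4 * n) (mulTable n (2 ^ e) T (gatherRow T (2 * n) pv)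
        (measuredPart k sl T 0) 0 n) ∧
      Frame [14, 15, 16] [7, 8, 9, 16, 17, 18, 19, 20, 21, 22, 23, 24] σ τ) := by
  have hB' := hB
  obtain ⟨hL, h4, h15, hk1, hkn, hkK, hKn, hd⟩ := hB'
  have hW : 0 < W := fit_lin hL (by omega)
  apply Runs.pre
  · apply Runs.seq (runs_loadColumns hB hσ hC (base := 0) (A := 16) (rC := 7) (be := .const 0)
      (by omega) (by omega) hC.r7 (by omega) (by simp)
      (fun τ hτ hF => Ev.const hW) (by omega) hT hsl hsln)
    rintro τ₁ hτ₁ ⟨q1, F1⟩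
    have C1 := hC.frame F1 (by decide)
    refine (runs_mulRowsAt hc hB hτ₁ C1 (eb := .const 0) (eR := .reg 0) (es := .reg 5)
      (base := 0) (R := n) (src := 2 * n) (by simp)
      (fun τ hτ hF => Ev.const hW)
      (fun τ hτ hF => Ev.reg hτ (C1.frame hF (by decide)).r0)
      (fun τ hτ hF => Ev.reg hτ (C1.frame hF (by decide)).r5) le_rfl (by omega) (by omega)
      (pv := pv) (by rw [F1.2 30 (by omega) (by decide)]; exact hp)
      hpn (hT.frame F1 (by decide) (by decide) (by decide)) q1).mono le_rfl
      fun τ₆ _ ⟨q6, F6⟩ => ?_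
    exact ⟨q6, (F1.trans F6).mono (by decide) (by decide)⟩
  · have h2 : 2 ^ e + 1 ≤ (n + 1) * (2 ^ e + 1) := Nat.le_mul_of_pos_left _ (by omega)
    omega

/-- Rows used by the first elimination are entered as zero rows, so they cannot become pivots; the
pivot rows for all multiplications are then cleared destabilizers dual to unused stabilizers. -/
theorem runs_reduceDestabilizers (hc : MulSpec c F d) (hB : Bounds W L n k (2 ^ e) d)
    (hσ : σ.IsWord W) (hC : Consts σ n k (2 ^ e)) (hT : TableAt σ (4 * n) n (4 * n) T)
    {A : ℕ → ℕ → ZMod 2} {u : ℕ → ZMod 2}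
    (hA : Stored (σ.arr 27) (4 * n) n (2 ^ e) A) (hA0 : ∀ i q, k ≤ q → A i q = 0)
    (hu : ∀ i < n, σ.arr 26 i = (u i).val) :
    Runs W (reduceDestabilizers c) σ
      (tElim F n e + tMulRows F n n (2 ^ e) + 1500 * ((n + 1) * (2 ^ e + 1))) (fun τ =>
      let E := run n (fun i q => if u i = 0 then A i q else 0) (2 ^ e)
      TableAt τ (4 * n) n (4 * n) (mulTable n (2 ^ e) T (gatherRow T 0 E.piv) E.X 0 n) ∧
      (∀ i < n, τ.arr 15 (i + 1) = (E.used i).val) ∧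
      Frame [8, 9, 10, 11, 12, 13, 14, 15, 16, 22] [7, 8, 9, 10, 11, 12, 13, 14, 15, 16, 17, 18, 19,
        20, 21, 22, 23, 24, 30] σ τ) := by
  have hB' := hB
  obtain ⟨hL, h4, h15, hk1, hkn, hkK, hKn, hd⟩ := hB'
  have hW : 1 < W := fit_lin hL (by omega)
  set E := run n (fun i q => if u i = 0 then A i q else 0) (2 ^ e) with hE
  apply Runs.pre
  · apply Runs.seq (runs_fillMatrix (A := 10) (rR := 0) (rC := 23)
      (e := .get 27 (.reg 40 * .reg 4 + .reg 41) *
        (.lt (.reg 41) (.reg 1) * .eqv (.get 26 (.reg 40)) (.const 0))) hσ hL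
      (by omega) (by omega) (by omega) (by simp)
      (fun i j => (if u i = 0 then A i j else 0 : ZMod 2).val) hC.r4
      hC.r0 hC.r23 (by omega) h4 (by omega) (by
        intro i j τ hi hj hτ hF h40 h41 ha hs
        have e1 := Ev.lt hW (Ev.reg hτ h41) (Ev.reg hτ ((hF.1 1 (by omega) (by simp)).trans hC.r1))
        have e2 := Ev.eqv hW (Ev.get hτ (A := 26) (Ev.reg hτ h40)
          (by rw [hF.2 26 (by omega) (by decide), hu i hi])) (Ev.const (by omega : 0 < W))
        refine (Ev.mask (Ev.get hτ (A := 27) ha rfl) (Ev.mask e1 e2 (indicator_le_one _))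
          (Nat.mul_le_mul (indicator_le_one _) (indicator_le_one _))).congr ?_
        rw [hF.2 27 (by omega) (by decide)]
        by_cases hjk : j < k
        · rw [hA i j hi (by omega), if_pos hjk, one_mul, ite_val]
          simp only [ZMod.val_eq_zero]
        · rw [if_neg hjk, zero_mul, mul_zero, hA0 i j (by omega), ite_self, ZMod.val_zero]))
    rintro τ₁ hτ₁ ⟨q1, F1⟩
    have C1 := hC.frame F1 (by decide)
    apply Runs.seq (runs_elim hc hB hτ₁ C1 (Y := fun i q => if u i = 0 then A i q else 0) q1)
    rintro τ₂ hτ₂ ⟨x2, u2, p2, F2'⟩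
    have F2 := F1.trans F2'
    have C2 := hC.frame F2 (by decide)
    apply Runs.seq (runs_copyElim hB hτ₂ C2 x2 p2)
    rintro τ₃ hτ₃ ⟨x3, p3, F3'⟩
    have F3 := F2.trans F3'
    have C3 := hC.frame F3 (by decide)
    refine (runs_mulRowsAt hc hB hτ₃ C3 (eb := .const 0) (eR := .reg 0) (es := .const 0)
      (base := 0) (R := n) (src := 0) (by simp)
      (fun τ hτ hF => Ev.const (by omega))
      (fun τ hτ hF => Ev.reg hτ (C3.frame hF (by decide)).r0)
      (fun τ hτ hF => Ev.const (by omega)) le_rfl (by omega) (by omega)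
      (pv := E.piv) p3
      (fun c _ => run_piv_le _ _) (hT.frame F3 (by decide) (by decide) (by decide)) (U := E.X)
      x3).mono le_rfl fun τ₆ _ ⟨q6, F6⟩ => ?_
    refine ⟨q6, ?_, (F3.trans F6).mono (by decide) (by decide)⟩
    rw [(F3'.trans F6).2 15 (by omega) (by decide)]; exact u2
  · have h2 : 2 ^ e + 1 ≤ (n + 1) * (2 ^ e + 1) := Nat.le_mul_of_pos_left _ (by omega)
    have h3 : (n + 1) * (2 * 2 ^ e + 1) ≤ 2 * ((n + 1) * (2 ^ e + 1)) := by nlinarith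
    omega

end

/-! ### The constraints on the outcomes -/

namespace PRow

theorem prod_congr {n : ℕ} {P P' : ℕ → PRow} {u u' : ℕ → ZMod 2} {a : PRow} {K : ℕ}
    (hu : ∀ c < K, u c = u' c) (hP : ∀ c < K, u c ≠ 0 → P c = P' c) :
    prod n P u a K = prod n P' u' a K := by
  induction K with
  | zero => rfl
  | succ K ih =>
    rw [prod, prod, ← hu K (by omega), ih (fun c hc => hu c (by omega)) fun c hc => hP c (by omega)]
    by_cases h : u K = 0
    · rw [if_pos h, if_pos h]
    · rw [if_neg h, if_neg h, hP K (by omega) h]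

theorem prod_append {n : ℕ} {P : ℕ → PRow} {u : ℕ → ZMod 2} {a : PRow} (m K : ℕ) :
    prod n P u a (m + K) = prod n (fun c => P (m + c)) (fun c => u (m + c)) (prod n P u a m) K := by
  induction K with
  | zero => rfl
  | succ K ih => rw [← add_assoc, prod, prod, ih]

theorem prod_of_zero {n : ℕ} {P : ℕ → PRow} {u : ℕ → ZMod 2} {a : PRow} {m K : ℕ} (h : m ≤ K)
    (hu : ∀ c, m ≤ c → u c = 0) : prod n P u a K = prod n P u a m := by
  induction K, h using Nat.le_induction with
  | base => rfl
  | succ K hK ih => rw [prod, if_pos (hu K hK), ih]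

end PRow

/-- The rows `3n + c`, multiplied by the first `m` stabilizers with the exponents `A · c`. -/
def constraintTable (n k : ℕ) (T : ℕ → PRow) (A : ℕ → ℕ → ZMod 2) (m i : ℕ) : PRow :=
  if 3 * n ≤ i ∧ i < 3 * n + k then
    PRow.prod n (fun r => T (n + r)) (fun r => if r < n then A r (i - 3 * n) else 0) (T i) m
  else T i

/-- A product over `n` stabilizers is taken in blocks of `K` consecutive factors. In the last blocks
the indices beyond `n` get exponent zero and select the identity. -/
theorem constraintTable_block {n k K bl : ℕ} (T : ℕ → PRow) (A : ℕ → ℕ → ZMod 2) :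
    mulTable n K (constraintTable n k T A (bl * K))
      (gatherRow (constraintTable n k T A (bl * K)) n
        (fun c => if bl * K + c < n then bl * K + c + 1 else 0))
      (fun c' c => if bl * K + c < n then A (bl * K + c) c' else 0) (3 * n) k =
    constraintTable n k T A ((bl + 1) * K) := by
  funext i
  rw [mulTable, constraintTable, constraintTable]
  split
  · rw [add_mul, one_mul, PRow.prod_append]
    refine PRow.prod_congr (fun c _ => rfl) fun c _ hc => ?_
    have h : bl * K + c < n := by
      by_contra h
      exact hc (if_neg h)
    rw [gatherRow, if_pos h, if_neg (by omega), constraintTable, if_neg (by omega)]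
    rfl
  · rfl

def constraintStep (c : Prog) : Prog :=
  .seq (map2 30 7 19 (.reg 40) ((.reg 17 * .reg 7 + .reg 40 + .const 1) *
    .lt (.reg 17 * .reg 7 + .reg 40) (.reg 0)))
  (.seq (map2 16 1 7 (.reg 40 * .reg 4 + .reg 41)
    (.get 27 ((.reg 17 * .reg 7 + .reg 41) * .reg 4 + .reg 40) *
      .lt (.reg 17 * .reg 7 + .reg 41) (.reg 0)))
  (mulRowsAt c (.reg 20) (.reg 1) (.reg 0)))

/-- Computes the stabilizers that restrict the outcomes. -/
def constraints (c : Prog) : Prog := forLoop 17 18 (constraintStep c)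

section

variable {c : Prog} {F : ℕ → ℕ} {d W L : ℕ} {σ : MachineState} {n k K : ℕ} {T : ℕ → PRow}

/-- Only `k` rows are multiplied, but by all `n` stabilizers, so the multiplication by `K` common
rows is repeated `n / K + 1` times. The exponent matrix is the transpose of the cleared destabilizer
entries. -/
theorem runs_constraints (hc : MulSpec c F d) (hB : Bounds W L n k K d)
    (hσ : σ.IsWord W) (hC : Consts σ n k K) (hT : TableAt σ (4 * n) n (4 * n) T)
    {A : ℕ → ℕ → ZMod 2} (hA : Stored (σ.arr 27) (4 * n) n K A) :
    Runs W (constraints c) σ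
      ((n / K + 1) * (tMulRows F n k K + 600 * ((k + 1) * (K + 1)) + 40) + 6) (fun τ =>
      TableAt τ (4 * n) n (4 * n) (constraintTable n k T A ((n / K + 1) * K)) ∧
      Frame [14, 15, 16, 17] [7, 8, 9, 16, 17, 18, 19, 20, 21, 22, 23, 24, 30] σ τ) := by
  have hB' := hB
  obtain ⟨hL, h4, h15, hk1, hkn, hkK, hKn, hd⟩ := hB'
  have hW : 1 < W := fit_lin hL (by omega)
  have h := runs_forLoop (c := constraintStep c) (r := 17) (b := 18) (σ := σ) (W := W)
    (fun bl τ => TableAt τ (4 * n) n (4 * n) (constraintTable n k T A (bl * K)) ∧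
      Frame [14, 15, 16, 17] [7, 8, 9, 16, 17, 18, 19, 20, 21, 22, 23, 24, 30] σ τ)
    (fun _ => tMulRows F n k K + 600 * ((k + 1) * (K + 1)) + 20) hσ hW
    (fun bl τ v ⟨h1, h2⟩ => ⟨h1, (h2.trans (Frame.setReg τ 17 v)).mono (by decide) (by decide)⟩)
    ⟨by
      rw [zero_mul, show constraintTable n k T A 0 = T by
        funext i; rw [constraintTable]; split <;> rfl]
      exact hT, (Frame.refl σ).mono (by decide) (by decide)⟩
    (fun bl τ h => h.2.1 18 (by omega) (by decide))
    (by
      rintro bl τ hbl hτ h17 ⟨hT', F0⟩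
      rw [hC.r18] at hbl
      have hblK : bl * K ≤ n :=
        (Nat.mul_le_mul_right K (show bl ≤ n / K by omega)).trans (Nat.div_mul_le_self n K)
      have C0 := hC.frame F0 (by decide)
      have ev : ∀ {As : List ℕ} {υ : MachineState} {r x : ℕ}, Frame [] As τ υ → υ.IsWord W →
          υ.reg r = x → x < K →
          Ev W υ (.reg 17 * .reg 7 + .reg r) (bl * K + x) ∧
          Ev W υ (.lt (.reg 17 * .reg 7 + .reg r) (.reg 0)) (if bl * K + x < n then 1 else 0) := by
        intro As υ r x hF hυ hr hx
        have h1 : Ev W υ (.reg 17 * .reg 7 + .reg r) (bl * K + x) :=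
          Ev.add (Ev.mul (Ev.reg hυ ((hF.1 17 (by omega) (by simp)).trans h17))
            (Ev.reg hυ (C0.frame hF (by simp)).r7) (fit_lin hL (by omega))) (Ev.reg hυ hr)
            (fit_lin hL (by omega))
        exact ⟨h1, Ev.lt hW h1 (Ev.reg hυ (C0.frame hF (by simp)).r0)⟩
      apply Runs.pre
      · apply Runs.seq (runs_fillVector (A := 30) (rR := 7)
          (e := (.reg 17 * .reg 7 + .reg 40 + .const 1) *
            .lt (.reg 17 * .reg 7 + .reg 40) (.reg 0)) hτ hW (by omega) C0.r19 (by simp)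
          (fun c => if bl * K + c < n then bl * K + c + 1 else 0) C0.r7 (by
          intro i υ hi hυ hF h40 _ _
          obtain ⟨e1, e2⟩ := ev hF hυ h40 hi
          refine (Ev.mask (Ev.add e1 (Ev.const hW) (fit_lin hL (by omega))) e2
            (indicator_le_one _)).congr ?_
          split <;> simp))
        rintro τ₁ hτ₁ ⟨q1, F1⟩
        have C1 := C0.frame F1 (by decide)
        apply Runs.seq (runs_fillMatrix (A := 16) (rR := 1) (rC := 7)
          (e := .get 27 ((.reg 17 * .reg 7 + .reg 41) * .reg 4 + .reg 40) *
            .lt (.reg 17 * .reg 7 + .reg 41) (.reg 0)) hτ₁ hL (by omega) (by omega) (by omega)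
          (by simp) (fun c' c => (if bl * K + c < n then A (bl * K + c) c' else 0 : ZMod 2).val)
          C1.r4 C1.r1 C1.r7 (by omega) h4 (by omega) (by
          intro i j υ hi hj hυ hF' h40 h41 _ _
          have hF := F1.trans hF'
          obtain ⟨e1, e2⟩ := ev hF hυ h41 hj
          refine (Ev.mask (Ev.get hυ (A := 27) (Ev.idx hL hυ (C0.frame hF (by decide)).r4 e1
            (Ev.reg hυ h40) (by omega) h4 (by omega)) rfl) e2 (indicator_le_one _)).congr ?_
          rw [hF.2 27 (by omega) (by decide), F0.2 27 (by omega) (by decide)]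
          by_cases h : bl * K + j < n
          · rw [if_pos h, if_pos h, mul_one, hA _ _ h (by omega)]
          · rw [if_neg h, if_neg h, mul_zero, ZMod.val_zero]))
        rintro τ₂ hτ₂ ⟨q2, F2'⟩
        have F2 := F1.trans F2'
        have C2 := C0.frame F2 (by decide)
        refine (runs_mulRowsAt hc hB hτ₂ C2 (eb := .reg 20) (eR := .reg 1) (es := .reg 0)
          (base := 3 * n) (R := k) (src := n) (by simp)
          (fun τ hτ hF => Ev.reg hτ (C2.frame hF (by decide)).r20)
          (fun τ hτ hF => Ev.reg hτ (C2.frame hF (by decide)).r1)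
          (fun τ hτ hF => Ev.reg hτ (C2.frame hF (by decide)).r0) hkn (by omega) (by omega)
          (pv := fun c => if bl * K + c < n then bl * K + c + 1 else 0)
          (by rw [F2'.2 30 (by omega) (by decide)]; exact q1)
          (fun c _ => by beta_reduce; split <;> omega)
          (hT'.frame F2 (by decide) (by decide) (by decide))
          (U := fun c' c => if bl * K + c < n then A (bl * K + c) c' else 0) q2).mono le_rfl
          fun τ₆ _ ⟨q6, F6⟩ => ?_
        refine ⟨((F2.trans F6).1 17 (by omega) (by decide)).trans h17, ?_,
          ((F0.trans F2).trans F6).mono (by decide) (by decide)⟩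
        rw [constraintTable_block] at q6
        exact q6
      · have h2 : K + 1 ≤ (k + 1) * (K + 1) := Nat.le_mul_of_pos_left _ (by omega)
        omega)
  rw [hC.r18] at h
  refine h.mono ?_ fun τ _ h => ⟨h.1, h.2⟩
  rw [Finset.sum_const, Finset.card_range, smul_eq_mul]
  have key : ∀ N t : ℕ, N * (t + 20 + 8) + 6 ≤ N * (t + 40) + 6 := fun N t =>
    Nat.add_le_add_right (Nat.mul_le_mul_left _ (by omega)) _
  exact key _ _

end

/-! ### The outcome -/

/-- The outcome for the random bits `b`. -/
def outcomeBit (n k : ℕ) (T : ℕ → PRow) (pv sl : ℕ → ℕ) (b : ℕ → ZMod 2) (c : ℕ) : ZMod 2 :=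
  if pv c = 0 then (((T (3 * n + c)).ph.val / 2 : ℕ) : ZMod 2) +
    ∑ c' ∈ Finset.range k, (if pv c' = 0 then 0 else (T (3 * n + c)).z (sl c') * b c')
  else b c

def outcomes : Prog :=
  .seq (map2 28 1 19 (.reg 40) (.get 9 (.reg 20 + .reg 40) / .const 2 *
      .eqv (.get 25 (.reg 40)) (.const 0) +
    .get 4 (.reg 40) * .lt (.const 0) (.get 25 (.reg 40))))
  (acc2 28 1 1 2 (.reg 40) (.get 8 ((.reg 20 + .reg 40) * .reg 4 + .get 5 (.reg 41)) *
    .get 4 (.reg 41) * (.eqv (.get 25 (.reg 40)) (.const 0) * .lt (.const 0) (.get 25 (.reg 41)))))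

/-- Register `3` tells whether the outcome is the string of input bits. -/
def compareOutcome : Prog :=
  .seq (.assign 3 (.const 1))
    (forLoop 22 1 (.assign 3 (.reg 3 * .eqv (.get 28 (.reg 22)) (.get 4 (.reg 22)))))

section

variable {c : Prog} {F : ℕ → ℕ} {d W L : ℕ} {σ : MachineState} {n k K : ℕ} {T : ℕ → PRow}
  {sl pv : ℕ → ℕ} {b z : ℕ → ZMod 2}

/-- Pivot columns copy the input bits. In the other columns the initial value is the sign `ph / 2`
of the constraint, to which the pivot bits in its `Z` part are added modulo `2`. -/
theorem runs_outcomes (hB : Bounds W L n k K d) (hσ : σ.IsWord W) (hC : Consts σ n k K)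
    (hT : TableAt σ (4 * n) n (4 * n) T) (hsl : ∀ c < k, σ.arr 5 c = sl c)
    (hsln : ∀ c < k, sl c < n) (hp : ∀ l < k, σ.arr 25 l = pv l)
    (hb : ∀ c < k, σ.arr 4 c = (b c).val) :
    Runs W outcomes σ (600 * ((k + 1) * (k + 1))) (fun τ =>
      (∀ c < k, τ.arr 28 c = (outcomeBit n k T pv sl b c).val) ∧ Frame [] [28] σ τ) := by
  obtain ⟨hL, h4, h15, hk1, hkn, hkK, hKn, hd⟩ := hB
  have hW' : 200 < W := by nlinarith
  have hW : 1 < W := by omega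
  apply Runs.pre
  · have ev : ∀ {υ : MachineState} {r x : ℕ}, Frame [] [28] σ υ → υ.IsWord W → υ.reg r = x → x < k →
        Ev W υ (.eqv (.get 25 (.reg r)) (.const 0)) (if pv x = 0 then 1 else 0) ∧
        Ev W υ (.lt (.const 0) (.get 25 (.reg r))) (if 0 < pv x then 1 else 0) ∧
        Ev W υ (.get 4 (.reg r)) (b x).val := by
      intro υ r x hF hυ hr hx
      have e : Ev W υ (.get 25 (.reg r)) (pv x) :=
        Ev.get hυ (Ev.reg hυ hr) (by rw [hF.2 25 (by omega) (by decide), hp x hx])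
      exact ⟨Ev.eqv hW e (Ev.const (by omega)), Ev.lt hW (Ev.const (by omega)) e,
        Ev.get hυ (Ev.reg hυ hr) (by rw [hF.2 4 (by omega) (by decide), hb x hx])⟩
    apply Runs.seq (runs_fillVector (A := 28) (rR := 1) (e := .get 9 (.reg 20 + .reg 40) / .const 2 *
      .eqv (.get 25 (.reg 40)) (.const 0) +
      .get 4 (.reg 40) * .lt (.const 0) (.get 25 (.reg 40))) hσ hW (by omega) hC.r19 (by simp)
      (fun c => if pv c = 0 then (T (3 * n + c)).ph.val / 2 else (b c).val) hC.r1 (by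
      intro i τ hi hτ hF h40 h40' _
      obtain ⟨e1, e2, e3⟩ := ev hF hτ h40 hi
      have e4 : Ev W τ (.get 9 (.reg 20 + .reg 40)) (T (3 * n + i)).ph.val :=
        Ev.get hτ (Ev.add (Ev.reg hτ ((hF.1 20 (by omega) (by decide)).trans hC.r20)) h40'
          (fit_lin hL (by omega))) (by rw [hF.2 9 (by omega) (by decide), hT.2.2 _ (by omega)])
      have b1 := ZMod.val_lt (T (3 * n + i)).ph
      have b2 := ZMod.val_lt (b i)
      refine (Ev.add (Ev.mask (Ev.div e4 (Ev.const (by omega))) e1 (indicator_le_one _))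
        (Ev.mask e3 e2 (indicator_le_one _)) ?_).congr ?_
      · split <;> split <;> omega
      · by_cases h : pv i = 0 <;> simp [h, Nat.pos_iff_ne_zero]))
    rintro τ₁ hτ₁ ⟨q1, F1⟩
    have C1 := hC.frame F1 (by decide)
    refine (runs_accumulate (A := 28) (rR := 1) (rC := 1) (μ := 2) (addr := .reg 40)
      (e := .get 8 ((.reg 20 + .reg 40) * .reg 4 + .get 5 (.reg 41)) *
        .get 4 (.reg 41) * (.eqv (.get 25 (.reg 40)) (.const 0) *
          .lt (.const 0) (.get 25 (.reg 41)))) hτ₁ hW' (by omega) (by omega) (by simp) (by omega)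
      (by omega) (fun i => i) (fun c c' => (if pv c = 0 then (if pv c' = 0 then 0 else
        (T (3 * n + c)).z (sl c') * b c') else 0 : ZMod 2).val) C1.r1 C1.r1 (fun _ _ _ _ h => h)
      (fun i hi => by
        rw [q1 i hi]
        have b1 := ZMod.val_lt (T (3 * n + i)).ph
        have b2 := ZMod.val_lt (b i)
        split <;> omega)
      (fun i j hi hj => (ZMod.val_lt _).le.trans (by omega))
      (by
        intro i j τ hi hj hτ hF' h40 h41
        have hF := (F1.trans hF').mono (Rs' := []) (As' := [28]) (by decide) (by decide)
        obtain ⟨e1, _, _⟩ := ev hF hτ h40 hi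
        obtain ⟨_, e2, e3⟩ := ev hF hτ h41 hj
        have hs := hsln j hj
        have C := hC.frame hF (by decide)
        have e4 : Ev W τ (.get 8 ((.reg 20 + .reg 40) * .reg 4 + .get 5 (.reg 41)))
            ((T (3 * n + i)).z (sl j)).val :=
          Ev.get hτ (Ev.idx hL hτ C.r4 (Ev.add (Ev.reg hτ C.r20) (Ev.reg hτ h40)
            (fit_lin hL (by omega))) (Ev.get hτ (Ev.reg hτ h41)
              (by rw [hF.2 5 (by omega) (by decide), hsl j hj])) (by omega) h4 (by omega))
            (by rw [hF.2 8 (by omega) (by decide), hT.2.1 _ _ (by omega) hs])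
        have hb2 := ZMod.val_lt (b j)
        refine ⟨Ev.reg hτ h40, (Ev.mask (Ev.mask e4 e3 (by omega)) (Ev.mask e1 e2
          (indicator_le_one _)) (Nat.mul_le_mul (indicator_le_one _) (indicator_le_one _))).congr ?_⟩
        by_cases h : pv i = 0
        · by_cases h' : pv j = 0
          · simp [h, h']
          · rw [if_pos h, if_pos h, if_neg h', if_pos (by omega), one_mul, mul_one]
            generalize (T (3 * n + i)).z (sl j) = x
            generalize b j = y
            revert x y; decide
        · simp [h])).mono le_rfl fun τ₂ _ ⟨q2, _, F2⟩ => ?_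
    refine ⟨fun c hc => ?_, (F1.trans F2).mono (by decide) (by decide)⟩
    rw [q2 c hc, q1 c hc, outcomeBit, ← ZMod.val_natCast]
    congr 1
    rw [Nat.cast_add, Nat.cast_sum]
    simp only [ZMod.natCast_zmod_val]
    by_cases h : pv c = 0
    · simp only [if_pos h]
    · simp only [if_neg h, Finset.sum_const_zero, add_zero, ZMod.natCast_zmod_val]
  · have h2 : k + 1 ≤ (k + 1) * (k + 1) := Nat.le_mul_of_pos_left _ (by omega)
    omega

theorem runs_compareOutcome (hσ : σ.IsWord W) (hW : 1 < W) (hk : σ.reg 1 = k)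
    (hz : ∀ c < k, σ.arr 28 c = (z c).val) (hb : ∀ c < k, σ.arr 4 c = (b c).val) :
    Runs W compareOutcome σ (20 * (k + 1)) (fun τ =>
      τ.reg 3 = (if ∀ c < k, z c = b c then 1 else 0) ∧ Frame [3, 22] [] σ τ) := by
  apply Runs.pre
  · apply Runs.seq (Runs.assignEv hσ 3 (Ev.const hW))
    rintro τ₁ hτ₁ ⟨v1, F1⟩
    have k1 := (F1.1 1 (by omega) (by decide)).trans hk
    have h := runs_forLoop
      (c := .assign 3 (.reg 3 * .eqv (.get 28 (.reg 22)) (.get 4 (.reg 22)))) (r := 22) (b := 1)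
      (σ := τ₁) (W := W) (fun i τ => τ.reg 3 = (if ∀ c < i, z c = b c then 1 else 0) ∧
        Frame [3, 22] [] σ τ) (fun _ => 8) hτ₁ hW
      (fun i τ v ⟨h1, h2⟩ => ⟨by rw [MachineState.setReg_reg, if_neg (by omega), h1],
        (h2.trans (Frame.setReg τ 22 v)).mono (by decide) (by decide)⟩)
      ⟨by simp [v1], F1.mono (by decide) (by decide)⟩
      (fun i τ h => by rw [h.2.1 1 (by omega) (by decide), hk, k1])
      (by
        rintro i τ hi hτ h22 ⟨h3, hF⟩
        rw [k1] at hi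
        have e1 : Ev W τ (.get 28 (.reg 22)) (z i).val :=
          Ev.get hτ (Ev.reg hτ h22) (by rw [hF.2 28 (by omega) (by decide), hz i hi])
        have e2 : Ev W τ (.get 4 (.reg 22)) (b i).val :=
          Ev.get hτ (Ev.reg hτ h22) (by rw [hF.2 4 (by omega) (by decide), hb i hi])
        refine (Runs.assignEv hτ 3 (Ev.mask (Ev.reg hτ h3) (Ev.eqv hW e1 e2)
          (indicator_le_one _))).mono (by simp) fun υ _ ⟨v, hF'⟩ => ?_
        refine ⟨(hF'.1 22 (by omega) (by decide)).trans h22, ?_,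
          (hF.trans hF').mono (by decide) (by decide)⟩
        rw [v]
        have hv : (z i).val = (b i).val ↔ z i = b i := (ZMod.val_injective 2).eq_iff
        simp only [hv, Nat.forall_lt_succ_right]
        split_ifs <;> simp_all)
    rw [k1] at h
    exact h
  · simp only [RExpr.cost_const, Finset.sum_const, Finset.card_range, smul_eq_mul]
    omega

end

/-! ### Lists of labels -/

/-- Lists the `i < n` with `e ≠ 0` in the array `A`; `i` is in register `22`. -/
def listProg (A : ℕ) (e : RExpr) : Prog :=
  .seq (.assign 21 (.const 0))
    (forLoop 22 0 (.seq (.store A (.reg 21) (.reg 22)) (.assign 21 (.reg 21 + e))))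

/-- Every `i` is written at the current end of the list, but the end advances only if `P i` holds,
so wrong entries are overwritten and accepted ones lie strictly before the end. -/
theorem runs_listProg {W L n A : ℕ} {σ : MachineState} {e : RExpr} (hσ : σ.IsWord W)
    (hL : L * L + L < W) (hnL : n + 1 ≤ L) (h0 : σ.reg 0 = n) (hA : A < 50) (hcost : e.cost ≤ 20)
    (P : ℕ → Prop) [DecidablePred P]
    (H : ∀ i τ, i < n → τ.IsWord W → Frame [21, 22] [A] σ τ → τ.reg 22 = i →
      Ev W τ e (if P i then 1 else 0)) :
    Runs W (listProg A e) σ (60 * (n + 1)) (fun τ =>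
      (∀ i < n, P i → τ.arr A (Nat.count P i) = i) ∧ Frame [21, 22] [A] σ τ) := by
  have hW : 1 < W := fit_lin hL (by omega)
  apply Runs.pre
  · apply Runs.seq (Runs.assignEv hσ 21 (Ev.const (by omega : 0 < W)))
    rintro τ₁ hτ₁ ⟨v1, F1⟩
    have k1 := (F1.1 0 (by omega) (by decide)).trans h0
    have h := runs_forLoop (c := .seq (.store A (.reg 21) (.reg 22)) (.assign 21 (.reg 21 + e)))
      (r := 22) (b := 0) (σ := τ₁) (W := W)
      (fun i τ => τ.reg 21 = Nat.count P i ∧ (∀ j < i, P j → τ.arr A (Nat.count P j) = j) ∧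
        Frame [21, 22] [A] σ τ) (fun _ => 26) hτ₁ hW
      (fun i τ v ⟨h1, h2, h3⟩ => ⟨by rw [MachineState.setReg_reg, if_neg (by omega), h1], h2,
        (h3.trans (Frame.setReg τ 22 v)).mono (by simp) (by simp)⟩)
      ⟨by simp [v1], fun j hj => by omega, F1.mono (by decide) (by simp)⟩
      (fun i τ h => by rw [h.2.2.1 0 (by omega) (by decide), h0, k1])
      (by
        rintro i τ hi hτ h22 ⟨h21, hl, hF⟩
        rw [k1] at hi
        apply Runs.pre
        · apply Runs.seq (Runs.store hτ A (i := .reg 21) (e := .reg 22) (Ev.reg hτ h21).1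
            (Ev.reg hτ h22).1 h21 h22)
          rintro υ hυ he
          have hF' : Frame [] [A] τ υ := he ▸ Frame.setArr τ A _ _
          have hυ22 : υ.reg 22 = i := (hF'.1 22 (by omega) (by simp)).trans h22
          have hcnt : Nat.count P i ≤ i := Nat.count_le P
          have hFυ := (hF.trans hF').mono (Rs' := [21, 22]) (As' := [A]) (by simp) (by simp)
          refine (Runs.assignEv hυ 21 (Ev.add
            (Ev.reg hυ ((hF'.1 21 (by omega) (by simp)).trans h21)) (H i υ hi hυ hFυ hυ22)
            (fit_lin hL (by split <;> omega)))).mono le_rfl fun ρ _ ⟨v, hF''⟩ => ?_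
          refine ⟨(hF''.1 22 (by omega) (by simp)).trans hυ22, ?_, fun j hj hPj => ?_,
            (hFυ.trans hF'').mono (by simp) (by simp)⟩
          · rw [v, Nat.count_succ]
          · rw [hF''.2 A hA (by simp), he, MachineState.setArr_arr]
            rcases Nat.lt_succ_iff_lt_or_eq.1 hj with hj | rfl
            · rw [if_neg, hl j hj hPj]
              have := Nat.count_strict_mono hPj hj
              omega
            · rw [if_pos rfl]
        · simp; omega)
    rw [k1] at h
    exact h.mono le_rfl fun τ _ h => ⟨h.2.1, h.2.2⟩
  · simp only [RExpr.cost_const, Finset.sum_const, Finset.card_range, smul_eq_mul]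
    omega

/-! ### Setup -/

def setConstants : Prog :=
  .seq (.assign 19 (.const 1))
  (.seq (.assign 4 (.const 4 * .reg 0))
  (.seq (.assign 5 (.const 2 * .reg 0))
  (.seq (.assign 20 (.const 3 * .reg 0))
  (.seq (.assign 6 (.reg 0 - .reg 1))
  (.seq (.assign 24 (.const 2 * .reg 6))
  (.seq (.assign 7 (.const 1))
  (.seq (.loop (.lt (.reg 7) (.reg 1)) (.assign 7 (.reg 7 + .reg 7)))
  (.seq (.assign 23 (.const 2 * .reg 7))
  (.assign 18 (.reg 0 / .reg 7 + .const 1))))))))))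

/-- Doubling from `1` until `k` is reached takes `Nat.clog 2 k` rounds, because `2^i < k` holds
exactly for the smaller exponents. -/
theorem runs_setConstants {W L n k : ℕ} {σ : MachineState} (hσ : σ.IsWord W)
    (hL : L * L + L < W) (h4L : 4 * n ≤ L) (h15 : 15 ≤ L) (h0 : σ.reg 0 = n) (h1 : σ.reg 1 = k)
    (hk1 : 1 ≤ k) (hkn : k ≤ n) :
    Runs W setConstants σ (100 * (k + 1)) (fun τ => Consts τ n k (2 ^ Nat.clog 2 k) ∧
      Frame [4, 5, 6, 7, 18, 19, 20, 23, 24] [] σ τ) := by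
  have hW : 1 < W := fit_lin hL (by omega)
  have hpow : ∀ i, i < Nat.clog 2 k → 2 ^ i < k := fun i hi => (Nat.lt_clog_iff_pow_lt (by omega)).1 hi
  have hclog : Nat.clog 2 k ≤ k := by
    by_contra h
    have := hpow k (by omega)
    have := Nat.lt_two_pow_self (n := k)
    omega
  have hK : k ≤ 2 ^ Nat.clog 2 k := Nat.le_pow_clog (by omega) k
  have hKn : 2 ^ Nat.clog 2 k ≤ 2 * n := by
    rcases Nat.eq_zero_or_pos (Nat.clog 2 k) with h | h
    · rw [h]; omega
    · have := hpow (Nat.clog 2 k - 1) (by omega)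
      rw [show Nat.clog 2 k = Nat.clog 2 k - 1 + 1 by omega, pow_succ]
      omega
  have small : ∀ x, x ≤ 15 → x < W := fun x hx => fit_lin hL (by omega)
  apply Runs.pre
  · apply Runs.seq (Runs.assignEv hσ 19 (Ev.const hW))
    rintro τ₁ hτ₁ ⟨v1, F1⟩
    have e0 : ∀ {Rs : List ℕ} {τ : MachineState}, Frame Rs [] σ τ → 0 ∉ Rs → τ.IsWord W →
        Ev W τ (.reg 0) n := fun hF hr hτ => Ev.reg hτ ((hF.1 0 (by omega) hr).trans h0)
    have e1 : ∀ {Rs : List ℕ} {τ : MachineState}, Frame Rs [] σ τ → 1 ∉ Rs → τ.IsWord W →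
        Ev W τ (.reg 1) k := fun hF hr hτ => Ev.reg hτ ((hF.1 1 (by omega) hr).trans h1)
    apply Runs.seq (Runs.assignEv hτ₁ 4 (Ev.mul (Ev.const (small 4 (by omega)))
      (e0 F1 (by decide) hτ₁) (fit_lin hL (by omega))))
    rintro τ₂ hτ₂ ⟨v2, F2⟩
    have G2 := F1.trans F2
    apply Runs.seq (Runs.assignEv hτ₂ 5 (Ev.mul (Ev.const (small 2 (by omega)))
      (e0 G2 (by decide) hτ₂) (fit_lin hL (by omega))))
    rintro τ₃ hτ₃ ⟨v3, F3⟩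
    have G3 := G2.trans F3
    apply Runs.seq (Runs.assignEv hτ₃ 20 (Ev.mul (Ev.const (small 3 (by omega)))
      (e0 G3 (by decide) hτ₃) (fit_lin hL (by omega))))
    rintro τ₄ hτ₄ ⟨v4, F4⟩
    have G4 := G3.trans F4
    apply Runs.seq (Runs.assignEv hτ₄ 6 (Ev.sub (e0 G4 (by decide) hτ₄) (e1 G4 (by decide) hτ₄)))
    rintro τ₅ hτ₅ ⟨v5, F5⟩
    have G5 := G4.trans F5
    apply Runs.seq (Runs.assignEv hτ₅ 24 (Ev.mul (Ev.const (small 2 (by omega)))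
      (Ev.reg hτ₅ v5) (fit_lin hL (by omega))))
    rintro τ₆ hτ₆ ⟨v6, F6⟩
    have G6 := G5.trans F6
    apply Runs.seq (Runs.assignEv hτ₆ 7 (Ev.const hW))
    rintro τ₇ hτ₇ ⟨v7, F7⟩
    have G7 := G6.trans F7
    apply Runs.seq (Runs.loop (W := W) (σ := τ₇) (e := .lt (.reg 7) (.reg 1))
      (c := .assign 7 (.reg 7 + .reg 7)) (Nat.clog 2 k)
      (fun i τ => τ.reg 7 = 2 ^ i ∧ Frame [7] [] τ₇ τ) (fun _ => 4) hτ₇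
      ⟨by rw [v7, pow_zero], (Frame.refl _).mono (by decide) (by decide)⟩
      (by
        rintro i τ hi hτ ⟨h7, hF⟩
        have := hpow i hi
        have e := Ev.lt hW (Ev.reg hτ h7) (e1 (G7.trans hF) (by decide) hτ)
        refine ⟨e.1, by rw [e.2, if_pos this]; omega, ?_⟩
        refine (Runs.assignEv hτ 7 (Ev.add (Ev.reg hτ h7) (Ev.reg hτ h7)
          (fit_lin hL (by omega)))).mono le_rfl fun υ _ ⟨v, hF'⟩ => ?_
        exact ⟨by rw [v, pow_succ, mul_two], (hF.trans hF').mono (by decide) (by decide)⟩)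
      (by
        rintro τ hτ ⟨h7, hF⟩
        have e := Ev.lt hW (Ev.reg hτ h7) (e1 (G7.trans hF) (by decide) hτ)
        exact ⟨e.1, by rw [e.2, if_neg (by omega)]⟩))
    rintro τ₈ hτ₈ ⟨v8, F8⟩
    have G8 := G7.trans F8
    apply Runs.seq (Runs.assignEv hτ₈ 23 (Ev.mul (Ev.const (small 2 (by omega)))
      (Ev.reg hτ₈ v8) (fit_lin hL (by omega))))
    rintro τ₉ hτ₉ ⟨v9, F9⟩
    have G9 := G8.trans F9
    have v8' : τ₉.reg 7 = 2 ^ Nat.clog 2 k := (F9.1 7 (by omega) (by decide)).trans v8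
    refine (Runs.assignEv hτ₉ 18 (Ev.add (Ev.div (e0 G9 (by decide) hτ₉) (Ev.reg hτ₉ v8'))
      (Ev.const hW) (fit_lin hL (by have := Nat.div_le_self n (2 ^ Nat.clog 2 k); omega)))).mono le_rfl
      fun τ hτ ⟨v, F⟩ => ?_
    have G := G9.trans F
    refine ⟨?_, G.mono (by decide) (by decide)⟩
    have K9 := F9.trans F
    have K8 := F8.trans K9
    have K7 := F7.trans K8
    have K6 := F6.trans K7
    have K5 := F5.trans K6
    have K4 := F4.trans K5
    have K3 := F3.trans K4
    have K2 := F2.trans K3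
    exact ⟨(G.1 0 (by omega) (by decide)).trans h0, (G.1 1 (by omega) (by decide)).trans h1,
      (K3.1 4 (by omega) (by decide)).trans v2, (K4.1 5 (by omega) (by decide)).trans v3,
      (K6.1 6 (by omega) (by decide)).trans v5, (F.1 7 (by omega) (by decide)).trans v8', v,
      (K2.1 19 (by omega) (by decide)).trans v1, (K5.1 20 (by omega) (by decide)).trans v4,
      (F.1 23 (by omega) (by decide)).trans v9, (K7.1 24 (by omega) (by decide)).trans v6⟩
  · simp
    omega

/-- Three copies of the rows of the input: destabilizers, stabilizers and again stabilizers. -/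
def initialTable (n : ℕ) (M : ℕ → ℕ → ZMod 2) (p s : ℕ → ZMod 2) (i : ℕ) : PRow :=
  if i < 3 * n then
    let r := if i < 2 * n then i else i - n
    ⟨((p r).val : ZMod 4) + twice (s r), M r, fun j => M r (n + j)⟩
  else PRow.one

/-- The row of the input in the row `40` of the table. -/
def inputRow : RExpr := .reg 40 - .reg 0 * (.const 1 - .lt (.reg 40) (.reg 5))

def loadTable : Prog :=
  .seq (map2 7 4 0 (.reg 40 * .reg 4 + .reg 41)
    (.get 0 (inputRow * .reg 5 + .reg 41) * .lt (.reg 40) (.reg 20)))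
  (.seq (map2 8 4 0 (.reg 40 * .reg 4 + .reg 41)
    (.get 0 (inputRow * .reg 5 + (.reg 0 + .reg 41)) * .lt (.reg 40) (.reg 20)))
  (map2 9 4 19 (.reg 40) (.get 1 inputRow * .lt (.reg 40) (.reg 20) +
    .const 2 * (.get 2 inputRow * .lt (.reg 40) (.reg 20)))))

theorem runs_loadTable {W L n k K d : ℕ} {σ : MachineState} (hB : Bounds W L n k K d)
    (hσ : σ.IsWord W) (hC : Consts σ n k K) {M : ℕ → ℕ → ZMod 2} {p s : ℕ → ZMod 2}
    (hM : Stored (σ.arr 0) (2 * n) (2 * n) (2 * n) M) (hp : ∀ i < 2 * n, σ.arr 1 i = (p i).val)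
    (hs : ∀ i < 2 * n, σ.arr 2 i = (s i).val) :
    Runs W loadTable σ (4000 * ((n + 1) * (n + 1))) (fun τ =>
      TableAt τ (4 * n) n (4 * n) (initialTable n M p s) ∧ Frame [] [7, 8, 9] σ τ) := by
  obtain ⟨hL, h4, h15, hk1, hkn, hkK, hKn, hd⟩ := hB
  have hW : 1 < W := fit_lin hL (by omega)
  have h2W : 2 < W := fit_lin hL (by omega)
  have h5W : 5 < W := fit_lin hL (by omega)
  have ev : ∀ {As : List ℕ} {τ : MachineState} {i : ℕ}, Frame [] As σ τ → τ.IsWord W → τ.reg 40 = i →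
      Ev W τ inputRow (if i < 2 * n then i else i - n) ∧
      Ev W τ (.lt (.reg 40) (.reg 20)) (if i < 3 * n then 1 else 0) := by
    intro As τ i hF hτ h40
    have C := hC.frame hF (by simp)
    refine ⟨(Ev.sub (Ev.reg hτ h40) (Ev.mask (Ev.reg hτ C.r0) (Ev.sub (Ev.const hW)
      (Ev.lt hW (Ev.reg hτ h40) (Ev.reg hτ C.r5))) (by omega))).congr ?_,
      Ev.lt hW (Ev.reg hτ h40) (Ev.reg hτ C.r20)⟩
    split <;> simp
  apply Runs.pre
  · apply Runs.seq (runs_fillMatrix (A := 7) (rR := 4) (rC := 0)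
      (e := .get 0 (inputRow * .reg 5 + .reg 41) * .lt (.reg 40) (.reg 20)) hσ hL (by omega)
      (by omega) (by omega) (by simp [inputRow])
      (fun i j => ((initialTable n M p s i).x j).val) hC.r4 hC.r4 hC.r0 h4 h4 (by omega) (by
      intro i j τ hi hj hτ hF h40 h41 _ _
      obtain ⟨e1, e2⟩ := ev hF hτ h40
      refine (Ev.mask (Ev.get hτ (A := 0) (Ev.idx hL hτ (hC.frame hF (by decide)).r5 e1
        (Ev.reg hτ h41) (by split <;> omega) (by omega) (by omega)) rfl) e2
        (indicator_le_one _)).congr ?_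
      rw [hF.2 0 (by omega) (by decide), initialTable]
      by_cases h : i < 3 * n
      · rw [if_pos h, if_pos h, mul_one, hM _ _ (by split <;> omega) (by omega)]
      · rw [if_neg h, if_neg h, mul_zero]; rfl))
    rintro τ₁ hτ₁ ⟨q1, F1⟩
    have C1 := hC.frame F1 (by decide)
    apply Runs.seq (runs_fillMatrix (A := 8) (rR := 4) (rC := 0)
      (e := .get 0 (inputRow * .reg 5 + (.reg 0 + .reg 41)) * .lt (.reg 40) (.reg 20)) hτ₁ hL
      (by omega) (by omega) (by omega) (by simp [inputRow])
      (fun i j => ((initialTable n M p s i).z j).val) C1.r4 C1.r4 C1.r0 h4 h4 (by omega) (by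
      intro i j τ hi hj hτ hF' h40 h41 _ _
      have hF := F1.trans hF'
      obtain ⟨e1, e2⟩ := ev hF hτ h40
      have C := hC.frame hF (by decide)
      refine (Ev.mask (Ev.get hτ (A := 0) (Ev.idx hL hτ C.r5 e1
        (Ev.add (Ev.reg hτ C.r0) (Ev.reg hτ h41) (fit_lin hL (by omega))) (by split <;> omega)
        (by omega) (by omega)) rfl) e2 (indicator_le_one _)).congr ?_
      rw [hF.2 0 (by omega) (by decide), initialTable]
      by_cases h : i < 3 * n
      · rw [if_pos h, if_pos h, mul_one, hM _ _ (by split <;> omega) (by omega)]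
      · rw [if_neg h, if_neg h, mul_zero]; rfl))
    rintro τ₂ hτ₂ ⟨q2, F2'⟩
    have F2 := F1.trans F2'
    have C2 := hC.frame F2 (by decide)
    refine (runs_fillVector (A := 9) (rR := 4) (e := .get 1 inputRow * .lt (.reg 40) (.reg 20) +
      .const 2 * (.get 2 inputRow * .lt (.reg 40) (.reg 20))) hτ₂ hW (by omega) C2.r19
      (by simp [inputRow]) (fun i => (initialTable n M p s i).ph.val) C2.r4 (by
      intro i τ hi hτ hF' h40 _ _
      have hF := F2.trans hF'
      obtain ⟨e1, e2⟩ := ev hF hτ h40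
      have e3 := Ev.mask (Ev.get hτ (A := 1) e1 rfl) e2 (indicator_le_one _)
      have e4 := Ev.mask (Ev.get hτ (A := 2) e1 rfl) e2 (indicator_le_one _)
      rw [hF.2 1 (by omega) (by decide)] at e3
      rw [hF.2 2 (by omega) (by decide)] at e4
      rw [initialTable]
      by_cases h : i < 3 * n
      · rw [if_pos h, mul_one, hp _ (by split <;> omega)] at e3
        rw [if_pos h, mul_one, hs _ (by split <;> omega)] at e4
        rw [if_pos h]
        have b3 := ZMod.val_lt (p (if i < 2 * n then i else i - n))
        have b4 := ZMod.val_lt (s (if i < 2 * n then i else i - n))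
        refine (Ev.add e3 (Ev.mul (Ev.const h2W) e4 (by omega)) (by omega)).congr ?_
        show _ = ((((p _).val : ZMod 4) + twice (s _)).val)
        generalize p _ = x
        generalize s _ = y
        revert x y; decide
      · rw [if_neg h, mul_zero] at e3 e4
        rw [if_neg h]
        exact (Ev.add e3 (Ev.mul (Ev.const h2W) e4 (by omega)) (by omega)).congr rfl)).mono le_rfl
      fun τ₃ _ ⟨q3, F3⟩ => ?_
    refine ⟨⟨?_, ?_, q3⟩, (F2.trans F3).mono (by decide) (by decide)⟩
    · rw [(F2'.trans F3).2 7 (by omega) (by decide)]; exact q1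
    · rw [F3.2 8 (by omega) (by decide)]; exact q2
  · nlinarith

/-! ### The output -/

section

variable (n k m : ℕ) (T : ℕ → PRow) (sl cl kl : ℕ → ℕ) (zz : ℕ → ZMod 2)

/-- The phase of the row `r` after the measured qubits are set to `zz`. -/
def outPhase (r : ℕ) : ZMod 4 :=
  (T r).ph + twice (∑ c ∈ Finset.range k, zz c * (T r).z (sl c))

/-- The row of the table that the output row `i` is taken from. -/
def outIndex (i : ℕ) : ℕ := if i < m then kl i else 2 * n + kl (i - m)

def outEntry (i j : ℕ) : ZMod 2 :=
  if j < m then (T (outIndex n m kl i)).x (cl j) else (T (outIndex n m kl i)).z (cl (j - m))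

def outP (i : ℕ) : ZMod 2 :=
  if i < m then ∑ c ∈ Finset.range m, (T (kl i)).x (cl c) * (T (kl i)).z (cl c)
  else ((outPhase k T sl zz (2 * n + kl (i - m))).val : ZMod 2)

def outS (i : ℕ) : ZMod 2 :=
  if i < m then 0 else (((outPhase k T sl zz (2 * n + kl (i - m))).val / 2 : ℕ) : ZMod 2)

end

/-- The row of the table for the output row in register `40`. -/
def outputRow : RExpr :=
  .get 29 (.reg 40 - .reg 6 * (.const 1 - .lt (.reg 40) (.reg 6))) +
    .reg 5 * (.const 1 - .lt (.reg 40) (.reg 6))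

/-- The column of the table for the output column in register `41`. -/
def outputCol : RExpr := .get 6 (.reg 41 - .reg 6 * (.const 1 - .lt (.reg 41) (.reg 6)))

def outputPhases : Prog :=
  .seq (map2 32 6 19 (.reg 40) (.get 9 (.reg 5 + .get 29 (.reg 40))))
  (.seq (acc2 32 6 1 4 (.reg 40) (.const 2 * (.get 28 (.reg 41) *
    .get 8 ((.reg 5 + .get 29 (.reg 40)) * .reg 4 + .get 5 (.reg 41)))))
  (.seq (map2 1 24 19 (.reg 40) (.get 32 (.reg 40 - .reg 6) % .const 2 *
    (.const 1 - .lt (.reg 40) (.reg 6))))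
  (.seq (acc2 1 6 6 2 (.reg 40) (.get 7 (.get 29 (.reg 40) * .reg 4 + .get 6 (.reg 41)) *
    .get 8 (.get 29 (.reg 40) * .reg 4 + .get 6 (.reg 41))))
  (map2 2 24 19 (.reg 40) (.get 32 (.reg 40 - .reg 6) / .const 2 *
    (.const 1 - .lt (.reg 40) (.reg 6)))))))

def outputMatrix : Prog :=
  .seq (map2 0 24 24 (.reg 40 * .reg 24 + .reg 41)
    (.get 7 (outputRow * .reg 4 + outputCol) * .lt (.reg 41) (.reg 6) +
      .get 8 (outputRow * .reg 4 + outputCol) * (.const 1 - .lt (.reg 41) (.reg 6))))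
  (map2 4 1 19 (.reg 40) (.get 28 (.reg 40)))

section

variable {d W L : ℕ} {σ : MachineState} {n k K : ℕ} {T : ℕ → PRow} {sl cl kl : ℕ → ℕ}
  {zz : ℕ → ZMod 2}

/-- A stabilizer phase in `ℤ/4` is split into its parity and its half, which are the bits `p` and
`s`. For a destabilizer only the parity matters, which must make the operator Hermitian, and the
sign is set to zero. In the upper half the truncated index difference reads cell `0`, and the value
is masked. -/
theorem runs_outputPhases (hB : Bounds W L n k K d) (hσ : σ.IsWord W) (hC : Consts σ n k K)
    (hT : TableAt σ (4 * n) n (4 * n) T) (hsl : ∀ c < k, σ.arr 5 c = sl c)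
    (hsln : ∀ c < k, sl c < n) (hcl : ∀ c < n - k, σ.arr 6 c = cl c)
    (hcln : ∀ c < n - k, cl c < n) (hkl : ∀ c < n - k, σ.arr 29 c = kl c)
    (hkln : ∀ c < n - k, kl c < n) (hz : ∀ c < k, σ.arr 28 c = (zz c).val) :
    Runs W outputPhases σ (4000 * ((n + 1) * (n + 1))) (fun τ =>
      (∀ i < 2 * (n - k), τ.arr 1 i = (outP n k (n - k) T sl cl kl zz i).val) ∧
      (∀ i < 2 * (n - k), τ.arr 2 i = (outS n k (n - k) T sl kl zz i).val) ∧
      Frame [] [1, 2, 32] σ τ) := by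
  obtain ⟨hL, h4, h15, hk1, hkn, hkK, hKn, hd⟩ := hB
  have hW' : 200 < W := by nlinarith
  have hW : 1 < W := by omega
  have rows : ∀ {As : List ℕ} {τ : MachineState} {i : ℕ}, Frame [] As σ τ → 29 ∉ As → τ.IsWord W →
      τ.reg 40 = i → i < n - k → Ev W τ (.get 29 (.reg 40)) (kl i) ∧
      Ev W τ (.reg 5 + .get 29 (.reg 40)) (2 * n + kl i) := by
    intro As τ i hF h29 hτ h40 hi
    have e : Ev W τ (.get 29 (.reg 40)) (kl i) :=
      Ev.get hτ (Ev.reg hτ h40) (by rw [hF.2 29 (by omega) h29, hkl i hi])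
    have := hkln i hi
    exact ⟨e, Ev.add (Ev.reg hτ (hC.frame hF (by simp)).r5) e (fit_lin hL (by omega))⟩
  apply Runs.pre
  · apply Runs.seq (runs_fillVector (A := 32) (rR := 6) (e := .get 9 (.reg 5 + .get 29 (.reg 40)))
      hσ hW (by omega) hC.r19 (by simp) (fun j => (T (2 * n + kl j)).ph.val) hC.r6 (by
      intro i τ hi hτ hF h40 _ _
      have := hkln i hi
      exact Ev.get hτ (rows hF (by decide) hτ h40 hi).2
        (by rw [hF.2 9 (by omega) (by decide), hT.2.2 _ (by omega)])))
    rintro τ₁ hτ₁ ⟨q1, F1⟩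
    have C1 := hC.frame F1 (by decide)
    apply Runs.seq (runs_accumulate (A := 32) (rR := 6) (rC := 1) (μ := 4) (addr := .reg 40)
      (e := .const 2 * (.get 28 (.reg 41) *
        .get 8 ((.reg 5 + .get 29 (.reg 40)) * .reg 4 + .get 5 (.reg 41)))) hτ₁ hW' (by omega)
      (by omega) (by simp) (by omega) (by omega) (fun i => i)
      (fun i c => 2 * ((zz c).val * ((T (2 * n + kl i)).z (sl c)).val)) C1.r6 C1.r1
      (fun _ _ _ _ h => h) (fun i hi => by rw [q1 i hi]; exact ZMod.val_lt _)
      (fun i j _ _ => (two_mul_val_le _ _).trans (by omega)) (by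
        intro i j τ hi hj hτ hF' h40 h41
        have hF := F1.trans hF'
        have h1 := hkln i hi
        have h2 := hsln j hj
        have b := two_mul_val_le (zz j) ((T (2 * n + kl i)).z (sl j))
        exact ⟨Ev.reg hτ h40, Ev.mul (Ev.const (by omega)) (Ev.mul
          (Ev.get hτ (Ev.reg hτ h41) (by rw [hF.2 28 (by omega) (by decide), hz j hj]))
          (Ev.get hτ (Ev.idx hL hτ (hC.frame hF (by decide)).r4
            (rows hF (by decide) hτ h40 hi).2 (Ev.get hτ (Ev.reg hτ h41)
              (by rw [hF.2 5 (by omega) (by decide), hsl j hj])) (by omega) h4 (by omega))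
            (by rw [hF.2 8 (by omega) (by decide), hT.2.1 _ _ (by omega) h2]))
          (by omega)) (by omega)⟩))
    rintro τ₂ hτ₂ ⟨q2, _, F2'⟩
    have F2 := F1.trans F2'
    have C2 := hC.frame F2 (by decide)
    have ph : ∀ j < n - k, τ₂.arr 32 j = (outPhase k T sl zz (2 * n + kl j)).val := by
      intro j hj
      rw [q2 j hj, q1 j hj, outPhase, ← ZMod.val_natCast, Nat.cast_add, Nat.cast_sum,
        ZMod.natCast_zmod_val, twice_sum]
      simp only [twice_mul]
    have sign : ∀ {As : List ℕ} {τ : MachineState} {i : ℕ}, Frame [] As σ τ → τ.IsWord W →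
        τ.reg 40 = i → Ev W τ (.reg 40 - .reg 6) (i - (n - k)) ∧
        Ev W τ (.const 1 - .lt (.reg 40) (.reg 6)) (if i < n - k then 0 else 1) := by
      intro As τ i hF hτ h40
      have e := Ev.reg hτ (hC.frame hF (by simp)).r6
      refine ⟨Ev.sub (Ev.reg hτ h40) e,
        (Ev.sub (Ev.const hW) (Ev.lt hW (Ev.reg hτ h40) e)).congr ?_⟩
      split <;> rfl
    apply Runs.seq (runs_fillVector (A := 1) (rR := 24) (e := .get 32 (.reg 40 - .reg 6) % .const 2 *
      (.const 1 - .lt (.reg 40) (.reg 6))) hτ₂ hW (by omega) C2.r19 (by simp)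
      (fun i => if i < n - k then 0 else (outPhase k T sl zz (2 * n + kl (i - (n - k)))).val % 2)
      C2.r24 (by
      intro i τ hi hτ hF' h40 _ _
      have hF := F2.trans hF'
      obtain ⟨e1, e2⟩ := sign hF hτ h40
      refine (Ev.mask (Ev.mod (Ev.get hτ e1 rfl) (Ev.const (by omega))) e2
        (by split <;> omega)).congr ?_
      rw [hF'.2 32 (by omega) (by decide)]
      by_cases h : i < n - k
      · rw [if_pos h, if_pos h, mul_zero]
      · rw [if_neg h, if_neg h, mul_one, ph _ (by omega)]))
    rintro τ₃ hτ₃ ⟨q3, F3'⟩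
    have F3 := F2.trans F3'
    have C3 := hC.frame F3 (by decide)
    apply Runs.seq (runs_accumulate (A := 1) (rR := 6) (rC := 6) (μ := 2) (addr := .reg 40)
      (e := .get 7 (.get 29 (.reg 40) * .reg 4 + .get 6 (.reg 41)) *
        .get 8 (.get 29 (.reg 40) * .reg 4 + .get 6 (.reg 41))) hτ₃ hW' (by omega)
      (by omega) (by simp) (by omega) (by omega) (fun i => i)
      (fun i c => ((T (kl i)).x (cl c) * (T (kl i)).z (cl c)).val) C3.r6 C3.r6
      (fun _ _ _ _ h => h) (fun i hi => by rw [q3 i (by omega), if_pos hi]; omega)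
      (fun i j _ _ => (ZMod.val_lt _).le.trans (by omega)) (by
        intro i j τ hi hj hτ hF' h40 h41
        have hF := F3.trans hF'
        have h1 := hkln i hi
        have h2 := hcln j hj
        have e := Ev.idx hL hτ (hC.frame hF (by decide)).r4
            (rows hF (by decide) hτ h40 hi).1 (Ev.get hτ (Ev.reg hτ h41)
              (by rw [hF.2 6 (by omega) (by decide), hcl j hj])) (by omega) h4 (by omega)
        have b := ZMod.val_lt ((T (kl i)).z (cl j))
        refine ⟨Ev.reg hτ h40, (Ev.mask
          (Ev.get hτ e (by rw [hF.2 7 (by omega) (by decide), hT.1 _ _ (by omega) h2]))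
          (Ev.get hτ e (by rw [hF.2 8 (by omega) (by decide), hT.2.1 _ _ (by omega) h2]))
          (by beta_reduce; omega)).congr ?_⟩
        beta_reduce
        generalize (T (kl i)).x (cl j) = x
        generalize (T (kl i)).z (cl j) = y
        revert x y; decide))
    rintro τ₄ hτ₄ ⟨q4, q4', F4'⟩
    have F4 := F3.trans F4'
    have C4 := hC.frame F4 (by decide)
    refine (runs_fillVector (A := 2) (rR := 24) (e := .get 32 (.reg 40 - .reg 6) / .const 2 *
      (.const 1 - .lt (.reg 40) (.reg 6))) hτ₄ hW (by omega) C4.r19 (by simp)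
      (fun i => (outS n k (n - k) T sl kl zz i).val)
      C4.r24 (by
      intro i τ hi hτ hF' h40 _ _
      have hF := F4.trans hF'
      obtain ⟨e1, e2⟩ := sign hF hτ h40
      refine (Ev.mask (Ev.div (Ev.get hτ e1 rfl) (Ev.const (by omega))) e2
        (by split <;> omega)).congr ?_
      rw [((F3'.trans F4').trans hF').2 32 (by omega) (by decide), outS]
      by_cases h : i < n - k
      · rw [if_pos h, if_pos h, mul_zero, ZMod.val_zero]
      · rw [if_neg h, if_neg h, mul_one, ph _ (by omega), ZMod.val_natCast, Nat.mod_eq_of_lt]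
        have := ZMod.val_lt (outPhase k T sl zz (2 * n + kl (i - (n - k))))
        omega)).mono le_rfl fun τ₅ _ ⟨q5, F5⟩ => ?_
    refine ⟨fun i hi => ?_, q5, (F4.trans F5).mono (by decide) (by decide)⟩
    rw [F5.2 1 (by omega) (by decide), outP]
    by_cases h : i < n - k
    · rw [q4 i h, q3 i hi, if_pos h, if_pos h, zero_add, ← ZMod.val_natCast, Nat.cast_sum]
      simp only [ZMod.natCast_zmod_val]
    · rw [q4' i (fun j hj => by omega), q3 i hi, if_neg h, if_neg h, ZMod.val_natCast]
  · have h1 : n - k ≤ n := Nat.sub_le _ _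
    generalize n - k = m at h1
    nlinarith [Nat.mul_le_mul (Nat.succ_le_succ h1) (Nat.succ_le_succ hkn),
      Nat.mul_le_mul (Nat.succ_le_succ h1) (Nat.succ_le_succ h1)]

theorem runs_outputMatrix (hB : Bounds W L n k K d) (hσ : σ.IsWord W) (hC : Consts σ n k K)
    (hT : TableAt σ (4 * n) n (4 * n) T) (hcl : ∀ c < n - k, σ.arr 6 c = cl c)
    (hcln : ∀ c < n - k, cl c < n) (hkl : ∀ c < n - k, σ.arr 29 c = kl c)
    (hkln : ∀ c < n - k, kl c < n) (hz : ∀ c < k, σ.arr 28 c = (zz c).val) :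
    Runs W outputMatrix σ (2000 * ((n + 1) * (n + 1))) (fun τ =>
      Stored (τ.arr 0) (2 * (n - k)) (2 * (n - k)) (2 * (n - k)) (outEntry n (n - k) T cl kl) ∧
      (∀ c < k, τ.arr 4 c = (zz c).val) ∧ Frame [] [0, 4] σ τ) := by
  obtain ⟨hL, h4, h15, hk1, hkn, hkK, hKn, hd⟩ := hB
  have hW : 1 < W := fit_lin hL (by omega)
  apply Runs.pre
  · apply Runs.seq (runs_fill (A := 0) (rR := 24) (rC := 24) (addr := .reg 40 * .reg 24 + .reg 41)
      (e := .get 7 (outputRow * .reg 4 + outputCol) * .lt (.reg 41) (.reg 6) +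
      .get 8 (outputRow * .reg 4 + outputCol) * (.const 1 - .lt (.reg 41) (.reg 6))) hσ hW
      (by omega) (by omega) (by simp [outputRow, outputCol]) (fun i j => i * (2 * (n - k)) + j)
      (fun i j => (outEntry n (n - k) T cl kl i j).val) hC.r24 hC.r24
      (fun i j i' j' _ hj _ hj' h => mul_add_inj hj hj' h) (by
      intro i j τ hi hj hτ hF h40 h41 _
      have C := hC.frame hF (by decide)
      have l0 := Ev.lt hW (Ev.reg hτ h40) (Ev.reg hτ C.r6)
      have l1 := Ev.lt hW (Ev.reg hτ h41) (Ev.reg hτ C.r6)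
      have l0' := Ev.sub (Ev.const hW) l0
      have l1' := Ev.sub (Ev.const hW) l1
      have hi' : i - (n - k) < n - k := by omega
      have hj' : j - (n - k) < n - k := by omega
      have i1 : (if i < n - k then i else i - (n - k)) < n - k := by split <;> omega
      have j1 : (if j < n - k then j else j - (n - k)) < n - k := by split <;> omega
      have x1 := hkln _ i1
      have x2 := hcln _ j1
      have er : Ev W τ outputRow (outIndex n (n - k) kl i) := by
        refine (Ev.add (x := kl (if i < n - k then i else i - (n - k)))
          (y := 2 * n * (1 - if i < n - k then 1 else 0))
          (Ev.get hτ ((Ev.sub (Ev.reg hτ h40) (Ev.mask (Ev.reg hτ C.r6) l0' (by omega))).congr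
            (y := if i < n - k then i else i - (n - k)) (by split <;> simp))
            (by rw [hF.2 29 (by omega) (by decide), hkl _ i1]))
          (Ev.mask (Ev.reg hτ C.r5) l0' (by omega)) (fit_lin hL ?_)).congr ?_
        · have : 2 * n * (1 - if i < n - k then 1 else 0) ≤ 2 * n := by split <;> simp
          omega
        · rw [outIndex]
          split
          · simp
          · simp [add_comm]
      have ec : Ev W τ outputCol (cl (if j < n - k then j else j - (n - k))) :=
        Ev.get hτ ((Ev.sub (Ev.reg hτ h41) (Ev.mask (Ev.reg hτ C.r6) l1' (by omega))).congr
          (y := if j < n - k then j else j - (n - k)) (by split <;> simp))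
          (by rw [hF.2 6 (by omega) (by decide), hcl _ j1])
      have hidx : outIndex n (n - k) kl i < 3 * n := by
        rw [outIndex]
        split
        · have := hkln i (by assumption); omega
        · have := hkln _ hi'; omega
      have ea := Ev.idx hL hτ C.r4 er ec (by omega) h4 (by omega)
      refine ⟨Ev.idx hL hτ C.r24 (Ev.reg hτ h40) (Ev.reg hτ h41) (by omega) (by omega) (by omega),
        (Ev.add (Ev.mask (Ev.get hτ (A := 7) ea
            (by rw [hF.2 7 (by omega) (by decide), hT.1 _ _ (by omega) x2])) l1 (indicator_le_one _))
          (Ev.mask (Ev.get hτ (A := 8) ea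
            (by rw [hF.2 8 (by omega) (by decide), hT.2.1 _ _ (by omega) x2])) l1' (by omega))
          ?_).congr ?_⟩
      · beta_reduce
        have b1 := ZMod.val_lt ((T (outIndex n (n - k) kl i)).x
          (cl (if j < n - k then j else j - (n - k))))
        have b2 := ZMod.val_lt ((T (outIndex n (n - k) kl i)).z
          (cl (if j < n - k then j else j - (n - k))))
        generalize ((T (outIndex n (n - k) kl i)).x _).val = x at *
        generalize ((T (outIndex n (n - k) kl i)).z _).val = y at *
        split <;> omega
      · rw [outEntry]
        by_cases h : j < n - k <;> simp [h]))
    rintro τ₁ hτ₁ ⟨q1, _, F1⟩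
    have C1 := hC.frame F1 (by decide)
    refine (runs_fillVector (A := 4) (rR := 1) (e := .get 28 (.reg 40)) hτ₁ hW (by omega) C1.r19
      (by simp) (fun c => (zz c).val) C1.r1 (by
      intro i τ hi hτ hF h40 ha _
      exact Ev.get hτ ha (by rw [(F1.trans hF).2 28 (by omega) (by decide), hz i hi]))).mono le_rfl
      fun τ₂ _ ⟨q2, F2⟩ => ?_
    refine ⟨?_, q2, (F1.trans F2).mono (by decide) (by decide)⟩
    rw [F2.2 0 (by omega) (by decide)]
    exact q1
  · have h1 : n - k ≤ n := Nat.sub_le _ _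
    generalize n - k = m at h1
    nlinarith [Nat.mul_le_mul (Nat.succ_le_succ h1) (Nat.succ_le_succ h1)]

end

/-! ### The whole program -/

namespace Measurement

section

variable (n k : ℕ) (sl : ℕ → ℕ) (T : ℕ → PRow)

/-- The block size of the eliminations, a power of two. -/
def width : ℕ := 2 ^ Nat.clog 2 k

/-- The elimination of the measured `X` parts of the stabilizers. -/
def stabElim : Elim := Elim.run n (measuredPart k sl T n) (width k)

/-- The table after the reduction of the stabilizers. -/
def stabTable : ℕ → PRow :=
  mulTable n (width k) T (gatherRow T n (stabElim n k sl T).piv) (stabElim n k sl T).X (2 * n) n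

/-- The table after the pivot columns of the destabilizers are cleared. -/
def clearTable : ℕ → PRow :=
  mulTable n (width k) (stabTable n k sl T)
    (gatherRow (stabTable n k sl T) (2 * n) (stabElim n k sl T).piv)
    (measuredPart k sl (stabTable n k sl T) 0) 0 n

/-- The measured `X` parts of the destabilizers. -/
def destabPart : ℕ → ℕ → ZMod 2 := measuredPart k sl (clearTable n k sl T) 0

/-- The table with the stabilizers that restrict the outcomes. -/
def outcomeTable : ℕ → PRow :=
  constraintTable n k (clearTable n k sl T) (destabPart n k sl T) ((n / width k + 1) * width k)

def outcome (b : ℕ → ZMod 2) : ℕ → ZMod 2 :=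
  outcomeBit n k (outcomeTable n k sl T) (stabElim n k sl T).piv sl b

/-- The elimination of the measured `X` parts of the destabilizers. -/
def destabElim : Elim :=
  Elim.run n (fun i q => if (stabElim n k sl T).used i = 0 then destabPart n k sl T i q else 0)
    (width k)

/-- The final table. -/
def finalTable : ℕ → PRow :=
  mulTable n (width k) (outcomeTable n k sl T)
    (gatherRow (outcomeTable n k sl T) 0 (destabElim n k sl T).piv) (destabElim n k sl T).X 0 n

/-- The rows that are kept. -/
def Kept (i : ℕ) : Prop := (stabElim n k sl T).used i = 0 ∧ (destabElim n k sl T).used i = 0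

instance : DecidablePred (Kept n k sl T) := fun i => inferInstanceAs (Decidable (_ ∧ _))

end

/-- The measurement program, for a program `c` that multiplies square matrices. -/
def prog (c : Prog) : Prog :=
  .seq setConstants
  (.seq (listProg 5 (.get 3 (.reg 22)))
  (.seq (listProg 6 (.const 1 - .get 3 (.reg 22)))
  (.seq loadTable
  (.seq (reduceStabilizers c)
  (.seq (clearDestabilizers c)
  (.seq (loadColumns 27 7 (.const 0))
  (.seq (constraints c)
  (.seq outcomes
  (.seq compareOutcome
  (.seq (reduceDestabilizers c)
  (.seq (listProg 29 (.eqv (.get 26 (.reg 22)) (.const 0) *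
    .eqv (.get 15 (.reg 22 + .const 1)) (.const 0)))
  (.seq outputPhases outputMatrix))))))))))))

def time (F : ℕ → ℕ) (n k : ℕ) : ℕ :=
  2 * tElim F n (Nat.clog 2 k) + 3 * tMulRows F n n (width k) +
    (n / width k + 1) * (tMulRows F n k (width k) + 600 * ((k + 1) * (width k + 1)) + 40) +
    20000 * ((n + 1) * (n + 1)) + 4000 * ((n + 1) * (width k + 1))

theorem width_bounds {n k : ℕ} (hk1 : 1 ≤ k) (hkn : k ≤ n) :
    k ≤ width k ∧ width k ≤ 2 * k ∧ width k ≤ 2 * n := by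
  have h : width k ≤ 2 * k := by
    rw [width]
    rcases Nat.eq_zero_or_pos (Nat.clog 2 k) with h | h
    · rw [h]; omega
    · have := (Nat.lt_clog_iff_pow_lt (b := 2) (x := k) (y := Nat.clog 2 k - 1) (by omega)).1 (by omega)
      rw [show Nat.clog 2 k = Nat.clog 2 k - 1 + 1 by omega, pow_succ]
      omega
  exact ⟨Nat.le_pow_clog (by omega) k, h, by omega⟩

section

variable {c : Prog} {F : ℕ → ℕ} {d W : ℕ} {σ : MachineState} {n k : ℕ}
  {M : ℕ → ℕ → ZMod 2} {p s b : ℕ → ZMod 2} {sl cl kl : ℕ → ℕ}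

/-- The abstract tables of `Measurement` are the successive contents of the arrays `7`, `8`, `9`.
The sequences `sl`, `cl`, `kl` enumerate the measured qubits, the other qubits and the kept rows;
their existence is a question of counting and is postponed. -/
theorem runs_prog (hc : MulSpec c F d) (hσ : σ.IsWord W)
    (hL : (4 * n + 15) * (4 * n + 15) + (4 * n + 15) < W) (hd : (width k + 2) ^ d ≤ W)
    (hk1 : 1 ≤ k) (hkn : k ≤ n) (h0 : σ.reg 0 = n) (h1 : σ.reg 1 = k)
    (hM : Stored (σ.arr 0) (2 * n) (2 * n) (2 * n) M) (hp : ∀ i < 2 * n, σ.arr 1 i = (p i).val)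
    (hs : ∀ i < 2 * n, σ.arr 2 i = (s i).val) (P : ℕ → Prop) [DecidablePred P]
    (hP : ∀ i < n, σ.arr 3 i = if P i then 1 else 0) (hb : ∀ c < k, σ.arr 4 c = (b c).val)
    (hsl : ∀ c < k, sl c < n ∧ P (sl c) ∧ Nat.count P (sl c) = c)
    (hcl : ∀ c < n - k, cl c < n ∧ ¬ P (cl c) ∧ Nat.count (fun i => ¬ P i) (cl c) = c)
    (hkl : ∀ c < n - k, kl c < n ∧ Kept n k sl (initialTable n M p s) (kl c) ∧
      Nat.count (Kept n k sl (initialTable n M p s)) (kl c) = c) :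
    Runs W (prog c) σ (time F n k) (fun τ =>
      let T := initialTable n M p s
      let z := outcome n k sl T b
      τ.reg 3 = (if ∀ c < k, z c = b c then 1 else 0) ∧ (∀ c < k, τ.arr 4 c = (z c).val) ∧
      Stored (τ.arr 0) (2 * (n - k)) (2 * (n - k)) (2 * (n - k))
        (outEntry n (n - k) (finalTable n k sl T) cl kl) ∧
      (∀ i < 2 * (n - k), τ.arr 1 i =
        (outP n k (n - k) (finalTable n k sl T) sl cl kl z i).val) ∧
      (∀ i < 2 * (n - k), τ.arr 2 i =
        (outS n k (n - k) (finalTable n k sl T) sl kl z i).val)) := by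
  obtain ⟨hkK, -, hKn⟩ := width_bounds hk1 hkn
  have hB : Bounds W (4 * n + 15) n k (width k) d :=
    ⟨hL, by omega, by omega, hk1, hkn, hkK, hKn, hd⟩
  have hW : 1 < W := fit_lin hL (by omega)
  set T := initialTable n M p s with hT
  apply Runs.pre
  · apply Runs.seq (runs_setConstants hσ hL (by omega) (by omega) h0 h1 hk1 hkn)
    rintro τ₁ hτ₁ ⟨C1, F1⟩
    have C1 : Consts τ₁ n k (width k) := C1
    have ev3 : ∀ {Rs As : List ℕ} {τ : MachineState} {i : ℕ}, Frame Rs As σ τ → 3 ∉ As →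
        τ.IsWord W → i < n → τ.reg 22 = i → Ev W τ (.get 3 (.reg 22)) (if P i then 1 else 0) :=
      fun hF h3 hτ hi h22 => Ev.get hτ (Ev.reg hτ h22) (by rw [hF.2 3 (by omega) h3, hP _ hi])
    apply Runs.seq (runs_listProg (A := 5) hτ₁ hL (by omega) C1.r0 (by omega) (by simp) P
      (fun i τ hi hτ hF h22 => ev3 (F1.trans hF) (by decide) hτ hi h22))
    rintro τ₂ hτ₂ ⟨l2, F2'⟩
    have F2 := F1.trans F2'
    have C2 := C1.frame F2' (by decide)
    apply Runs.seq (runs_listProg (A := 6) (e := .const 1 - .get 3 (.reg 22)) hτ₂ hL (by omega)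
      C2.r0 (by omega) (by simp) (fun i => ¬ P i) (fun i τ hi hτ hF h22 =>
        (Ev.sub (Ev.const hW) (ev3 (F2.trans hF) (by decide) hτ hi h22)).congr
          (by by_cases h : P i <;> simp [h])))
    rintro τ₃ hτ₃ ⟨l3, F3'⟩
    have F3 := F2.trans F3'
    have C3 := C2.frame F3' (by decide)
    apply Runs.seq (runs_loadTable hB hτ₃ C3 (M := M) (p := p) (s := s)
      (by rw [F3.2 0 (by omega) (by decide)]; exact hM)
      (by rw [F3.2 1 (by omega) (by decide)]; exact hp)
      (by rw [F3.2 2 (by omega) (by decide)]; exact hs))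
    rintro τ₄ hτ₄ ⟨T4, F4'⟩
    have F4 := F3.trans F4'
    have C4 := C3.frame F4' (by decide)
    have sl4 : ∀ c < k, τ₄.arr 5 c = sl c := fun c hc => by
      obtain ⟨a1, a2, a3⟩ := hsl c hc
      have := l2 _ a1 a2
      rwa [a3, ← (F3'.trans F4').2 5 (by omega) (by decide)] at this
    have cl4 : ∀ c < n - k, τ₄.arr 6 c = cl c := fun c hc => by
      obtain ⟨a1, a2, a3⟩ := hcl c hc
      have := l3 _ a1 a2
      rwa [a3, ← F4'.2 6 (by omega) (by decide)] at this
    apply Runs.seq (runs_reduceStabilizers hc hB hτ₄ C4 T4 sl4 fun c hc => (hsl c hc).1)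
    rintro τ₅ hτ₅ ⟨T5, p5, q5, u5, F5'⟩
    have F5 := F4.trans F5'
    have C5 := C4.frame F5' (by decide)
    have T5 : TableAt τ₅ (4 * n) n (4 * n) (stabTable n k sl T) := T5
    have u5 : ∀ i < n, τ₅.arr 26 i = ((stabElim n k sl T).used i).val := u5
    have q5 : ∀ l < width k, τ₅.arr 25 l = (stabElim n k sl T).piv l := q5
    apply Runs.seq (runs_clearDestabilizers hc hB hτ₅ C5 T5
      (by rw [F5'.2 5 (by omega) (by decide)]; exact sl4) (fun c hc => (hsl c hc).1) p5
      (fun l _ => Elim.run_piv_le _ _))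
    rintro τ₆ hτ₆ ⟨T6, F6'⟩
    have F6 := F5.trans F6'
    have G6 := F5'.trans F6'
    have C6 := C5.frame F6' (by decide)
    have T6 : TableAt τ₆ (4 * n) n (4 * n) (clearTable n k sl T) := T6
    have sl6 : ∀ c < k, τ₆.arr 5 c = sl c := by
      rw [G6.2 5 (by omega) (by decide)]; exact sl4
    apply Runs.seq (runs_loadColumns hB hτ₆ C6 (base := 0) (A := 27) (rC := 7) (be := .const 0)
      (by omega) (by omega) C6.r7 (by omega) (by simp)
      (fun τ hτ hF => Ev.const (by omega)) (by omega) T6 sl6 fun c hc => (hsl c hc).1)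
    rintro τ₇ hτ₇ ⟨A7, F7'⟩
    have F7 := F6.trans F7'
    have G7 := G6.trans F7'
    have C7 := C6.frame F7' (by decide)
    have A7 : Stored (τ₇.arr 27) (4 * n) n (width k) (destabPart n k sl T) := A7
    apply Runs.seq (runs_constraints hc hB hτ₇ C7
      (T6.frame F7' (by decide) (by decide) (by decide)) A7)
    rintro τ₈ hτ₈ ⟨T8, F8'⟩
    have F8 := F7.trans F8'
    have G8 := G7.trans F8'
    have H8 := (F6'.trans F7').trans F8'
    have C8 := C7.frame F8' (by decide)
    have T8 : TableAt τ₈ (4 * n) n (4 * n) (outcomeTable n k sl T) := T8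
    apply Runs.seq (runs_outcomes (b := b) (pv := (stabElim n k sl T).piv) hB hτ₈ C8 T8
      (by rw [G8.2 5 (by omega) (by decide)]; exact sl4) (fun c hc => (hsl c hc).1)
      (fun l hl => by rw [H8.2 25 (by omega) (by decide)]; exact q5 l (by omega))
      (by rw [F8.2 4 (by omega) (by decide)]; exact hb))
    rintro τ₉ hτ₉ ⟨z9, F9'⟩
    have F9 := F8.trans F9'
    have C9 := C8.frame F9' (by decide)
    have z9 : ∀ c < k, τ₉.arr 28 c = (outcome n k sl T b c).val := z9
    apply Runs.seq (runs_compareOutcome (b := b) hτ₉ hW C9.r1 z9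
      (by rw [F9.2 4 (by omega) (by decide)]; exact hb))
    rintro τa hτa ⟨ra, Fa'⟩
    have Ga := F9'.trans Fa'
    have Ca := C9.frame Fa' (by decide)
    have Ha := (F8'.trans Ga)
    have Ka := H8.trans Ga
    apply Runs.seq (runs_reduceDestabilizers hc hB hτa Ca
      (T8.frame Ga (by decide) (by decide) (by decide))
      (A := destabPart n k sl T) (u := (stabElim n k sl T).used)
      (by rw [Ha.2 27 (by omega) (by decide)]; exact A7)
      (fun i q hq => by rw [destabPart, measuredPart, if_neg (by omega)])
      (by rw [Ka.2 26 (by omega) (by decide)]; exact u5))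
    rintro τb hτb ⟨Tb, ub, Fb'⟩
    have Cb := Ca.frame Fb' (by decide)
    have Tb : TableAt τb (4 * n) n (4 * n) (finalTable n k sl T) := Tb
    have ub : ∀ i < n, τb.arr 15 (i + 1) = ((destabElim n k sl T).used i).val := ub
    have Kb := Ka.trans Fb'
    apply Runs.seq (runs_listProg (A := 29) (e := .eqv (.get 26 (.reg 22)) (.const 0) *
      .eqv (.get 15 (.reg 22 + .const 1)) (.const 0)) hτb hL (by omega)
      Cb.r0 (by omega) (by simp) (Kept n k sl T) (fun i τ hi hτ hF h22 => by
        have e1 : Ev W τ (.get 26 (.reg 22)) ((stabElim n k sl T).used i).val :=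
          Ev.get hτ (Ev.reg hτ h22) (by rw [(Kb.trans hF).2 26 (by omega) (by decide), u5 i hi])
        have e2 : Ev W τ (.get 15 (.reg 22 + .const 1)) ((destabElim n k sl T).used i).val :=
          Ev.get hτ (Ev.add (Ev.reg hτ h22) (Ev.const hW) (fit_lin hL (by omega)))
            (by rw [hF.2 15 (by omega) (by decide), ub i hi])
        refine (Ev.mask (Ev.eqv hW e1 (Ev.const (by omega))) (Ev.eqv hW e2 (Ev.const (by omega)))
          (indicator_le_one _)).congr ?_
        simp only [ZMod.val_eq_zero, Kept]
        by_cases h1 : (stabElim n k sl T).used i = 0 <;>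
          by_cases h2 : (destabElim n k sl T).used i = 0 <;> simp [h1, h2]))
    rintro τe hτe ⟨le, Fe'⟩
    have Ce := Cb.frame Fe' (by decide)
    have Te := Tb.frame Fe' (by decide) (by decide) (by decide)
    have Ge := (G8.trans Ga).trans (Fb'.trans Fe')
    have kle : ∀ c < n - k, τe.arr 29 c = kl c := fun c hc => by
      obtain ⟨a1, a2, a3⟩ := hkl c hc
      have := le _ a1 a2
      rwa [a3] at this
    have ze : ∀ c < k, τe.arr 28 c = (outcome n k sl T b c).val := by
      rw [((Fa'.trans Fb').trans Fe').2 28 (by omega) (by decide)]; exact z9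
    have cle : ∀ c < n - k, τe.arr 6 c = cl c := by
      rw [Ge.2 6 (by omega) (by decide)]; exact cl4
    apply Runs.seq (runs_outputPhases hB hτe Ce Te
      (by rw [Ge.2 5 (by omega) (by decide)]; exact sl4) (fun c hc => (hsl c hc).1)
      cle (fun c hc => (hcl c hc).1) kle (fun c hc => (hkl c hc).1) ze)
    rintro τf hτf ⟨pf, sf, Ff'⟩
    have Cf := Ce.frame Ff' (by decide)
    refine (runs_outputMatrix (zz := outcome n k sl T b) hB hτf Cf (Te.frame Ff' (by decide) (by decide) (by decide))
      (by rw [Ff'.2 6 (by omega) (by decide)]; exact cle) (fun c hc => (hcl c hc).1)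
      (by rw [Ff'.2 29 (by omega) (by decide)]; exact kle) (fun c hc => (hkl c hc).1)
      (by rw [Ff'.2 28 (by omega) (by decide)]; exact ze)).mono le_rfl fun τ _ ⟨m, z, Fg⟩ => ?_
    refine ⟨?_, z, m, ?_, ?_⟩
    · rw [(((Fb'.trans Fe').trans Ff').trans Fg).1 3 (by omega) (by decide)]; exact ra
    · rw [Fg.2 1 (by omega) (by decide)]; exact pf
    · rw [Fg.2 2 (by omega) (by decide)]; exact sf
  · have e1 : n + 1 ≤ (n + 1) * (n + 1) := Nat.le_mul_of_pos_right _ (by omega)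
    have e2 : k + 1 ≤ (n + 1) * (n + 1) := by omega
    have e3 : (k + 1) * (k + 1) ≤ (n + 1) * (n + 1) := Nat.mul_le_mul (by omega) (by omega)
    unfold time
    rw [show 2 ^ Nat.clog 2 k = width k from rfl]
    generalize (n / width k + 1) * (tMulRows F n k (width k) +
      600 * ((k + 1) * (width k + 1)) + 40) = x
    generalize (n + 1) * (n + 1) = y at *
    generalize (k + 1) * (k + 1) = y' at *
    generalize (n + 1) * (width k + 1) = y'' at *
    omega

end

end Measurement

/-! ### The symplectic form on the rows -/

namespace PRow

/-- The symplectic form, which tells whether two rows anticommute. -/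
def form (n : ℕ) (a b : PRow) : ZMod 2 := ∑ j ∈ Finset.range n, (a.x j * b.z j + a.z j * b.x j)

variable {n : ℕ}

theorem form_comm (a b : PRow) : form n a b = form n b a :=
  Finset.sum_congr rfl fun j _ => by ring

theorem form_one (b : PRow) : form n one b = 0 := by simp [form, one]

theorem form_prod (P : ℕ → PRow) (u : ℕ → ZMod 2) (a b : PRow) (K : ℕ) :
    form n (prod n P u a K) b = form n a b + ∑ c ∈ Finset.range K, u c * form n (P c) b := by
  simp only [form, prod_x, prod_z, Finset.mul_sum]
  rw [Finset.sum_comm, ← Finset.sum_add_distrib]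
  refine Finset.sum_congr rfl fun j _ => ?_
  rw [add_mul, add_mul, Finset.sum_mul, Finset.sum_mul]
  have : ∀ c, u c * ((P c).x j * b.z j + (P c).z j * b.x j) =
      u c * (P c).x j * b.z j + u c * (P c).z j * b.x j := fun c => by ring
  simp only [this, Finset.sum_add_distrib]
  ring

/-- The row with a given `Z` part. -/
def ofZ (v : ℕ → ZMod 2) : PRow := ⟨0, fun _ => 0, v⟩

theorem form_ofZ (a : PRow) (v : ℕ → ZMod 2) :
    form n a (ofZ v) = ∑ j ∈ Finset.range n, a.x j * v j := by simp [form, ofZ]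

end PRow

open PRow Elim

theorem gatherRow_form {n : ℕ} (T : ℕ → PRow) (src : ℕ) (pv : ℕ → ℕ) (c : ℕ) (b : PRow) :
    form n (gatherRow T src pv c) b = pivRow pv (fun p => form n (T (src + p)) b) c := by
  rw [gatherRow, pivRow]
  split
  · exact form_one b
  · rfl

theorem gatherRow_x (T : ℕ → PRow) (src : ℕ) (pv : ℕ → ℕ) (c j : ℕ) :
    (gatherRow T src pv c).x j = pivRow pv (fun p => (T (src + p)).x j) c := by
  rw [gatherRow, pivRow]
  split <;> rfl

theorem add_self_zmod (a : ZMod 2) : a + a = 0 := by revert a; decide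

theorem ne_zero_zmod {a : ZMod 2} (h : a ≠ 0) : a = 1 := by revert a; decide

namespace Elim

variable {n : ℕ} {Y : ℕ → ℕ → ZMod 2}

/-- Rows that are zero stay unused. -/
theorem used_of_zero_row {p : ℕ} (h : ∀ c, Y p c = 0) (t : ℕ) :
    (∀ c, (run n Y t).X p c = 0) ∧ (run n Y t).used p = 0 := by
  induction t with
  | zero => exact ⟨h, rfl⟩
  | succ t ih =>
    have hm : (run n Y t).mult n t p = 0 := by rw [mult, ih.1 t, ite_self]
    refine ⟨fun c => ?_, ?_⟩
    · rw [run_succ_X, hm, ih.1 c]; simp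
    · rw [run_succ_used, if_neg, ih.2]
      intro hp
      have := ((choose_spec (n := n) (Y := Y) t).2 (by omega)).2.2
      rw [← hp, Nat.add_sub_cancel, ih.1 t] at this
      exact absurd this (by decide)

/-- The row operations read row `i` and the pivot rows only. Values on other rows, in particular on
used rows during the second elimination, may be replaced freely. -/
theorem app_congr {t i : ℕ} {y y' : ℕ → ZMod 2} (hi : y i = y' i)
    (h : ∀ l < t, (run n Y t).piv l ≠ 0 → y ((run n Y t).piv l - 1) = y' ((run n Y t).piv l - 1)) :
    app n Y t y i = app n Y t y' i := by
  rw [app, app, hi]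
  congr 1
  refine Finset.sum_congr rfl fun l hl => ?_
  rw [pivRow, pivRow]
  split
  · rfl
  · rw [h l (Finset.mem_range.1 hl) (by assumption)]

theorem app_zero_col (t i : ℕ) : app n Y t (fun _ => 0) i = 0 := by simp [app, pivRow]

theorem piv_used {l t : ℕ} (hl : l < t) (h : (run n Y t).piv l ≠ 0) :
    (run n Y t).used ((run n Y t).piv l - 1) = 1 := (used_iff t _).2 ⟨l, hl, by omega⟩

end Elim

/-! ### Algebraic invariants of the two eliminations. -/

namespace Measurement

/-- The rows `i` and `n + i` are destabilizers and stabilizers. -/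
structure Symp (n : ℕ) (T : ℕ → PRow) : Prop where
  xx : ∀ i < n, ∀ j < n, form n (T i) (T j) = 0
  zz : ∀ i < n, ∀ j < n, form n (T (n + i)) (T (n + j)) = 0
  xz : ∀ i < n, ∀ j < n, form n (T i) (T (n + j)) = if i = j then 1 else 0
  copy : ∀ i < n, T (2 * n + i) = T (n + i)
  rest : ∀ i, 3 * n ≤ i → T i = PRow.one
  -- What commutes with all stabilizers lies in their span, with coordinates given by the dual
  -- destabilizers.
  complete : ∀ w, (∀ i < n, form n (T (n + i)) w = 0) → ∀ j < n,
    w.x j = ∑ i ∈ Finset.range n, form n (T i) w * (T (n + i)).x j ∧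
    w.z j = ∑ i ∈ Finset.range n, form n (T i) w * (T (n + i)).z j

section

variable (n k : ℕ) (sl : ℕ → ℕ) (T : ℕ → PRow)

/-- The reduced stabilizers. -/
def stab (i : ℕ) : PRow := stabTable n k sl T (2 * n + i)

/-- The destabilizers with cleared pivot columns. -/
def clear (i : ℕ) : PRow := clearTable n k sl T i

/-- The final destabilizers. -/
def destab (i : ℕ) : PRow := finalTable n k sl T i

end

section

variable {n k : ℕ} {sl : ℕ → ℕ} {T : ℕ → PRow}

local notation "E₁" => stabElim n k sl T
local notation "E₂" => destabElim n k sl T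

theorem measuredPart_eq_zero (base i q : ℕ) (h : k ≤ q) : measuredPart k sl T base i q = 0 :=
  if_neg (by omega)

theorem stabElim_piv_eq_zero {q : ℕ} (h : k ≤ q) : (E₁).piv q = 0 :=
  run_piv_eq_zero _ _ k (measuredPart_eq_zero _) h

theorem lt_of_piv {q : ℕ} (h : (E₁).piv q ≠ 0) : q < k := by
  by_contra hq
  exact h (stabElim_piv_eq_zero (by omega))

theorem le_width : k ≤ width k := Nat.le_pow_clog (by omega) k

theorem stabTable_low {i : ℕ} (h : i < 2 * n) : stabTable n k sl T i = T i := by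
  rw [stabTable, mulTable, if_neg (by omega)]

theorem stab_eq {i : ℕ} (hi : i < n) : stab n k sl T i =
    PRow.prod n (gatherRow T n (E₁).piv) ((E₁).X i) (T (2 * n + i)) (width k) := by
  rw [stab, stabTable, mulTable, if_pos (by omega), Nat.add_sub_cancel_left]

theorem clear_eq {i : ℕ} (hi : i < n) : clear n k sl T i =
    PRow.prod n (gatherRow (stabTable n k sl T) (2 * n) (E₁).piv)
      (measuredPart k sl (stabTable n k sl T) 0 i) (T i) (width k) := by
  rw [clear, clearTable, mulTable, if_pos (by omega), stabTable_low (by omega), Nat.sub_zero]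

theorem clearTable_high {i : ℕ} (h : n ≤ i) : clearTable n k sl T i = stabTable n k sl T i := by
  rw [clearTable, mulTable, if_neg (by omega)]

theorem outcomeTable_low {i : ℕ} (h : i < 3 * n) :
    outcomeTable n k sl T i = clearTable n k sl T i := by
  rw [outcomeTable, constraintTable, if_neg (by omega)]

theorem finalTable_stab {i : ℕ} (hi : i < n) :
    finalTable n k sl T (2 * n + i) = stab n k sl T i := by
  rw [finalTable, mulTable, if_neg (by omega), outcomeTable_low (by omega),
    clearTable_high (by omega), stab]

theorem destab_eq {i : ℕ} (hi : i < n) : destab n k sl T i =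
    PRow.prod n (gatherRow (outcomeTable n k sl T) 0 (E₂).piv) ((E₂).X i) (clear n k sl T i)
      (width k) := by
  rw [destab, finalTable, mulTable, if_pos (by omega), outcomeTable_low (by omega), Nat.sub_zero,
    clear]

/-- The symplectic form is additive in each row and the identity has form zero, so the form with a
fixed row undergoes the row operations of the elimination. -/
theorem stab_form (hT : Symp n T) {i : ℕ} (hi : i < n) (b : PRow) :
    form n (stab n k sl T i) b =
      app n (measuredPart k sl T n) (width k) (fun p => form n (T (n + p)) b) i := by
  rw [stab_eq hi, form_prod, hT.copy i hi]
  simp only [gatherRow_form]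
  rfl

theorem stab_x (hT : Symp n T) {i : ℕ} (hi : i < n) (j : ℕ) :
    (stab n k sl T i).x j =
      app n (measuredPart k sl T n) (width k) (fun p => (T (n + p)).x j) i := by
  rw [stab_eq hi, prod_x, hT.copy i hi]
  simp only [gatherRow_x]
  rfl

theorem piv_sub_lt {q : ℕ} (h : (E₁).piv q ≠ 0) : (E₁).piv q - 1 < n := by
  have := run_piv_le (n := n) (Y := measuredPart k sl T n) (width k) q
  rw [stabElim] at *
  omega

theorem piv₂_sub_lt {q : ℕ} (h : (E₂).piv q ≠ 0) : (E₂).piv q - 1 < n := by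
  have : (E₂).piv q ≤ n := run_piv_le _ _
  omega

/-- These are the stabilizers that survive the measurement: without an `X` part on the measured
qubits they commute with the measured operators. -/
theorem stab_x_unused (hT : Symp n T) {i q : ℕ} (hi : i < n) (hu : (E₁).used i = 0) (hq : q < k) :
    (stab n k sl T i).x (sl q) = 0 := by
  rw [stab_x hT hi, ← (app_reduced (width k) q (hq.trans_le le_width)).2 i hi hu]
  congr 1
  funext p
  rw [measuredPart, if_pos hq]

theorem stab_x_pivot (hT : Symp n T) {i q : ℕ} (hi : i < n) (hp : (E₁).piv q ≠ 0) :
    (stab n k sl T i).x (sl q) = if i + 1 = (E₁).piv q then 1 else 0 := by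
  have hq := lt_of_piv hp
  rw [stab_x hT hi, stabElim, ← (app_reduced (width k) q (hq.trans_le le_width)).1 hp i]
  congr 1
  funext p
  rw [measuredPart, if_pos hq]

/-- Sums over the pivot columns of the row `i`. -/
theorem sum_pivot_eq {q : ℕ} (hp : (E₁).piv q ≠ 0) (f : ℕ → ZMod 2) :
    ∑ c ∈ Finset.range k, f c * (if (E₁).piv c = 0 then 0 else
      if (E₁).piv c - 1 + 1 = (E₁).piv q then 1 else 0) = f q := by
  rw [Finset.sum_eq_single q]
  · rw [if_neg hp, if_pos (by omega), mul_one]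
  · intro c hc hcq
    split
    · rw [mul_zero]
    · rename_i h
      rw [if_neg, mul_zero]
      intro he
      refine hcq (piv_inj (n := n) (Y := measuredPart k sl T n) (t := width k)
        ((Finset.mem_range.1 hc).trans_le le_width) ((lt_of_piv hp).trans_le le_width) h ?_)
      rw [stabElim] at *
      omega
  · intro h
    exact absurd (Finset.mem_range.2 (lt_of_piv hp)) h

theorem sum_width {f : ℕ → ZMod 2} (h : ∀ c, k ≤ c → f c = 0) :
    ∑ c ∈ Finset.range (width k), f c = ∑ c ∈ Finset.range k, f c := by
  symm
  refine Finset.sum_subset (Finset.range_subset_range.2 le_width) fun c _ hc => h c ?_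
  rw [Finset.mem_range] at hc
  omega

theorem clear_x {i : ℕ} (hi : i < n) (j : ℕ) : (clear n k sl T i).x j = (T i).x j +
    ∑ c ∈ Finset.range k, (T i).x (sl c) * pivRow (E₁).piv (fun p => (stab n k sl T p).x j) c := by
  rw [clear_eq hi, prod_x, sum_width fun c hc => by rw [measuredPart_eq_zero _ _ _ hc, zero_mul]]
  congr 1
  refine Finset.sum_congr rfl fun c hc => ?_
  rw [measuredPart, if_pos (Finset.mem_range.1 hc), zero_add, stabTable_low (by omega), gatherRow_x]
  rfl

theorem clear_form {i : ℕ} (hi : i < n) (b : PRow) : form n (clear n k sl T i) b = form n (T i) b +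
    ∑ c ∈ Finset.range k, (T i).x (sl c) *
      pivRow (E₁).piv (fun p => form n (stab n k sl T p) b) c := by
  rw [clear_eq hi, form_prod, sum_width fun c hc => by rw [measuredPart_eq_zero _ _ _ hc, zero_mul]]
  congr 1
  refine Finset.sum_congr rfl fun c hc => ?_
  rw [measuredPart, if_pos (Finset.mem_range.1 hc), zero_add, stabTable_low (by omega),
    gatherRow_form]
  rfl

/-- The pivot columns of the reduced stabilizers are unit vectors, so exactly one factor affects
column `q`, and it adds the entry to itself. -/
theorem clear_x_pivot (hT : Symp n T) {i q : ℕ} (hi : i < n) (hp : (E₁).piv q ≠ 0) :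
    (clear n k sl T i).x (sl q) = 0 := by
  rw [clear_x hi]
  have : ∀ c ∈ Finset.range k, (T i).x (sl c) *
      pivRow (E₁).piv (fun p => (stab n k sl T p).x (sl q)) c = (T i).x (sl c) *
      (if (E₁).piv c = 0 then 0 else if (E₁).piv c - 1 + 1 = (E₁).piv q then 1 else 0) := by
    intro c _
    rw [pivRow]
    split
    · rfl
    · rw [stab_x_pivot hT (piv_sub_lt (by assumption)) hp]
  rw [Finset.sum_congr rfl this, sum_pivot_eq hp (fun c => (T i).x (sl c)), add_self_zmod]

theorem stab_stab (hT : Symp n T) {i j : ℕ} (hi : i < n) (hj : j < n) :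
    form n (stab n k sl T i) (stab n k sl T j) = 0 := by
  rw [stab_form hT hi, ← app_zero_col (n := n) (Y := measuredPart k sl T n) (width k) i]
  have key : ∀ p < n, form n (T (n + p)) (stab n k sl T j) = 0 := by
    intro p hp
    rw [form_comm, stab_form hT hj, ← app_zero_col (n := n) (Y := measuredPart k sl T n) (width k) j]
    refine app_congr (hT.zz j hj p hp) fun l _ h => hT.zz _ (piv_sub_lt h) p hp
  exact app_congr (key i hi) fun l _ h => key _ (piv_sub_lt h)

/-- The reduced row `j` differs from the original stabilizer `j` by pivot rows only. An unused index
`i` is not a pivot row, so destabilizer `i` commutes with all those factors. -/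
theorem destabilizer_stab (hT : Symp n T) {i j : ℕ} (hi : i < n) (hj : j < n)
    (hu : (E₁).used i = 0) : form n (T i) (stab n k sl T j) = if i = j then 1 else 0 := by
  have hne : ∀ l < width k, (E₁).piv l ≠ 0 → (E₁).piv l - 1 ≠ i := by
    rintro l hl h rfl
    have := piv_used (n := n) (Y := measuredPart k sl T n) hl h
    rw [stabElim] at hu
    rw [hu] at this
    exact absurd this (by decide)
  rw [form_comm, stab_form hT hj, app]
  rw [Finset.sum_eq_zero, add_zero, form_comm, hT.xz i hi j hj]
  intro l hl
  rw [pivRow]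
  split
  · rw [mul_zero]
  · rename_i h
    rw [form_comm]
    exact (congrArg _ ((hT.xz i hi _ (piv_sub_lt h)).trans
      (if_neg (hne l (Finset.mem_range.1 hl) h).symm))).trans (mul_zero _)

/-- Clearing multiplies by stabilizers, which commute with all stabilizers. -/
theorem clear_stab (hT : Symp n T) {i j : ℕ} (hi : i < n) (hj : j < n) (hu : (E₁).used i = 0) :
    form n (clear n k sl T i) (stab n k sl T j) = if i = j then 1 else 0 := by
  rw [clear_form hi, destabilizer_stab hT hi hj hu, Finset.sum_eq_zero, add_zero]
  intro c _
  rw [pivRow]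
  split
  · rw [mul_zero]
  · rw [stab_stab hT (piv_sub_lt (by assumption)) hj, mul_zero]

/-- The extra factors are reduced stabilizers with pivot indices, and by duality those commute with
the destabilizers of unused index. -/
theorem clear_clear (hT : Symp n T) {i j : ℕ} (hi : i < n) (hj : j < n) (hu : (E₁).used i = 0)
    (hu' : (E₁).used j = 0) : form n (clear n k sl T i) (clear n k sl T j) = 0 := by
  have hne : ∀ {i}, (E₁).used i = 0 → ∀ c ∈ Finset.range k, (E₁).piv c ≠ 0 → i ≠ (E₁).piv c - 1 := by
    rintro i hu c hc h rfl
    have := piv_used (n := n) (Y := measuredPart k sl T n)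
      ((Finset.mem_range.1 hc).trans_le le_width) h
    rw [stabElim] at hu
    rw [hu] at this
    exact absurd this (by decide)
  rw [clear_form hi, form_comm, clear_form hj, form_comm, hT.xx i hi j hj, zero_add,
    Finset.sum_eq_zero, Finset.sum_eq_zero, add_zero]
  · intro c hc
    rw [pivRow]
    split
    · rw [mul_zero]
    · rename_i h
      rw [form_comm, clear_stab hT hj (piv_sub_lt h) hu', if_neg (hne hu' c hc h), mul_zero]
  · intro c hc
    rw [pivRow]
    split
    · rw [mul_zero]
    · rename_i h
      rw [form_comm, destabilizer_stab hT hi (piv_sub_lt h) hu, if_neg (hne hu c hc h), mul_zero]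

/-- The measured `X` parts of the destabilizers, without the used rows. -/
def unusedPart (n k : ℕ) (sl : ℕ → ℕ) (T : ℕ → PRow) (i q : ℕ) : ZMod 2 :=
  if (stabElim n k sl T).used i = 0 then destabPart n k sl T i q else 0

theorem destabElim_eq : E₂ = run n (unusedPart n k sl T) (width k) := rfl

/-- The rows used by the first elimination are zero in the second one, and a zero row never becomes
a pivot. -/
theorem unused_of_used {i : ℕ} (h : (E₂).used i = 1) : (E₁).used i = 0 := by
  by_contra hu
  have := (used_of_zero_row (n := n) (Y := unusedPart n k sl T) (p := i)
    (fun c => if_neg hu) (width k)).2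
  rw [← destabElim_eq, h] at this
  exact absurd this (by decide)

theorem piv₂_unused {l : ℕ} (hl : l < width k) (h : (E₂).piv l ≠ 0) :
    (E₁).used ((E₂).piv l - 1) = 0 := unused_of_used (piv_used hl h)

theorem destab_form {i : ℕ} (hi : i < n) (b : PRow) : form n (destab n k sl T i) b =
    app n (unusedPart n k sl T) (width k) (fun p => form n (clear n k sl T p) b) i := by
  rw [destab_eq hi, form_prod]
  simp only [gatherRow_form, app]
  congr 1
  refine Finset.sum_congr rfl fun l _ => ?_
  rw [destabElim_eq, pivRow, pivRow]
  split
  · rfl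
  · rename_i h
    have := piv₂_sub_lt (n := n) (k := k) (sl := sl) (T := T) h
    rw [zero_add, outcomeTable_low (by rw [destabElim_eq] at this; omega)]
    rfl

theorem destab_x {i : ℕ} (hi : i < n) (j : ℕ) : (destab n k sl T i).x j =
    app n (unusedPart n k sl T) (width k) (fun p => (clear n k sl T p).x j) i := by
  rw [destab_eq hi, prod_x]
  simp only [gatherRow_x, app]
  congr 1
  refine Finset.sum_congr rfl fun l _ => ?_
  rw [destabElim_eq, pivRow, pivRow]
  split
  · rfl
  · rename_i h
    have := piv₂_sub_lt (n := n) (k := k) (sl := sl) (T := T) h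
    rw [zero_add, outcomeTable_low (by rw [destabElim_eq] at this; omega)]
    rfl

/-- The second elimination supports all columns on its pivot rows. On a row unused by the first
elimination, the eliminated matrix agrees with the cleared `X` part, and this holds for the row
itself and for the pivot rows. -/
theorem destab_x_measured {i q : ℕ} (hi : i < n) (hK : Kept n k sl T i) (hq : q < k) :
    (destab n k sl T i).x (sl q) = 0 := by
  have hval : ∀ p, (E₁).used p = 0 → (clear n k sl T p).x (sl q) = unusedPart n k sl T p q := by
    intro p hp
    rw [unusedPart, if_pos hp, destabPart, measuredPart, if_pos hq, zero_add, clear]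
  rw [destab_x hi, ← (app_reduced (width k) q (hq.trans_le le_width)).2 i hi hK.2]
  exact app_congr (hval i hK.1) fun l hl h => hval _ (piv₂_unused hl h)

/-- A final destabilizer differs from the cleared one by cleared destabilizers that are pivots of
the second elimination. These are dual to stabilizers that are not kept, so duality among kept rows
survives. -/
theorem destab_stab (hT : Symp n T) {i j : ℕ} (hi : i < n) (hj : j < n) (hK : Kept n k sl T i)
    (hK' : Kept n k sl T j) :
    form n (destab n k sl T i) (stab n k sl T j) = if i = j then 1 else 0 := by
  rw [destab_form hi, app, clear_stab hT hi hj hK.1, Finset.sum_eq_zero, add_zero]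
  intro l hl
  rw [pivRow]
  split
  · rw [mul_zero]
  · rename_i h
    have hl' := Finset.mem_range.1 hl
    have h1 := piv_used hl' h
    refine (congrArg _ ((clear_stab hT (piv₂_sub_lt h) hj (piv₂_unused hl' h)).trans
      (if_neg ?_))).trans (mul_zero _)
    rintro rfl
    have := hK'.2
    rw [destabElim_eq] at this
    exact absurd (h1.symm.trans this) (by decide)

theorem destab_destab (hT : Symp n T) {i j : ℕ} (hi : i < n) (hj : j < n) (hK : Kept n k sl T i)
    (hK' : Kept n k sl T j) : form n (destab n k sl T i) (destab n k sl T j) = 0 := by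
  have key : ∀ p < n, (E₁).used p = 0 →
      form n (clear n k sl T p) (destab n k sl T j) = 0 := by
    intro p hp hu
    rw [form_comm, destab_form hj,
      ← app_zero_col (n := n) (Y := unusedPart n k sl T) (width k) j]
    exact app_congr (clear_clear hT hj hp hK'.1 hu) fun l hl h =>
      clear_clear hT (piv₂_sub_lt h) hp (piv₂_unused hl h) hu
  rw [destab_form hi, ← app_zero_col (n := n) (Y := unusedPart n k sl T) (width k) i]
  exact app_congr (key i hi hK.1) fun l hl h => key _ (piv₂_sub_lt h) (piv₂_unused hl h)

end

end Measurement

open PRow Elim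

theorem PRow.prod_induction {n : ℕ} {Q : PRow → Prop} (hmul : ∀ a b, Q a → Q b → Q (a.mul n b))
    {P : ℕ → PRow} {u : ℕ → ZMod 2} {a : PRow} (ha : Q a) (K : ℕ)
    (hP : ∀ c < K, u c ≠ 0 → Q (P c)) : Q (PRow.prod n P u a K) := by
  induction K with
  | zero => exact ha
  | succ K ih =>
    have := ih fun c hc => hP c (by omega)
    rw [PRow.prod]
    split
    · exact this
    · exact hmul _ _ this (hP K (by omega) (by assumption))

namespace Measurement

variable {n k : ℕ} {sl : ℕ → ℕ} {T : ℕ → PRow}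

local notation "E₁" => stabElim n k sl T
local notation "E₂" => destabElim n k sl T

/-! ### The constraints on the outcomes -/

/-- The coefficients of the constraint for the column `c`. -/
def coeff (n k : ℕ) (sl : ℕ → ℕ) (T : ℕ → PRow) (c c' : ℕ) : ZMod 2 :=
  (if c' = c then 1 else 0) +
    pivRow (stabElim n k sl T).piv (fun p => (stab n k sl T p).x (sl c)) c'

theorem sum_coeff {c : ℕ} (hc : c < k) (f : ℕ → ZMod 2) :
    ∑ c' ∈ Finset.range k, coeff n k sl T c c' * f c' = f c + ∑ c' ∈ Finset.range k,
      f c' * pivRow (E₁).piv (fun p => (stab n k sl T p).x (sl c)) c' := by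
  simp only [coeff, add_mul, Finset.sum_add_distrib, ite_mul, one_mul, zero_mul]
  rw [Finset.sum_ite_eq', if_pos (Finset.mem_range.2 hc)]
  congr 1
  exact Finset.sum_congr rfl fun _ _ => mul_comm _ _

/-- The `Z` part of the constraint for the column `c`. -/
def constraintZ (n k : ℕ) (sl : ℕ → ℕ) (T : ℕ → PRow) (c j : ℕ) : ZMod 2 :=
  ∑ c' ∈ Finset.range k, coeff n k sl T c c' * (if sl c' = j then 1 else 0)

theorem sum_constraintZ (hsl : ∀ c < k, sl c < n) (c : ℕ) (f : ℕ → ZMod 2) :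
    ∑ j ∈ Finset.range n, f j * constraintZ n k sl T c j =
      ∑ c' ∈ Finset.range k, coeff n k sl T c c' * f (sl c') := by
  simp only [constraintZ, Finset.mul_sum]
  rw [Finset.sum_comm]
  refine Finset.sum_congr rfl fun c' hc' => ?_
  have : ∀ j, f j * (coeff n k sl T c c' * (if sl c' = j then 1 else 0)) =
      if sl c' = j then coeff n k sl T c c' * f j else 0 := fun j => by
    split <;> ring
  simp only [this]
  rw [Finset.sum_ite_eq, if_pos (Finset.mem_range.2 (hsl c' (Finset.mem_range.1 hc')))]

/-- An unused stabilizer has no measured `X` part at all. A pivot stabilizer meets `Z` on qubit `c`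
and `Z` on its own pivot qubit with equal coefficients, and the two contributions cancel. -/
theorem stab_form_constraint (hT : Symp n T) (hsl : ∀ c < k, sl c < n) {c i : ℕ} (hc : c < k)
    (hi : i < n) : form n (stab n k sl T i) (ofZ (constraintZ n k sl T c)) = 0 := by
  rw [form_ofZ, sum_constraintZ hsl, sum_coeff hc (fun c' => (stab n k sl T i).x (sl c'))]
  beta_reduce
  by_cases hu : (E₁).used i = 0
  · rw [stab_x_unused hT hi hu hc, zero_add]
    refine Finset.sum_eq_zero fun c' hc' => ?_
    rw [stab_x_unused hT hi hu (Finset.mem_range.1 hc'), zero_mul]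
  · obtain ⟨q, hq, hp⟩ := (used_iff (n := n) (Y := measuredPart k sl T n) (width k) i).1
      (ne_zero_zmod hu)
    have hp0 : (E₁).piv q ≠ 0 := by rw [stabElim, hp]; omega
    rw [Finset.sum_eq_single q]
    · rw [stab_x_pivot hT hi hp0, stabElim, if_pos hp.symm, ← stabElim, one_mul, pivRow, if_neg hp0]
      rw [show (E₁).piv q - 1 = i by rw [stabElim, hp]; omega]
      exact add_self_zmod _
    · intro c' _ hne
      rw [pivRow]
      split
      · rw [mul_zero]
      · rename_i h
        rw [stab_x_pivot hT hi h, if_neg, zero_mul]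
        intro he
        exact hne (piv_inj ((lt_of_piv h).trans_le le_width) hq h (he.symm.trans hp.symm))
    · intro h
      exact absurd (Finset.mem_range.2 (lt_of_piv hp0)) h

/-- The coefficients of the constraint are the ones with which the pivot stabilizers enter column
`c` when a destabilizer is cleared, so both sides are the same sum. This is why the cleared table
already contains the coordinates of the constraints. -/
theorem destab_form_constraint (hsl : ∀ c < k, sl c < n) {c i : ℕ} (hc : c < k) (hi : i < n) :
    form n (T i) (ofZ (constraintZ n k sl T c)) = (clear n k sl T i).x (sl c) := by
  rw [form_ofZ, sum_constraintZ hsl, sum_coeff hc (fun c' => (T i).x (sl c')), clear_x hi]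

theorem outcomeTable_constraint (hk : 1 ≤ k) (hT : Symp n T) {c : ℕ} (hc : c < k) :
    outcomeTable n k sl T (3 * n + c) =
      PRow.prod n (fun r => T (n + r)) (fun r => (clear n k sl T r).x (sl c)) PRow.one n := by
  have hw : 0 < width k := by have := le_width (k := k); omega
  have hm : n ≤ (n / width k + 1) * width k := (lt_div_add_one_mul hw).le
  rw [outcomeTable, constraintTable, if_pos (by omega), prod_of_zero hm fun c hc => if_neg (by omega)]
  have h1 : clearTable n k sl T (3 * n + c) = PRow.one := by
    rw [clearTable_high (by omega), stabTable, mulTable, if_neg (by omega), hT.rest _ (by omega)]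
  rw [h1]
  refine PRow.prod_congr (fun r hr => ?_) fun r hr _ => ?_
  · rw [if_pos hr, destabPart, measuredPart, Nat.add_sub_cancel_left, if_pos hc, zero_add]
    rfl
  · beta_reduce
    rw [clearTable_high (by omega), stabTable_low (by omega)]

/-- The `Z`-type operator commutes with the reduced stabilizers, hence with the original ones
because the row operations are injective. By completeness it is the product of stabilizers with
exponents given by the destabilizers, and this product is what the program forms. -/
theorem constraint_spec (hk : 1 ≤ k) (hT : Symp n T) (hsl : ∀ c < k, sl c < n) {c j : ℕ}
    (hc : c < k) (hj : j < n) :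
    (outcomeTable n k sl T (3 * n + c)).x j = 0 ∧
    (outcomeTable n k sl T (3 * n + c)).z j = constraintZ n k sl T c j := by
  have hw : ∀ i < n, form n (T (n + i)) (ofZ (constraintZ n k sl T c)) = 0 := by
    refine app_injective (n := n) (Y := measuredPart k sl T n) (width k)
      (fun p => form n (T (n + p)) (ofZ (constraintZ n k sl T c))) fun i hi => ?_
    rw [← stab_form hT hi, stab_form_constraint hT hsl hc hi]
  have h := hT.complete _ hw j hj
  have e : ∀ i ∈ Finset.range n, form n (T i) (ofZ (constraintZ n k sl T c)) =
      (clear n k sl T i).x (sl c) := fun i hi =>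
    destab_form_constraint hsl hc (Finset.mem_range.1 hi)
  rw [outcomeTable_constraint hk hT hc, prod_x, prod_z]
  constructor
  · refine ((zero_add _).trans ?_).trans h.1.symm
    exact Finset.sum_congr rfl fun i hi => by rw [e i hi]
  · refine ((zero_add _).trans ?_).trans h.2.symm
    exact Finset.sum_congr rfl fun i hi => by rw [e i hi]

/-- Distinct columns belong to distinct qubits, so the entry on a measured qubit consists of a
single coefficient. -/
theorem constraint_z (hk : 1 ≤ k) (hT : Symp n T) (hsl : ∀ c < k, sl c < n)
    (hinj : ∀ c < k, ∀ c' < k, sl c = sl c' → c = c') {c c' : ℕ} (hc : c < k) (hc' : c' < k) :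
    (outcomeTable n k sl T (3 * n + c)).z (sl c') = coeff n k sl T c c' := by
  rw [(constraint_spec hk hT hsl hc (hsl c' hc')).2, constraintZ, Finset.sum_eq_single c']
  · rw [if_pos rfl, mul_one]
  · intro d hd hne
    rw [if_neg fun h => hne (hinj _ (Finset.mem_range.1 hd) _ hc' h), mul_zero]
  · intro h
    exact absurd (Finset.mem_range.2 hc') h

/-- Sums over the constraint for a column `c` without a pivot. -/
theorem sum_constraint (hk : 1 ≤ k) (hT : Symp n T) (hsl : ∀ c < k, sl c < n)
    (hinj : ∀ c < k, ∀ c' < k, sl c = sl c' → c = c') {c : ℕ} (hc : c < k) (h0 : (E₁).piv c = 0)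
    (f : ℕ → ZMod 2) :
    ∑ j ∈ Finset.range n, (outcomeTable n k sl T (3 * n + c)).z j * f j =
      f (sl c) + ∑ c' ∈ Finset.range k, (if (E₁).piv c' = 0 then 0 else
        (outcomeTable n k sl T (3 * n + c)).z (sl c') * f (sl c')) := by
  have e : ∀ j ∈ Finset.range n, (outcomeTable n k sl T (3 * n + c)).z j * f j =
      f j * constraintZ n k sl T c j := fun j hj => by
    rw [(constraint_spec hk hT hsl hc (Finset.mem_range.1 hj)).2, mul_comm]
  rw [Finset.sum_congr rfl e, sum_constraintZ hsl, sum_coeff hc (fun c' => f (sl c'))]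
  congr 1
  refine Finset.sum_congr rfl fun c' hc' => ?_
  rw [constraint_z hk hT hsl hinj hc (Finset.mem_range.1 hc'), coeff, pivRow]
  by_cases h : (E₁).piv c' = 0
  · rw [if_pos h, if_pos h, mul_zero]
  · rw [if_neg h, if_neg h, if_neg (by rintro rfl; exact h h0), zero_add, mul_comm]

/-! ### Predicates on the rows -/

/-- Used for the property that the operator fixes the state: it passes to all products of
stabilizers, phases included. -/
theorem stab_induction {Q : PRow → Prop} (hmul : ∀ a b, Q a → Q b → Q (a.mul n b))
    (hone : Q PRow.one) (hT : Symp n T) (hQ : ∀ i < n, Q (T (n + i))) {i : ℕ} (hi : i < n) :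
    Q (stab n k sl T i) := by
  rw [stab_eq hi]
  refine PRow.prod_induction hmul ?_ _ fun c _ _ => ?_
  · rw [hT.copy i hi]
    exact hQ i hi
  · rw [gatherRow]
    split
    · exact hone
    · exact hQ _ (piv_sub_lt (by assumption))

theorem constraint_induction {Q : PRow → Prop} (hmul : ∀ a b, Q a → Q b → Q (a.mul n b))
    (hone : Q PRow.one) (hk : 1 ≤ k) (hT : Symp n T) (hQ : ∀ i < n, Q (T (n + i))) {c : ℕ}
    (hc : c < k) : Q (outcomeTable n k sl T (3 * n + c)) := by
  rw [outcomeTable_constraint hk hT hc]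
  exact PRow.prod_induction hmul hone _ fun c hc _ => hQ c hc

/-! ### The number of rows that are kept -/

/-- The column was cleared, so it is zero in the second elimination and stays zero under row
operations; no row can be chosen for it. -/
theorem piv₂_eq_zero (hT : Symp n T) {c : ℕ} (hc : c < k) (h : (E₁).piv c ≠ 0) :
    (E₂).piv c = 0 := by
  have hc' : c < width k := hc.trans_le le_width
  rw [destabElim_eq, run_piv hc']
  by_contra h0
  have hs := (choose_spec (n := n) (Y := unusedPart n k sl T) c).2 h0
  have hz : ∀ p < n, unusedPart n k sl T p c = 0 := fun p hp => by
    rw [unusedPart, destabPart, measuredPart, if_pos hc, zero_add]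
    exact ite_eq_right_iff.2 fun _ => clear_x_pivot hT hp h
  have h1 := hs.2.2
  rw [← app_col c c le_rfl] at h1
  have : app n (unusedPart n k sl T) c (fun p => unusedPart n k sl T p c)
      ((run n (unusedPart n k sl T) c).choose n c - 1) =
      app n (unusedPart n k sl T) c (fun _ => 0)
      ((run n (unusedPart n k sl T) c).choose n c - 1) := by
    refine app_congr (hz _ hs.1) fun l _ hl => hz _ ?_
    have := run_piv_le (n := n) (Y := unusedPart n k sl T) c l
    omega
  rw [this, app_zero_col] at h1
  exact absurd h1 (by decide)

theorem exists_pivot_of_not_kept {i : ℕ} (h : ¬ Kept n k sl T i) :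
    ∃ c < k, (E₁).piv c = i + 1 ∨ (E₂).piv c = i + 1 := by
  rw [Kept, not_and_or] at h
  rcases h with h | h
  · obtain ⟨c, -, hp⟩ := (used_iff (n := n) (Y := measuredPart k sl T n) (width k) i).1
      (ne_zero_zmod h)
    exact ⟨c, lt_of_piv (by rw [stabElim, hp]; omega), Or.inl hp⟩
  · obtain ⟨c, -, hp⟩ := (used_iff (n := n) (Y := unusedPart n k sl T) (width k) i).1
      (ne_zero_zmod h)
    refine ⟨c, ?_, Or.inr hp⟩
    by_contra hc
    have := run_piv_eq_zero (n := n) (Y := unusedPart n k sl T) (width k) c k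
      (fun i c hc => by
        rw [unusedPart, destabPart, measuredPart_eq_zero _ _ _ hc, ite_self]) (by omega)
    omega

/-- Send a discarded row to the column in which it is a pivot. Each column has at most one pivot row
in the two eliminations together, so this map is injective. -/
theorem card_not_kept_le (hT : Symp n T) :
    ((Finset.range n).filter fun i => ¬ Kept n k sl T i).card ≤ k := by
  have h : ∀ i, ∃ c, ¬ Kept n k sl T i → c < k ∧ ((E₁).piv c = i + 1 ∨ (E₂).piv c = i + 1) := by
    intro i
    by_cases hi : Kept n k sl T i
    · exact ⟨0, fun h => absurd hi h⟩
    · obtain ⟨c, h⟩ := exists_pivot_of_not_kept hi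
      exact ⟨c, fun _ => h⟩
  choose f hf using h
  refine (Finset.card_le_card_of_injOn (t := Finset.range k) f (fun i hi => ?_) fun i hi j hj hij => ?_).trans
    (Finset.card_range k).le
  · have := hf i (Finset.mem_filter.1 hi).2
    simpa using this.1
  · have h1 := hf i (Finset.mem_filter.1 hi).2
    have h2 := hf j (Finset.mem_filter.1 hj).2
    rw [← hij] at h2
    have h3 := piv₂_eq_zero (n := n) (sl := sl) (T := T) hT h1.1
    omega

end Measurement

/-! ### Pauli operators with phases in `ℤ/4` -/

/-- The sign `(-1)^a`. -/
def sgn (a : ZMod 2) : ℂ := (-1) ^ a.val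

theorem sgn_zero : sgn 0 = 1 := by simp [sgn]

theorem sgn_one : sgn 1 = -1 := by rw [sgn, show (1 : ZMod 2).val = 1 from rfl, pow_one]

theorem sgn_add (a b : ZMod 2) : sgn (a + b) = sgn a * sgn b := by
  rcases two_or a with rfl | rfl <;> rcases two_or b with rfl | rfl <;>
    simp [sgn_zero, sgn_one, show (1 : ZMod 2) + 1 = 0 from rfl]

theorem sgn_mul_self (a : ZMod 2) : sgn a * sgn a = 1 := by
  rw [← sgn_add, add_self_zmod, sgn_zero]

theorem sgn_injective : Function.Injective sgn := by
  intro a b h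
  rcases two_or a with rfl | rfl <;> rcases two_or b with rfl | rfl <;>
    simp only [sgn_zero, sgn_one] at h <;> first | rfl | (norm_num at h)

theorem norm_sgn (a : ZMod 2) : ‖sgn a‖ = 1 := by simp [sgn]

theorem star_sgn (a : ZMod 2) : star (sgn a) = sgn a := by simp [sgn]

/-- The phase `i^p`. -/
def iph (p : ZMod 4) : ℂ := Complex.I ^ p.val

theorem iph_natCast (a : ℕ) : iph (a : ZMod 4) = Complex.I ^ a := by
  rw [iph, ZMod.val_natCast]
  conv_rhs => rw [← Nat.div_add_mod a 4, pow_add, pow_mul, Complex.I_pow_four, one_pow, one_mul]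

theorem iph_add (p q : ZMod 4) : iph (p + q) = iph p * iph q := by
  have h : p + q = ((p.val + q.val : ℕ) : ZMod 4) := by simp
  rw [h, iph_natCast, pow_add]
  rfl

theorem iph_zero : iph 0 = 1 := by simp [iph]

theorem iph_twice (a : ZMod 2) : iph (twice a) = sgn a := by
  have h : twice a = ((2 * a.val : ℕ) : ZMod 4) := by simp [twice]
  rw [h, iph_natCast, pow_mul, Complex.I_sq]
  rfl

theorem norm_iph (p : ZMod 4) : ‖iph p‖ = 1 := by simp [iph]

theorem iph_mul_neg (p : ZMod 4) : iph p * iph (-p) = 1 := by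
  rw [← iph_add, add_neg_cancel, iph_zero]

theorem star_iph (p : ZMod 4) : star (iph p) = iph (-p) := by
  have h : iph p ≠ 0 := fun h => by have := norm_iph p; rw [h] at this; simp at this
  refine mul_left_cancel₀ h ?_
  rw [iph_mul_neg, Complex.star_def, Complex.mul_conj, Complex.normSq_eq_norm_sq, norm_iph]
  norm_num

theorem iph_injective : Function.Injective iph := by
  intro p q h
  have h1 : iph (p - q) = 1 := by
    rw [sub_eq_add_neg, iph_add, h, ← iph_add, add_neg_cancel, iph_zero]
  have key : ∀ r : ZMod 4, iph r = 1 → r = 0 := by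
    intro r hr
    have h4 : r.val < 4 := r.val_lt
    rw [iph] at hr
    by_contra hne
    have h0 : r.val ≠ 0 := by rwa [Ne, ZMod.val_eq_zero]
    have : r.val = 1 ∨ r.val = 2 ∨ r.val = 3 := by omega
    rcases this with h | h | h <;> rw [h] at hr <;> norm_num [Complex.ext_iff, pow_succ] at hr
  exact sub_eq_zero.1 (key _ h1)

section

variable {ι : Type} [Fintype ι] [DecidableEq ι]

theorem bits_add_self (a : Bits ι) : a + a = 0 := funext fun _ => add_self_zmod _

theorem bits_add_cancel (y a : Bits ι) : y + a + a = y := by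
  rw [add_assoc, bits_add_self, add_zero]

theorem bits_eq_add_iff (x y a : Bits ι) : x = y + a ↔ y = x + a := by
  constructor <;> rintro rfl <;> rw [bits_add_cancel]

/-- The Pauli operator `i^p X^a Z^b`. -/
def phOp (p : ZMod 4) (a b : Bits ι) : Matrix (Bits ι) (Bits ι) ℂ := iph p • pauliXZ a b

theorem phOp_apply (p : ZMod 4) (a b x y : Bits ι) :
    phOp p a b x y = if x = y + a then iph p * sgn (b ⬝ᵥ y) else 0 := by
  rw [phOp, Matrix.smul_apply, pauliXZ, Matrix.of_apply, smul_eq_mul, mul_ite, mul_zero]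
  rfl

theorem phOp_mulVec (p : ZMod 4) (a b : Bits ι) (ψ : QVec ι) :
    phOp p a b *ᵥ ψ = fun y => iph p * sgn (b ⬝ᵥ (y + a)) * ψ (y + a) := by
  funext x
  rw [Matrix.mulVec, dotProduct, Finset.sum_eq_single (x + a)]
  · rw [phOp_apply, if_pos (bits_add_cancel x a).symm]
  · intro y _ hy
    rw [phOp_apply, if_neg fun h => hy ((bits_eq_add_iff x y a).1 h), zero_mul]
  · intro h
    exact absurd (Finset.mem_univ _) h

theorem phOp_mul (p q : ZMod 4) (a b a' b' : Bits ι) :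
    phOp p a b * phOp q a' b' = phOp (p + q + twice (b ⬝ᵥ a')) (a + a') (b + b') := by
  ext x y
  rw [Matrix.mul_apply, Finset.sum_eq_single (y + a')]
  · rw [phOp_apply, phOp_apply, phOp_apply, if_pos (rfl : y + a' = y + a'), add_assoc y a' a,
      add_comm a' a]
    by_cases h : x = y + (a + a')
    · rw [if_pos h, if_pos h, iph_add, iph_add, iph_twice, dotProduct_add, add_dotProduct, sgn_add,
        sgn_add]
      ring
    · rw [if_neg h, if_neg h, zero_mul]
  · intro z _ hz
    rw [phOp_apply q, if_neg hz, mul_zero]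
  · intro h
    exact absurd (Finset.mem_univ _) h

theorem phOp_zero : phOp 0 (0 : Bits ι) 0 = 1 := by
  ext x y
  rw [phOp_apply, Matrix.one_apply, add_zero, zero_dotProduct, sgn_zero, iph_zero, mul_one]

theorem phOp_add_twice (p : ZMod 4) (c : ZMod 2) (a b : Bits ι) :
    phOp (p + twice c) a b = sgn c • phOp p a b := by
  rw [phOp, phOp, iph_add, iph_twice, mul_comm, mul_smul]

theorem phOp_ne_zero (p : ZMod 4) (a b : Bits ι) : phOp p a b ≠ 0 := by
  intro h
  have := congrFun (congrFun h a) 0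
  rw [phOp_apply, if_pos (zero_add a).symm, dotProduct_zero, sgn_zero, mul_one] at this
  have h1 := norm_iph p
  rw [this] at h1
  simp at h1

/-- The adjoint reverses the order of the two parts, and restoring it costs the sign of `b ⬝ᵥ a`. An
operator is thus Hermitian when twice its phase equals this sign. -/
theorem phOp_conjTranspose (p : ZMod 4) (a b : Bits ι) :
    (phOp p a b)ᴴ = phOp (-p + twice (b ⬝ᵥ a)) a b := by
  ext x y
  rw [Matrix.conjTranspose_apply, phOp_apply, phOp_apply]
  by_cases h : y = x + a
  · rw [if_pos h, if_pos ((bits_eq_add_iff y x a).1 h), star_mul', star_iph, star_sgn, iph_add,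
      iph_twice, h, dotProduct_add, sgn_add]
    linear_combination (- iph (-p) * sgn (b ⬝ᵥ x)) * sgn_mul_self (b ⬝ᵥ a)
  · rw [if_neg h, if_neg fun h' => h ((bits_eq_add_iff y x a).2 h'), star_zero]

theorem phOp_conjTranspose_mul_self (p : ZMod 4) (a b : Bits ι) :
    (phOp p a b)ᴴ * phOp p a b = 1 := by
  rw [phOp_conjTranspose, phOp_mul, bits_add_self, bits_add_self, ← phOp_zero]
  congr 1
  have : twice (b ⬝ᵥ a) + twice (b ⬝ᵥ a) = 0 := by rw [← twice_add, add_self_zmod]; rfl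
  linear_combination this

/-- The symplectic form. -/
def sympl (a b a' b' : Bits ι) : ZMod 2 := a ⬝ᵥ b' + b ⬝ᵥ a'

theorem phOp_mul_comm (p q : ZMod 4) (a b a' b' : Bits ι) :
    phOp p a b * phOp q a' b' = sgn (sympl a b a' b') • (phOp q a' b' * phOp p a b) := by
  rw [phOp_mul, phOp_mul, ← phOp_add_twice, add_comm a', add_comm b']
  congr 1
  rw [sympl, twice_add, dotProduct_comm b' a]
  have : twice (a ⬝ᵥ b') + twice (a ⬝ᵥ b') = 0 := by rw [← twice_add, add_self_zmod]; rfl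
  linear_combination -this

/-- The symplectic form is determined by the commutation relation. -/
theorem sympl_eq_of_mul_comm {p q : ZMod 4} {a b a' b' : Bits ι} {c : ZMod 2}
    (h : phOp p a b * phOp q a' b' = sgn c • (phOp q a' b' * phOp p a b)) :
    sympl a b a' b' = c := by
  rw [phOp_mul_comm] at h
  have h' := sub_eq_zero.2 h
  rw [← sub_smul, phOp_mul, smul_eq_zero, or_iff_left (phOp_ne_zero _ _ _), sub_eq_zero] at h'
  exact sgn_injective h'

theorem phasedPauli_eq (α β : ZMod 2) (a b : Bits ι) :
    phasedPauli α β a b = phOp ((α.val : ZMod 4) + twice β) a b := by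
  rw [phasedPauli, phOp, iph_add, iph_twice, iph_natCast]
  rfl

theorem pauliXZ_eq (a b : Bits ι) : pauliXZ a b = phOp 0 a b := by
  rw [phOp, iph_zero, one_smul]

end

/-! ### Tableaux from the commutation relations -/

section

variable {ι R : Type} [DecidableEq ι] [Ring R] {x : ι → R}

/-- The product of the powers `x i ^ y i`, in the order of a list. -/
def listPow (x : ι → R) (l : List ι) (y : Bits ι) : R := (l.map fun i => x i ^ (y i).val).prod

theorem listPow_cons (i : ι) (l : List ι) (y : Bits ι) :
    listPow x (i :: l) y = x i ^ (y i).val * listPow x l y := by simp [listPow]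

theorem commute_listPow {a : R} (h : ∀ i, Commute a (x i)) (l : List ι) (y : Bits ι) :
    Commute a (listPow x l y) := by
  induction l with
  | nil => exact Commute.one_right a
  | cons i l ih =>
    rw [listPow_cons]
    exact ((h i).pow_right _).mul_right ih

theorem pow_val_add {a : R} (h : a * a = 1) (u v : ZMod 2) :
    a ^ (u + v).val = a ^ u.val * a ^ v.val := by
  rcases two_or u with rfl | rfl <;> rcases two_or v with rfl | rfl <;>
    simp [show (1 : ZMod 2) + 1 = 0 from rfl, show (1 : ZMod 2).val = 1 from rfl, h]

theorem listPow_add (hx : ∀ i j, Commute (x i) (x j)) (h1 : ∀ i, x i * x i = 1) (l : List ι)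
    (y y' : Bits ι) : listPow x l (y + y') = listPow x l y * listPow x l y' := by
  induction l with
  | nil => simp [listPow]
  | cons i l ih =>
    have := (commute_listPow (hx i) l y).pow_left (y' i).val
    rw [listPow_cons, listPow_cons, listPow_cons, Pi.add_apply, pow_val_add (h1 i), ih, mul_assoc,
      mul_assoc, ← mul_assoc (x i ^ (y' i).val), this.eq, mul_assoc]

theorem listPow_zero (l : List ι) : listPow x l 0 = 1 := by
  induction l with
  | nil => rfl
  | cons i l ih => rw [listPow_cons, ih]; simp

theorem listPow_single {l : List ι} (hl : l.Nodup) (j : ι) :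
    listPow x l (Pi.single j 1) = if j ∈ l then x j else 1 := by
  induction l with
  | nil => rfl
  | cons i l ih =>
    rw [List.nodup_cons] at hl
    rw [listPow_cons, ih hl.2]
    by_cases h : j = i
    · subst h
      simp [hl.1, show (1 : ZMod 2).val = 1 from rfl]
    · rw [Pi.single_eq_of_ne (Ne.symm h)]
      simp [h]

theorem listPow_star [StarRing R] (hx : ∀ i j, Commute (x i) (x j)) (hs : ∀ i, star (x i) = x i)
    (l : List ι) (y : Bits ι) : star (listPow x l y) = listPow x l y := by
  induction l with
  | nil => exact star_one R
  | cons i l ih =>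
    rw [listPow_cons, star_mul, ih, star_pow, hs]
    exact ((commute_listPow (hx i) l y).pow_left _).eq.symm

/-- Each factor is passed with its own sign, and only the factor `j` anticommutes with `z`, so the
total sign is the bit `y j` when the list is duplicate-free and contains `j`. -/
theorem mul_listPow [Algebra ℂ R] {z : R} {j : ι}
    (hz : ∀ i, z * x i = sgn (if i = j then 1 else 0) • (x i * z)) (l : List ι) (y : Bits ι) :
    z * listPow x l y =
      sgn ((l.map fun i => if i = j then y i else 0).sum) • (listPow x l y * z) := by
  induction l with
  | nil => simp [listPow, sgn_zero]
  | cons i l ih =>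
    have h1 : z * x i ^ (y i).val = sgn (if i = j then y i else 0) • (x i ^ (y i).val * z) := by
      rcases two_or (y i) with h | h
      · rw [h]; simp [sgn_zero]
      · rw [h, show (1 : ZMod 2).val = 1 from rfl, pow_one, hz]
    rw [listPow_cons, ← mul_assoc, h1, smul_mul_assoc, mul_assoc, ih, List.map_cons, List.sum_cons,
      sgn_add, mul_smul_comm, smul_smul, mul_assoc]

end

/-! ### Clifford unitaries from a state and dual families of operators. -/

section

variable {ι : Type} [Fintype ι] [DecidableEq ι]

theorem sum_norm_sq_eq (ψ : QVec ι) : ((∑ x, ‖ψ x‖ ^ 2 : ℝ) : ℂ) = star ψ ⬝ᵥ ψ := by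
  rw [dotProduct, Complex.ofReal_sum]
  refine Finset.sum_congr rfl fun x _ => ?_
  rw [Pi.star_apply, Complex.star_def, mul_comm, Complex.mul_conj, Complex.normSq_eq_norm_sq]

/-- The unitary with columns `x^y ψ`. -/
theorem exists_unitary {ψ : QVec ι} {x z : ι → Matrix (Bits ι) (Bits ι) ℂ} (hψ : star ψ ⬝ᵥ ψ = 1)
    (hx : ∀ i j, Commute (x i) (x j)) (h1 : ∀ i, x i * x i = 1) (hs : ∀ i, star (x i) = x i)
    (hzu : ∀ j, (z j)ᴴ * z j = 1)
    (hzx : ∀ j i, z j * x i = sgn (if i = j then 1 else 0) • (x i * z j))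
    (hz : ∀ j, z j *ᵥ ψ = ψ) :
    ∃ Q ∈ Matrix.unitaryGroup (Bits ι) ℂ,
      (∀ j, Q * pauliXZ (Pi.single j 1) 0 * Qᴴ = x j) ∧
      (∀ j, Q * pauliXZ 0 (Pi.single j 1) * Qᴴ = z j) := by
  let U : Bits ι → Matrix (Bits ι) (Bits ι) ℂ := listPow x Finset.univ.toList
  have hU : ∀ y y', U (y + y') = U y * U y' := listPow_add hx h1 _
  have hU1 : ∀ j, U (Pi.single j 1) = x j := fun j =>
    (listPow_single (Finset.nodup_toList _) j).trans (if_pos (by simp))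
  have hUs : ∀ y, (U y)ᴴ = U y := listPow_star hx hs _
  have hzU : ∀ j y, z j * U y = sgn (y j) • (U y * z j) := by
    intro j y
    have := mul_listPow (hzx j) Finset.univ.toList y
    rwa [Finset.sum_map_toList, Finset.sum_ite_eq', if_pos (Finset.mem_univ _)] at this
  let Q : Matrix (Bits ι) (Bits ι) ℂ := Matrix.of fun a y => (U y *ᵥ ψ) a
  have hcol : ∀ (P : Matrix (Bits ι) (Bits ι) ℂ) (a y), (P * Q) a y = (P *ᵥ (U y *ᵥ ψ)) a :=
    fun P a y => rfl
  -- If the bit `v j` is set, `z j` anticommutes with `U v` while fixing `ψ`, so the inner product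
  -- equals its own negative.
  have horth : ∀ v : Bits ι, star ψ ⬝ᵥ (U v *ᵥ ψ) = if v = 0 then 1 else 0 := by
    intro v
    split
    · rename_i h
      rw [h, show U 0 = 1 from listPow_zero _, Matrix.one_mulVec, hψ]
    · rename_i h
      obtain ⟨j, hj⟩ : ∃ j, v j ≠ 0 := by
        by_contra h'
        push Not at h'
        exact h (funext h')
      have e : star ψ ⬝ᵥ (U v *ᵥ ψ) = sgn (v j) • (star ψ ⬝ᵥ (U v *ᵥ ψ)) := by
        conv_lhs => rw [← hz j]
        rw [Matrix.star_mulVec, ← Matrix.dotProduct_mulVec, Matrix.mulVec_mulVec,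
          Matrix.mulVec_mulVec]
        have : U v * z j = sgn (v j) • (z j * U v) := by
          rw [hzU, smul_smul, sgn_mul_self, one_smul]
        rw [mul_assoc, this, mul_smul_comm, ← mul_assoc, hzu, one_mul, Matrix.smul_mulVec, dotProduct_smul]
      rw [ne_zero_zmod hj, sgn_one, smul_eq_mul] at e
      have : (2 : ℂ) * (star ψ ⬝ᵥ (U v *ᵥ ψ)) = 0 := by linear_combination e
      simpa using this
  -- The operators `U y` are Hermitian and multiply like translations, so the Gram matrix of the
  -- columns consists of the inner products `horth` at `y + y'`.
  have hQ : star Q * Q = 1 := by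
    ext y y'
    have : (star Q * Q) y y' = star (U y *ᵥ ψ) ⬝ᵥ (U y' *ᵥ ψ) := rfl
    rw [this, Matrix.star_mulVec, ← Matrix.dotProduct_mulVec, Matrix.mulVec_mulVec, hUs, ← hU,
      horth, Matrix.one_apply]
    congr 1
    rw [eq_iff_iff]
    constructor
    · intro h
      rw [← bits_add_cancel y y', h, zero_add]
    · rintro rfl
      exact bits_add_self y
  -- The matrix is square: there are as many columns as basis states.
  have hQ' : Q * Qᴴ = 1 := mul_eq_one_comm.1 hQ
  refine ⟨Q, Matrix.mem_unitaryGroup_iff'.2 hQ, fun j => ?_, fun j => ?_⟩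
  · have : Q * pauliXZ (Pi.single j 1) 0 = x j * Q := by
      ext a y
      rw [hcol, Matrix.mulVec_mulVec, ← hU1, ← hU, Matrix.mul_apply,
        Finset.sum_eq_single (y + Pi.single j 1)]
      · rw [pauliXZ_eq, phOp_apply, if_pos rfl, zero_dotProduct, sgn_zero, iph_zero, mul_one, mul_one,
          add_comm]
        rfl
      · intro b _ hb
        rw [pauliXZ_eq, phOp_apply, if_neg hb, mul_zero]
      · intro h
        exact absurd (Finset.mem_univ _) h
    rw [this, mul_assoc, hQ', mul_one]
  · have : Q * pauliXZ 0 (Pi.single j 1) = z j * Q := by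
      ext a y
      rw [hcol, Matrix.mulVec_mulVec, hzU, Matrix.smul_mulVec, ← Matrix.mulVec_mulVec, hz,
        Matrix.mul_apply, Finset.sum_eq_single y]
      · rw [pauliXZ_eq, phOp_apply, if_pos (add_zero y).symm, single_dotProduct, one_mul, iph_zero,
          one_mul, mul_comm]
        rfl
      · intro b _ hb
        rw [pauliXZ_eq, phOp_apply, if_neg (by rwa [add_zero]), mul_zero]
      · intro h
        exact absurd (Finset.mem_univ _) h
    rw [this, mul_assoc, hQ', mul_one]

namespace Tableau

/-- The phase of a row. -/
def phase (T : Tableau ι) (j : ι ⊕ ι) : ZMod 4 := ((T.p j).val : ZMod 4) + twice (T.s j)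

/-- The `X` part of a row. -/
def xPart (T : Tableau ι) (j : ι ⊕ ι) : Bits ι := fun i => T.M j (Sum.inl i)

/-- The `Z` part of a row. -/
def zPart (T : Tableau ι) (j : ι ⊕ ι) : Bits ι := fun i => T.M j (Sum.inr i)

theorem row_eq (T : Tableau ι) (j : ι ⊕ ι) :
    T.row j = phOp (T.phase j) (T.xPart j) (T.zPart j) := phasedPauli_eq _ _ _ _

/-- The symplectic form of two rows. -/
def form (T : Tableau ι) (i j : ι ⊕ ι) : ZMod 2 :=
  sympl (T.xPart i) (T.zPart i) (T.xPart j) (T.zPart j)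

theorem row_comm (T : Tableau ι) (i j : ι ⊕ ι) :
    T.row i * T.row j = sgn (T.form i j) • (T.row j * T.row i) := by
  rw [row_eq, row_eq, phOp_mul_comm]
  rfl

/-- The parity condition `hp` makes the destabilizers Hermitian involutions, so `exists_unitary`
applies. Their signs are arbitrary, since changing them only changes the unitary and not the state
that is fixed. -/
theorem isTableauOf_of_form {T : Tableau ι} {ψ : QVec ι} (hψ : ∑ x, ‖ψ x‖ ^ 2 = 1)
    (hxx : ∀ i j, T.form (Sum.inl i) (Sum.inl j) = 0)
    (hzx : ∀ i j, T.form (Sum.inr j) (Sum.inl i) = if i = j then 1 else 0)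
    (hp : ∀ i, T.p (Sum.inl i) = T.zPart (Sum.inl i) ⬝ᵥ T.xPart (Sum.inl i))
    (hz : ∀ j, T.row (Sum.inr j) *ᵥ ψ = ψ) : T.IsTableauOf ψ := by
  have hphase : ∀ i, T.phase (Sum.inl i) + T.phase (Sum.inl i) =
      twice (T.zPart (Sum.inl i) ⬝ᵥ T.xPart (Sum.inl i)) := by
    intro i
    rw [← hp, phase]
    generalize T.p (Sum.inl i) = a
    generalize T.s (Sum.inl i) = b
    revert a b
    decide
  have hd : ∀ a : ZMod 2, twice a + twice a = 0 := by decide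
  refine ⟨?_, hψ, hz⟩
  obtain ⟨Q, hQ, h1, h2⟩ := exists_unitary (ψ := ψ) (x := fun i => T.row (Sum.inl i))
    (z := fun i => T.row (Sum.inr i)) (by rw [← sum_norm_sq_eq, hψ, Complex.ofReal_one])
    (fun i j => by
      rw [commute_iff_eq, row_comm, hxx, sgn_zero, one_smul])
    (fun i => by
      beta_reduce
      rw [row_eq, phOp_mul, bits_add_self, bits_add_self, hphase, hd, phOp_zero])
    (fun i => by
      beta_reduce
      rw [row_eq, Matrix.star_eq_conjTranspose, phOp_conjTranspose, ← hphase]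
      congr 1
      ring)
    (fun i => by
      beta_reduce
      rw [row_eq, phOp_conjTranspose_mul_self])
    (fun j i => by
      beta_reduce
      rw [row_comm, hzx]) hz
  exact ⟨Q, hQ, h1, h2⟩

/-- The rows of a Clifford tableau satisfy the relations of the Pauli operators. -/
theorem form_of_represents {T : Tableau ι} {Q : Matrix (Bits ι) (Bits ι) ℂ}
    (hQ : Q ∈ Matrix.unitaryGroup (Bits ι) ℂ) (h : T.Represents Q) (i j : ι) :
    T.form (Sum.inl i) (Sum.inl j) = 0 ∧ T.form (Sum.inr i) (Sum.inr j) = 0 ∧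
    T.form (Sum.inl i) (Sum.inr j) = if i = j then 1 else 0 := by
  have hQ' : Qᴴ * Q = 1 := Matrix.mem_unitaryGroup_iff'.1 hQ
  -- Conjugation by a unitary is multiplicative, so commutation signs are those of the standard
  -- operators.
  have key : ∀ (r r' : ι ⊕ ι) (a b a' b' : Bits ι), Q * pauliXZ a b * Qᴴ = T.row r →
      Q * pauliXZ a' b' * Qᴴ = T.row r' → T.form r r' = sympl a b a' b' := by
    intro r r' a b a' b' h1 h2
    have hmul : ∀ A B : Matrix (Bits ι) (Bits ι) ℂ,
        Q * A * Qᴴ * (Q * B * Qᴴ) = Q * (A * B) * Qᴴ := fun A B => by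
      calc Q * A * Qᴴ * (Q * B * Qᴴ) = Q * A * (Qᴴ * Q) * B * Qᴴ := by simp only [mul_assoc]
        _ = _ := by rw [hQ', mul_one]; simp only [mul_assoc]
    refine sympl_eq_of_mul_comm (p := T.phase r) (q := T.phase r') ?_
    rw [← row_eq, ← row_eq, ← h1, ← h2, hmul, hmul, pauliXZ_eq, pauliXZ_eq, phOp_mul_comm,
      mul_smul_comm, smul_mul_assoc]
  refine ⟨?_, ?_, ?_⟩
  · rw [key _ _ _ _ _ _ (h.1 i) (h.1 j), sympl, dotProduct_zero, zero_dotProduct, add_zero]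
  · rw [key _ _ _ _ _ _ (h.2 i) (h.2 j), sympl, dotProduct_zero, zero_dotProduct, add_zero]
  · rw [key _ _ _ _ _ _ (h.1 i) (h.2 j), sympl, dotProduct_zero, add_zero, single_dotProduct,
      one_mul, Pi.single_apply]

end Tableau

end

/-! ### The rows of a tableau on `n` qubits -/

namespace PRow

variable {n : ℕ}

/-- The `X` part, as a bit string on `n` qubits. -/
def xs (n : ℕ) (R : PRow) : Bits (Fin n) := fun j => R.x j

/-- The `Z` part, as a bit string on `n` qubits. -/
def zs (n : ℕ) (R : PRow) : Bits (Fin n) := fun j => R.z j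

/-- The Pauli operator of a row. -/
def toOp (n : ℕ) (R : PRow) : Matrix (Bits (Fin n)) (Bits (Fin n)) ℂ := phOp R.ph (R.xs n) (R.zs n)

theorem toOp_mul (a b : PRow) : (a.mul n b).toOp n = a.toOp n * b.toOp n := by
  rw [toOp, toOp, toOp, phOp_mul, mul, Finset.sum_range]
  rfl

theorem toOp_one : one.toOp n = 1 := phOp_zero

theorem form_eq_sympl (a b : PRow) : form n a b = sympl (a.xs n) (a.zs n) (b.xs n) (b.zs n) := by
  rw [form, sympl, dotProduct, dotProduct, ← Finset.sum_add_distrib, Finset.sum_range]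
  rfl

end PRow

theorem position_fin {n : ℕ} (i : Fin n) : position i = i := by
  rw [position]
  convert Fin.card_Iio i using 2
  ext j
  simp

section

variable {n : ℕ}

/-- The function on numbers of rows for a function on rows. -/
def onSlots (f : Fin n ⊕ Fin n → ZMod 2) (r : ℕ) : ZMod 2 :=
  if h : r < n then f (Sum.inl ⟨r, h⟩) else if h : r - n < n then f (Sum.inr ⟨r - n, h⟩) else 0

theorem onSlots_inl (f : Fin n ⊕ Fin n → ZMod 2) (i : Fin n) : onSlots f i = f (Sum.inl i) :=
  dif_pos i.2

theorem onSlots_inr (f : Fin n ⊕ Fin n → ZMod 2) (i : Fin n) :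
    onSlots f (n + i) = f (Sum.inr i) := by
  have h : n + (i : ℕ) - n = i := by omega
  rw [onSlots, dif_neg (by omega), dif_pos (by omega)]
  congr 2
  exact Fin.ext h

theorem onSlots_slot (f : Fin n ⊕ Fin n → ZMod 2) (a : Fin n ⊕ Fin n) :
    onSlots f (slot a) = f a := by
  rcases a with i | i
  · rw [slot, position_fin, onSlots_inl]
  · rw [slot, position_fin, Fintype.card_fin, onSlots_inr]

theorem exists_slot {r : ℕ} (h : r < 2 * n) : ∃ a : Fin n ⊕ Fin n, slot a = r := by
  by_cases hr : r < n
  · exact ⟨Sum.inl ⟨r, hr⟩, position_fin _⟩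
  · refine ⟨Sum.inr ⟨r - n, by omega⟩, ?_⟩
    rw [slot, position_fin, Fintype.card_fin]
    show n + (r - n) = r
    omega

end

namespace Tableau

variable {n : ℕ} (T : Tableau (Fin n))

/-- The matrix of a tableau, indexed by the numbers of the rows and the columns. -/
def entry (r c : ℕ) : ZMod 2 := onSlots (fun a => onSlots (T.M a) c) r

/-- The initial table of the measurement program. -/
def table : ℕ → PRow := initialTable n T.entry (onSlots T.p) (onSlots T.s)

theorem table_inl (i : Fin n) : (T.table i).ph = T.phase (Sum.inl i) ∧
    (T.table i).xs n = T.xPart (Sum.inl i) ∧ (T.table i).zs n = T.zPart (Sum.inl i) := by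
  have hi := i.2
  rw [table, initialTable, if_pos (by omega), if_pos (by omega)]
  refine ⟨?_, funext fun j => ?_, funext fun j => ?_⟩
  · dsimp only
    rw [onSlots_inl, onSlots_inl, phase]
  · show T.entry i j = _
    rw [entry, onSlots_inl, onSlots_inl, xPart]
  · show T.entry i (n + j) = _
    rw [entry, onSlots_inl, onSlots_inr, zPart]

theorem table_inr (i : Fin n) : (T.table (n + i)).ph = T.phase (Sum.inr i) ∧
    (T.table (n + i)).xs n = T.xPart (Sum.inr i) ∧
    (T.table (n + i)).zs n = T.zPart (Sum.inr i) := by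
  have hi := i.2
  rw [table, initialTable, if_pos (by omega), if_pos (by omega)]
  refine ⟨?_, funext fun j => ?_, funext fun j => ?_⟩
  · dsimp only
    rw [onSlots_inr, onSlots_inr, phase]
  · show T.entry (n + i) j = _
    rw [entry, onSlots_inr, onSlots_inl, xPart]
  · show T.entry (n + i) (n + j) = _
    rw [entry, onSlots_inr, onSlots_inr, zPart]

theorem toOp_table (i : Fin n) : (T.table (n + i)).toOp n = T.row (Sum.inr i) := by
  obtain ⟨h1, h2, h3⟩ := T.table_inr i
  rw [PRow.toOp, h1, h2, h3, row_eq]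

variable {T}

theorem form_comm (i j : Fin n ⊕ Fin n) : T.form i j = T.form j i := by
  rw [form, form, sympl, sympl, add_comm, dotProduct_comm, dotProduct_comm (T.xPart i)]

/-- A Clifford tableau is a basis, and the symplectic form gives the coordinates. -/
theorem eq_sum_form (hT : T.IsClifford) (w : Fin n ⊕ Fin n → ZMod 2) (c : Fin n ⊕ Fin n) :
    w c = ∑ i, (∑ j, (T.M (Sum.inr i) (Sum.inr j) * w (Sum.inl j) +
        T.M (Sum.inr i) (Sum.inl j) * w (Sum.inr j))) * T.M (Sum.inl i) c +
      ∑ i, (∑ j, (T.M (Sum.inl i) (Sum.inr j) * w (Sum.inl j) +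
        T.M (Sum.inl i) (Sum.inl j) * w (Sum.inr j))) * T.M (Sum.inr i) c := by
  obtain ⟨Q, hQ, hR⟩ := hT
  -- `B` is the transpose of `M` with both halves exchanged, so `M * B` lists symplectic forms with
  -- upper and lower rows exchanged, which is the identity. For square matrices then also `B * M =
  -- 1`, and `w = (w ᵥ* B) ᵥ* M` is the expansion sought.
  let B : Matrix (Fin n ⊕ Fin n) (Fin n ⊕ Fin n) (ZMod 2) :=
    fun c r => T.M r.swap c.swap
  have hB : ∀ r s, (T.M * B) r s = T.form r s.swap := by
    intro r s
    rw [Matrix.mul_apply, Fintype.sum_sum_type]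
    rfl
  have h1 : T.M * B = 1 := by
    ext r s
    rw [hB, Matrix.one_apply]
    rcases r with i | i <;> rcases s with j | j
    · rw [Sum.swap_inl, (form_of_represents hQ hR i j).2.2]
      simp
    · rw [Sum.swap_inr, (form_of_represents hQ hR i j).1]
      simp
    · rw [Sum.swap_inl, (form_of_represents hQ hR i j).2.1]
      simp
    · rw [Sum.swap_inr, form_comm, (form_of_represents hQ hR j i).2.2]
      simp [eq_comm]
  have h2 : w ᵥ* (B * T.M) = w := by rw [mul_eq_one_comm.1 h1, Matrix.vecMul_one]
  rw [← congrFun h2 c, ← Matrix.vecMul_vecMul, Matrix.vecMul, dotProduct, Fintype.sum_sum_type]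
  have h3 : ∀ r, (w ᵥ* B) r = ∑ j, (T.M r.swap (Sum.inr j) * w (Sum.inl j) +
      T.M r.swap (Sum.inl j) * w (Sum.inr j)) := by
    intro r
    rw [Matrix.vecMul, dotProduct, Fintype.sum_sum_type, ← Finset.sum_add_distrib]
    refine Finset.sum_congr rfl fun j _ => ?_
    rw [mul_comm, mul_comm (w (Sum.inr j))]
    rfl
  simp only [h3]
  simp only [Matrix.vecMul, dotProduct, Fintype.sum_sum_type, Sum.swap_inl, Sum.swap_inr] at h3 ⊢

/-- The relations come from conjugation of the standard operators. Completeness is `eq_sum_form`,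
where the coefficients of the destabilizers are the forms with the stabilizers and vanish. -/
theorem symp_table (hT : T.IsClifford) : Measurement.Symp n T.table := by
  obtain ⟨Q, hQ, hR⟩ := id hT
  refine ⟨fun i hi j hj => ?_, fun i hi j hj => ?_, fun i hi j hj => ?_, fun i hi => ?_,
    fun i hi => ?_, fun w hw j hj => ?_⟩
  · obtain ⟨-, h1, h2⟩ := T.table_inl ⟨i, hi⟩
    obtain ⟨-, h3, h4⟩ := T.table_inl ⟨j, hj⟩
    rw [PRow.form_eq_sympl, h1, h2, h3, h4]
    exact (form_of_represents hQ hR _ _).1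
  · obtain ⟨-, h1, h2⟩ := T.table_inr ⟨i, hi⟩
    obtain ⟨-, h3, h4⟩ := T.table_inr ⟨j, hj⟩
    rw [PRow.form_eq_sympl, h1, h2, h3, h4]
    exact (form_of_represents hQ hR _ _).2.1
  · obtain ⟨-, h1, h2⟩ := T.table_inl ⟨i, hi⟩
    obtain ⟨-, h3, h4⟩ := T.table_inr ⟨j, hj⟩
    rw [PRow.form_eq_sympl, h1, h2, h3, h4]
    refine (form_of_represents hQ hR _ _).2.2.trans ?_
    simp
  · have h : 2 * n + i - n = n + i := by omega
    have h1 : 2 * n + i < 3 * n := by omega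
    have h2 : ¬ 2 * n + i < 2 * n := by omega
    have h3 : n + i < 3 * n := by omega
    have h4 : n + i < 2 * n := by omega
    simp only [table, initialTable, if_pos h1, if_neg h2, if_pos h3, if_pos h4, h]
  · simp only [table, initialTable]
    rw [if_neg (by omega)]
  · let v : Fin n ⊕ Fin n → ZMod 2 := Sum.elim (w.xs n) (w.zs n)
    have hinr : ∀ i : Fin n, ∑ j : Fin n, (T.M (Sum.inr i) (Sum.inr j) * v (Sum.inl j) +
        T.M (Sum.inr i) (Sum.inl j) * v (Sum.inr j)) = PRow.form n (T.table (n + i)) w := by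
      intro i
      obtain ⟨-, h1, h2⟩ := T.table_inr i
      rw [PRow.form_eq_sympl, h1, h2, sympl, add_comm, Finset.sum_add_distrib]
      rfl
    have hinl : ∀ i : Fin n, ∑ j : Fin n, (T.M (Sum.inl i) (Sum.inr j) * v (Sum.inl j) +
        T.M (Sum.inl i) (Sum.inl j) * v (Sum.inr j)) = PRow.form n (T.table i) w := by
      intro i
      obtain ⟨-, h1, h2⟩ := T.table_inl i
      rw [PRow.form_eq_sympl, h1, h2, sympl, add_comm, Finset.sum_add_distrib]
      rfl
    have key := eq_sum_form hT v
    simp only [hinr, hinl, hw _ (Fin.is_lt _), zero_mul, Finset.sum_const_zero, zero_add] at key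
    constructor
    · rw [Finset.sum_range]
      refine (key (Sum.inl ⟨j, hj⟩)).trans (Finset.sum_congr rfl fun i _ => ?_)
      exact congrArg _ (congrFun (T.table_inr i).2.1 ⟨j, hj⟩).symm
    · rw [Finset.sum_range]
      refine (key (Sum.inr ⟨j, hj⟩)).trans (Finset.sum_congr rfl fun i _ => ?_)
      exact congrArg _ (congrFun (T.table_inr i).2.2 ⟨j, hj⟩).symm

end Tableau

/-! ### The qubits of a set, in increasing order -/

theorem nth_of_lt_count {P : ℕ → Prop} [DecidablePred P] {n c : ℕ} (h : c < Nat.count P n) :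
    Nat.nth P c < n ∧ P (Nat.nth P c) ∧ Nat.count P (Nat.nth P c) = c := by
  have hc : ∀ hf : (Set.ofPred P).Finite, c < hf.toFinset.card := fun hf =>
    h.trans_le (Nat.count_le_card hf n)
  exact ⟨Nat.nth_lt_of_lt_count h, Nat.nth_mem _ hc, Nat.count_nth hc⟩

section

variable {n : ℕ} (p : Fin n → Prop) [DecidablePred p]

/-- A set of qubits, as a predicate on the natural numbers. -/
def onNat (j : ℕ) : Prop := ∃ h : j < n, p ⟨j, h⟩

instance : DecidablePred (onNat p) := fun j => inferInstanceAs (Decidable (∃ h : j < n, p ⟨j, h⟩))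

/-- The number of the qubit with a given place in the increasing list of the qubits in a set. -/
noncomputable def label (c : ℕ) : ℕ := Nat.nth (onNat p) c

variable {p} [Fintype {i // p i}]

/-- Connects the order on a subset of the qubits with the counting of natural numbers that the
listing program performs. -/
theorem position_eq_count (i : {i // p i}) : position i = Nat.count (onNat p) i := by
  rw [position, Nat.count_eq_card_filter_range]
  refine Finset.card_bij (fun a _ => ((a : Fin n) : ℕ)) (fun a ha => ?_) (fun a _ b _ h => ?_)
    fun b hb => ?_
  · rw [Finset.mem_filter, Finset.mem_range]
    exact ⟨(Finset.mem_filter.1 ha).2, a.1.2, a.2⟩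
  · exact Subtype.ext (Fin.ext h)
  · rw [Finset.mem_filter, Finset.mem_range] at hb
    obtain ⟨hlt, h, hp⟩ := hb
    exact ⟨⟨⟨b, h⟩, hp⟩, by rw [Finset.mem_filter]; exact ⟨Finset.mem_univ _, hlt⟩, rfl⟩

theorem label_position (i : {i // p i}) : label p (position i) = i := by
  rw [label, position_eq_count]
  exact Nat.nth_count ⟨i.1.2, i.2⟩

theorem position_injective : Function.Injective (position : {i // p i} → ℕ) := fun i j h =>
  Subtype.ext (Fin.ext (by rw [← label_position i, ← label_position j, h]))

theorem count_onNat : Nat.count (onNat p) n = Fintype.card {i // p i} := by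
  rw [Nat.count_eq_card_filter_range, ← Finset.card_univ]
  symm
  refine Finset.card_bij (fun a _ => ((a : Fin n) : ℕ)) (fun a _ => ?_) (fun a _ b _ h => ?_)
    fun b hb => ?_
  · rw [Finset.mem_filter, Finset.mem_range]
    exact ⟨a.1.2, a.1.2, a.2⟩
  · exact Subtype.ext (Fin.ext h)
  · obtain ⟨h, hp⟩ := (Finset.mem_filter.1 hb).2
    exact ⟨⟨⟨b, h⟩, hp⟩, Finset.mem_univ _, rfl⟩

theorem label_spec {c : ℕ} (h : c < Fintype.card {i // p i}) :
    label p c < n ∧ onNat p (label p c) ∧ Nat.count (onNat p) (label p c) = c :=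
  nth_of_lt_count (by rwa [count_onNat])

theorem exists_position {c : ℕ} (h : c < Fintype.card {i // p i}) :
    ∃ i : {i // p i}, position i = c := by
  obtain ⟨-, ⟨h1, h2⟩, h3⟩ := label_spec h
  exact ⟨⟨⟨_, h1⟩, h2⟩, by rw [position_eq_count]; exact h3⟩

theorem position_lt (i : {i // p i}) : position i < Fintype.card {i // p i} := by
  rw [position, ← Finset.card_univ]
  exact Finset.card_lt_card (Finset.filter_ssubset.2 ⟨i, Finset.mem_univ _, lt_irrefl i⟩)

theorem label_injective {c c' : ℕ} (h : c < Fintype.card {i // p i})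
    (h' : c' < Fintype.card {i // p i}) (he : label p c = label p c') : c = c' := by
  rw [← (label_spec h).2.2, he, (label_spec h').2.2]

theorem sum_position {M : Type*} [AddCommMonoid M] (f : ℕ → M) :
    ∑ c ∈ Finset.range (Fintype.card {i // p i}), f c = ∑ i : {i // p i}, f (position i) := by
  symm
  refine Finset.sum_bij (fun i _ => position i) (fun i _ => Finset.mem_range.2 (position_lt i))
    (fun i _ j _ h => position_injective h) (fun c hc => ?_) fun i _ => rfl
  obtain ⟨i, hi⟩ := exists_position (Finset.mem_range.1 hc)
  exact ⟨i, Finset.mem_univ _, hi⟩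

variable (p) in
/-- A bit string on a set of qubits, as a sequence. -/
noncomputable def bitsAt (r : Bits {i // p i}) (c : ℕ) : ZMod 2 :=
  if h : ∃ i : {i // p i}, position i = c then r h.choose else 0

theorem bitsAt_position (r : Bits {i // p i}) (i : {i // p i}) :
    bitsAt p r (position i) = r i := by
  have h : ∃ j : {i // p i}, position j = position i := ⟨i, rfl⟩
  rw [bitsAt, dif_pos h, position_injective h.choose_spec]

end

/-! ### Measurement outcomes -/

section

variable {n : ℕ} {S : Finset (Fin n)} {ψ : QVec (Fin n)}

/-- The bits on `S`. -/
def restrictIn (S : Finset (Fin n)) (u : Bits (Fin n)) : Bits {i // i ∈ S} := fun i => u i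

/-- The bits off `S`. -/
def restrictOut (S : Finset (Fin n)) (u : Bits (Fin n)) : Bits {i // i ∉ S} := fun i => u i

theorem mergeBits_restrict (u : Bits (Fin n)) :
    mergeBits S (restrictIn S u) (restrictOut S u) = u := by
  funext i
  rw [mergeBits]
  split <;> rfl

theorem mergeBits_add (z : Bits {i // i ∈ S}) (y : Bits {i // i ∉ S}) (u : Bits (Fin n)) :
    mergeBits S (z + restrictIn S u) (y + restrictOut S u) = mergeBits S z y + u := by
  funext i
  rw [mergeBits, Pi.add_apply, mergeBits]
  split <;> rfl

theorem restrictIn_mergeBits (z : Bits {i // i ∈ S}) (y : Bits {i // i ∉ S}) :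
    restrictIn S (mergeBits S z y) = z := by
  funext i
  rw [restrictIn, mergeBits, dif_pos i.2]

theorem restrictOut_mergeBits (z : Bits {i // i ∈ S}) (y : Bits {i // i ∉ S}) :
    restrictOut S (mergeBits S z y) = y := by
  funext i
  rw [restrictOut, mergeBits, dif_neg i.2]

theorem sum_outcomeProb (ψ : QVec (Fin n)) : ∑ z, outcomeProb S ψ z = ∑ x, ‖ψ x‖ ^ 2 := by
  simp only [outcomeProb, project]
  rw [← Finset.sum_product' Finset.univ Finset.univ (fun z y => ‖ψ (mergeBits S z y)‖ ^ 2)]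
  refine Finset.sum_bij' (fun a _ => mergeBits S a.1 a.2)
    (fun x _ => (restrictIn S x, restrictOut S x)) (fun _ _ => Finset.mem_univ _)
    (fun _ _ => Finset.mem_univ _) (fun a _ => ?_) (fun x _ => mergeBits_restrict x) fun _ _ => rfl
  exact Prod.ext (restrictIn_mergeBits _ _) (restrictOut_mergeBits _ _)

/-- A translation that preserves the moduli of the amplitudes permutes the bits off `S` inside the
sum and moves the outcome by its bits on `S`. -/
theorem outcomeProb_shift {u : Bits (Fin n)} (hu : ∀ y, ‖ψ (y + u)‖ = ‖ψ y‖)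
    (z : Bits {i // i ∈ S}) : outcomeProb S ψ (z + restrictIn S u) = outcomeProb S ψ z := by
  rw [outcomeProb, ← Equiv.sum_comp (Equiv.addRight (restrictOut S u))]
  refine Finset.sum_congr rfl fun y _ => ?_
  rw [Equiv.coe_addRight, project, mergeBits_add, hu]
  rfl

theorem exists_amplitude {z : Bits {i // i ∈ S}} (h : outcomeProb S ψ z ≠ 0) :
    ∃ x, restrictIn S x = z ∧ ψ x ≠ 0 := by
  by_contra hc
  push Not at hc
  refine h (Finset.sum_eq_zero fun y _ => ?_)
  rw [project, hc _ (restrictIn_mergeBits z y), norm_zero, zero_pow two_ne_zero]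

/-- The operator of the row fixes the state. -/
def Fixes (ψ : QVec (Fin n)) (R : PRow) : Prop := R.toOp n *ᵥ ψ = ψ

theorem Fixes.mul {a b : PRow} (ha : Fixes ψ a) (hb : Fixes ψ b) : Fixes ψ (a.mul n b) := by
  rw [Fixes, PRow.toOp_mul, ← Matrix.mulVec_mulVec, show b.toOp n *ᵥ ψ = ψ from hb]
  exact ha

theorem Fixes.one : Fixes ψ PRow.one := by rw [Fixes, PRow.toOp_one, Matrix.one_mulVec]

theorem Fixes.apply {R : PRow} (h : Fixes ψ R) (y : Bits (Fin n)) :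
    iph R.ph * sgn (R.zs n ⬝ᵥ (y + R.xs n)) * ψ (y + R.xs n) = ψ y := by
  rw [Fixes, PRow.toOp, phOp_mulVec] at h
  exact congrFun h y

theorem Fixes.norm {R : PRow} (h : Fixes ψ R) (y : Bits (Fin n)) :
    ‖ψ (y + R.xs n)‖ = ‖ψ y‖ := by
  rw [← h.apply y, norm_mul, norm_mul, norm_iph, norm_sgn, one_mul, one_mul]

/-- An operator without an `X` part restricts the basis states of nonzero amplitude. -/
theorem Fixes.constraint {R : PRow} (h : Fixes ψ R) (hx : R.xs n = 0) {y : Bits (Fin n)}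
    (hy : ψ y ≠ 0) : ((R.ph.val / 2 : ℕ) : ZMod 2) = R.zs n ⬝ᵥ y := by
  have h1 := h.apply y
  rw [hx, add_zero, mul_eq_right₀ hy, ← iph_twice, ← iph_add, ← iph_zero] at h1
  have h2 := iph_injective h1
  revert h2
  generalize R.ph = a
  generalize R.zs n ⬝ᵥ y = b
  revert a b
  decide

end

/-! ### The Born rule for the computed outcomes. -/

namespace Measurement

variable {n : ℕ} (S : Finset (Fin n)) (T : Tableau (Fin n))

/-- The numbers of the measured qubits. -/
noncomputable abbrev measured (S : Finset (Fin n)) : ℕ → ℕ := label (· ∈ S)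

/-- The pivots of the columns of the measured qubits. -/
noncomputable abbrev pivots : ℕ → ℕ := (stabElim n S.card (measured S) T.table).piv

/-- The outcome of the measurement, for given input bits. -/
noncomputable def out (r : Bits {i // i ∈ S}) : Bits {i // i ∈ S} := fun i =>
  outcome n S.card (measured S) T.table (bitsAt (· ∈ S) r) (position i)

variable {S T} {ψ : QVec (Fin n)}

theorem card_measured : Fintype.card {i // i ∈ S} = S.card := Fintype.card_coe S

theorem position_lt_card (i : {i // i ∈ S}) : position i < S.card :=
  card_measured (S := S) ▸ position_lt i

theorem measured_lt {c : ℕ} (h : c < S.card) : measured S c < n :=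
  (label_spec (by rwa [card_measured])).1

theorem measured_injective : ∀ c < S.card, ∀ c' < S.card, measured S c = measured S c' → c = c' :=
  fun _ h _ h' he => label_injective (by rwa [card_measured]) (by rwa [card_measured]) he

theorem sum_measured {M : Type*} [AddCommMonoid M] (f : ℕ → M) :
    ∑ c ∈ Finset.range S.card, f c = ∑ i : {i // i ∈ S}, f (position i) := by
  rw [← card_measured, sum_position]

theorem out_pivot (r : Bits {i // i ∈ S}) {i : {i // i ∈ S}} (h : pivots S T (position i) ≠ 0) :
    out S T r i = r i := by
  rw [out, outcome, outcomeBit, if_neg h, bitsAt_position]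

/-- In a column without a pivot the outcome reads the input bits of pivot columns only; the other
input bits are ignored. -/
theorem out_congr {r r' : Bits {i // i ∈ S}}
    (h : ∀ i, pivots S T (position i) ≠ 0 → r i = r' i) : out S T r = out S T r' := by
  funext i
  rw [out, out, outcome, outcome, outcomeBit, outcomeBit]
  split
  · congr 1
    rw [sum_measured, sum_measured]
    refine Finset.sum_congr rfl fun j _ => ?_
    split
    · rfl
    · rw [bitsAt_position, bitsAt_position, h j (by assumption)]
  · rw [bitsAt_position, bitsAt_position, h i (by assumption)]

theorem out_eq_iff {r r' : Bits {i // i ∈ S}} : out S T r = out S T r' ↔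
    ∀ i, pivots S T (position i) ≠ 0 → r i = r' i :=
  ⟨fun h i hi => by rw [← out_pivot r hi, h, out_pivot r' hi], out_congr⟩

theorem fixes_table (h : T.IsTableauOf ψ) : ∀ i < n, Fixes ψ (T.table (n + i)) := by
  intro i hi
  have := T.toOp_table ⟨i, hi⟩
  rw [Fixes, this]
  exact h.2.2 _

theorem fixes_stab (h : T.IsTableauOf ψ) {k : ℕ} {sl : ℕ → ℕ} {i : ℕ} (hi : i < n) :
    Fixes ψ (stab n k sl T.table i) :=
  stab_induction (Q := Fixes ψ) (fun _ _ => Fixes.mul) Fixes.one (Tableau.symp_table h.1) (fixes_table h) hi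

/-- Only the basis states with the right bits on `S` have nonzero amplitude. -/
theorem out_restrictIn (hS : S.Nonempty) (h : T.IsTableauOf ψ) {y : Bits (Fin n)} (hy : ψ y ≠ 0) :
    out S T (restrictIn S y) = restrictIn S y := by
  have hT := Tableau.symp_table h.1
  have hk : 1 ≤ S.card := hS.card_pos
  funext i
  rw [out, outcome, outcomeBit]
  split
  · rename_i h0
    have hi := position_lt_card i
    have hF : Fixes ψ (outcomeTable n S.card (measured S) T.table (3 * n + position i)) :=
      constraint_induction (Q := Fixes ψ) (fun _ _ => Fixes.mul) Fixes.one hk hT (fixes_table h) hi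
    have hsl : ∀ c < S.card, measured S c < n := fun _ => measured_lt
    rw [hF.constraint (funext fun j => (constraint_spec hk hT hsl hi j.2).1) hy]
    let f : ℕ → ZMod 2 := fun j => if hj : j < n then y ⟨j, hj⟩ else 0
    have hf : ∀ j : {i // i ∈ S}, f (measured S (position j)) = restrictIn S y j := by
      intro j
      rw [show measured S (position j) = j from label_position (p := (· ∈ S)) j]
      exact dif_pos j.1.2
    have e : (outcomeTable n S.card (measured S) T.table (3 * n + position i)).zs n ⬝ᵥ y =
        ∑ j ∈ Finset.range n,
          (outcomeTable n S.card (measured S) T.table (3 * n + position i)).z j * f j := by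
      rw [Finset.sum_range]
      exact Finset.sum_congr rfl fun j _ => congrArg _ (show f j = y j from dif_pos j.2).symm
    -- The sign of the constraint contributes the bit at column `i` plus the pivot bits in its `Z`
    -- part. The definition of the outcome adds those pivot bits once more, and they cancel.
    rw [e, sum_constraint hk hT hsl measured_injective hi h0, hf, sum_measured, sum_measured,
      add_assoc, ← Finset.sum_add_distrib, Finset.sum_eq_zero, add_zero]
    intro j _
    rw [hf, bitsAt_position]
    split
    · exact add_zero _
    · exact add_self_zmod _
  · exact bitsAt_position _ _

theorem out_of_outcomeProb_ne_zero (hS : S.Nonempty) (h : T.IsTableauOf ψ) {z : Bits {i // i ∈ S}}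
    (hz : outcomeProb S ψ z ≠ 0) : out S T z = z := by
  obtain ⟨x, rfl, hx⟩ := exists_amplitude hz
  exact out_restrictIn hS h hx

/-- The shift is the sum of the `X` parts of the pivot stabilizers for the bits set in `w`. Each of
them preserves the moduli of the amplitudes, and as the pivot columns are unit vectors the bits in
these columns are exactly those of `w`. -/
theorem exists_shift (h : T.IsTableauOf ψ) (w : Bits {i // i ∈ S}) : ∃ u : Bits (Fin n),
    (∀ y, ‖ψ (y + u)‖ = ‖ψ y‖) ∧
    ∀ i, pivots S T (position i) ≠ 0 → restrictIn S u i = w i := by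
  have hT := Tableau.symp_table h.1
  refine ⟨∑ c ∈ Finset.range S.card, if pivots S T c = 0 then 0 else
    bitsAt (· ∈ S) w c • (stab n S.card (measured S) T.table (pivots S T c - 1)).xs n, ?_, ?_⟩
  · refine Finset.sum_induction _ (fun u : Bits (Fin n) => ∀ y, ‖ψ (y + u)‖ = ‖ψ y‖)
      (fun u v hu hv y => by rw [← add_assoc, hv, hu]) (fun y => by rw [add_zero]) fun c _ => ?_
    split
    · exact fun y => by rw [add_zero]
    · rename_i hc
      rcases two_or (bitsAt (· ∈ S) w c) with h0 | h1
      · rw [h0, zero_smul]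
        exact fun y => by rw [add_zero]
      · rw [h1, one_smul]
        exact (fixes_stab h (piv_sub_lt hc)).norm
  · intro i hi
    rw [restrictIn, Finset.sum_apply, ← bitsAt_position w i, ← sum_pivot_eq hi (bitsAt (· ∈ S) w)]
    refine Finset.sum_congr rfl fun c _ => ?_
    have hs := label_position (p := (· ∈ S)) i
    split
    · rw [mul_zero]
      rfl
    · rename_i hc
      rw [Pi.smul_apply, smul_eq_mul, PRow.xs, ← hs]
      exact congrArg _ (stab_x_pivot hT (piv_sub_lt hc) hi)

/-- All the possible outcomes have the same probability. -/
theorem outcomeProb_eq (hS : S.Nonempty) (h : T.IsTableauOf ψ) {z z' : Bits {i // i ∈ S}}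
    (hz : outcomeProb S ψ z ≠ 0) (hz' : out S T z' = z') :
    outcomeProb S ψ z' = outcomeProb S ψ z := by
  obtain ⟨u, hu, huw⟩ := exists_shift h (z + z')
  have h1 := outcomeProb_shift (S := S) hu z
  have h2 := out_of_outcomeProb_ne_zero hS h (h1.symm ▸ hz)
  have h3 : out S T z' = out S T (z + restrictIn S u) := out_congr fun i hi => by
    rw [Pi.add_apply, huw i hi, Pi.add_apply, ← add_assoc, add_self_zmod, zero_add]
  have h4 : z' = z + restrictIn S u := hz'.symm.trans (h3.trans h2)
  exact (congrArg _ h4).trans h1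

/-- Some outcome is possible because the probabilities sum to one. Shifting it until its pivot bits
agree with `r` keeps its probability, and the shifted outcome is a fixed point of `out`, hence equal
to `out r`. -/
theorem outcomeProb_out_ne_zero (hS : S.Nonempty) (h : T.IsTableauOf ψ) (r : Bits {i // i ∈ S}) :
    outcomeProb S ψ (out S T r) ≠ 0 := by
  obtain ⟨z, hz⟩ : ∃ z, outcomeProb S ψ z ≠ 0 := by
    by_contra hc
    push Not at hc
    have h1 := sum_outcomeProb (S := S) ψ
    rw [Finset.sum_eq_zero fun z _ => hc z, h.2.1] at h1
    exact zero_ne_one h1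
  obtain ⟨u, hu, huw⟩ := exists_shift h (z + r)
  have h1 := outcomeProb_shift (S := S) hu z
  have h2 := out_of_outcomeProb_ne_zero hS h (h1.symm ▸ hz)
  have h3 : out S T r = out S T (z + restrictIn S u) := out_congr fun i hi => by
    rw [Pi.add_apply, huw i hi, Pi.add_apply, ← add_assoc, add_self_zmod, zero_add]
  rw [h3, h2, h1]
  exact hz

/-- For uniformly random input bits, the outcomes are distributed by the Born rule. -/
theorem card_out_eq (hS : S.Nonempty) (h : T.IsTableauOf ψ) (z : Bits {i // i ∈ S}) :
    ((Finset.univ.filter fun r => out S T r = z).card : ℝ) / 2 ^ S.card = outcomeProb S ψ z := by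
  -- Fibres over fixed points are cosets of the strings that vanish in the pivot columns;
  -- translation by `z'` maps the fibre over `z'` to the one over `out 0`.
  have hcard : ∀ z', out S T z' = z' → (Finset.univ.filter fun r => out S T r = z').card =
      (Finset.univ.filter fun r => out S T r = out S T 0).card := by
    intro z' hz'
    refine Finset.card_bij' (fun r _ => r + z') (fun r _ => r + z') (fun r hr => ?_) (fun r hr => ?_)
      (fun r _ => bits_add_cancel r z') fun r _ => bits_add_cancel r z'
    all_goals
      rw [Finset.mem_filter] at hr ⊢
      refine ⟨Finset.mem_univ _, ?_⟩
      beta_reduce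
    · rw [← hz', out_eq_iff] at hr
      exact out_eq_iff.2 fun i hi => by rw [Pi.add_apply, hr.2 i hi, add_self_zmod, Pi.zero_apply]
    · rw [← hz', out_eq_iff.2]
      intro i hi
      rw [Pi.add_apply, out_eq_iff.1 hr.2 i hi, Pi.zero_apply, zero_add, hz']
  set N := (Finset.univ.filter fun r => out S T r = out S T 0).card with hN
  set p := outcomeProb S ψ (out S T 0) with hp
  have hp0 : p ≠ 0 := outcomeProb_out_ne_zero hS h 0
  by_cases hz : out S T z = z
  · rw [hcard z hz, outcomeProb_eq hS h hp0 hz, ← hp]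
    set Z := Finset.univ.filter fun z => out S T z = z with hZ
    have hout : ∀ r, out S T r ∈ Z := fun r => by
      rw [hZ, Finset.mem_filter]
      exact ⟨Finset.mem_univ _, out_of_outcomeProb_ne_zero hS h (outcomeProb_out_ne_zero hS h r)⟩
    -- The input strings are counted by fibres, one of size `N` for each fixed point.
    have h1 : (2 ^ S.card : ℝ) = Z.card * N := by
      have := Finset.card_eq_sum_card_fiberwise (f := out S T) (s := Finset.univ) (t := Z)
        fun r _ => hout r
      rw [Finset.sum_congr rfl fun z' hz' => hcard z' (Finset.mem_filter.1 hz').2, Finset.sum_const,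
        smul_eq_mul, Finset.card_univ, Fintype.card_fun, card_measured, ZMod.card] at this
      exact_mod_cast this
    -- The total probability is one and is shared equally among the fixed points.
    have h2 : (Z.card : ℝ) * p = 1 := by
      rw [← h.2.1, ← sum_outcomeProb (S := S), ← nsmul_eq_mul, ← Finset.sum_const]
      rw [← Finset.sum_subset (Finset.subset_univ Z)]
      · exact Finset.sum_congr rfl fun z' hz' =>
          (outcomeProb_eq hS h hp0 (Finset.mem_filter.1 hz').2).symm
      · intro z' _ hz'
        by_contra hne
        exact hz' (Finset.mem_filter.2
          ⟨Finset.mem_univ _, out_of_outcomeProb_ne_zero hS h hne⟩)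
    rw [h1, div_eq_iff (by rw [← h1]; positivity)]
    linear_combination (-(N : ℝ)) * h2
  · have h1 : outcomeProb S ψ z = 0 := by
      by_contra hne
      exact hz (out_of_outcomeProb_ne_zero hS h hne)
    rw [h1, Finset.filter_false_of_mem, Finset.card_empty, Nat.cast_zero, zero_div]
    rintro r - rfl
    exact hz (out_of_outcomeProb_ne_zero hS h (outcomeProb_out_ne_zero hS h r))

end Measurement

/-! ### The state after the measurement -/

section

variable {n : ℕ} {S : Finset (Fin n)} {ψ : QVec (Fin n)}

theorem dotProduct_split (a b : Bits (Fin n)) : a ⬝ᵥ b =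
    restrictIn S a ⬝ᵥ restrictIn S b + restrictOut S a ⬝ᵥ restrictOut S b := by
  symm
  convert Fintype.sum_subtype_add_sum_subtype (· ∈ S) fun i => a i * b i using 2
  · exact Finset.sum_congr (by ext; simp) fun _ _ => rfl
  · rfl
  · rfl

/-- The symplectic form of rows that have no `X` part on `S`. -/
theorem form_eq_restrict {a b : PRow} (ha : restrictIn S (a.xs n) = 0)
    (hb : restrictIn S (b.xs n) = 0) : a.form n b =
      sympl (restrictOut S (a.xs n)) (restrictOut S (a.zs n)) (restrictOut S (b.xs n))
        (restrictOut S (b.zs n)) := by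
  rw [PRow.form_eq_sympl, sympl, sympl, dotProduct_split (S := S), ha, zero_dotProduct, zero_add,
    dotProduct_split (S := S) (a.zs n), hb, dotProduct_zero, zero_add]

/-- An operator without an `X` part on `S` acts there diagonally. On the bits `z` it is the sign of
the inner product with its `Z` part, which is absorbed into the phase. -/
theorem project_fixed {R : PRow} (h : Fixes ψ R) (hx : restrictIn S (R.xs n) = 0)
    (z : Bits {i // i ∈ S}) :
    phOp (R.ph + twice (z ⬝ᵥ restrictIn S (R.zs n))) (restrictOut S (R.xs n))
      (restrictOut S (R.zs n)) *ᵥ project S ψ z = project S ψ z := by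
  rw [phOp_mulVec]
  funext y
  have h1 := h.apply (mergeBits S z y)
  have h2 : mergeBits S z (y + restrictOut S (R.xs n)) = mergeBits S z y + R.xs n := by
    rw [← mergeBits_add, hx, add_zero]
  rw [dotProduct_split (S := S), ← h2, restrictIn_mergeBits, restrictOut_mergeBits] at h1
  rw [project, iph_add, iph_twice, project, ← h1, sgn_add, dotProduct_comm z]
  ring

theorem sum_postState {z : Bits {i // i ∈ S}} (h : outcomeProb S ψ z ≠ 0) :
    ∑ y, ‖postState S ψ z y‖ ^ 2 = 1 := by
  have h0 : 0 ≤ outcomeProb S ψ z := Finset.sum_nonneg fun y _ => sq_nonneg _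
  simp only [postState, norm_div, div_pow, Complex.norm_real, Real.norm_eq_abs, sq_abs,
    Real.sq_sqrt h0]
  rw [← Finset.sum_div]
  exact div_self h

theorem postState_fixed {A : Matrix (Bits {i // i ∉ S}) (Bits {i // i ∉ S}) ℂ}
    {z : Bits {i // i ∈ S}} (h : A *ᵥ project S ψ z = project S ψ z) :
    A *ᵥ postState S ψ z = postState S ψ z := by
  have e : postState S ψ z = ((Real.sqrt (outcomeProb S ψ z) : ℂ))⁻¹ • project S ψ z := by
    funext y
    rw [postState, Pi.smul_apply, smul_eq_mul, div_eq_inv_mul]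
  rw [e, Matrix.mulVec_smul, h]

end

/-- Vectors that form a symplectic basis of a subspace number at most the dimension. -/
theorem card_le_of_sympl {κ ι : Type} [Fintype κ] [DecidableEq κ] [Fintype ι] [DecidableEq ι]
    {x z x' z' : κ → Bits ι} (hxx : ∀ i j, sympl (x i) (z i) (x j) (z j) = 0)
    (hzz : ∀ i j, sympl (x' i) (z' i) (x' j) (z' j) = 0)
    (hxz : ∀ i j, sympl (x i) (z i) (x' j) (z' j) = if i = j then 1 else 0) :
    Fintype.card κ ≤ Fintype.card ι := by
  -- The relations say that `A`, the matrix of all the vectors, has a right inverse, so its `2 *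
  -- card κ` rows are independent in a space of dimension `2 * card ι`.
  let A : Matrix (κ ⊕ κ) (ι ⊕ ι) (ZMod 2) := fun r c =>
    Sum.elim (fun i => Sum.elim (x i) (z i) c) (fun i => Sum.elim (x' i) (z' i) c) r
  let B : Matrix (ι ⊕ ι) (κ ⊕ κ) (ZMod 2) := fun c r => A r.swap c.swap
  have hB : ∀ r s, (A * B) r s = sympl (fun j => A r (Sum.inl j)) (fun j => A r (Sum.inr j))
      (fun j => A s.swap (Sum.inl j)) (fun j => A s.swap (Sum.inr j)) := by
    intro r s
    rw [Matrix.mul_apply, Fintype.sum_sum_type]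
    rfl
  have h1 : A * B = 1 := by
    ext r s
    rw [hB, Matrix.one_apply]
    rcases r with i | i <;> rcases s with j | j
    · exact (hxz i j).trans (by simp)
    · exact (hxx i j).trans (by simp)
    · exact (hzz i j).trans (by simp)
    · have : sympl (x' i) (z' i) (x j) (z j) = sympl (x j) (z j) (x' i) (z' i) := by
        rw [sympl, sympl, add_comm, dotProduct_comm, dotProduct_comm (x' i)]
      exact this.trans ((hxz j i).trans (by simp [eq_comm]))
  have h2 := (Matrix.rank_mul_le_left A B).trans A.rank_le_card_width
  rw [h1, Matrix.rank_one, Fintype.card_sum, Fintype.card_sum] at h2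
  omega

/-! ### The tableau of the post-measurement state. -/

namespace Measurement

variable {n : ℕ} (S : Finset (Fin n)) (T : Tableau (Fin n))

/-- The rows that are kept. -/
abbrev keptRow : ℕ → Prop := Kept n S.card (measured S) T.table

/-- The numbers of the rows that are kept. -/
noncomputable abbrev keptLabel : ℕ → ℕ := Nat.nth (keptRow S T)

/-- The numbers of the remaining qubits. -/
noncomputable abbrev remaining (S : Finset (Fin n)) : ℕ → ℕ := label (· ∉ S)

/-- The tableau of the state after the measurement, for given input bits. -/
noncomputable def tab (r : Bits {i // i ∈ S}) : Tableau {i // i ∉ S} where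
  M a b := outEntry n (n - S.card) (finalTable n S.card (measured S) T.table) (remaining S)
    (keptLabel S T) (slot a) (slot b)
  p a := outP n S.card (n - S.card) (finalTable n S.card (measured S) T.table) (measured S)
    (remaining S) (keptLabel S T)
    (outcome n S.card (measured S) T.table (bitsAt (· ∈ S) r)) (slot a)
  s a := outS n S.card (n - S.card) (finalTable n S.card (measured S) T.table) (measured S)
    (keptLabel S T) (outcome n S.card (measured S) T.table (bitsAt (· ∈ S) r)) (slot a)

variable {S T} {ψ : QVec (Fin n)}

theorem card_remaining : Fintype.card {i // i ∉ S} = n - S.card := by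
  rw [Fintype.card_subtype_compl, Fintype.card_fin, card_measured]

theorem exists_measured (q : {i // i ∈ S}) : ∃ c < S.card, measured S c = q :=
  ⟨position q, position_lt_card q, label_position (p := (· ∈ S)) q⟩

theorem stab_restrictIn (hT : T.IsClifford) {i : ℕ} (hi : i < n) (hK : keptRow S T i) :
    restrictIn S ((stab n S.card (measured S) T.table i).xs n) = 0 := by
  funext q
  obtain ⟨c, hc, hq⟩ := exists_measured q
  have := stab_x_unused (Tableau.symp_table hT) hi hK.1 hc
  rwa [hq] at this

theorem destab_restrictIn {i : ℕ} (hi : i < n) (hK : keptRow S T i) :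
    restrictIn S ((destab n S.card (measured S) T.table i).xs n) = 0 := by
  funext q
  obtain ⟨c, hc, hq⟩ := exists_measured q
  have := destab_x_measured hi hK hc
  rwa [hq] at this

/-- Two inequalities meet. Kept rows restricted to the remaining qubits form dual families, so they
are at most `n - k` in number, and at most `k` rows are discarded. -/
theorem count_kept (hT : T.IsClifford) : Nat.count (keptRow S T) n = n - S.card := by
  have hs := Tableau.symp_table hT
  have h1 : Nat.count (keptRow S T) n ≤ n - S.card := by
    have := card_le_of_sympl (κ := {i : Fin n // keptRow S T i}) (ι := {i // i ∉ S})
      (x := fun i => restrictOut S ((destab n S.card (measured S) T.table i).xs n))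
      (z := fun i => restrictOut S ((destab n S.card (measured S) T.table i).zs n))
      (x' := fun i => restrictOut S ((stab n S.card (measured S) T.table i).xs n))
      (z' := fun i => restrictOut S ((stab n S.card (measured S) T.table i).zs n))
      (fun i j => by
        rw [← form_eq_restrict (destab_restrictIn i.1.2 i.2) (destab_restrictIn j.1.2 j.2)]
        exact destab_destab hs i.1.2 j.1.2 i.2 j.2)
      (fun i j => by
        rw [← form_eq_restrict (stab_restrictIn hT i.1.2 i.2) (stab_restrictIn hT j.1.2 j.2)]
        exact stab_stab hs i.1.2 j.1.2)
      (fun i j => by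
        rw [← form_eq_restrict (destab_restrictIn i.1.2 i.2) (stab_restrictIn hT j.1.2 j.2)]
        refine (destab_stab hs i.1.2 j.1.2 i.2 j.2).trans ?_
        simp only [← Fin.ext_iff, ← Subtype.ext_iff])
    rw [card_remaining, ← count_onNat] at this
    convert this using 1
    rw [Nat.count_eq_card_filter_range, Nat.count_eq_card_filter_range]
    congr 1
    refine Finset.filter_congr fun i hi => ?_
    exact ⟨fun h => ⟨Finset.mem_range.1 hi, h⟩, fun ⟨_, h⟩ => h⟩
  have h2 : ((Finset.range n).filter fun i => ¬ keptRow S T i).card ≤ S.card := by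
    convert card_not_kept_le (k := S.card) (sl := measured S) hs
  have h3 := Finset.card_filter_add_card_filter_not (s := Finset.range n) (keptRow S T)
  rw [← Nat.count_eq_card_filter_range, Finset.card_range] at h3
  omega

theorem keptLabel_spec (hT : T.IsClifford) {c : ℕ} (h : c < n - S.card) :
    keptLabel S T c < n ∧ keptRow S T (keptLabel S T c) ∧
      Nat.count (keptRow S T) (keptLabel S T c) = c :=
  nth_of_lt_count (by rwa [count_kept hT])

theorem position_lt_remaining (i : {i // i ∉ S}) : position i < n - S.card :=
  card_remaining (S := S) ▸ position_lt i

theorem slot_inr (i : {i // i ∉ S}) : slot (Sum.inr i) = n - S.card + position i := by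
  rw [slot, card_remaining]

theorem outIndex_inl (i : {i // i ∉ S}) :
    outIndex n (n - S.card) (keptLabel S T) (slot (Sum.inl i)) = keptLabel S T (position i) := by
  rw [slot, outIndex, if_pos (position_lt_remaining i)]

theorem outIndex_inr (i : {i // i ∉ S}) :
    outIndex n (n - S.card) (keptLabel S T) (slot (Sum.inr i)) =
      2 * n + keptLabel S T (position i) := by
  rw [slot_inr, outIndex, if_neg (by omega), Nat.add_sub_cancel_left]

theorem tab_parts (r : Bits {i // i ∈ S}) (a : {i // i ∉ S} ⊕ {i // i ∉ S}) :
    let R := finalTable n S.card (measured S) T.table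
      (outIndex n (n - S.card) (keptLabel S T) (slot a))
    (tab S T r).xPart a = restrictOut S (R.xs n) ∧
    (tab S T r).zPart a = restrictOut S (R.zs n) := by
  intro R
  have hl : ∀ j : {i // i ∉ S}, remaining S (position j) = j :=
    fun j => label_position (p := (· ∉ S)) j
  refine ⟨funext fun j => ?_, funext fun j => ?_⟩
  · show outEntry _ _ _ _ _ _ (slot (Sum.inl j)) = _
    rw [slot, outEntry, if_pos (position_lt_remaining j), hl]
    rfl
  · show outEntry _ _ _ _ _ _ (slot (Sum.inr j)) = _
    rw [slot_inr, outEntry, if_neg (by omega), Nat.add_sub_cancel_left, hl]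
    rfl

/-- Parity and half recover a phase in `ℤ/4` as `i^α (-1)^β`. -/
theorem phase_decomposition (q : ZMod 4) :
    (((q.val : ZMod 2)).val : ZMod 4) + twice ((q.val / 2 : ℕ) : ZMod 2) = q := by
  revert q
  decide

theorem tab_phase (r : Bits {i // i ∈ S}) (hT : T.IsClifford) (j : {i // i ∉ S}) :
    (tab S T r).phase (Sum.inr j) =
      (stab n S.card (measured S) T.table (keptLabel S T (position j))).ph + twice (out S T r ⬝ᵥ
        restrictIn S ((stab n S.card (measured S) T.table (keptLabel S T (position j))).zs n)) := by
  have hK := (keptLabel_spec (S := S) hT (position_lt_remaining j)).1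
  rw [Tableau.phase]
  show ((outP _ _ _ _ _ _ _ _ (slot (Sum.inr j))).val : ZMod 4) +
    twice (outS _ _ _ _ _ _ _ (slot (Sum.inr j))) = _
  rw [slot_inr, outP, outS, if_neg (by omega), if_neg (by omega), phase_decomposition,
    Nat.add_sub_cancel_left, outPhase, finalTable_stab hK, sum_measured]
  congr 2
  refine Finset.sum_congr rfl fun i _ => ?_
  rw [show measured S (position i) = i from label_position (p := (· ∈ S)) i]
  rfl

/-- Kept rows have no `X` part on `S`, so their forms are those of the restrictions, and the kept
stabilizers with the outcome substituted fix the projected state. The remaining condition, Hermitian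
destabilizers, holds by the definition of `outP`. -/
theorem tab_isTableauOf (r : Bits {i // i ∈ S}) (h : T.IsTableauOf ψ)
    (hr : outcomeProb S ψ (out S T r) ≠ 0) : (tab S T r).IsTableauOf (postState S ψ (out S T r)) := by
  have hs := Tableau.symp_table h.1
  have hK : ∀ i : {i // i ∉ S}, _ := fun i =>
    keptLabel_spec (S := S) h.1 (position_lt_remaining i)
  have hxl : ∀ i : {i // i ∉ S}, (tab S T r).xPart (Sum.inl i) = restrictOut S
      ((destab n S.card (measured S) T.table (keptLabel S T (position i))).xs n) := fun i => by
    rw [(tab_parts r _).1, outIndex_inl]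
    rfl
  have hzl : ∀ i : {i // i ∉ S}, (tab S T r).zPart (Sum.inl i) = restrictOut S
      ((destab n S.card (measured S) T.table (keptLabel S T (position i))).zs n) := fun i => by
    rw [(tab_parts r _).2, outIndex_inl]
    rfl
  have hxr : ∀ i : {i // i ∉ S}, (tab S T r).xPart (Sum.inr i) = restrictOut S
      ((stab n S.card (measured S) T.table (keptLabel S T (position i))).xs n) := fun i => by
    rw [(tab_parts r _).1, outIndex_inr, finalTable_stab (hK i).1]
  have hzr : ∀ i : {i // i ∉ S}, (tab S T r).zPart (Sum.inr i) = restrictOut S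
      ((stab n S.card (measured S) T.table (keptLabel S T (position i))).zs n) := fun i => by
    rw [(tab_parts r _).2, outIndex_inr, finalTable_stab (hK i).1]
  refine Tableau.isTableauOf_of_form (sum_postState hr) (fun i j => ?_) (fun i j => ?_) (fun i => ?_)
    fun j => ?_
  · rw [Tableau.form, hxl, hzl, hxl, hzl, ← form_eq_restrict
      (destab_restrictIn (hK i).1 (hK i).2.1) (destab_restrictIn (hK j).1 (hK j).2.1)]
    exact destab_destab hs (hK i).1 (hK j).1 (hK i).2.1 (hK j).2.1
  · rw [Tableau.form, hxr, hzr, hxl, hzl, ← form_eq_restrict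
      (stab_restrictIn h.1 (hK j).1 (hK j).2.1) (destab_restrictIn (hK i).1 (hK i).2.1),
      PRow.form_comm, destab_stab hs (hK i).1 (hK j).1 (hK i).2.1 (hK j).2.1]
    congr 1
    rw [eq_iff_iff]
    refine ⟨fun he => position_injective ?_, fun he => by rw [he]⟩
    rw [← (hK i).2.2, he, (hK j).2.2]
  · rw [hzl, hxl]
    show outP _ _ _ _ _ _ _ _ (slot (Sum.inl i)) = _
    rw [slot, outP, if_pos (position_lt_remaining i), ← card_remaining (S := S), sum_position]
    refine Finset.sum_congr rfl fun j _ => ?_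
    rw [show remaining S (position j) = j from label_position (p := (· ∉ S)) j, mul_comm]
    rfl
  · refine postState_fixed ?_
    rw [Tableau.row_eq, tab_phase r h.1, hxr, hzr]
    exact project_fixed (fixes_stab h (hK j).1) (stab_restrictIn h.1 (hK j).1 (hK j).2.1) _

end Measurement

/-! ### Schoolbook matrix multiplication -/

/-- Multiplies the `n × n` matrices in the arrays `0` and `1` by definition. -/
def schoolbook : Prog :=
  .seq (.assign 1 (.reg 0 * .reg 0))
  (.seq (map2 2 0 0 (.reg 40 * .reg 0 + .reg 41) (.const 0))
  (acc2 2 1 0 2 (.reg 40) (.get 0 (.reg 40 / .reg 0 * .reg 0 + .reg 41) *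
    .get 1 (.reg 41 * .reg 0 + .reg 40 % .reg 0))))

/-- One accumulation loop suffices if the `n * n` target cells are numbered in a row; the row and
the column of the target are recovered by division with remainder. -/
theorem runs_schoolbook {n W : ℕ} (hn : 1 ≤ n) {X Y : Matrix (Fin n) (Fin n) (ZMod 2)}
    (hW : (n + 2) ^ 8 ≤ W) {σ : MachineState} (hσ : σ.IsWord W) (h0 : σ.reg 0 = n)
    (hX : StoresMatrix σ 0 X) (hY : StoresMatrix σ 1 Y) :
    Runs W schoolbook σ (4 + 200 * ((n + 1) * (n + 1)) + 200 * ((n * n + 1) * (n + 1)))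
      (fun τ => StoresMatrix τ 2 (X * Y)) := by
  have h200 : 200 < W := by
    have h3 : 3 ^ 8 ≤ (n + 2) ^ 8 := Nat.pow_le_pow_left (by omega) 8
    omega
  have hL : (n + 2) * (n + 2) + (n + 2) < W := by
    have h3 : (n + 2) ^ 3 ≤ (n + 2) ^ 8 := Nat.pow_le_pow_right (by omega) (by omega)
    have h4 : (n + 2) * (n + 2) + (n + 2) < (n + 2) ^ 3 := by nlinarith
    omega
  have hW1 : 1 < W := by omega
  have hnn : n * n < W := fit_mul hL (by omega) (by omega)
  have hidx : ∀ x y, x < n → y < n → x * n + y < W := fun x y hx hy =>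
    mul_add_lt hL (by omega) (by omega) (by omega)
  apply Runs.pre
  · apply Runs.seq (Runs.assignEv hσ 1 (v := n * n) (Ev.mul (.reg hσ h0) (.reg hσ h0) hnn))
    rintro τ₁ hτ₁ ⟨r1, F1⟩
    have r0 : τ₁.reg 0 = n := (F1.1 0 (by omega) (by simp)).trans h0
    refine Runs.seq (runs_map2 hτ₁ hW1 (A := 2) (rR := 0) (rC := 0)
      (addr := .reg 40 * .reg 0 + .reg 41) (e := .const 0) (by omega) (by omega) (by decide)
      (fun i j => i * n + j) (fun _ _ => 0) r0 r0 (fun i j i' j' _ hj _ hj' h => mul_add_inj hj hj' h)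
      fun i j τ hi hj hτ hr h40 h41 _ _ => ?_) (t₂ := 200 * ((n * n + 1) * (n + 1))) ?_
    · have e0 : τ.reg 0 = n := (hr 0 (by omega)).trans r0
      have := Ev.add (.mul (.reg hτ h40) (.reg hτ e0) (fit_mul hL (by omega) (by omega)))
        (.reg hτ h41) (hidx i j hi hj)
      exact ⟨this.1, this.2, (show 0 < W by omega), rfl⟩
    · rintro τ₂ hτ₂ ⟨q1, -, q3, q4⟩
      have r0' : τ₂.reg 0 = n := (q3 0 (by omega) (by omega)).trans r0
      have r1' : τ₂.reg 1 = n * n := (q3 1 (by omega) (by omega)).trans r1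
      have a0 : τ₂.arr 0 = σ.arr 0 := (q4 0 (by omega)).trans (F1.2 0 (by omega) (by simp))
      have a1 : τ₂.arr 1 = σ.arr 1 := (q4 1 (by omega)).trans (F1.2 1 (by omega) (by simp))
      have hz : ∀ i < n * n, τ₂.arr 2 i = 0 := fun i hi => by
        have := q1 (i / n) (i % n) (Nat.div_lt_of_lt_mul hi) (Nat.mod_lt _ hn)
        beta_reduce at this
        rwa [Nat.div_add_mod'] at this
      let g : ℕ → ℕ → ℕ := fun i j => σ.arr 0 (i / n * n + j) * σ.arr 1 (j * n + i % n)
      have h1 : ∀ i j, i < n * n → j < n → σ.arr 0 (i / n * n + j) ≤ 1 ∧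
          σ.arr 1 (j * n + i % n) ≤ 1 := by
        intro i j hi hj
        have hx := hX ⟨i / n, Nat.div_lt_of_lt_mul hi⟩ ⟨j, hj⟩
        have hy := hY ⟨j, hj⟩ ⟨i % n, Nat.mod_lt _ hn⟩
        dsimp only at hx hy
        rw [hx, hy]
        exact ⟨Nat.lt_succ_iff.1 (ZMod.val_lt _), Nat.lt_succ_iff.1 (ZMod.val_lt _)⟩
      refine (runs_acc2 hτ₂ h200 (A := 2) (rR := 1) (rC := 0) (μ := 2) (addr := .reg 40)
        (e := .get 0 (.reg 40 / .reg 0 * .reg 0 + .reg 41) *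
          .get 1 (.reg 41 * .reg 0 + .reg 40 % .reg 0)) (by omega) (by omega) (by decide) (by omega)
        (by omega) (fun i => i) g r1' r0' (fun _ _ _ _ h => h) (fun i hi => by rw [hz i hi]; omega)
        (fun i j hi hj => ?_) fun i j τ hi hj hτ hr h40 h41 ha => ?_).mono le_rfl ?_
      · obtain ⟨h2, h3⟩ := h1 i j hi hj
        exact (Nat.mul_le_mul h2 h3).trans (by omega)
      · obtain ⟨h2, h3⟩ := h1 i j hi hj
        have e0 : τ.reg 0 = n := (hr 0 (by omega)).trans r0'
        have hd := Nat.div_lt_of_lt_mul hi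
        have hm := Nat.mod_lt i hn
        have E40 := Ev.reg hτ h40
        have E41 := Ev.reg hτ h41
        have E0 := Ev.reg hτ e0
        have x := Ev.get (A := 0) hτ (.add (.mul (.div E40 E0) E0
          (fit_mul hL (by omega) (by omega))) E41 (hidx _ _ hd hj))
          (show _ = σ.arr 0 (i / n * n + j) by rw [ha 0 (by omega), a0])
        have y := Ev.get (A := 1) hτ (.add (.mul E41 E0 (fit_mul hL (by omega) (by omega)))
          (.mod E40 E0) (hidx _ _ hj hm))
          (show _ = σ.arr 1 (j * n + i % n) by rw [ha 1 (by omega), a1])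
        have xy := Ev.mask x y h3
        exact ⟨E40.1, E40.2, xy.1, xy.2⟩
      · rintro τ - ⟨q, -⟩ i j
        have hij : (i : ℕ) * n + j < n * n := by
          have hi := i.2
          have hj := j.2
          nlinarith [Nat.mul_le_mul_right n (show (i : ℕ) + 1 ≤ n by omega)]
        have := q _ hij
        beta_reduce at this
        rw [this, hz _ hij, zero_add, ← ZMod.val_natCast, Nat.cast_sum, Matrix.mul_apply]
        congr 1
        rw [Finset.sum_range]
        refine Finset.sum_congr rfl fun l _ => ?_
        have hdiv : ((i : ℕ) * n + j) / n = i := by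
          rw [mul_comm, Nat.mul_add_div hn, Nat.div_eq_of_lt j.2, add_zero]
        have hmod : ((i : ℕ) * n + j) % n = j := by
          rw [mul_comm, Nat.mul_add_mod, Nat.mod_eq_of_lt j.2]
        dsimp only [g]
        rw [hdiv, hmod, hX i l, hY l j, Nat.cast_mul, ZMod.natCast_zmod_val, ZMod.natCast_zmod_val]
  · show 3 + 1 + _ ≤ _
    omega

/-- Needed for the part `k n²` of the bound, which is smaller than `n² k^(ω-2)` when `ω > 3`. -/
theorem matMulInTime_three : MatMulInTime 3 := by
  refine ⟨schoolbook, 2000, 8, fun n hn X Y W hW σ hσ h0 hX hY => ?_⟩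
  obtain ⟨σ', t, he, ht, -, hs⟩ := runs_schoolbook hn hW hσ h0 hX hY
  refine ⟨σ', t, he, ?_, hs⟩
  have h1 : t ≤ 2000 * n ^ 3 := ht.trans (by
    have h2 : n * n ≤ n ^ 3 := by nlinarith
    have h3 : n ≤ n ^ 3 := by nlinarith
    have h4 : 1 ≤ n ^ 3 := Nat.one_le_pow _ _ hn
    ring_nf at *
    omega)
  have h2 : ((2000 * n ^ 3 : ℕ) : ℝ) = (2000 : ℕ) * (n : ℝ) ^ (3 : ℝ) := by
    rw [show (3 : ℝ) = (3 : ℕ) by norm_num, Real.rpow_natCast]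
    push_cast
    ring
  rw [← h2]
  exact_mod_cast h1

/-! ### The running time -/

namespace Measurement

/-- The time for the multiplication of `m × m` matrices. -/
noncomputable def mulTime (w : ℝ) (C m : ℕ) : ℕ := ⌊(C : ℝ) * (m : ℝ) ^ w⌋₊

variable {w : ℝ} {C : ℕ}

theorem one_le_pow (hw : 2 ≤ w) {m : ℕ} (hm : 1 ≤ m) : 1 ≤ (m : ℝ) ^ (w - 2) :=
  Real.one_le_rpow (by exact_mod_cast hm) (by linarith)

/-- Copying a block is quadratic in `m` and `w ≥ 2`, so it is dominated by the multiplication up to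
constants: `600 * 4 + 50 = 2450`. -/
theorem block_le (hw : 2 ≤ w) {m : ℕ} (hm : 1 ≤ m) :
    ((600 * ((m + 1) * (m + 1)) + mulTime w C m + 50 : ℕ) : ℝ) ≤
      (2450 + C) * ((m : ℝ) ^ 2 * (m : ℝ) ^ (w - 2)) := by
  have hm' : (1 : ℝ) ≤ m := by exact_mod_cast hm
  have hP := one_le_pow hw hm
  have hF : ((mulTime w C m : ℕ) : ℝ) ≤ C * ((m : ℝ) ^ 2 * (m : ℝ) ^ (w - 2)) := by
    refine (Nat.floor_le (by positivity)).trans (le_of_eq ?_)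
    rw [← Real.rpow_natCast, ← Real.rpow_add (by linarith)]
    norm_num
  have h1 : (1 : ℝ) ≤ (m : ℝ) ^ 2 := by nlinarith
  have h2 : (m : ℝ) ^ 2 ≤ (m : ℝ) ^ 2 * (m : ℝ) ^ (w - 2) := le_mul_of_one_le_right (by positivity) hP
  have h3 : ((m : ℝ) + 1) * (m + 1) ≤ 4 * (m : ℝ) ^ 2 := by nlinarith
  push_cast
  linarith

theorem tMul_le (hw : 2 ≤ w) {m R K D : ℕ} (hm : 1 ≤ m) {a b c r s : ℝ}
    (ha : ((R / m + 1 : ℕ) : ℝ) ≤ a) (hb : ((D / m + 1 : ℕ) : ℝ) ≤ b)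
    (hc : ((K / m + 1 : ℕ) : ℝ) ≤ c) (hr : (R : ℝ) + 1 ≤ r) (hs : (D : ℝ) + 1 ≤ s) :
    (tMul (mulTime w C) R K D m : ℝ) ≤
      200 * (r * s) + a * b * c * ((2450 + C) * ((m : ℝ) ^ 2 * (m : ℝ) ^ (w - 2))) + 50 := by
  have hB := block_le (C := C) hw hm
  rw [tMul, Nat.cast_add, Nat.cast_add, Nat.cast_mul ((R / m + 1)), Nat.cast_mul ((D / m + 1)),
    Nat.cast_mul ((K / m + 1))]
  have h0 : ∀ x : ℕ, (0 : ℝ) ≤ x := fun x => Nat.cast_nonneg x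
  have h1 : ((200 * ((R + 1) * (D + 1)) : ℕ) : ℝ) ≤ 200 * (r * s) := by
    push_cast
    have := mul_le_mul hr hs (by positivity) (le_trans (by positivity) hr)
    linarith
  have ha0 := (h0 _).trans ha
  have hb0 := (h0 _).trans hb
  have hc0 := (h0 _).trans hc
  have h2 := mul_le_mul ha (mul_le_mul hb (mul_le_mul hc hB (h0 _) hc0) (by positivity) hb0)
    (by positivity) ha0
  rw [show ((50 : ℕ) : ℝ) = 50 by norm_num]
  linarith

/-- Since `m ≤ 2 * n`, the rounding term `1` is at most `2 * n / m`. -/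
theorem div_le {n m x : ℕ} (hm : 1 ≤ m) (hmn : m ≤ 2 * n) (hx : x ≤ n) :
    ((x / m + 1 : ℕ) : ℝ) ≤ 3 * (n / m : ℝ) := by
  have hm' : (0 : ℝ) < m := by exact_mod_cast hm
  have h1 : ((x / m : ℕ) : ℝ) ≤ x / m := Nat.cast_div_le
  have h2 : (x : ℝ) / m ≤ n / m := by gcongr
  have h3 : 1 ≤ 2 * ((n : ℝ) / m) := by
    rw [← mul_div_assoc, le_div_iff₀ hm', one_mul]
    exact_mod_cast hmn
  push_cast
  linarith

theorem div_le_two {m x : ℕ} (hm : 1 ≤ m) (hx : x ≤ m) : ((x / m + 1 : ℕ) : ℝ) ≤ 2 := by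
  have : x / m ≤ 1 := Nat.div_le_of_le_mul (by omega)
  exact_mod_cast (by omega : x / m + 1 ≤ 2)

/-- The products that occur in the bounds. -/
structure Sizes (x y P : ℝ) : Prop where
  hx : 1 ≤ x
  hy : 1 ≤ y
  hxy : y ≤ 2 * x
  hP : 1 ≤ P

namespace Sizes

theorem bounds {x y P : ℝ} (h : Sizes x y P) : y ≤ x * y ∧ x ≤ x * y ∧ 1 ≤ x * y ∧ y * y ≤ 2 * (x * y) ∧ x * y ≤ x * y * P ∧
    x * y ≤ 2 * (x * x) ∧ x * x ≤ x * x * P ∧ 1 ≤ x * x ∧ x ≤ x * x ∧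
    x * y * P ≤ 2 * (x * x * P) ∧ y * y * P ≤ 2 * (x * y * P) := by
  obtain ⟨hx, hy, hxy, hP⟩ := h
  have h1 : 1 ≤ x * y := by nlinarith
  have h2 : 1 ≤ x * x := by nlinarith
  have h3 : x * y ≤ 2 * (x * x) := by nlinarith
  have h4 : y * y ≤ 2 * (x * y) := by nlinarith
  refine ⟨by nlinarith, by nlinarith, h1, h4, le_mul_of_one_le_right (by positivity) hP, h3,
    le_mul_of_one_le_right (by positivity) hP, h2, by nlinarith, ?_, ?_⟩
  · nlinarith [mul_le_mul_of_nonneg_right h3 (by linarith : 0 ≤ P)]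
  · nlinarith [mul_le_mul_of_nonneg_right h4 (by linarith : 0 ≤ P)]

end Sizes

section

variable {n m : ℕ}

theorem sizes (hw : 2 ≤ w) (hn : 1 ≤ n) (hm : 1 ≤ m) (hmn : m ≤ 2 * n) :
    Sizes n m ((m : ℝ) ^ (w - 2)) :=
  ⟨by exact_mod_cast hn, by exact_mod_cast hm, by exact_mod_cast hmn, one_le_pow hw hm⟩

/-- In this and the next four bounds a direction of length `n` contributes of order `n / m` blocks,
one of length at most `m` at most two, and each block costs of order `m^w`. One long direction gives
`n * m * m^(w-2)`, two long directions give `n * n * m^(w-2)`. -/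
theorem tMul_square_le (hw : 2 ≤ w) (hn : 1 ≤ n) (hm : 1 ≤ m) (hmn : m ≤ 2 * n) :
    (tMul (mulTime w C) n m m m : ℝ) ≤
      (850 + 12 * (2450 + C)) * (n * m * (m : ℝ) ^ (w - 2)) := by
  have hS := sizes hw hn hm hmn
  have hm0 : (m : ℝ) ≠ 0 := by have := hS.hy; positivity
  have h := tMul_le (C := C) hw hm (div_le hm hmn le_rfl) (div_le_two hm le_rfl)
    (div_le_two hm le_rfl) (show (n : ℝ) + 1 ≤ 2 * n by linarith [hS.hx])
    (show (m : ℝ) + 1 ≤ 2 * m by linarith [hS.hy])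
  have e : 3 * ((n : ℝ) / m) * 2 * 2 * ((2450 + C) * ((m : ℝ) ^ 2 * (m : ℝ) ^ (w - 2))) =
      12 * (2450 + C) * (n * m * (m : ℝ) ^ (w - 2)) := by field_simp; ring
  rw [e] at h
  obtain ⟨b1, b2, b3, b4, b5, -⟩ := hS.bounds
  linarith

theorem tMul_tall_le (hw : 2 ≤ w) (hn : 1 ≤ n) (hm : 1 ≤ m) (hmn : m ≤ 2 * n) :
    (tMul (mulTime w C) m n m m : ℝ) ≤
      (1650 + 12 * (2450 + C)) * (n * m * (m : ℝ) ^ (w - 2)) := by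
  have hS := sizes hw hn hm hmn
  have hm0 : (m : ℝ) ≠ 0 := by have := hS.hy; positivity
  have h := tMul_le (C := C) hw hm (div_le_two hm le_rfl) (div_le_two hm le_rfl)
    (div_le hm hmn le_rfl) (show (m : ℝ) + 1 ≤ 2 * m by linarith [hS.hy])
    (show (m : ℝ) + 1 ≤ 2 * m by linarith [hS.hy])
  have e : 2 * 2 * (3 * ((n : ℝ) / m)) * ((2450 + C) * ((m : ℝ) ^ 2 * (m : ℝ) ^ (w - 2))) =
      12 * (2450 + C) * (n * m * (m : ℝ) ^ (w - 2)) := by field_simp; ring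
  rw [e] at h
  obtain ⟨b1, b2, b3, b4, b5, -⟩ := hS.bounds
  linarith

theorem tMul_wide_le (hw : 2 ≤ w) (hn : 1 ≤ n) (hm : 1 ≤ m) (hmn : m ≤ 2 * n) :
    (tMul (mulTime w C) n m n m : ℝ) ≤
      (850 + 18 * (2450 + C)) * (n * n * (m : ℝ) ^ (w - 2)) := by
  have hS := sizes hw hn hm hmn
  have hm0 : (m : ℝ) ≠ 0 := by have := hS.hy; positivity
  have h := tMul_le (C := C) hw hm (div_le hm hmn le_rfl) (div_le hm hmn le_rfl)
    (div_le_two hm le_rfl) (show (n : ℝ) + 1 ≤ 2 * n by linarith [hS.hx])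
    (show (n : ℝ) + 1 ≤ 2 * n by linarith [hS.hx])
  have e : 3 * ((n : ℝ) / m) * (3 * (n / m)) * 2 * ((2450 + C) * ((m : ℝ) ^ 2 * (m : ℝ) ^ (w - 2))) =
      18 * (2450 + C) * (n * n * (m : ℝ) ^ (w - 2)) := by field_simp; ring
  rw [e] at h
  obtain ⟨b1, b2, b3, b4, b5, b6, b7, b8, -⟩ := hS.bounds
  linarith

theorem tMul_small_le (hw : 2 ≤ w) (hn : 1 ≤ n) (hm : 1 ≤ m) (hmn : m ≤ 2 * n) {k : ℕ}
    (hk : k ≤ m) : (tMul (mulTime w C) k m m m : ℝ) ≤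
      (1650 + 16 * (2450 + C)) * (n * m * (m : ℝ) ^ (w - 2)) := by
  have hS := sizes hw hn hm hmn
  have hk' : (k : ℝ) ≤ m := by exact_mod_cast hk
  have h := tMul_le (C := C) hw hm (div_le_two hm hk) (div_le_two hm le_rfl)
    (div_le_two hm le_rfl) (show (k : ℝ) + 1 ≤ 2 * m by linarith [hS.hy])
    (show (m : ℝ) + 1 ≤ 2 * m by linarith [hS.hy])
  obtain ⟨b1, b2, b3, b4, b5, b6, b7, b8, b9, b10, b11⟩ := hS.bounds
  have e : (2 : ℝ) * 2 * 2 * ((2450 + C) * ((m : ℝ) ^ 2 * (m : ℝ) ^ (w - 2))) =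
      8 * ((2450 + C) * (m * m * (m : ℝ) ^ (w - 2))) := by ring
  rw [e] at h
  have := mul_le_mul_of_nonneg_left b11 (show (0 : ℝ) ≤ 2450 + C by positivity)
  linarith

theorem tMul_flat_le (hw : 2 ≤ w) (hn : 1 ≤ n) (hm : 1 ≤ m) (hmn : m ≤ 2 * n) {k : ℕ}
    (hk : k ≤ m) : (tMul (mulTime w C) k m n m : ℝ) ≤
      (850 + 12 * (2450 + C)) * (n * m * (m : ℝ) ^ (w - 2)) := by
  have hS := sizes hw hn hm hmn
  have hm0 : (m : ℝ) ≠ 0 := by have := hS.hy; positivity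
  have hk' : (k : ℝ) ≤ m := by exact_mod_cast hk
  have h := tMul_le (C := C) hw hm (div_le_two hm hk) (div_le hm hmn le_rfl)
    (div_le_two hm le_rfl) (show (k : ℝ) + 1 ≤ 2 * m by linarith [hS.hy])
    (show (n : ℝ) + 1 ≤ 2 * n by linarith [hS.hx])
  have e : 2 * (3 * ((n : ℝ) / m)) * 2 * ((2450 + C) * ((m : ℝ) ^ 2 * (m : ℝ) ^ (w - 2))) =
      12 * (2450 + C) * (n * m * (m : ℝ) ^ (w - 2)) := by field_simp; ring
  rw [e] at h
  obtain ⟨b1, b2, b3, b4, b5, -⟩ := hS.bounds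
  linarith

theorem tOp_le (hw : 2 ≤ w) (hn : 1 ≤ n) (hm : 1 ≤ m) (hmn : m ≤ 2 * n) :
    (tOp (mulTime w C) n m : ℝ) ≤ (4050 + 12 * (2450 + C)) * (n * m * (m : ℝ) ^ (w - 2)) := by
  have hS := sizes hw hn hm hmn
  have h := tMul_square_le (C := C) hw hn hm hmn
  rw [tOp]
  push_cast
  obtain ⟨b1, b2, b3, b4, b5, -⟩ := hS.bounds
  linarith

theorem tMulRows_le (hw : 2 ≤ w) (hn : 1 ≤ n) (hm : 1 ≤ m) (hmn : m ≤ 2 * n) :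
    (tMulRows (mulTime w C) n n m : ℝ) ≤
      (30000 + 100 * (2450 + C)) * (n * n * (m : ℝ) ^ (w - 2)) := by
  have hS := sizes hw hn hm hmn
  have h1 := tMul_square_le (C := C) hw hn hm hmn
  have h2 := tMul_tall_le (C := C) hw hn hm hmn
  have h3 := tMul_wide_le (C := C) hw hn hm hmn
  obtain ⟨b1, b2, b3, b4, b5, b6, b7, b8, b9, b10, b11⟩ := hS.bounds
  have b12 := mul_le_mul_of_nonneg_left b10 (Nat.cast_nonneg (α := ℝ) C)
  have b13 := mul_nonneg (Nat.cast_nonneg (α := ℝ) C)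
    (show (0 : ℝ) ≤ n * n * (m : ℝ) ^ (w - 2) by linarith)
  rw [tMulRows]
  push_cast
  linarith

/-- With only `k ≤ m` target rows every product has at most one direction of length `n`. This saves
the factor `n / m` that is lost by repeating the operation for all blocks of stabilizers. -/
theorem tMulRows_flat_le (hw : 2 ≤ w) (hn : 1 ≤ n) (hm : 1 ≤ m) (hmn : m ≤ 2 * n) {k : ℕ}
    (hk : k ≤ m) : (tMulRows (mulTime w C) n k m : ℝ) ≤
      (30000 + 100 * (2450 + C)) * (n * m * (m : ℝ) ^ (w - 2)) := by
  have hS := sizes hw hn hm hmn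
  have hk' : (k : ℝ) ≤ m := by exact_mod_cast hk
  have h1 := tMul_small_le (C := C) hw hn hm hmn hk
  have h2 := tMul_tall_le (C := C) hw hn hm hmn
  have h3 := tMul_flat_le (C := C) hw hn hm hmn hk
  obtain ⟨b1, b2, b3, b4, b5, b6, b7, b8, b9, b10, b11⟩ := hS.bounds
  have b13 := mul_nonneg (Nat.cast_nonneg (α := ℝ) C)
    (show (0 : ℝ) ≤ n * m * (m : ℝ) ^ (w - 2) by linarith)
  have c1 : (k : ℝ) * m ≤ m * m := mul_le_mul_of_nonneg_right hk' (by positivity)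
  have c2 : (k : ℝ) * n ≤ m * n := mul_le_mul_of_nonneg_right hk' (by positivity)
  rw [tMulRows]
  push_cast
  linarith

end

/-! ### The eliminations -/

/-- Exchanging the sums, the number of `j < 2^e` with `2^h ∣ j + 1` is `2^(e-h)`. -/
theorem tElim_le_sum (F : ℕ → ℕ) (n e : ℕ) : tElim F n e ≤ 2 ^ e * (500 * (n + 1) + 60) +
    ∑ h ∈ Finset.range (e + 1), 2 ^ (e - h) * (tOp F n (2 ^ h) + 60) + 400 * (n + 1) + 10 := by
  rw [tElim]
  have h1 : ∑ j ∈ Finset.range (2 ^ e), (500 * (n + 1) +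
      (∑ h ∈ Finset.range (e + 1), if 2 ^ h ∣ j + 1 then tOp F n (2 ^ h) + 60 else 0) + 60) =
      2 ^ e * (500 * (n + 1) + 60) +
      ∑ h ∈ Finset.range (e + 1), 2 ^ (e - h) * (tOp F n (2 ^ h) + 60) := by
    rw [Finset.sum_add_distrib, Finset.sum_add_distrib, Finset.sum_comm, Finset.sum_const,
      Finset.sum_const, Finset.card_range, smul_eq_mul, smul_eq_mul]
    have : ∀ h ∈ Finset.range (e + 1), (∑ j ∈ Finset.range (2 ^ e),
        if 2 ^ h ∣ j + 1 then tOp F n (2 ^ h) + 60 else 0) =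
        2 ^ (e - h) * (tOp F n (2 ^ h) + 60) := by
      intro h hh
      rw [Finset.mem_range] at hh
      rw [← Finset.sum_filter, Finset.sum_const, Nat.card_multiples, smul_eq_mul,
        Nat.pow_div (by omega) (by omega)]
    rw [Finset.sum_congr rfl this]
    ring
  omega

/-- The `2^(e-h)` operations on blocks of width `2^h` cost of order `n * 2^h * q^h` each, with `q =
2^(w-2)`. Every level thus contributes `n * 2^e * q^h`. -/
theorem tElim_le (hw : 2 ≤ w) {n e : ℕ} (hn : 1 ≤ n) (he : 2 ^ e ≤ 2 * n) :
    (tElim (mulTime w C) n e : ℝ) ≤ (6000 + 12 * (2450 + C)) *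
      ((n * (2 ^ e : ℕ)) * ∑ h ∈ Finset.range (e + 1), ((2 : ℝ) ^ (w - 2)) ^ h) := by
  have hS := sizes hw hn (Nat.one_le_two_pow (n := e)) he
  obtain ⟨b1, b2, b3, -⟩ := hS.bounds
  set q : ℝ := (2 : ℝ) ^ (w - 2) with hq
  have hq1 : 1 ≤ q := Real.one_le_rpow (by norm_num) (by linarith)
  have hsum : ∀ h ∈ Finset.range (e + 1),
      ((2 ^ (e - h) * (tOp (mulTime w C) n (2 ^ h) + 60) : ℕ) : ℝ) ≤
        (4110 + 12 * (2450 + C)) * (n * (2 ^ e : ℕ) * q ^ h) := by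
    intro h hh
    rw [Finset.mem_range] at hh
    have hle : 2 ^ h ≤ 2 * n := (Nat.pow_le_pow_right (by omega) (by omega)).trans he
    have h1 := tOp_le (C := C) hw hn (Nat.one_le_two_pow (n := h)) hle
    obtain ⟨-, -, c3, -, c5, -⟩ := (sizes hw hn (Nat.one_le_two_pow (n := h)) hle).bounds
    have hpow : ((2 ^ h : ℕ) : ℝ) ^ (w - 2) = q ^ h := by
      rw [hq, Nat.cast_pow, Nat.cast_ofNat, ← Real.rpow_natCast, ← Real.rpow_natCast,
        ← Real.rpow_mul (by norm_num), ← Real.rpow_mul (by norm_num), mul_comm]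
    rw [hpow] at h1 c5
    have h2 : (tOp (mulTime w C) n (2 ^ h) : ℝ) + 60 ≤
        (4110 + 12 * (2450 + C)) * (n * (2 ^ h : ℕ) * q ^ h) := by linarith
    have h3 : ((2 ^ (e - h) : ℕ) : ℝ) * (2 ^ h : ℕ) = (2 ^ e : ℕ) := by
      rw [← Nat.cast_mul, ← pow_add, Nat.sub_add_cancel (by omega)]
    rw [Nat.cast_mul, Nat.cast_add, Nat.cast_ofNat, ← h3]
    calc _ ≤ ((2 ^ (e - h) : ℕ) : ℝ) * ((4110 + 12 * (2450 + C)) * (n * (2 ^ h : ℕ) * q ^ h)) :=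
          mul_le_mul_of_nonneg_left h2 (Nat.cast_nonneg _)
      _ = _ := by ring
  have h1 : (tElim (mulTime w C) n e : ℝ) ≤ ((2 ^ e * (500 * (n + 1) + 60) + ∑ h ∈
      Finset.range (e + 1), 2 ^ (e - h) * (tOp (mulTime w C) n (2 ^ h) + 60) +
        400 * (n + 1) + 10 : ℕ) : ℝ) := by exact_mod_cast tElim_le_sum _ n e
  have h2 := Finset.sum_le_sum hsum
  rw [← Finset.mul_sum, ← Finset.mul_sum, ← Nat.cast_sum] at h2
  have h3 : (1 : ℝ) ≤ ∑ h ∈ Finset.range (e + 1), q ^ h := by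
    rw [Finset.sum_range_succ']
    have : 0 ≤ ∑ h ∈ Finset.range e, q ^ (h + 1) := Finset.sum_nonneg fun h _ => by positivity
    linarith [pow_zero q]
  have h4 : (n : ℝ) * (2 ^ e : ℕ) ≤ n * (2 ^ e : ℕ) * ∑ h ∈ Finset.range (e + 1), q ^ h :=
    le_mul_of_one_le_right (by positivity) h3
  rw [Nat.cast_add, Nat.cast_add, Nat.cast_add, Nat.cast_mul] at h1
  generalize ((∑ h ∈ Finset.range (e + 1), 2 ^ (e - h) * (tOp (mulTime w C) n (2 ^ h) + 60) : ℕ) : ℝ)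
    = s at *
  generalize ∑ h ∈ Finset.range (e + 1), q ^ h = t at *
  generalize ((2 ^ e : ℕ) : ℝ) = y at *
  push_cast at h1
  linarith

/-- The multiplications of all rows and the repeated multiplications of `k` rows are both of order
`n² m^(w-2)`. Only the eliminations produce the sum over the levels, and there with `n * m` in place
of `n²`. -/
theorem time_le_sum (hw : 2 ≤ w) {n k : ℕ} (hk1 : 1 ≤ k) (hkn : k ≤ n) :
    (time (mulTime w C) n k : ℝ) ≤ (1000000 + 2000 * (2450 + C)) *
      (n * n * (width k : ℝ) ^ (w - 2) +
        n * width k * ∑ h ∈ Finset.range (Nat.clog 2 k + 1), ((2 : ℝ) ^ (w - 2)) ^ h) := by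
  obtain ⟨w1, -, w3⟩ := width_bounds hk1 hkn
  have hn : 1 ≤ n := hk1.trans hkn
  have hm : 1 ≤ width k := hk1.trans w1
  have hS := sizes hw hn hm w3
  have hk' : (k : ℝ) ≤ width k := by exact_mod_cast w1
  have h1 := tElim_le (C := C) hw hn (e := Nat.clog 2 k) w3
  rw [show 2 ^ Nat.clog 2 k = width k from rfl] at h1
  have h2 := tMulRows_le (C := C) hw hn hm w3
  have h3 := tMulRows_flat_le (C := C) hw hn hm w3 w1
  obtain ⟨b1, b2, b3, b4, b5, b6, b7, b8, b9, b10, b11⟩ := hS.bounds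
  set m := width k with hmdef
  set P := (m : ℝ) ^ (w - 2) with hP
  set t := ∑ h ∈ Finset.range (Nat.clog 2 k + 1), ((2 : ℝ) ^ (w - 2)) ^ h
  have ht : 0 ≤ t := Finset.sum_nonneg fun h _ => by positivity
  have c1 : (k : ℝ) * m ≤ m * m := mul_le_mul_of_nonneg_right hk' (by positivity)
  have h4 : ((tMulRows (mulTime w C) n k m + 600 * ((k + 1) * (m + 1)) + 40 : ℕ) : ℝ) ≤
      (40000 + 100 * (2450 + C)) * (n * m * P) := by
    push_cast
    linarith [hS.hy]
  have h5 := mul_le_mul (div_le hm w3 le_rfl) h4 (Nat.cast_nonneg _) (by positivity)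
  have hm0 : (m : ℝ) ≠ 0 := by have := hS.hy; positivity
  have e : 3 * ((n : ℝ) / m) * ((40000 + 100 * (2450 + C)) * (n * m * P)) =
      3 * (40000 + 100 * (2450 + C)) * (n * n * P) := by field_simp
  rw [e] at h5
  have d1 : 0 ≤ (C : ℝ) * (n * m * t) := by positivity
  have d2 : 0 ≤ (n : ℝ) * m * t := by positivity
  have d3 : 0 ≤ (C : ℝ) * (n * n * P) := by positivity
  rw [time, ← hmdef, Nat.cast_add, Nat.cast_add, Nat.cast_add, Nat.cast_add,
    Nat.cast_mul (n / m + 1)]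
  generalize ((n / m + 1 : ℕ) : ℝ) * _ = u at *
  push_cast
  linarith

end Measurement

/-! ### The theorem -/

/-- The fast program is replaced by the schoolbook one when `ω ≥ 3`. The choice is made once,
depending on `ω` alone. -/
theorem MatMulInTime.min_three {ω : ℝ} (h : MatMulInTime ω) : MatMulInTime (min ω 3) := by
  rcases le_total ω 3 with h' | h'
  · rwa [min_eq_left h']
  · rw [min_eq_right h']
    exact matMulInTime_three

namespace Measurement

/-- From `2 ^ Nat.clog 2 k ≤ 2 * n` by taking logarithms, with `Real.log 2 > 1/2`. -/
theorem clog_le {n k : ℕ} (hk1 : 1 ≤ k) (hkn : k ≤ n) : (Nat.clog 2 k : ℝ) ≤ 1 + 2 * Real.log n := by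
  have hn : (1 : ℝ) ≤ n := by exact_mod_cast hk1.trans hkn
  have h1 : (2 : ℝ) ^ Nat.clog 2 k ≤ 2 * n := by exact_mod_cast (width_bounds hk1 hkn).2.2
  have h2 := Real.log_le_log (by positivity) h1
  rw [Real.log_pow, Real.log_mul (by norm_num) (by linarith)] at h2
  have h3 := Real.log_two_gt_d9
  have h4 := Real.log_nonneg hn
  by_contra hc
  push Not at hc
  nlinarith

/-- The exponent satisfies `w - 2 ≤ 1` for the bound `k n²` and `w ≤ ω` for the other one; the
logarithm is nonnegative and only enlarges the right-hand side. -/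
theorem rpow_le_measureBound {ω w : ℝ} (hw2 : 2 ≤ w) (hw3 : w ≤ 3) (hwω : w ≤ ω) {n k : ℕ}
    (hk1 : 1 ≤ k) (hkn : k ≤ n) : n * n * (k : ℝ) ^ (w - 2) ≤ measureBound ω n k := by
  have hk : (1 : ℝ) ≤ k := by exact_mod_cast hk1
  have hn : (k : ℝ) ≤ n := by exact_mod_cast hkn
  have h1 : (k : ℝ) ^ (w - 2) ≤ k := by
    calc (k : ℝ) ^ (w - 2) ≤ (k : ℝ) ^ (1 : ℝ) := Real.rpow_le_rpow_of_exponent_le hk (by linarith)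
      _ = k := Real.rpow_one _
  have h2 : (k : ℝ) ^ (w - 2) ≤ (k : ℝ) ^ (ω - 2) :=
    Real.rpow_le_rpow_of_exponent_le hk (by linarith)
  have h3 : 0 ≤ if ω = 2 then Real.log n else Real.log ((n : ℝ) / k) := by
    split
    · exact Real.log_nonneg (hk.trans hn)
    · exact Real.log_nonneg ((one_le_div (by linarith)).2 hn)
  refine le_min ?_ ?_
  · calc n * n * (k : ℝ) ^ (w - 2) ≤ (n : ℝ) ^ 2 * (k : ℝ) ^ (ω - 2) := by
          rw [sq]
          exact mul_le_mul_of_nonneg_left h2 (by positivity)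
      _ ≤ _ := le_mul_of_one_le_right (by positivity) (by linarith)
  · calc n * n * (k : ℝ) ^ (w - 2) ≤ n * n * k := mul_le_mul_of_nonneg_left h1 (by positivity)
      _ = _ := by ring

theorem width_rpow_le {w : ℝ} (hw2 : 2 ≤ w) (hw3 : w ≤ 3) {n k : ℕ} (hk1 : 1 ≤ k) (hkn : k ≤ n) :
    (width k : ℝ) ^ (w - 2) ≤ 2 * (k : ℝ) ^ (w - 2) := by
  have h1 : (width k : ℝ) ≤ 2 * k := by exact_mod_cast (width_bounds hk1 hkn).2.1
  calc (width k : ℝ) ^ (w - 2) ≤ (2 * k : ℝ) ^ (w - 2) :=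
        Real.rpow_le_rpow (by positivity) h1 (by linarith)
    _ = (2 : ℝ) ^ (w - 2) * (k : ℝ) ^ (w - 2) := Real.mul_rpow (by norm_num) (by positivity)
    _ ≤ (2 : ℝ) ^ (1 : ℝ) * (k : ℝ) ^ (w - 2) := by
        refine mul_le_mul_of_nonneg_right ?_ (by positivity)
        exact Real.rpow_le_rpow_of_exponent_le (by norm_num) (by linarith)
    _ = _ := by rw [Real.rpow_one]

/-- The levels of the recursion form a geometric sum, with a constant ratio if `w = 2`. -/
theorem sum_levels_le {ω w : ℝ} (hw2 : 2 ≤ w) (hw3 : w ≤ 3) (hwω : w ≤ ω) (h2 : w = 2 → ω = 2) :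
    ∃ D : ℝ, 0 ≤ D ∧ ∀ n k : ℕ, 1 ≤ k → k ≤ n → n * (width k : ℝ) *
      ∑ h ∈ Finset.range (Nat.clog 2 k + 1), ((2 : ℝ) ^ (w - 2)) ^ h ≤ D * measureBound ω n k := by
  rcases hw2.eq_or_lt with hw | hw
  · refine ⟨4, by norm_num, fun n k hk1 hkn => ?_⟩
    have hω := h2 hw.symm
    obtain ⟨-, w2, w3⟩ := width_bounds hk1 hkn
    have hk : (1 : ℝ) ≤ k := by exact_mod_cast hk1
    have hn : (k : ℝ) ≤ n := by exact_mod_cast hkn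
    have hm : (width k : ℝ) ≤ 2 * k := by exact_mod_cast w2
    have hl := Real.log_nonneg (hk.trans hn)
    have e1 : ∑ h ∈ Finset.range (Nat.clog 2 k + 1), ((2 : ℝ) ^ (w - 2)) ^ h = Nat.clog 2 k + 1 := by
      rw [← hw, sub_self, Real.rpow_zero]
      simp
    rw [e1, measureBound, hω, if_pos rfl, sub_self, Real.rpow_zero, mul_one,
      mul_min_of_nonneg _ _ (by norm_num)]
    refine le_min ?_ ?_
    · have h3 := clog_le hk1 hkn
      calc (n : ℝ) * width k * (Nat.clog 2 k + 1) ≤ n * (2 * n) * (2 * (1 + Real.log n)) := by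
            have : (width k : ℝ) ≤ 2 * n := by linarith
            gcongr
            linarith
        _ = _ := by ring
    -- Here the number of levels is estimated by `2 * n`: the eliminations have `n * k` in place of
    -- `n²`, so a whole factor `n` is available to absorb it.
    · have h3 : ((Nat.clog 2 k : ℝ)) + 1 ≤ 2 * n := by
        have : Nat.clog 2 k < 2 ^ Nat.clog 2 k := Nat.lt_two_pow_self
        have h4 : Nat.clog 2 k + 1 ≤ 2 * n := this.trans_le w3
        exact_mod_cast h4
      calc (n : ℝ) * width k * (Nat.clog 2 k + 1) ≤ n * (2 * k) * (2 * n) := by gcongr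
        _ = _ := by ring
  · set q : ℝ := (2 : ℝ) ^ (w - 2) with hq
    have hq1 : 1 < q := Real.one_lt_rpow (by norm_num) (by linarith)
    have hq0 : 0 < q - 1 := by linarith
    refine ⟨4 * (q / (q - 1)), by positivity, fun n k hk1 hkn => ?_⟩
    obtain ⟨-, w2, -⟩ := width_bounds hk1 hkn
    have hn : (k : ℝ) ≤ n := by exact_mod_cast hkn
    have hm : (width k : ℝ) ≤ 2 * n := by
      have : (width k : ℝ) ≤ 2 * k := by exact_mod_cast w2
      linarith
    have e1 : q ^ Nat.clog 2 k = (width k : ℝ) ^ (w - 2) := by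
      rw [hq, width, Nat.cast_pow, Nat.cast_ofNat, ← Real.rpow_natCast, ← Real.rpow_natCast,
        ← Real.rpow_mul (by norm_num), ← Real.rpow_mul (by norm_num), mul_comm]
    have h1 : ∑ h ∈ Finset.range (Nat.clog 2 k + 1), q ^ h ≤
        q / (q - 1) * (2 * (k : ℝ) ^ (w - 2)) := by
      rw [geom_sum_eq hq1.ne', div_mul_eq_mul_div]
      refine div_le_div_of_nonneg_right ?_ hq0.le
      have := mul_le_mul_of_nonneg_left (width_rpow_le hw2 hw3 hk1 hkn) (by linarith : 0 ≤ q)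
      rw [← e1] at this
      rw [pow_succ]
      linarith
    calc (n : ℝ) * width k * _ ≤ n * (2 * n) * (q / (q - 1) * (2 * (k : ℝ) ^ (w - 2))) := by
          gcongr
      _ = 4 * (q / (q - 1)) * (n * n * (k : ℝ) ^ (w - 2)) := by ring
      _ ≤ _ := mul_le_mul_of_nonneg_left (rpow_le_measureBound hw2 hw3 hwω hk1 hkn) (by positivity)

theorem time_le {ω : ℝ} (hω : 2 ≤ ω) (C : ℕ) : ∃ D : ℕ, ∀ n k : ℕ, 1 ≤ k → k ≤ n →
    (time (mulTime (min ω 3) C) n k : ℝ) ≤ D * measureBound ω n k := by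
  have hw2 : 2 ≤ min ω 3 := le_min hω (by norm_num)
  obtain ⟨D, hD, h⟩ := sum_levels_le (ω := ω) hw2 (min_le_right _ _) (min_le_left _ _) fun h => by
    rcases min_choice ω 3 with h' | h'
    · rwa [h'] at h
    · rw [h'] at h
      norm_num at h
  refine ⟨⌈(1000000 + 2000 * (2450 + (C : ℝ))) * (2 + D)⌉₊, fun n k hk1 hkn => ?_⟩
  have h1 := rpow_le_measureBound hw2 (min_le_right ω 3) (min_le_left ω 3) hk1 hkn
  have h2 := width_rpow_le hw2 (min_le_right ω 3) hk1 hkn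
  have hB : 0 ≤ measureBound ω n k := le_trans (by positivity) h1
  have h3 : (n : ℝ) * n * (width k : ℝ) ^ (min ω 3 - 2) ≤ 2 * measureBound ω n k := by
    have := mul_le_mul_of_nonneg_left h2 (show (0 : ℝ) ≤ n * n by positivity)
    linarith
  calc (time (mulTime (min ω 3) C) n k : ℝ) ≤ _ := time_le_sum hw2 hk1 hkn
    _ ≤ (1000000 + 2000 * (2450 + (C : ℝ))) * (2 * measureBound ω n k + D * measureBound ω n k) :=
        mul_le_mul_of_nonneg_left (add_le_add h3 (h n k hk1 hkn)) (by positivity)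
    _ = (1000000 + 2000 * (2450 + (C : ℝ))) * (2 + D) * measureBound ω n k := by ring
    _ ≤ _ := mul_le_mul_of_nonneg_right (Nat.le_ceil _) hB

/-- The factor `2` in the exponent comes from `width k + 2 ≤ (n + 2)^2`. The summand `7` comes from
`4 * n + 15 ≤ (n + 2)^3`, whose square has exponent `6`, with one more factor for the linear term.
-/
theorem word_bounds {n k d W : ℕ} (hk1 : 1 ≤ k) (hkn : k ≤ n) (hW : (n + 2) ^ (2 * d + 7) ≤ W) :
    (4 * n + 15) * (4 * n + 15) + (4 * n + 15) < W ∧ (width k + 2) ^ d ≤ W := by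
  obtain ⟨-, -, w3⟩ := width_bounds hk1 hkn
  have hn : 1 ≤ n := hk1.trans hkn
  have h7 : (n + 2) ^ 7 ≤ (n + 2) ^ (2 * d + 7) := Nat.pow_le_pow_right (by omega) (by omega)
  have hd : (n + 2) ^ (2 * d) ≤ (n + 2) ^ (2 * d + 7) := Nat.pow_le_pow_right (by omega) (by omega)
  constructor
  · have h1 : 4 * n + 15 ≤ (n + 2) ^ 3 := by
      have : 3 ^ 2 ≤ (n + 2) ^ 2 := Nat.pow_le_pow_left (by omega) 2
      rw [pow_succ]
      nlinarith
    have h2 : (n + 2) ^ 7 = (n + 2) ^ 3 * (n + 2) ^ 3 * (n + 2) := by ring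
    generalize (n + 2) ^ 3 = x at *
    have h3 : (4 * n + 15) * (4 * n + 15) ≤ x * x := Nat.mul_le_mul h1 h1
    have h4 : x ≤ x * x := Nat.le_mul_of_pos_left _ (by omega)
    have h5 : x * x * 3 ≤ x * x * (n + 2) := Nat.mul_le_mul_left _ (by omega)
    omega
  · refine le_trans ?_ (hd.trans hW)
    rw [pow_mul]
    exact Nat.pow_le_pow_left (by nlinarith) d

/-! ### Correctness of the program on stored inputs. -/

section

variable {n : ℕ} {S : Finset (Fin n)} {T : Tableau (Fin n)} {ψ : QVec (Fin n)}

theorem slot_lt (a : {i // i ∉ S} ⊕ {i // i ∉ S}) : slot a < 2 * (n - S.card) := by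
  rcases a with i | i
  · have := position_lt_remaining i
    rw [slot]
    omega
  · have := position_lt_remaining i
    rw [slot_inr]
    omega

theorem remaining_spec {c : ℕ} (h : c < n - S.card) : remaining S c < n ∧
    ¬ onNat (· ∈ S) (remaining S c) ∧
      Nat.count (fun i => ¬ onNat (· ∈ S) i) (remaining S c) = c := by
  obtain ⟨h1, ⟨h2, h3⟩, h4⟩ := label_spec (p := (· ∉ S)) (c := c) (by rwa [card_remaining])
  refine ⟨h1, fun ⟨_, h⟩ => h3 h, ?_⟩
  refine Eq.trans ?_ h4
  rw [Nat.count_eq_card_filter_range, Nat.count_eq_card_filter_range]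
  congr 1
  refine Finset.filter_congr fun i hi => ?_
  have hi' : i < n := (Finset.mem_range.1 hi).trans h1
  exact ⟨fun h => ⟨hi', fun hm => h ⟨hi', hm⟩⟩, fun ⟨_, h⟩ ⟨_, hm⟩ => h hm⟩

/-- The program computes the outcome and the tableau of the state after the measurement. -/
theorem runs_measure {c : Prog} {F : ℕ → ℕ} {d W mode : ℕ} (hc : MulSpec c F d) (hS : S.Nonempty)
    (h : T.IsTableauOf ψ) (hW : (n + 2) ^ (2 * d + 7) ≤ W) {σ : MachineState} (hσ : σ.IsWord W)
    {r : Bits {i // i ∈ S}} (hin : IsInput σ mode S T r) :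
    ∃ (σ' : MachineState) (t : ℕ), Exec W (prog c) σ σ' t ∧ t ≤ time F n S.card ∧
      σ'.reg 3 = (if out S T r = r then 1 else 0) ∧ StoresBits σ' 4 (out S T r) ∧
      StoresTableau σ' (tab S T r) := by
  obtain ⟨h0, h1, -, ⟨hM, hp, hs⟩, h3, h4⟩ := hin
  have hk1 : 1 ≤ S.card := hS.card_pos
  have hkn : S.card ≤ n := (Finset.card_le_univ S).trans (Fintype.card_fin n).le
  obtain ⟨hL, hd⟩ := word_bounds (d := d) hk1 hkn hW
  obtain ⟨σ', t, he, ht, -, q1, q2, q3, q4, q5⟩ := runs_prog (b := bitsAt (· ∈ S) r)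
    (M := T.entry) (p := onSlots T.p) (s := onSlots T.s) hc hσ hL hd hk1 hkn h0 h1
    (fun i j hi hj => by
      obtain ⟨a, rfl⟩ := exists_slot hi
      obtain ⟨b, rfl⟩ := exists_slot hj
      have := hM a b
      rw [Fintype.card_fin] at this
      rw [this, Tableau.entry, onSlots_slot, onSlots_slot])
    (fun i hi => by
      obtain ⟨a, rfl⟩ := exists_slot hi
      rw [hp, onSlots_slot])
    (fun i hi => by
      obtain ⟨a, rfl⟩ := exists_slot hi
      rw [hs, onSlots_slot])
    (onNat (· ∈ S))
    (fun i hi => by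
      refine (h3 ⟨i, hi⟩).trans (if_congr ?_ rfl rfl)
      exact ⟨fun h => ⟨hi, h⟩, fun ⟨_, h⟩ => h⟩)
    (fun c hc => by
      obtain ⟨i, rfl⟩ := exists_position (p := (· ∈ S)) (c := c) (by rwa [card_measured])
      rw [h4, bitsAt_position])
    (fun c hc => label_spec (p := (· ∈ S)) (by rwa [card_measured]))
    (fun c hc => remaining_spec hc)
    (fun c hc => keptLabel_spec h.1 hc)
  refine ⟨σ', t, he, ht, q1.trans (if_congr ?_ rfl rfl), fun i => q2 _ (position_lt_card i),
    fun a b => ?_, fun a => q4 _ (slot_lt a), fun a => q5 _ (slot_lt a)⟩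
  · constructor
    · intro hz
      funext i
      exact (hz _ (position_lt_card i)).trans (bitsAt_position _ _)
    · intro hz c hc
      obtain ⟨i, rfl⟩ := exists_position (p := (· ∈ S)) (c := c) (by rwa [card_measured])
      exact (congrFun hz i).trans (bitsAt_position _ _).symm
  · rw [card_remaining]
    exact q3 _ _ (slot_lt a) (slot_lt b)

end

end Measurement

theorem mainTheorem9 (ω : ℝ) (hω : 2 ≤ ω) (hmul : MatMulInTime ω) :
    ∃ (c : Prog) (C d : ℕ), ∀ (n : ℕ) (S : Finset (Fin n)), S.Nonempty →
      ∀ (T : Tableau (Fin n)) (ψ : QVec (Fin n)), T.IsTableauOf ψ →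
      -- measurement: `k` uniformly random bits `r` are part of the input
      (∃ (out : Bits {i // i ∈ S} → Bits {i // i ∈ S})
          (tab : Bits {i // i ∈ S} → Tableau {i // i ∉ S}),
        (∀ (r : Bits {i // i ∈ S}) (W : ℕ), (n + 2) ^ d ≤ W →
          ∀ σ : MachineState, σ.IsWord W → IsInput σ 0 S T r →
            ∃ (σ' : MachineState) (t : ℕ), Exec W c σ σ' t ∧
              (t : ℝ) ≤ C * measureBound ω n S.card ∧
              StoresBits σ' 4 (out r) ∧ StoresTableau σ' (tab r)) ∧
        (∀ z : Bits {i // i ∈ S},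
          ((Finset.univ.filter fun r => out r = z).card : ℝ) / 2 ^ S.card = outcomeProb S ψ z) ∧
        (∀ r : Bits {i // i ∈ S}, (tab r).IsTableauOf (postState S ψ (out r)))) ∧
      -- postselection on the outcome `z`; register `3` tells whether it has nonzero probability
      (∀ z : Bits {i // i ∈ S},
        (outcomeProb S ψ z = 0 →
          ∀ W : ℕ, (n + 2) ^ d ≤ W → ∀ σ : MachineState, σ.IsWord W → IsInput σ 1 S T z →
            ∃ (σ' : MachineState) (t : ℕ), Exec W c σ σ' t ∧
              (t : ℝ) ≤ C * measureBound ω n S.card ∧ σ'.reg 3 = 0) ∧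
        (outcomeProb S ψ z ≠ 0 →
          ∃ T' : Tableau {i // i ∉ S}, T'.IsTableauOf (postState S ψ z) ∧
            ∀ W : ℕ, (n + 2) ^ d ≤ W → ∀ σ : MachineState, σ.IsWord W → IsInput σ 1 S T z →
              ∃ (σ' : MachineState) (t : ℕ), Exec W c σ σ' t ∧
                (t : ℝ) ≤ C * measureBound ω n S.card ∧ σ'.reg 3 = 1 ∧
                StoresTableau σ' T')) := by
  obtain ⟨c, C, d, hc⟩ := hmul.min_three.mulSpec
  obtain ⟨D, hD⟩ := Measurement.time_le hω C
  refine ⟨Measurement.prog c, D, 2 * d + 7, fun n S hS T ψ h => ?_⟩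
  have hk1 : 1 ≤ S.card := hS.card_pos
  have hkn : S.card ≤ n := (Finset.card_le_univ S).trans (Fintype.card_fin n).le
  have key : ∀ (mode : ℕ) (r : Bits {i // i ∈ S}) (W : ℕ), (n + 2) ^ (2 * d + 7) ≤ W →
      ∀ σ : MachineState, σ.IsWord W → IsInput σ mode S T r →
        ∃ (σ' : MachineState) (t : ℕ), Exec W (Measurement.prog c) σ σ' t ∧
          (t : ℝ) ≤ D * measureBound ω n S.card ∧
          σ'.reg 3 = (if Measurement.out S T r = r then 1 else 0) ∧
          StoresBits σ' 4 (Measurement.out S T r) ∧ StoresTableau σ' (Measurement.tab S T r) := by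
    intro mode r W hW σ hσ hin
    obtain ⟨σ', t, he, ht, h'⟩ := Measurement.runs_measure hc hS h hW hσ hin
    exact ⟨σ', t, he, (Nat.cast_le.2 ht).trans (hD n S.card hk1 hkn), h'⟩
  -- Both modes use the same run. In postselection the desired outcome takes the place of the random
  -- bits, and it is possible if and only if `out` reproduces it.
  refine ⟨⟨Measurement.out S T, Measurement.tab S T, fun r W hW σ hσ hin => ?_,
    Measurement.card_out_eq hS h, fun r => Measurement.tab_isTableauOf r h
      (Measurement.outcomeProb_out_ne_zero hS h r)⟩, fun z => ⟨fun hz W hW σ hσ hin => ?_, fun hz => ?_⟩⟩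
  · obtain ⟨σ', t, h1, h2, -, h3⟩ := key 0 r W hW σ hσ hin
    exact ⟨σ', t, h1, h2, h3⟩
  · obtain ⟨σ', t, h1, h2, h3, -⟩ := key 1 z W hW σ hσ hin
    refine ⟨σ', t, h1, h2, h3.trans (if_neg fun ho => ?_)⟩
    exact Measurement.outcomeProb_out_ne_zero hS h z (ho.symm ▸ hz)
  -- The computed outcome is then `z` itself, so the tableau for the input bits `z` is already that
  -- of the postselected state.
  · have ho := Measurement.out_of_outcomeProb_ne_zero hS h hz
    refine ⟨Measurement.tab S T z, ?_, fun W hW σ hσ hin => ?_⟩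
    · have := Measurement.tab_isTableauOf z h (Measurement.outcomeProb_out_ne_zero hS h z)
      rwa [ho] at this
    · obtain ⟨σ', t, h1, h2, h3, -, h4⟩ := key 1 z W hW σ hσ hin
      exact ⟨σ', t, h1, h2, h3.trans (if_pos ho), h4⟩
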